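/- \textbf{Model.} For $n\in\mathbb N$ and $p,s,\alpha\in[0,1]$, the seeded correlated Erdős–Rényi model $\mathcal G(n,p;s,\alpha)$ is generated as follows. Let $G_0\sim\mathcal G(n,p)$ be an Erdős–Rényi graph on $[n]$. Let $G_1^*$ and $G_2$ be two subgraphs of $G_0$, each obtained by keeping every edge of $G_0$ independently with probability $s$, the two subsamplings being independent. Let $\pi^*$ be an independent uniformly random permutation of $[n]$, and let $G_1$ be the graph obtained from $G_1^*$ by relabelling every vertex $i$ as $\pi^*(i)$. Independently for every $i\in[n]$, let $\pi_0(i)=\pi^*(i)$ with probability $\alpha$ ($i$ is then called a seed) and $\pi_0(i)={?}$ otherwise. One observes $G_1$, $G_2$, $\pi_0$. \textbf{Algorithm 1.} Input: $G_1,G_2,\pi_0$ and integers $m,\ell\ge 0$. An $\ell$-path is a path with $\ell$ edges; $\ell$-paths starting at the same vertex are independent if they are vertex-disjoint except for that starting vertex; $\Gamma^G_\ell(v)$ is the set of vertices at distance exactly $\ell$ from $v$ in $G$. (1) For each $i_1\in V(G_1)$ not in the image of $\pi_0$ and each $i_2\in V(G_2)$ with $\pi_0(i_2)={?}$: if there is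 a set $L\subset\Gamma^{G_2}_\ell(i_2)$ of $m$ seeds such that there are $m$ independent $\ell$-paths in $G_2$ from $i_2$ to the $m$ vertices of $L$, and $\pi_0(L)\subset\Gamma_\ell^{G_1}(i_1)$ consists of $m$ vertices to which there are $m$ independent $\ell$-paths in $G_1$ from $i_1$, match $i_2$ with $i_1$. (2) Match every seed $i$ with $\pi_0(i)$. Then, simultaneously for all pairs $(i_1,i_2)\in V(G_1)\times V(G_2)$ of vertices that are both still unmatched: if there is an already matched pair $(j_1,j_2)$ (with $j_2\in V(G_2)$ matched to $j_1\in V(G_1)$) such that $i_1$ is adjacent to $j_1$ in $G_1$ and $i_2$ is adjacent to $j_2$ in $G_2$, match $i_2$ with $i_1$. (3) If some vertex of $G_1$ or of $G_2$ has been matched to two different vertices, or some vertex is unmatched, output a uniformly random permutation $\hat\pi$, independent of everything else. Otherwise output the permutation $\hat\pi$ with $\hat\pi(i_2)=i_1$ for all matched pairs. \textbf{Theorem.} (a) Algorithm 1 runs in polynomial time: there is one program for a random access machine (unit cost; addition, truncated subtraction, array access, tests; the random permutation of step (3) is supplied as part of the input) that computes its output for all $n$ and all inputs $G_1,G_2,\pi_0,m,\ell$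 in a number of steps bounded by a fixed polynomial in $n$. (b) Let $\epsilon>0$ be a fixed constant. There is a rule choosing $m=m(n,p,s,\alpha)$ and $\ell=\ell(n,p,s,\alpha)$, with $$m=\lceil 2/\epsilon\rceil,\qquad \ell=\Big\lfloor\Big(\tfrac12-\epsilon\Big)\frac{\log n}{\log(nps^2)}\Big\rfloor\qquad\text{whenever } nps^2\le n^{\epsilon},$$ such that the following holds. Let $p=p_n$, $s=s_n$, $\alpha=\alpha_n$ be sequences in $[0,1]$ such that, for all large $n$, $np\le n^{1/2-\epsilon}$, $s$ is bounded away from $0$ (that is, $s=\Theta(1)$) and $\alpha\ge n^{-1/2+3\epsilon}$, and such that $nps^2-\log n\to+\infty$ as $n\to\infty$. Then, under $\mathcal G(n,p;s,\alpha)$, Algorithm 1 with these $m$ and $\ell$ outputs $\hat\pi=\pi^*$ with probability $1-o(1)$ as $n\to\infty$. -/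

import Mathlib

open MeasureTheory ProbabilityTheory Filter Topology
open scoped unitInterval

/-! ### The seeded correlated Erdős–Rényi model -/

namespace SeededGM

/-- The discrete σ-algebra on the finite set of permutations of `[n]`. -/
instance permMeasurableSpace (n : ℕ) : MeasurableSpace (Equiv.Perm (Fin n)) := ⊤

/-- The sources of randomness, in this order: the parent graph `G₀`; the two sets of edge marks
used to subsample `G₀` (as graphs on `[n]`); the latent permutation `π*`; the seed set `I₀`;
the random permutation that the algorithm outputs when it fails. -/
abbrev Sample (n : ℕ) : Type :=
  SimpleGraph (Fin n) × SimpleGraph (Fin n) × SimpleGraph (Fin n) × Equiv.Perm (Fin n) ×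
    Set (Fin n) × Equiv.Perm (Fin n)

/-- The joint law: all six components are independent; `G₀` is an Erdős–Rényi graph with edge
probability `p`, every pair is marked with probability `s` in either subsampling, every vertex is a
seed with probability `α`, and both permutations are uniform. -/
noncomputable def law (n : ℕ) (p s α : I) : Measure (Sample n) :=
  (SimpleGraph.binomialRandom (Fin n) p).prod <|
    (SimpleGraph.binomialRandom (Fin n) s).prod <|
      (SimpleGraph.binomialRandom (Fin n) s).prod <|
        (PMF.uniformOfFintype (Equiv.Perm (Fin n))).toMeasure.prod <|
          (setBernoulli (Set.univ : Set (Fin n)) α).prod <|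
            (PMF.uniformOfFintype (Equiv.Perm (Fin n))).toMeasure

namespace Sample

variable {n : ℕ}

/-- The latent permutation `π*`. -/
def latent (ω : Sample n) : Equiv.Perm (Fin n) := ω.2.2.2.1

/-- `G₁*`, the first subsample of the parent graph. -/
def graphOneStar (ω : Sample n) : SimpleGraph (Fin n) := ω.1 ⊓ ω.2.1

/-- `G₁`, obtained from `G₁*` by relabelling every vertex `i` as `π*(i)`: the vertices
`u, v` are adjacent in `G₁` iff `π*⁻¹(u), π*⁻¹(v)` are adjacent in `G₁*`. -/
def graphOne (ω : Sample n) : SimpleGraph (Fin n) :=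
  ω.graphOneStar.comap ω.latent.symm

/-- `G₂`, the second subsample of the parent graph. -/
def graphTwo (ω : Sample n) : SimpleGraph (Fin n) := ω.1 ⊓ ω.2.2.1

open Classical in
/-- The seed map `π₀`: equal to `π*` on the seed set and `?` (that is, `none`) off it. -/
noncomputable def seedMap (ω : Sample n) : Fin n → Option (Fin n) :=
  fun i => if i ∈ ω.2.2.2.2.1 then some (ω.latent i) else none

/-- The uniform permutation, independent of everything else, used by the algorithm on failure. -/
def fallback (ω : Sample n) : Equiv.Perm (Fin n) := ω.2.2.2.2.2

end Sample

/-! ### The algorithm -/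

/-- `Γ_ℓ(r)`: the vertices at distance exactly `ℓ` from `r`. -/
def sphere {V : Type} (G : SimpleGraph V) (ℓ : ℕ) (r : V) : Set V :=
  {v | G.edist r v = (ℓ : ℕ∞)}

/-- There are `m` independent `ℓ`-paths from `r` to `x 0, …, x (m-1)`: paths of length `ℓ` which are
vertex-disjoint except for their common starting vertex `r`. -/
def IndependentPaths {V : Type} (G : SimpleGraph V) (ℓ : ℕ) (r : V) {m : ℕ} (x : Fin m → V) :
    Prop :=
  ∃ P : (k : Fin m) → G.Walk r (x k),
    (∀ k, (P k).IsPath ∧ (P k).length = ℓ) ∧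
      ∀ j k, j ≠ k → ∀ v, v ∈ (P j).support → v ∈ (P k).support → v = r

section Algorithm

variable {n : ℕ} (G₁ G₂ : SimpleGraph (Fin n)) (π₀ : Fin n → Option (Fin n)) (m ℓ : ℕ)

/-- First matching step: the unseeded vertices `i₂` of `G₂` and `i₁` of `G₁` are matched if there is
a set `L = {x 0, …, x (m-1)} ⊆ Γ_ℓ(i₂)` of `m` seeds with `m` independent `ℓ`-paths from `i₂` to `L`
in `G₂`, such that `π₀(L) = {y 0, …, y (m-1)} ⊆ Γ_ℓ(i₁)` and there are `m` independent `ℓ`-paths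
from `i₁` to `π₀(L)` in `G₁`. -/
def HighDegreeMatch (i₂ i₁ : Fin n) : Prop :=
  π₀ i₂ = none ∧ (∀ j, π₀ j ≠ some i₁) ∧
    ∃ x y : Fin m → Fin n,
      Function.Injective x ∧ Function.Injective y ∧ (∀ k, π₀ (x k) = some (y k)) ∧
        (∀ k, x k ∈ sphere G₂ ℓ i₂) ∧ IndependentPaths G₂ ℓ i₂ x ∧
          (∀ k, y k ∈ sphere G₁ ℓ i₁) ∧ IndependentPaths G₁ ℓ i₁ y

/-- The pairs matched before the second step: those of the first step together with the seeds. -/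
def Matched (i₂ i₁ : Fin n) : Prop :=
  HighDegreeMatch G₁ G₂ π₀ m ℓ i₂ i₁ ∨ π₀ i₂ = some i₁

/-- Second matching step: the still unmatched vertices `i₂` of `G₂` and `i₁` of `G₁` are matched if
they are adjacent to the two members of an already matched pair. -/
def LowDegreeMatch (i₂ i₁ : Fin n) : Prop :=
  (∀ j, ¬ Matched G₁ G₂ π₀ m ℓ i₂ j) ∧ (∀ j, ¬ Matched G₁ G₂ π₀ m ℓ j i₁) ∧
    ∃ j₂ j₁, Matched G₁ G₂ π₀ m ℓ j₂ j₁ ∧ G₁.Adj i₁ j₁ ∧ G₂.Adj i₂ j₂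

/-- All pairs matched in the end. -/
def FinalMatch (i₂ i₁ : Fin n) : Prop :=
  Matched G₁ G₂ π₀ m ℓ i₂ i₁ ∨ LowDegreeMatch G₁ G₂ π₀ m ℓ i₂ i₁

/-- A conflict: some vertex (on either side) is matched to two different vertices. -/
def Conflict (R : Fin n → Fin n → Prop) : Prop :=
  (∃ i₂ i₁ j₁, R i₂ i₁ ∧ R i₂ j₁ ∧ i₁ ≠ j₁) ∨ (∃ i₂ j₂ i₁, R i₂ i₁ ∧ R j₂ i₁ ∧ i₂ ≠ j₂)

open Classical in
/-- The output `π̂ : V(G₂) → V(G₁)`. If there is no conflict in either step and every vertex is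
matched, it is the (unique) permutation given by the matching; otherwise it is `ρ`. -/
noncomputable def algorithmOutput (ρ : Equiv.Perm (Fin n)) : Equiv.Perm (Fin n) :=
  if h : ¬ Conflict (HighDegreeMatch G₁ G₂ π₀ m ℓ) ∧ ¬ Conflict (FinalMatch G₁ G₂ π₀ m ℓ) ∧
      ∃ π : Equiv.Perm (Fin n), ∀ i, FinalMatch G₁ G₂ π₀ m ℓ i (π i)
  then h.2.2.choose
  else ρ

end Algorithm

/-- The probability that the algorithm with parameters `m` and `ℓ` outputs `π*`. -/
noncomputable def successProbability (n : ℕ) (p s α : I) (m ℓ : ℕ) : ℝ :=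
  (law n p s α).real
    {ω | algorithmOutput ω.graphOne ω.graphTwo ω.seedMap m ℓ ω.fallback = ω.latent}

/-! ### Running time

Programs are while-programs for a random access machine: finitely many integer variables and
integer arrays, addition, truncated subtraction, and array access as the only operations. Every
elementary operation costs one unit. (There is no multiplication, so that the length of
the numbers grows by at most one bit per unit of time.) -/

/-- The content of the memory: variables and arrays, both named by natural numbers. -/
structure Store where
  var : ℕ → ℕ
  arr : ℕ → ℕ → ℕ

inductive Expr where
  | num (c : ℕ)
  | var (x : ℕ)
  | get (a : ℕ) (e : Expr)
  | add (e f : Expr)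
  | sub (e f : Expr)

def Expr.eval (S : Store) : Expr → ℕ
  | num c => c
  | var x => S.var x
  | get a e => S.arr a (e.eval S)
  | add e f => e.eval S + f.eval S
  | sub e f => e.eval S - f.eval S

/-- The number of elementary operations in the evaluation of an expression. -/
def Expr.cost : Expr → ℕ
  | num _ => 1
  | var _ => 1
  | get _ e => e.cost + 1
  | add e f => e.cost + f.cost + 1
  | sub e f => e.cost + f.cost + 1

inductive Program where
  | skip
  | assign (x : ℕ) (e : Expr)
  | write (a : ℕ) (index value : Expr)
  | seq (c d : Program)
  | cond (test : Expr) (c d : Program)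
  | loop (test : Expr) (body : Program)

/-- `Runs c S t S'`: started in `S`, the program `c` halts after `t` time units in `S'`. A test
holds if its value is nonzero. -/
inductive Runs : Program → Store → ℕ → Store → Prop
  | skip (S : Store) : Runs .skip S 1 S
  | assign (S : Store) (x : ℕ) (e : Expr) :
      Runs (.assign x e) S (e.cost + 1) ⟨Function.update S.var x (e.eval S), S.arr⟩
  | write (S : Store) (a : ℕ) (e f : Expr) :
      Runs (.write a e f) S (e.cost + f.cost + 1)
        ⟨S.var, Function.update S.arr a (Function.update (S.arr a) (e.eval S) (f.eval S))⟩
  | seq {c d : Program} {S S' S'' : Store} {t t' : ℕ} :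
      Runs c S t S' → Runs d S' t' S'' → Runs (.seq c d) S (t + t') S''
  | cond_true {b : Expr} {c d : Program} {S S' : Store} {t : ℕ} :
      b.eval S ≠ 0 → Runs c S t S' → Runs (.cond b c d) S (b.cost + 1 + t) S'
  | cond_false {b : Expr} {c d : Program} {S S' : Store} {t : ℕ} :
      b.eval S = 0 → Runs d S t S' → Runs (.cond b c d) S (b.cost + 1 + t) S'
  | loop_stop {b : Expr} {c : Program} {S : Store} :
      b.eval S = 0 → Runs (.loop b c) S (b.cost + 1) S
  | loop_step {b : Expr} {c : Program} {S S' S'' : Store} {t t' : ℕ} :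
      b.eval S ≠ 0 → Runs c S t S' → Runs (.loop b c) S' t' S'' →
        Runs (.loop b c) S (b.cost + 1 + t + t') S''

open Classical in
/-- The adjacency matrix of a graph on `[n]`, row by row. -/
noncomputable def encodeGraph {n : ℕ} (G : SimpleGraph (Fin n)) : ℕ → ℕ :=
  fun k => if ∃ i j : Fin n, k = (i : ℕ) * n + (j : ℕ) ∧ G.Adj i j then 1 else 0

/-- The seed map as an array: entry `0` for `?`, and `v + 1` for the vertex `v`. -/
def encodeSeeds {n : ℕ} (π₀ : Fin n → Option (Fin n)) : ℕ → ℕ :=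
  fun k => if h : k < n then (π₀ ⟨k, h⟩).elim 0 (fun v => (v : ℕ) + 1) else 0

def encodePerm {n : ℕ} (ρ : Equiv.Perm (Fin n)) : ℕ → ℕ :=
  fun k => if h : k < n then (ρ ⟨k, h⟩ : ℕ) else 0

/-- The initial memory: the variables `0, 1, 2` hold `n, m, ℓ`, the arrays `0, 1, 2, 3` hold `G₁`,
`G₂`, `π₀` and the permutation to output on failure, and everything else is zero. -/
noncomputable def inputStore {n : ℕ} (G₁ G₂ : SimpleGraph (Fin n))
    (π₀ : Fin n → Option (Fin n)) (m ℓ : ℕ) (ρ : Equiv.Perm (Fin n)) : Store where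
  var := fun x => if x = 0 then n else if x = 1 then m else if x = 2 then ℓ else 0
  arr := fun a =>
    if a = 0 then encodeGraph G₁
    else if a = 1 then encodeGraph G₂
    else if a = 2 then encodeSeeds π₀
    else if a = 3 then encodePerm ρ
    else fun _ => 0

/-- The algorithm runs in polynomial time: a single program computes its output (left in the array
`4`) from every input, in a number of steps bounded by a polynomial in the number `n` of vertices,
uniformly in all other inputs. -/
def AlgorithmPolynomialTime : Prop :=
  ∃ (c : Program) (C d : ℕ), ∀ (n : ℕ) (G₁ G₂ : SimpleGraph (Fin n))
    (π₀ : Fin n → Option (Fin n)) (m ℓ : ℕ) (ρ : Equiv.Perm (Fin n)),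
    ∃ (t : ℕ) (S : Store), Runs c (inputStore G₁ G₂ π₀ m ℓ ρ) t S ∧ t ≤ C * (n + 1) ^ d ∧
      ∀ i : Fin n, S.arr 4 (i : ℕ) = (algorithmOutput G₁ G₂ π₀ m ℓ ρ i : ℕ)

end SeededGM

/-! Throughout, d = nps² is the average degree of `cap`, the intersection of G₁* and G₂; x = np is
that of the parent graph, and L is the path length. As s is bounded away from 0, x ≤ C₀ d for a
constant C₀.

Deterministic part. Undoing the relabelling by π* turns a first-step match into a statement about a
single vertex set: v and u are `Linked` if they are joined, in G₂ and in G₁* respectively, by m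
independent L-paths to the same m seeds at distance L from both. `Good` lists what suffices for
exact recovery (`algorithmOutput_eq_latent`): distinct vertices are never linked; an unseeded vertex
is linked to itself unless its degree in `cap` is low; `cap` has no isolated vertex; low vertices
are pairwise neither adjacent nor at distance two in the parent graph. Then the first step is
correct outside the low vertices, and every low vertex has a correctly matched neighbour that it
shares with no other low vertex.

Wrong pairs (`expect_linked_le`). If v ≠ u are linked, any K of the m paths at v form a spider with
K·L edges whose feet are seeds. The path from u to a foot has only L edges, which is too short to
stay inside the spider, except possibly for the one leg that contains u. Hence all other paths
contain an ear of the spider (`exists_ear`), and these ears are edge-disjoint. The expected number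
of spiders at v is at most (x^L α)^K, each ear contributes a factor of order x^L / n up to powers of
K and L, and a linked pair yields m(m-1)⋯(m-K+1) spiders at once. Markov's inequality concludes.

Right pairs (`expect_not_linked_self_le`). The neighbours of v in `cap` are split into m groups of
size g, and each group is grown along edges of `cap` while the parent graph is explored
breadth-first. What has been explored is independent of the edges to fresh vertices, so by Chernoff
each group grows by a factor d/32 per generation and finally meets the seeds. Paths found in this
way are geodesic in the parent graph and hence in both subgraphs.

Low degrees. Since d ≥ log n, two close vertices that are both low appear with probability at most a
constant times n(x + x²)e^(-3d/2), which is polynomially small. Isolated vertices are excluded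
because d - log n tends to infinity.

Parameters. For d ≤ n^ε the prescribed L makes x^L about n^(1/2-ε), and K = m ≥ 2/ε makes the first
moment small even with α replaced by 1. For larger d the radius is bounded: L is the least radius at
which n^ε seeds are expected, and m lies n^(ε/4) above the order d^(2L)α/n of the number of seeds
common to two unrelated spheres, yet below d and d^L α (`freeCount_bounds`); K is then a constant.

Running time. The only real difficulty is to decide whether the m pairs of paths exist. As the paths
are geodesic, this is a disjoint-paths problem in a layered graph that leads from i₂ to the seeds,
through π₀, and back to i₁. It is equivalent to the existence of a permutation all of whose moves
are allowed (`highDegreeMatch_iff_hasPerm`), hence to a perfect matching, which an auction decides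
(`AuctionState.outcome`). The program is written in a small language in which every loop has the
bound 3n+2; its compiler is proved correct and polynomial once and for all (`executes_compile`). -/

namespace SeededGM

/-! ### Expectations over finite product spaces -/

section Expectation

set_option linter.unusedSectionVars false

variable {J X : Type*} [Fintype J] [DecidableEq J] [Fintype X]

/-- `w j` is a probability vector for every `j`. -/
structure IsWeight (w : J → X → ℝ) : Prop where
  nonneg : ∀ j x, 0 ≤ w j x
  sum_eq_one : ∀ j, ∑ x, w j x = 1

/-- The expectation of `f` when the coordinates are independent and the coordinate `j` has law
`w j`. -/
noncomputable def expect (w : J → X → ℝ) (f : (J → X) → ℝ) : ℝ :=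
  ∑ ω, (∏ j, w j (ω j)) * f ω

open Classical in
/-- The probability of the event `P` when the coordinates are independent. -/
noncomputable def prob (w : J → X → ℝ) (P : (J → X) → Prop) : ℝ :=
  expect w fun ω => if P ω then 1 else 0

variable {w : J → X → ℝ} {f g : (J → X) → ℝ} {P Q : (J → X) → Prop}

lemma IsWeight.prod_nonneg (hw : IsWeight w) (ω : J → X) : 0 ≤ ∏ j, w j (ω j) :=
  Finset.prod_nonneg fun j _ => hw.nonneg j _

lemma expect_one (hw : IsWeight w) : expect w (fun _ => 1) = 1 := by
  have h := Finset.prod_univ_sum (fun _ : J => (Finset.univ : Finset X)) w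
  simp only [hw.sum_eq_one, Finset.prod_const_one, Fintype.piFinset_univ] at h
  simp [expect, ← h]

lemma expect_mono (hw : IsWeight w) (h : ∀ ω, f ω ≤ g ω) : expect w f ≤ expect w g :=
  Finset.sum_le_sum fun ω _ => mul_le_mul_of_nonneg_left (h ω) (hw.prod_nonneg ω)

lemma expect_const_mul (c : ℝ) : expect w (fun ω => c * f ω) = c * expect w f := by
  simp only [expect, Finset.mul_sum]
  exact Finset.sum_congr rfl fun ω _ => by ring

lemma expect_const (hw : IsWeight w) (c : ℝ) : expect w (fun _ => c) = c := by
  simpa [expect_one hw] using expect_const_mul (w := w) (f := fun _ => 1) c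

lemma expect_nonneg (hw : IsWeight w) (h : ∀ ω, 0 ≤ f ω) : 0 ≤ expect w f := by
  simpa [expect_const hw] using expect_mono hw h

lemma expect_add : expect w (fun ω => f ω + g ω) = expect w f + expect w g := by
  simp only [expect, mul_add, Finset.sum_add_distrib]

lemma expect_sum {ι : Type*} (s : Finset ι) (F : ι → (J → X) → ℝ) :
    expect w (fun ω => ∑ i ∈ s, F i ω) = ∑ i ∈ s, expect w (F i) := by
  simp only [expect, Finset.mul_sum]
  exact Finset.sum_comm

/-- Splitting the coordinates into those in `S` and the others makes every expectation a double sum.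
In it `f` sees only the first variable and `g` only the second, so all sums factor. -/
lemma expect_mul_of_dependsOn (hw : IsWeight w) {S T : Set J} (hST : Disjoint S T)
    (hf : DependsOn f S) (hg : DependsOn g T) :
    expect w (fun ω => f ω * g ω) = expect w f * expect w g := by
  classical
  rcases isEmpty_or_nonempty (J → X) with hE | ⟨⟨ω₀⟩⟩
  -- An empty product space would have total mass 0 instead of 1.
  · have h := expect_one hw
    simp [expect] at h
  let e := Equiv.piEquivPiSubtypeProd (fun j => j ∈ S) (fun _ : J => X)
  have key : ∀ h : (J → X) → ℝ, expect w h = ∑ a, ∑ b,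
      (∏ j, w j.1 (a j)) * (∏ j, w j.1 (b j)) * h (e.symm (a, b)) := by
    intro h
    rw [expect, ← e.symm.sum_comp, Fintype.sum_prod_type]
    refine Finset.sum_congr rfl fun a _ => Finset.sum_congr rfl fun b _ => ?_
    rw [← Fintype.prod_subtype_mul_prod_subtype (fun j => j ∈ S)]
    congr 2
    · refine Finset.prod_congr rfl fun j _ => ?_
      simp [e, Equiv.piEquivPiSubtypeProd, j.2]
    · refine Finset.prod_congr rfl fun j _ => ?_
      simp [e, Equiv.piEquivPiSubtypeProd, j.2]
  have hF : ∀ a b, f (e.symm (a, b)) = f (e.symm (a, (e ω₀).2)) := fun a b =>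
    hf fun j hj => by simp [e, Equiv.piEquivPiSubtypeProd, hj]
  have hG : ∀ a b, g (e.symm (a, b)) = g (e.symm ((e ω₀).1, b)) := fun a b =>
    hg fun j hj => by
      have : j ∉ S := fun h => hST.le_bot ⟨h, hj⟩
      simp [e, Equiv.piEquivPiSubtypeProd, this]
  have h1 := expect_one hw
  rw [key] at h1 ⊢
  rw [key f, key g]
  simp only [hF _ _, mul_one] at h1 ⊢
  set A : ({j // j ∈ S} → X) → ℝ := fun a => ∏ j, w j.1 (a j)
  set B : ({j // j ∉ S} → X) → ℝ := fun b => ∏ j, w j.1 (b j)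
  have h1' : (∑ a, A a) * (∑ b, B b) = 1 := by rw [Finset.sum_mul_sum]; exact h1
  have e1 : ∑ a, ∑ b, A a * B b * f (e.symm (a, (e ω₀).2)) =
      (∑ a, A a * f (e.symm (a, (e ω₀).2))) * ∑ b, B b := by
    rw [Finset.sum_mul_sum]
    exact Finset.sum_congr rfl fun a _ => Finset.sum_congr rfl fun b _ => by ring
  have e2 : ∑ a, ∑ b, A a * B b * g (e.symm (a, b)) =
      (∑ a, A a) * ∑ b, B b * g (e.symm ((e ω₀).1, b)) := by
    rw [Finset.sum_mul_sum]
    exact Finset.sum_congr rfl fun a _ => Finset.sum_congr rfl fun b _ => by rw [hG]; ring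
  have e3 : ∑ a, ∑ b, A a * B b * (f (e.symm (a, (e ω₀).2)) * g (e.symm (a, b))) =
      (∑ a, A a * f (e.symm (a, (e ω₀).2))) * ∑ b, B b * g (e.symm ((e ω₀).1, b)) := by
    rw [Finset.sum_mul_sum]
    exact Finset.sum_congr rfl fun a _ => Finset.sum_congr rfl fun b _ => by rw [hG]; ring
  change ∑ a, ∑ b, A a * B b * (f (e.symm (a, (e ω₀).2)) * g (e.symm (a, b))) =
    (∑ a, ∑ b, A a * B b * f (e.symm (a, (e ω₀).2))) * ∑ a, ∑ b, A a * B b * g (e.symm (a, b))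
  rw [e1, e2, e3]
  -- The right-hand side carries the superfluous factor `(∑ A) * (∑ B)`, which is the total mass.
  linear_combination (-(∑ a, A a * f (e.symm (a, (e ω₀).2))) *
    (∑ b, B b * g (e.symm ((e ω₀).1, b)))) * h1'

lemma DependsOn.finset_prod {ι : Type*} {R : Finset ι} {F : ι → (J → X) → ℝ} {S : ι → Set J}
    (hF : ∀ v ∈ R, DependsOn (F v) (S v)) :
    DependsOn (fun ω => ∏ v ∈ R, F v ω) (⋃ v ∈ R, S v) := fun _ _ h =>
  Finset.prod_congr rfl fun v hv => hF v hv fun j hj => h j (Set.mem_biUnion hv hj)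

lemma expect_prod_of_dependsOn (hw : IsWeight w) {ι : Type*} (R : Finset ι)
    {F : ι → (J → X) → ℝ} {S : ι → Set J} (hF : ∀ v ∈ R, DependsOn (F v) (S v))
    (hS : (R : Set ι).PairwiseDisjoint S) :
    expect w (fun ω => ∏ v ∈ R, F v ω) = ∏ v ∈ R, expect w (F v) := by
  classical
  induction R using Finset.induction_on with
  | empty => simpa using expect_one hw
  | insert v R hv ih =>
    simp only [Finset.prod_insert hv]
    have hF' : ∀ u ∈ R, DependsOn (F u) (S u) := fun u hu => hF u (Finset.mem_insert_of_mem hu)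
    rw [expect_mul_of_dependsOn hw _ (hF v (Finset.mem_insert_self v R))
      (DependsOn.finset_prod hF'), ih hF']
    · exact hS.subset (by simp)
    · rw [Set.disjoint_iUnion₂_right]
      intro u hu
      exact hS (by simp) (by simp [hu]) (by rintro rfl; exact hv hu)

/-- Weighting only the coordinate `j` by `h` in the expansion of the product of sums leaves the
factor 1 at every other coordinate. -/
lemma expect_coord (hw : IsWeight w) (j : J) (h : X → ℝ) :
    expect w (fun ω => h (ω j)) = ∑ x, w j x * h x := by
  have hp := Finset.prod_univ_sum (fun _ : J => (Finset.univ : Finset X))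
    (fun i x => w i x * if i = j then h x else 1)
  have e1 : ∀ i, ∑ x, (w i x * if i = j then h x else 1) =
      if i = j then ∑ x, w j x * h x else 1 := by
    intro i
    by_cases hi : i = j
    · subst hi; simp
    · simp [hi, hw.sum_eq_one]
  simp only [e1, Finset.prod_ite_eq', Finset.mem_univ, if_true, Fintype.piFinset_univ,
    Finset.prod_mul_distrib] at hp
  rw [hp, expect]

lemma prob_nonneg (hw : IsWeight w) : 0 ≤ prob w P :=
  expect_nonneg hw fun ω => by split_ifs <;> norm_num

lemma prob_mono (hw : IsWeight w) (h : ∀ ω, P ω → Q ω) : prob w P ≤ prob w Q := by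
  refine expect_mono hw fun ω => ?_
  by_cases hP : P ω
  · simp [hP, h ω hP]
  · simp only [hP, if_false]; split_ifs <;> norm_num

lemma prob_le_one (hw : IsWeight w) : prob w P ≤ 1 := by
  rw [← expect_one hw]
  exact expect_mono hw fun ω => by split_ifs <;> norm_num

lemma prob_le_expect (hw : IsWeight w) (h0 : ∀ ω, 0 ≤ f ω) (h : ∀ ω, P ω → 1 ≤ f ω) :
    prob w P ≤ expect w f := by
  refine expect_mono hw fun ω => ?_
  by_cases hP : P ω
  · simpa [hP] using h ω hP
  · simpa [hP] using h0 ω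

lemma prob_or_le (hw : IsWeight w) : prob w (fun ω => P ω ∨ Q ω) ≤ prob w P + prob w Q := by
  classical
  have : prob w P + prob w Q =
      expect w (fun ω => (if P ω then (1 : ℝ) else 0) + if Q ω then 1 else 0) := by
    simp only [prob, expect, mul_add, Finset.sum_add_distrib]
  rw [this]
  refine expect_mono hw fun ω => ?_
  by_cases hP : P ω <;> by_cases hQ : Q ω <;> simp [hP, hQ]

lemma prob_exists_mem_le (hw : IsWeight w) {ι : Type*} (s : Finset ι) (A : ι → (J → X) → Prop) :
    prob w (fun ω => ∃ i ∈ s, A i ω) ≤ ∑ i ∈ s, prob w (A i) := by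
  classical
  simp only [prob]
  rw [← expect_sum]
  refine expect_mono hw fun ω => ?_
  split_ifs with h
  · obtain ⟨i, hi, hA⟩ := h
    refine le_trans (by simp [hA]) (Finset.single_le_sum (f := fun i => if A i ω then (1 : ℝ) else 0)
      (fun i _ => by split_ifs <;> norm_num) hi)
  · exact Finset.sum_nonneg fun i _ => by split_ifs <;> norm_num

lemma prob_exists_le (hw : IsWeight w) {ι : Type*} [Fintype ι] (A : ι → (J → X) → Prop) :
    prob w (fun ω => ∃ i, A i ω) ≤ ∑ i, prob w (A i) := by
  simpa using prob_exists_mem_le hw Finset.univ A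

lemma prob_and_of_dependsOn (hw : IsWeight w) {S T : Set J} (hST : Disjoint S T)
    (hP : DependsOn P S) (hQ : DependsOn Q T) :
    prob w (fun ω => P ω ∧ Q ω) = prob w P * prob w Q := by
  classical
  simp only [prob]
  rw [← expect_mul_of_dependsOn hw hST]
  · congr 1; ext ω
    by_cases h1 : P ω <;> by_cases h2 : Q ω <;> simp [h1, h2]
  · intro x y h; simp only [hP h]
  · intro x y h; simp only [hQ h]

lemma sum_prob_eq {ι : Type*} [Fintype ι] (hw : IsWeight w) (F : (J → X) → ι) :
    ∑ i, prob w (fun ω => F ω = i) = 1 := by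
  classical
  simp only [prob]
  rw [← expect_sum]
  refine (congrArg (expect w) (funext fun ω => ?_)).trans (expect_one hw)
  rw [Finset.sum_eq_single (F ω)] <;> simp +contextual [eq_comm]

/-- The total probability bound: `Q` has conditional probability at most `δ` given the value
of `F`, in the sense that, on the event `F = i`, it implies an event independent of `F = i` of
probability at most `δ`. -/
lemma prob_le_of_fibres (hw : IsWeight w) {ι : Type*} [Finite ι] (F : (J → X) → ι) (δ : ℝ)
    (hδ : 0 ≤ δ)
    (h : ∀ i, (∃ ω, F ω = i ∧ Q ω) → ∃ (S T : Set J) (B : (J → X) → Prop), Disjoint S T ∧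
      DependsOn (fun ω => F ω = i) S ∧ DependsOn B T ∧ (∀ ω, F ω = i → Q ω → B ω) ∧
      prob w B ≤ δ) :
    prob w Q ≤ δ := by
  classical
  cases nonempty_fintype ι
  have h1 : prob w Q ≤ ∑ i, prob w (fun ω => F ω = i ∧ Q ω) :=
    (prob_mono hw fun ω hω => ⟨F ω, rfl, hω⟩).trans
      (prob_exists_le hw fun i ω => F ω = i ∧ Q ω)
  refine h1.trans ?_
  rw [← mul_one δ, ← sum_prob_eq hw F, Finset.mul_sum]
  refine Finset.sum_le_sum fun i _ => ?_
  by_cases hi : ∃ ω, F ω = i ∧ Q ω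
  · obtain ⟨S, T, B, hST, hF, hB, hQB, hle⟩ := h i hi
    calc prob w (fun ω => F ω = i ∧ Q ω) ≤ prob w (fun ω => F ω = i ∧ B ω) :=
          prob_mono hw fun ω hω => ⟨hω.1, hQB ω hω.1 hω.2⟩
      _ = prob w (fun ω => F ω = i) * prob w B := prob_and_of_dependsOn hw hST hF hB
      _ ≤ _ := by rw [mul_comm]; exact mul_le_mul_of_nonneg_right hle (prob_nonneg hw)
  -- A value of `F` that is incompatible with `Q` contributes nothing, so no independent event is
  -- needed for it.
  · have : prob w (fun ω => F ω = i ∧ Q ω) ≤ prob w (fun _ => False) :=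
      prob_mono hw fun ω hω => hi ⟨ω, hω⟩
    refine this.trans ?_
    have h0 : prob w (fun _ : J → X => False) = 0 := by simp [prob, expect]
    rw [h0]
    exact mul_nonneg hδ (prob_nonneg hw)

lemma prob_forall_mem (hw : IsWeight w) (F : Finset J) (A : J → X → Prop)
    [∀ j, DecidablePred (A j)] :
    prob w (fun ω => ∀ j ∈ F, A j (ω j)) = ∏ j ∈ F, ∑ x, if A j x then w j x else 0 := by
  have h1 : prob w (fun ω => ∀ j ∈ F, A j (ω j)) =
      expect w (fun ω => ∏ j ∈ F, if A j (ω j) then (1 : ℝ) else 0) := by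
    refine congrArg (expect w) (funext fun ω => ?_)
    split_ifs with h
    · exact (Finset.prod_eq_one fun j hj => by simp [h j hj]).symm
    · push Not at h
      obtain ⟨j, hj, hA⟩ := h
      exact (Finset.prod_eq_zero hj (by simp [hA])).symm
  rw [h1, expect_prod_of_dependsOn hw F (S := fun j => {j})]
  · refine Finset.prod_congr rfl fun j _ => ?_
    rw [expect_coord hw j fun x => if A j x then (1 : ℝ) else 0]
    exact Finset.sum_congr rfl fun x _ => by simp
  · intro j _ x y h
    simp [h j rfl]
  · intro i _ j _ hij
    simpa using hij

end Expectation


/-! ### The law as a finite product -/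

section Law

instance measurableSingletonClass_simpleGraph (V : Type) [Countable V] :
    MeasurableSingletonClass (SimpleGraph V) where
  measurableSet_singleton G := by
    have h : ({G} : Set (SimpleGraph V)) = SimpleGraph.edgeSet ⁻¹' {G.edgeSet} := by
      ext H; simp
    rw [h]
    exact SimpleGraph.measurableEmbedding_edgeSet.measurable (measurableSet_singleton _)

lemma measureReal_prod_eq_sum {α β : Type*} [Fintype α] [Fintype β] [MeasurableSpace α]
    [MeasurableSpace β] [MeasurableSingletonClass α] [MeasurableSingletonClass β]
    (μ : Measure α) (ν : Measure β) [IsFiniteMeasure μ] [IsFiniteMeasure ν] (S : Set (α × β)) :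
    (μ.prod ν).real S = ∑ a, μ.real {a} * ν.real {b | (a, b) ∈ S} := by
  rw [measureReal_def, Measure.prod_apply (Set.toFinite S).measurableSet, lintegral_fintype,
    ENNReal.toReal_sum]
  · refine Finset.sum_congr rfl fun a _ => ?_
    rw [ENNReal.toReal_mul, mul_comm]
    rfl
  · intro a _
    exact ENNReal.mul_ne_top (measure_ne_top _ _) (measure_ne_top _ _)

/-- The weights of independent Bernoulli variables. -/
noncomputable def bernoulliWeight (J : Type*) (p : ℝ) : J → Bool → ℝ :=
  fun _ b => if b then p else 1 - p

lemma isWeight_bernoulliWeight (J : Type*) [Fintype J] [DecidableEq J] (p : I) :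
    IsWeight (bernoulliWeight J p) :=
  ⟨fun _ b => by cases b <;> simp [bernoulliWeight, p.2.1, p.2.2], fun _ => by
    simp [bernoulliWeight]⟩

variable {V : Type} [Fintype V] [DecidableEq V]

/-- The graph whose edges are the (off-diagonal) pairs marked `true`. -/
def graphOf (ω : Sym2 V → Bool) : SimpleGraph V where
  Adj u v := u ≠ v ∧ ω s(u, v) = true
  symm := ⟨fun u v h => ⟨h.1.symm, by rw [Sym2.eq_swap]; exact h.2⟩⟩
  loopless := ⟨fun _ h => h.1 rfl⟩

/-- The diagonal marks are ignored by `graphOf`. Only the off-diagonal coordinates are constrained,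
and the others integrate to one. -/
lemma graphOf_eq_iff (ω : Sym2 V → Bool) (G : SimpleGraph V) :
    graphOf ω = G ↔ ∀ e ∈ (Finset.univ.filter fun e : Sym2 V => ¬ e.IsDiag),
      (ω e = true ↔ e ∈ G.edgeSet) := by
  constructor
  · rintro rfl e he
    induction e with
    | _ u v => simp at he; simp [graphOf, he]
  · intro h
    ext u v
    by_cases huv : u = v
    · subst huv; simp
    · have := h s(u, v) (by simpa using huv)
      simp only [SimpleGraph.mem_edgeSet] at this
      simp [graphOf, huv, this]

/-- The Erdős–Rényi law is the law of the graph of independent coin flips. As there are finitely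
many graphs, agreement on singletons is all that is needed. -/
lemma binomialRandom_real_singleton (p : I) (G : SimpleGraph V) :
    (SimpleGraph.binomialRandom V p).real {G} =
      prob (bernoulliWeight (Sym2 V) p) (fun ω => graphOf ω = G) := by
  classical
  simp only [graphOf_eq_iff]
  rw [prob_forall_mem (isWeight_bernoulliWeight _ p) _ fun e b => (b = true ↔ e ∈ G.edgeSet)]
  have h1 : ∀ e : Sym2 V, (∑ x : Bool, if (x = true ↔ e ∈ G.edgeSet) then
      bernoulliWeight (Sym2 V) p e x else 0) = if e ∈ G.edgeSet then (p : ℝ) else 1 - p := by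
    intro e
    by_cases he : e ∈ G.edgeSet <;> simp [he, bernoulliWeight]
  simp only [h1]
  rw [measureReal_def, SimpleGraph.binomialRandom, SimpleGraph.measurableEmbedding_edgeSet.comap_apply,
    Set.image_singleton, ← measureReal_def,
    setBernoulli_real_singleton p (by simp) (Set.toFinite _), Finset.prod_ite]
  simp only [Finset.prod_const]
  congr 2
  · rw [← Set.ncard_coe_finset]
    congr 1
    ext e
    simp only [Finset.coe_filter, Finset.mem_filter, Finset.mem_univ, true_and, Set.mem_ofPred_eq]
    exact ⟨fun h => ⟨G.not_isDiag_of_mem_edgeSet h, h⟩, fun h => h.2⟩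
  · rw [← Set.ncard_coe_finset]
    congr 1
    ext e
    simp

lemma setBernoulli_univ_real_singleton (p : I) (S : Set V) :
    (setBernoulli (Set.univ : Set V) p).real {S} =
      prob (bernoulliWeight V p) (fun ω => {v | ω v = true} = S) := by
  classical
  have h0 : ∀ ω : V → Bool, ({v | ω v = true} = S) ↔ ∀ v ∈ (Finset.univ : Finset V),
      (ω v = true ↔ v ∈ S) := fun ω => by simp [Set.ext_iff]
  simp only [h0]
  rw [prob_forall_mem (isWeight_bernoulliWeight _ p) _ fun v b => (b = true ↔ v ∈ S)]
  have h1 : ∀ v : V, (∑ x : Bool, if (x = true ↔ v ∈ S) then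
      bernoulliWeight V p v x else 0) = if v ∈ S then (p : ℝ) else 1 - p := by
    intro v
    by_cases he : v ∈ S <;> simp [he, bernoulliWeight]
  simp only [h1]
  rw [setBernoulli_real_singleton p (by simp) (Set.toFinite _), Finset.prod_ite]
  simp only [Finset.prod_const]
  congr 2
  · rw [← Set.ncard_coe_finset]; congr 1; ext e; simp
  · rw [← Set.ncard_coe_finset]; congr 1; ext e; simp

lemma sum_prob_mul {J X ι : Type*} [Fintype J] [DecidableEq J] [Fintype X] [Fintype ι]
    (w : J → X → ℝ) (F : (J → X) → ι) (h : ι → ℝ) :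
    ∑ i, prob w (fun ω => F ω = i) * h i = expect w fun ω => h (F ω) := by
  classical
  simp only [prob, expect, Finset.sum_mul]
  rw [Finset.sum_comm]
  refine Finset.sum_congr rfl fun ω _ => ?_
  rw [Finset.sum_eq_single (F ω)] <;> simp +contextual [eq_comm]

/-- Two independent families over the same index set are one independent family of pairs. This
merges the three edge samples into a single `Mark` per pair of vertices. -/
lemma expect_prod_weight {J X Y : Type*} [Fintype J] [DecidableEq J] [Fintype X] [Fintype Y]
    (w : J → X → ℝ) (w' : J → Y → ℝ) (f : (J → X) → (J → Y) → ℝ) :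
    expect w (fun ω => expect w' (f ω)) =
      expect (fun j (x : X × Y) => w j x.1 * w' j x.2)
        fun ω => f (fun j => (ω j).1) (fun j => (ω j).2) := by
  simp only [expect, Finset.mul_sum]
  rw [← (Equiv.arrowProdEquivProdArrow J (fun _ => X) (fun _ => Y)).symm.sum_comp,
    Fintype.sum_prod_type]
  refine Finset.sum_congr rfl fun a _ => Finset.sum_congr rfl fun b _ => ?_
  simp [Equiv.arrowProdEquivProdArrow, Finset.prod_mul_distrib, mul_assoc]

/-- The three marks of a pair: membership in `G₀` and in the two sets of edge marks. -/
abbrev Mark : Type := Bool × Bool × Bool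

/-- The weights of the three marks of a pair. -/
noncomputable def markWeight (V : Type) (p s : ℝ) : Sym2 V → Mark → ℝ :=
  fun e x => bernoulliWeight (Sym2 V) p e x.1 *
    (bernoulliWeight (Sym2 V) s e x.2.1 * bernoulliWeight (Sym2 V) s e x.2.2)

lemma isWeight_markWeight (p s : I) : IsWeight (markWeight V p s) := by
  have hp := isWeight_bernoulliWeight (Sym2 V) p
  have hs := isWeight_bernoulliWeight (Sym2 V) s
  refine ⟨fun e x => mul_nonneg (hp.nonneg _ _) (mul_nonneg (hs.nonneg _ _) (hs.nonneg _ _)),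
    fun e => ?_⟩
  simp only [Fintype.sum_prod_type, markWeight, ← Finset.mul_sum, hs.sum_eq_one, mul_one,
    hp.sum_eq_one]

/-- The parent graph read off from the marks. -/
def parent (ω : Sym2 V → Mark) : SimpleGraph V := graphOf fun e => (ω e).1

/-- The first set of edge marks. -/
def markOne (ω : Sym2 V → Mark) : SimpleGraph V := graphOf fun e => (ω e).2.1

/-- The second set of edge marks. -/
def markTwo (ω : Sym2 V → Mark) : SimpleGraph V := graphOf fun e => (ω e).2.2

-- The event does not mention the latent permutation or the fallback permutation, so both integrate
-- out. What remains is a finite product over pairs and vertices, to which the elementary calculus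
-- above applies.
open Classical in
lemma law_real_eq_expect (n : ℕ) (p s α : I)
    (P : SimpleGraph (Fin n) → SimpleGraph (Fin n) → SimpleGraph (Fin n) → Set (Fin n) → Prop) :
    (law n p s α).real {ω | P ω.1 ω.2.1 ω.2.2.1 ω.2.2.2.2.1} =
      expect (markWeight (Fin n) p s) fun ω => prob (bernoulliWeight (Fin n) α) fun τ =>
        P (parent ω) (markOne ω) (markTwo ω) {v | τ v = true} := by
  have key : ∀ A B C, ((PMF.uniformOfFintype (Equiv.Perm (Fin n))).toMeasure.prod <|
          (setBernoulli (Set.univ : Set (Fin n)) α).prod <|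
            (PMF.uniformOfFintype (Equiv.Perm (Fin n))).toMeasure).real
            {x | P A B C x.2.1} = prob (bernoulliWeight (Fin n) α) fun τ =>
        P A B C {v | τ v = true} := by
    intro A B C
    rw [measureReal_prod_eq_sum]
    simp only [Set.mem_ofPred_eq]
    rw [← Finset.sum_mul, show (∑ i : Equiv.Perm (Fin n),
      (PMF.uniformOfFintype (Equiv.Perm (Fin n))).toMeasure.real {i}) = 1 by
        rw [sum_measureReal_singleton]; simp, one_mul, measureReal_prod_eq_sum]
    simp only [Set.mem_ofPred_eq, setBernoulli_univ_real_singleton]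
    rw [sum_prob_mul, prob]
    congr 1; ext τ
    by_cases h : P A B C {v | τ v = true} <;> simp [h]
  rw [law, measureReal_prod_eq_sum]
  simp only [Set.mem_ofPred_eq, binomialRandom_real_singleton]
  rw [sum_prob_mul]
  have h2 : ∀ A, ((SimpleGraph.binomialRandom (Fin n) s).prod <|
      (SimpleGraph.binomialRandom (Fin n) s).prod <|
        (PMF.uniformOfFintype (Equiv.Perm (Fin n))).toMeasure.prod <|
          (setBernoulli (Set.univ : Set (Fin n)) α).prod <|
            (PMF.uniformOfFintype (Equiv.Perm (Fin n))).toMeasure).real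
              {x | P A x.1 x.2.1 x.2.2.2.1} =
      expect (bernoulliWeight (Sym2 (Fin n)) s) fun b =>
        expect (bernoulliWeight (Sym2 (Fin n)) s) fun c =>
          prob (bernoulliWeight (Fin n) α) fun τ =>
            P A (graphOf b) (graphOf c) {v | τ v = true} := by
    intro A
    rw [measureReal_prod_eq_sum]
    simp only [Set.mem_ofPred_eq, binomialRandom_real_singleton]
    rw [sum_prob_mul]
    congr 1; ext b
    rw [measureReal_prod_eq_sum]
    simp only [Set.mem_ofPred_eq, binomialRandom_real_singleton]
    rw [sum_prob_mul]
    congr 1; ext c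
    exact key _ _ _
  simp only [h2]
  simp only [expect_prod_weight]
  rfl

end Law


/-! ### A deterministic criterion for success -/

section Deterministic

lemma IndependentPaths.map {V W : Type} {G : SimpleGraph V} {G' : SimpleGraph W} (φ : G →g G')
    (hφ : Function.Injective φ) {ℓ m : ℕ} {r : V} {x : Fin m → V}
    (h : IndependentPaths G ℓ r x) : IndependentPaths G' ℓ (φ r) (fun k => φ (x k)) := by
  obtain ⟨P, hP, hd⟩ := h
  refine ⟨fun k => (P k).map φ, fun k => ⟨(SimpleGraph.Walk.isPath_map_iff_of_injective hφ).2 (hP k).1, by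
    simpa using (hP k).2⟩, fun j k hjk v hv hv' => ?_⟩
  simp only [SimpleGraph.Walk.support_map, List.mem_map] at hv hv'
  obtain ⟨a, ha, rfl⟩ := hv
  obtain ⟨b, hb, hab⟩ := hv'
  obtain rfl := hφ hab
  rw [hd j k hjk b ha hb]

lemma edist_iso_le {V W : Type} {G : SimpleGraph V} {G' : SimpleGraph W} (φ : G ≃g G') (a b : V) :
    G'.edist (φ a) (φ b) ≤ G.edist a b := by
  by_cases h : G.Reachable a b
  · obtain ⟨p, hp⟩ := h.exists_walk_length_eq_edist
    rw [← hp]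
    have := SimpleGraph.Walk.edist_le (p.map φ.toHom)
    simpa using this
  · rw [SimpleGraph.edist_eq_top_of_not_reachable h]
    exact le_top

lemma mem_sphere_iso {V W : Type} {G : SimpleGraph V} {G' : SimpleGraph W} (φ : G ≃g G') {ℓ : ℕ}
    {a b : V} : φ b ∈ sphere G' ℓ (φ a) ↔ b ∈ sphere G ℓ a := by
  have h : G'.edist (φ a) (φ b) = G.edist a b := by
    refine le_antisymm (edist_iso_le φ a b) ?_
    simpa using edist_iso_le φ.symm (φ a) (φ b)
  simp [sphere, h]

/-- The vertices `v` of `G₂` and `u` of `G₁` are linked by `m` independent `ℓ`-paths to the same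
`m` elements of `S`, at distance `ℓ` from both of them. -/
def Linked {V : Type} (G₁ G₂ : SimpleGraph V) (S : Set V) (m ℓ : ℕ) (v u : V) : Prop :=
  ∃ x : Fin m → V, Function.Injective x ∧ (∀ k, x k ∈ S) ∧
    (∀ k, x k ∈ sphere G₂ ℓ v) ∧ IndependentPaths G₂ ℓ v x ∧
      (∀ k, x k ∈ sphere G₁ ℓ u) ∧ IndependentPaths G₁ ℓ u x

variable {n : ℕ}

/-- The inverse of π* is an isomorphism of G₁ onto G₁*, and the seed map forces `y k = ω.latent (x
k)`. The second family of endpoints therefore disappears from the condition. -/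
lemma highDegreeMatch_iff (ω : Sample n) (m ℓ : ℕ) (v u : Fin n) :
    HighDegreeMatch ω.graphOne ω.graphTwo ω.seedMap m ℓ v (ω.latent u) ↔
      v ∉ ω.2.2.2.2.1 ∧ u ∉ ω.2.2.2.2.1 ∧
        Linked ω.graphOneStar ω.graphTwo ω.2.2.2.2.1 m ℓ v u := by
  let φ : ω.graphOne ≃g ω.graphOneStar := SimpleGraph.Iso.comap ω.latent.symm ω.graphOneStar
  have hφ : ∀ a, φ a = ω.latent.symm a := fun a => rfl
  have hφ' : ∀ a, φ.symm a = ω.latent a := fun a => rfl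
  have hmem : ∀ i j, ω.seedMap i = some j ↔ i ∈ ω.2.2.2.2.1 ∧ ω.latent i = j := by
    intro i j; simp [Sample.seedMap]
  refine and_congr (by simp [Sample.seedMap]) (and_congr ?_ ?_)
  · simp only [ne_eq, hmem, not_and]
    exact ⟨fun h hu => h u hu rfl, fun h j hj hju => h (ω.latent.injective hju ▸ hj)⟩
  · constructor
    · rintro ⟨x, y, hx, hy, hxy, h1, h2, h3, h4⟩
      have hyx : ∀ k, y k = ω.latent (x k) := fun k => ((hmem _ _).1 (hxy k)).2.symm
      refine ⟨x, hx, fun k => ((hmem _ _).1 (hxy k)).1, h1, h2, fun k => ?_, ?_⟩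
      · have := (mem_sphere_iso φ).2 (h3 k)
        simpa [hφ, hyx] using this
      · have := h4.map φ.toHom φ.injective
        have e1 : φ.toHom (ω.latent u) = u := by
          change ω.latent.symm (ω.latent u) = u; simp
        have e2 : (fun k => φ.toHom (y k)) = x := by
          funext k; change ω.latent.symm (y k) = x k; simp [hyx]
        rwa [e1, e2] at this
    · rintro ⟨x, hx, hS, h1, h2, h3, h4⟩
      refine ⟨x, fun k => ω.latent (x k), hx, ω.latent.injective.comp hx,
        fun k => (hmem _ _).2 ⟨hS k, rfl⟩, h1, h2, fun k => ?_, ?_⟩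
      · have := (mem_sphere_iso φ.symm).2 (h3 k)
        simpa [hφ'] using this
      · exact h4.map φ.symm.toHom φ.symm.injective

/-- Sufficient conditions for the algorithm to recover the latent permutation: no wrong pair is
linked, all vertices outside `S ∪ low` are linked to themselves, `H` has no isolated vertex, and
vertices of `low` are far apart in the parent graph. -/
structure Good {V : Type} (G₀ H : SimpleGraph V) (S low : Set V) (link : V → V → Prop) :
    Prop where
  eq_of_link : ∀ v u, link v u → v = u
  link_self : ∀ v, v ∉ S → v ∉ low → link v v
  exists_adj : ∀ v, ∃ w, H.Adj v w
  not_adj : ∀ u v, u ∈ low → v ∈ low → ¬ G₀.Adj u v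
  not_adj_adj : ∀ u v w, u ∈ low → v ∈ low → u ≠ v → G₀.Adj u w → G₀.Adj v w → False

/-- All pairs matched before the second step are correct, and only low vertices are left over. A
wrong pair in the second step would put two low vertices next to the same vertex of the parent
graph; on the other hand every low vertex has a neighbour in `H`, which is not low and hence already
matched. -/
lemma algorithmOutput_eq_latent (ω : Sample n) (m ℓ : ℕ) (low : Set (Fin n))
    (h : Good ω.1 (ω.graphOneStar ⊓ ω.graphTwo) ω.2.2.2.2.1 low
      (Linked ω.graphOneStar ω.graphTwo ω.2.2.2.2.1 m ℓ)) :
    algorithmOutput ω.graphOne ω.graphTwo ω.seedMap m ℓ ω.fallback = ω.latent := by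
  set M := Matched ω.graphOne ω.graphTwo ω.seedMap m ℓ with hM
  have hmem : ∀ i j, ω.seedMap i = some j ↔ i ∈ ω.2.2.2.2.1 ∧ ω.latent i = j := by
    intro i j; simp [Sample.seedMap]
  have adj1 : ∀ a b, ω.graphOne.Adj (ω.latent a) (ω.latent b) ↔ ω.graphOneStar.Adj a b := by
    intro a b; simp [Sample.graphOne]
  have mEq : ∀ v u, M v (ω.latent u) → v = u := by
    rintro v u (hvu | hvu)
    · exact h.eq_of_link v u ((highDegreeMatch_iff ω m ℓ v u).1 hvu).2.2
    · exact ω.latent.injective ((hmem _ _).1 hvu).2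
  have mSelf : ∀ v, v ∉ low → M v (ω.latent v) := by
    intro v hv
    by_cases hS : v ∈ ω.2.2.2.2.1
    · exact Or.inr ((hmem _ _).2 ⟨hS, rfl⟩)
    · exact Or.inl ((highDegreeMatch_iff ω m ℓ v v).2 ⟨hS, hS, h.link_self v hS hv⟩)
  have fEq : ∀ v u, FinalMatch ω.graphOne ω.graphTwo ω.seedMap m ℓ v (ω.latent u) → v = u := by
    rintro v u (hvu | ⟨h1, h2, j₂, j₁, hj, ha1, ha2⟩)
    · exact mEq v u hvu
    · obtain ⟨j, rfl⟩ := ω.latent.surjective j₁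
      obtain rfl := mEq _ _ hj
      by_contra hne
      have hv : v ∈ low := by
        by_contra hv; exact h1 _ (mSelf v hv)
      have hu : u ∈ low := by
        by_contra hu; exact h2 _ (mSelf u hu)
      exact h.not_adj_adj v u j₂ hv hu hne (by exact ha2.1) (by exact ((adj1 _ _).1 ha1).1)
  have fSelf : ∀ v, FinalMatch ω.graphOne ω.graphTwo ω.seedMap m ℓ v (ω.latent v) := by
    intro v
    by_cases hmv : M v (ω.latent v)
    · exact Or.inl hmv
    have hv : v ∈ low := by
      by_contra hv; exact hmv (mSelf v hv)
    obtain ⟨w, hw⟩ := h.exists_adj v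
    have hwl : w ∉ low := fun hwl => h.not_adj v w hv hwl hw.1.1
    refine Or.inr ⟨fun j hj => ?_, fun j hj => ?_, w, ω.latent w, mSelf w hwl,
      (adj1 _ _).2 hw.1, hw.2⟩
    · obtain ⟨u, rfl⟩ := ω.latent.surjective j
      obtain rfl := mEq _ _ hj
      exact hmv hj
    · obtain rfl := mEq _ _ hj
      exact hmv hj
  have fEq' : ∀ v j, FinalMatch ω.graphOne ω.graphTwo ω.seedMap m ℓ v j → j = ω.latent v := by
    intro v j hj
    obtain ⟨u, rfl⟩ := ω.latent.surjective j
    rw [fEq v u hj]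
  have cF : ¬ Conflict (FinalMatch ω.graphOne ω.graphTwo ω.seedMap m ℓ) := by
    rintro (⟨i, a, b, ha, hb, hne⟩ | ⟨a, b, i, ha, hb, hne⟩)
    · exact hne ((fEq' _ _ ha).trans (fEq' _ _ hb).symm)
    · exact hne (ω.latent.injective ((fEq' _ _ ha).symm.trans (fEq' _ _ hb)))
  have cH : ¬ Conflict (HighDegreeMatch ω.graphOne ω.graphTwo ω.seedMap m ℓ) := by
    rintro (⟨i, a, b, ha, hb, hne⟩ | ⟨a, b, i, ha, hb, hne⟩)
    · exact cF (Or.inl ⟨i, a, b, Or.inl (Or.inl ha), Or.inl (Or.inl hb), hne⟩)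
    · exact cF (Or.inr ⟨a, b, i, Or.inl (Or.inl ha), Or.inl (Or.inl hb), hne⟩)
  have hall : ¬ Conflict (HighDegreeMatch ω.graphOne ω.graphTwo ω.seedMap m ℓ) ∧
      ¬ Conflict (FinalMatch ω.graphOne ω.graphTwo ω.seedMap m ℓ) ∧
      ∃ π : Equiv.Perm (Fin n), ∀ i, FinalMatch ω.graphOne ω.graphTwo ω.seedMap m ℓ i (π i) :=
    ⟨cH, cF, ω.latent, fSelf⟩
  rw [algorithmOutput, dif_pos hall]
  ext i
  rw [fEq' _ _ (hall.2.2.choose_spec i)]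

end Deterministic


/-! ### Wrong pairs are not linked -/

section Spider

set_option linter.unusedSectionVars false

variable {V : Type} [Fintype V] [DecidableEq V]

lemma prob_parent_forall (p s : I) (F : Finset (Sym2 V)) :
    prob (markWeight V p s) (fun ω => ∀ e ∈ F, (ω e).1 = true) = (p : ℝ) ^ F.card := by
  rw [prob_forall_mem (isWeight_markWeight p s) F fun _ x => x.1 = true]
  rw [Finset.prod_congr rfl (g := fun _ => (p : ℝ)), Finset.prod_const]
  intro e _
  simp [Fintype.sum_prod_type, markWeight, bernoulliWeight]
  ring

lemma prob_seeds_forall (α : I) (F : Finset V) :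
    prob (bernoulliWeight V α) (fun τ => ∀ v ∈ F, τ v = true) = (α : ℝ) ^ F.card := by
  rw [prob_forall_mem (isWeight_bernoulliWeight V α) F fun _ x => x = true]
  rw [Finset.prod_congr rfl (g := fun _ => (α : ℝ)), Finset.prod_const]
  intro e _
  simp [bernoulliWeight]

/-- The vertices along a family of independent paths. -/
lemma IndependentPaths.exists_fun {W : Type} {G : SimpleGraph W} {ℓ m : ℕ} {r : W} {x : Fin m → W}
    (h : IndependentPaths G ℓ r x) : ∃ q : Fin m → ℕ → W, (∀ k, q k 0 = r) ∧ (∀ k, q k ℓ = x k) ∧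
      (∀ k t, t < ℓ → G.Adj (q k t) (q k (t + 1))) ∧
      (∀ k t t', t ≤ ℓ → t' ≤ ℓ → q k t = q k t' → t = t') ∧
      (∀ j k, j ≠ k → ∀ t t', q j t = q k t' → q j t = r) := by
  obtain ⟨P, hP, hd⟩ := h
  refine ⟨fun k => (P k).getVert, fun k => by simp, fun k => ?_, fun k t ht => ?_,
    fun k t t' ht ht' he => ?_, fun j k hjk t t' he => ?_⟩
  · rw [← (hP k).2]; simp
  · exact (P k).adj_getVert_succ (by rw [(hP k).2]; exact ht)
  · exact (hP k).1.getVert_injOn (by simpa [(hP k).2] using ht) (by simpa [(hP k).2] using ht') he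
  · exact hd j k hjk _ ((P j).getVert_mem_support t) (he ▸ (P k).getVert_mem_support t')

variable {K ℓ : ℕ}

/-- The edges of the spider with centre `v` and legs `T 0, …, T (K-1)`. -/
def spiderEdges (v : V) (T : Fin K → Fin ℓ → V) : Finset (Sym2 V) :=
  Finset.univ.image fun i : Fin K × Fin ℓ =>
    s((Fin.cons v (T i.1) : Fin (ℓ + 1) → V) i.2.castSucc, T i.1 i.2)

/-- The legs are disjoint paths which avoid the centre. -/
def IsSpider (v : V) (T : Fin K → Fin ℓ → V) : Prop :=
  Function.Injective (fun i : Fin K × Fin ℓ => T i.1 i.2) ∧ ∀ k t, T k t ≠ v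

/-- The vertices of the spider, and one more vertex `u`. -/
def spiderVertices (u v : V) (T : Fin K → Fin ℓ → V) : Finset V :=
  insert u (insert v (Finset.univ.image fun i : Fin K × Fin ℓ => T i.1 i.2))

lemma card_spiderVertices_le (u v : V) (T : Fin K → Fin ℓ → V) :
    (spiderVertices u v T).card ≤ K * ℓ + 2 := by
  refine (Finset.card_insert_le _ _).trans ?_
  have h1 := Finset.card_insert_le v (Finset.univ.image fun i : Fin K × Fin ℓ => T i.1 i.2)
  have h2 := Finset.card_image_le (s := Finset.univ) (f := fun i : Fin K × Fin ℓ => T i.1 i.2)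
  simp only [Finset.card_univ, Fintype.card_prod, Fintype.card_fin] at h2
  omega

/-- `Fin.cons v (T k)` lists the leg with the centre put in front, so its entry at `t.castSucc` is
the predecessor of `T k t` on the way out from the centre. -/
lemma cons_ne_of_isSpider {v : V} {T : Fin K → Fin ℓ → V} (hT : IsSpider v T) (k j : Fin K)
    (t t' : Fin ℓ) (h : (Fin.cons v (T k) : Fin (ℓ + 1) → V) t.castSucc = T j t') :
    k = j ∧ (t : ℕ) = t' + 1 := by
  obtain ⟨t, ht⟩ := t
  cases t with
  | zero => exact absurd h.symm (hT.2 j t')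
  | succ t =>
    have : T k ⟨t, by omega⟩ = T j t' := h
    have := hT.1 (a₁ := (k, ⟨t, by omega⟩)) (a₂ := (j, t')) this
    simp only [Prod.mk.injEq, Fin.ext_iff] at this
    exact ⟨Fin.ext this.1, by simpa using this.2⟩

lemma card_spiderEdges {v : V} {T : Fin K → Fin ℓ → V} (hT : IsSpider v T) :
    (spiderEdges v T).card = K * ℓ := by
  rw [spiderEdges, Finset.card_image_of_injective]
  · simp
  · rintro ⟨k, t⟩ ⟨j, t'⟩ h
    simp only [Sym2.eq_iff] at h
    rcases h with ⟨-, h⟩ | ⟨h1, h2⟩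
    · exact hT.1 h
    · have a := (cons_ne_of_isSpider hT _ _ _ _ h1).2
      have b := (cons_ne_of_isSpider hT _ _ _ _ h2.symm).2
      omega

/-- Every vertex of an edge of the spider is a vertex of the spider. -/
lemma mem_spiderVertices_of_mem_edges (u : V) {v : V} {T : Fin K → Fin ℓ → V} {a b : V}
    (h : s(a, b) ∈ spiderEdges v T) :
    a ∈ spiderVertices u v T ∧ b ∈ spiderVertices u v T := by
  simp only [spiderEdges, Finset.mem_image, Finset.mem_univ, true_and, Prod.exists] at h
  obtain ⟨k, t, h⟩ := h
  have h1 : T k t ∈ spiderVertices u v T := by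
    simp only [spiderVertices, Finset.mem_insert, Finset.mem_image, Finset.mem_univ, true_and]
    exact Or.inr (Or.inr ⟨(k, t), rfl⟩)
  have h2 : (Fin.cons v (T k) : Fin (ℓ + 1) → V) t.castSucc ∈ spiderVertices u v T := by
    obtain ⟨t, ht⟩ := t
    cases t with
    | zero => simp [spiderVertices]
    | succ t =>
      simp only [spiderVertices, Finset.mem_insert, Finset.mem_image, Finset.mem_univ, true_and]
      exact Or.inr (Or.inr ⟨(k, ⟨t, by omega⟩), rfl⟩)
  rcases Sym2.eq_iff.1 h with ⟨rfl, rfl⟩ | ⟨rfl, rfl⟩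
  · exact ⟨h2, h1⟩
  · exact ⟨h1, h2⟩

/-- A potential on the spider which grows along the leg `k` and decreases along the others. -/
lemma exists_potential {v : V} {T : Fin K → Fin ℓ → V} (hT : IsSpider v T) (k : Fin K) :
    ∃ φ : V → ℤ, φ v = 0 ∧ (∀ t, φ (T k t) = t + 1) ∧ (∀ j t, j ≠ k → φ (T j t) = -(t + 1)) ∧
      ∀ a b, s(a, b) ∈ spiderEdges v T → φ b ≤ φ a + 1 := by
  classical
  let φ : V → ℤ := fun w => if h : ∃ i : Fin K × Fin ℓ, T i.1 i.2 = w then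
    (if h.choose.1 = k then (h.choose.2 : ℤ) + 1 else -((h.choose.2 : ℤ) + 1)) else 0
  have hφ : ∀ j t, φ (T j t) = if j = k then (t : ℤ) + 1 else -((t : ℤ) + 1) := by
    intro j t
    have h : ∃ i : Fin K × Fin ℓ, T i.1 i.2 = T j t := ⟨(j, t), rfl⟩
    have hc : h.choose = (j, t) := hT.1 h.choose_spec
    simp only [φ, dif_pos h, hc]
  have h0 : φ v = 0 := by
    have : ¬ ∃ i : Fin K × Fin ℓ, T i.1 i.2 = v := fun ⟨i, hi⟩ => hT.2 _ _ hi
    simp only [φ, dif_neg this]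
  refine ⟨φ, h0, fun t => by simp [hφ], fun j t hj => by simp [hφ, hj], fun a b h => ?_⟩
  simp only [spiderEdges, Finset.mem_image, Finset.mem_univ, true_and, Prod.exists] at h
  obtain ⟨j, t, h⟩ := h
  have h2 : φ ((Fin.cons v (T j) : Fin (ℓ + 1) → V) t.castSucc) =
      if j = k then (t : ℤ) else -(t : ℤ) := by
    obtain ⟨t, ht⟩ := t
    cases t with
    | zero => simp [h0]
    | succ t =>
      refine (hφ j ⟨t, by omega⟩).trans ?_
      push_cast; rfl
  have h1 := hφ j t
  rcases Sym2.eq_iff.1 h with ⟨rfl, rfl⟩ | ⟨rfl, rfl⟩ <;>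
    · rw [h1, h2]; split_ifs <;> omega

/-- The edges of a path given by the list of its vertices. -/
def pathEdges {a : ℕ} (f : Fin (a + 2) → V) : Finset (Sym2 V) :=
  Finset.univ.image fun i : Fin (a + 1) => s(f i.castSucc, f i.succ)

lemma card_pathEdges {a : ℕ} {f : Fin (a + 2) → V} (hf : Function.Injective f) :
    (pathEdges f).card = a + 1 := by
  rw [pathEdges, Finset.card_image_of_injective]
  · simp
  · intro i j h
    simp only [Sym2.eq_iff, hf.eq_iff, Fin.ext_iff, Fin.val_castSucc, Fin.val_succ] at h
    exact Fin.ext (by omega)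

/-- A path with at least one and at most `ℓ` edges, given by the list of its vertices. -/
abbrev Ear (V : Type) (ℓ : ℕ) : Type := (a : Fin ℓ) × (Fin (a + 2) → V)

/-- If `q` is a path of length `ℓ` from `u` to the end of the leg `k` of a spider with centre
`v ≠ u`, and `u` does not lie on that leg, then `q` contains an ear of the spider. -/
lemma exists_ear {u v : V} (huv : u ≠ v) {T : Fin K → Fin ℓ → V} (hT : IsSpider v T) (k : Fin K)
    (hk : ∀ t, T k t ≠ u) {q : ℕ → V} (hℓ : 0 < ℓ) (h0 : q 0 = u)
    (hend : q ℓ = T k ⟨ℓ - 1, by omega⟩)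
    (hinj : ∀ t t', t ≤ ℓ → t' ≤ ℓ → q t = q t' → t = t') :
    ∃ η : Ear V ℓ, Function.Injective η.2 ∧ η.2 0 ∈ spiderVertices u v T ∧
      η.2 (Fin.last _) ∈ spiderVertices u v T ∧
      ∀ e ∈ pathEdges η.2, e ∉ spiderEdges v T ∧ ∃ t < ℓ, e = s(q t, q (t + 1)) := by
  classical
  -- Otherwise all of `q` runs inside the spider. Then `u` lies on a leg other than `k` and has
  -- potential at most -1. The potential rises by at most one per step, so after `ℓ` steps it is at
  -- most `ℓ - 1`, whereas the end of the leg `k` has potential `ℓ`.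
  have hex : ∃ t, t < ℓ ∧ s(q t, q (t + 1)) ∉ spiderEdges v T := by
    by_contra hcon
    push Not at hcon
    obtain ⟨φ, hφv, hφk, hφj, hφe⟩ := exists_potential hT k
    have hu := (mem_spiderVertices_of_mem_edges v (hcon 0 hℓ)).1
    rw [h0] at hu
    simp only [spiderVertices, Finset.mem_insert, huv, false_or, Finset.mem_image,
      Finset.mem_univ, true_and, Prod.exists] at hu
    obtain ⟨j, t, hjt⟩ := hu
    have hjk : j ≠ k := by rintro rfl; exact hk t hjt
    have hφu : φ u ≤ -1 := by rw [← hjt, hφj j t hjk]; omega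
    have hstep : ∀ t, t ≤ ℓ → φ (q t) ≤ t - 1 := by
      intro t
      induction t with
      | zero => intro _; rw [h0]; simpa using hφu
      | succ t ih =>
        intro ht
        have h1 := ih (by omega)
        have h2 := hφe _ _ (hcon t (by omega))
        push_cast; omega
    have h1 := hstep ℓ le_rfl
    rw [hend, hφk] at h1
    simp only at h1
    omega
  set t₀ := Nat.find hex with ht₀
  obtain ⟨ht₀ℓ, ht₀e⟩ := Nat.find_spec hex
  have hmin : ∀ t < t₀, s(q t, q (t + 1)) ∈ spiderEdges v T := by
    intro t ht
    have := Nat.find_min hex ht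
    push Not at this
    exact this (by omega)
  -- The ear starts with the first edge of `q` outside the spider and stops where `q` takes an edge
  -- of the spider again, or at the end of `q`, which is a vertex of the spider anyway.
  have hexb : ∃ b, t₀ < b ∧ b ≤ ℓ ∧ (b = ℓ ∨ s(q b, q (b + 1)) ∈ spiderEdges v T) :=
    ⟨ℓ, ht₀ℓ, le_rfl, Or.inl rfl⟩
  set b := Nat.find hexb with hb
  obtain ⟨hb1, hb2, hb3⟩ := Nat.find_spec hexb
  rw [← hb] at hb1 hb2 hb3
  have hbmin : ∀ t, t₀ ≤ t → t < b → s(q t, q (t + 1)) ∉ spiderEdges v T := by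
    intro t h1 h2
    rcases h1.eq_or_lt with rfl | h1
    · exact ht₀e
    · have := Nat.find_min hexb h2
      push Not at this
      exact (this h1 (by omega)).2
  have hqU : q ℓ ∈ spiderVertices u v T := by
    rw [hend]
    simp only [spiderVertices, Finset.mem_insert, Finset.mem_image, Finset.mem_univ, true_and]
    exact Or.inr (Or.inr ⟨(k, _), rfl⟩)
  -- The ear has `b - t₀` edges; the index of an `Ear` counts one less, namely its interior
  -- vertices.
  refine ⟨⟨⟨b - t₀ - 1, by omega⟩, fun i => q (t₀ + i)⟩, ?_, ?_, ?_, ?_⟩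
  · intro i j hij
    have hi := i.2
    have hj := j.2
    simp only at hi hj
    have := hinj _ _ (by omega) (by omega) hij
    exact Fin.ext (by omega)
  · simp only [Fin.val_zero, add_zero]
    -- This is why `u` is included among the vertices of the spider: the ear may start at `u`
    -- itself.
    rcases Nat.eq_zero_or_pos t₀ with h | h
    · rw [h, h0]; simp [spiderVertices]
    · have := hmin (t₀ - 1) (by omega)
      rw [show t₀ - 1 + 1 = t₀ by omega] at this
      exact (mem_spiderVertices_of_mem_edges u this).2
  · simp only [Fin.val_last]
    rw [show t₀ + (b - t₀ - 1 + 1) = b by omega]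
    rcases hb3 with h | h
    · rw [h]; exact hqU
    · exact (mem_spiderVertices_of_mem_edges u h).1
  · intro e he
    simp only [pathEdges, Finset.mem_image, Finset.mem_univ, true_and] at he
    obtain ⟨i, rfl⟩ := he
    have hi : (i : ℕ) < b - t₀ - 1 + 1 := i.2
    simp only [Fin.val_castSucc, Fin.val_succ, ← add_assoc]
    exact ⟨hbmin _ (by omega) (by omega), t₀ + i, by omega, rfl⟩

end Spider


/-! ### First moment of spiders with ears -/

section FirstMoment

set_option linter.unusedSectionVars false

variable {V : Type} [Fintype V] [DecidableEq V] {K ℓ : ℕ}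

/-- The spider `T` is contained in the graph of marked pairs, together with edge-disjoint ears
for all legs but one. -/
def SpiderWithEars (u v : V) (T : Fin K → Fin ℓ → V) (E : Set (Sym2 V)) : Prop :=
  (∀ e ∈ spiderEdges v T, e ∈ E) ∧ ∃ (r : Fin K) (η : {k // k ≠ r} → Ear V ℓ),
    (∀ k, Function.Injective (η k).2 ∧ (η k).2 0 ∈ spiderVertices u v T ∧
      (η k).2 (Fin.last _) ∈ spiderVertices u v T) ∧
    (∀ k, ∀ e ∈ pathEdges (η k).2, e ∉ spiderEdges v T ∧ e ∈ E) ∧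
    ∀ j k, j ≠ k → Disjoint (pathEdges (η j).2) (pathEdges (η k).2)

/-- An ear with `a` interior vertices has two ends in `U`, `a` free vertices and `a + 1` edges. -/
lemma sum_ears_le (p : I) (U : Finset V) :
    ∑ η ∈ (Finset.univ.filter fun η : Ear V ℓ => η.2 0 ∈ U ∧ η.2 (Fin.last _) ∈ U),
      (p : ℝ) ^ ((η.1 : ℕ) + 1) ≤
    ∑ a : Fin ℓ, (U.card : ℝ) ^ 2 * (Fintype.card V : ℝ) ^ (a : ℕ) * (p : ℝ) ^ ((a : ℕ) + 1) := by
  rw [Finset.sum_filter, Fintype.sum_sigma]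
  refine Finset.sum_le_sum fun a _ => ?_
  rw [← Finset.sum_filter]
  dsimp only
  rw [Finset.sum_const, nsmul_eq_mul]
  refine mul_le_mul_of_nonneg_right ?_ (pow_nonneg p.2.1 _)
  have hsub : (Finset.univ.filter fun f : Fin ((a : ℕ) + 2) → V => f 0 ∈ U ∧ f (Fin.last _) ∈ U) ⊆
      Fintype.piFinset (fun i : Fin ((a : ℕ) + 2) =>
        (Fin.cons U (Fin.snoc (fun _ : Fin (a : ℕ) => (Finset.univ : Finset V)) U :
          Fin ((a : ℕ) + 1) → Finset V) : Fin ((a : ℕ) + 2) → Finset V) i) := by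
    intro f hf
    simp only [Finset.mem_filter, Finset.mem_univ, true_and] at hf
    rw [Fintype.mem_piFinset]
    intro i
    refine Fin.cases ?_ (fun i => ?_) i
    · simpa using hf.1
    · rw [Fin.cons_succ]
      refine Fin.lastCases ?_ (fun i => ?_) i
      · simpa using hf.2
      · simp
  have hcard := Finset.card_le_card hsub
  rw [Fintype.card_piFinset, Fin.prod_univ_succ, Fin.prod_univ_castSucc] at hcard
  simp only [Fin.cons_zero, Fin.cons_succ, Fin.snoc_castSucc, Fin.snoc_last, Finset.card_univ,
    Finset.prod_const, Fintype.card_fin] at hcard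
  calc _ ≤ ((U.card * (Fintype.card V ^ (a : ℕ) * U.card) : ℕ) : ℝ) := by exact_mod_cast hcard
    _ = _ := by push_cast; ring

/-- The expected number of ears of a spider with `K` legs of length `ℓ` on `n` vertices. -/
noncomputable def earWeight (K ℓ n : ℕ) (p : ℝ) : ℝ :=
  ∑ a : Fin ℓ, ((K * ℓ + 2 : ℕ) : ℝ) ^ 2 * (n : ℝ) ^ (a : ℕ) * p ^ ((a : ℕ) + 1)

lemma earWeight_nonneg (K ℓ n : ℕ) (p : I) : 0 ≤ earWeight K ℓ n p :=
  Finset.sum_nonneg fun a _ => mul_nonneg (by positivity) (pow_nonneg p.2.1 _)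

/-- Union bound over the exceptional leg `r` and over the ears of the other legs. Edge-disjointness
makes the number of prescribed edges additive, so the sum over families of ears is a product of `K -
1` equal sums. -/
lemma prob_spiderWithEars_le (p s : I) {u v : V} {T : Fin K → Fin ℓ → V} (hT : IsSpider v T) :
    prob (markWeight V p s) (fun ω => SpiderWithEars u v T {e | (ω e).1 = true}) ≤
      (p : ℝ) ^ (K * ℓ) * (K * earWeight K ℓ (Fintype.card V) p ^ (K - 1)) := by
  classical
  have hw := isWeight_markWeight (V := V) p s
  set U := spiderVertices u v T
  let A : Finset (Ear V ℓ) :=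
    Finset.univ.filter fun η : Ear V ℓ => η.2 0 ∈ U ∧ η.2 (Fin.last _) ∈ U
  have hA : ∑ η ∈ A, (p : ℝ) ^ ((η.1 : ℕ) + 1) ≤ earWeight K ℓ (Fintype.card V) p := by
    refine (sum_ears_le p U).trans (Finset.sum_le_sum fun a _ => ?_)
    refine mul_le_mul_of_nonneg_right (mul_le_mul_of_nonneg_right ?_ (by positivity))
      (pow_nonneg p.2.1 _)
    exact pow_le_pow_left₀ (by positivity) (by exact_mod_cast card_spiderVertices_le u v T) 2
  let F : (r : Fin K) → ({k // k ≠ r} → Ear V ℓ) → Finset (Sym2 V) := fun r η =>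
    spiderEdges v T ∪ Finset.univ.biUnion fun k => pathEdges (η k).2
  let adm : (r : Fin K) → ({k // k ≠ r} → Ear V ℓ) → Prop := fun r η =>
    (∀ k, Function.Injective (η k).2) ∧
    (∀ k, ∀ e ∈ pathEdges (η k).2, e ∉ spiderEdges v T) ∧
    ∀ j k, j ≠ k → Disjoint (pathEdges (η j).2) (pathEdges (η k).2)
  have h1 : prob (markWeight V p s) (fun ω => SpiderWithEars u v T {e | (ω e).1 = true}) ≤
      ∑ r : Fin K, ∑ η ∈ Fintype.piFinset (fun _ : {k // k ≠ r} => A),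
        prob (markWeight V p s) (fun ω => adm r η ∧ ∀ e ∈ F r η, (ω e).1 = true) := by
    have b1 := prob_exists_le hw (fun (r : Fin K) ω => ∃ η ∈ Fintype.piFinset
      (fun _ : {k // k ≠ r} => A), adm r η ∧ ∀ e ∈ F r η, (ω e).1 = true)
    have b2 := fun r : Fin K => prob_exists_mem_le hw (Fintype.piFinset
      (fun _ : {k // k ≠ r} => A)) (fun η ω => adm r η ∧ ∀ e ∈ F r η, (ω e).1 = true)
    refine le_trans (prob_mono hw ?_) (b1.trans (Finset.sum_le_sum fun r _ => b2 r))
    rintro ω ⟨hE, r, η, ha, hb, hc⟩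
    refine ⟨r, η, ?_, ⟨fun k => (ha k).1, fun k e he => (hb k e he).1, hc⟩, ?_⟩
    · rw [Fintype.mem_piFinset]
      intro k
      simp only [A, Finset.mem_filter, Finset.mem_univ, true_and]
      exact (ha k).2
    · intro e he
      simp only [F, Finset.mem_union, Finset.mem_biUnion, Finset.mem_univ, true_and] at he
      rcases he with he | ⟨k, he⟩
      · exact hE e he
      · exact (hb k e he).2
  have h2 : ∀ r η, prob (markWeight V p s) (fun ω => adm r η ∧ ∀ e ∈ F r η, (ω e).1 = true) ≤
      (p : ℝ) ^ (K * ℓ) * ∏ k, (p : ℝ) ^ (((η k).1 : ℕ) + 1) := by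
    intro r η
    by_cases had : adm r η
    · have hcard : (F r η).card = K * ℓ + ∑ k, (((η k).1 : ℕ) + 1) := by
        rw [Finset.card_union_of_disjoint, card_spiderEdges hT, Finset.card_biUnion]
        · congr 1
          exact Finset.sum_congr rfl fun k _ => card_pathEdges (had.1 k)
        · exact fun j _ k _ hjk => had.2.2 j k hjk
        · rw [Finset.disjoint_biUnion_right]
          intro k _
          rw [Finset.disjoint_right]
          exact had.2.1 k
      refine (prob_mono hw (fun ω hω => hω.2)).trans ?_
      rw [prob_parent_forall, hcard, pow_add, Finset.prod_pow_eq_pow_sum]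
    · refine (prob_mono hw (Q := fun _ => False) (fun ω hω => had hω.1)).trans ?_
      have : prob (markWeight V p s) (fun _ => False) = 0 := by simp [prob, expect]
      rw [this]
      exact mul_nonneg (pow_nonneg p.2.1 _) (Finset.prod_nonneg fun k _ => pow_nonneg p.2.1 _)
  refine h1.trans ?_
  have h3 : ∀ r : Fin K, ∑ η ∈ Fintype.piFinset (fun _ : {k // k ≠ r} => A),
      (p : ℝ) ^ (K * ℓ) * ∏ k, (p : ℝ) ^ (((η k).1 : ℕ) + 1) ≤
      (p : ℝ) ^ (K * ℓ) * earWeight K ℓ (Fintype.card V) p ^ (K - 1) := by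
    intro r
    rw [← Finset.mul_sum]
    refine mul_le_mul_of_nonneg_left ?_ (pow_nonneg p.2.1 _)
    -- The sum over all families of ears of a product of weights is the product over the legs of the
    -- sums over a single ear.
    rw [← Finset.prod_univ_sum (fun _ : {k // k ≠ r} => A)
      (fun _ η => (p : ℝ) ^ ((η.1 : ℕ) + 1)), Finset.prod_const]
    have hc : (Finset.univ : Finset {k // k ≠ r}).card = K - 1 := by
      rw [Finset.card_univ, Fintype.card_subtype_compl]; simp
    rw [hc]
    exact pow_le_pow_left₀ (Finset.sum_nonneg fun _ _ => pow_nonneg p.2.1 _) hA _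
  calc _ ≤ ∑ r : Fin K, (p : ℝ) ^ (K * ℓ) * earWeight K ℓ (Fintype.card V) p ^ (K - 1) :=
        Finset.sum_le_sum fun r _ => (Finset.sum_le_sum fun η _ => h2 r η).trans (h3 r)
    _ = _ := by simp; ring

open Classical in
/-- The number of spiders with ears whose legs end in `S`. -/
noncomputable def spiderCount (K ℓ : ℕ) (u v : V) (E : Set (Sym2 V)) (S : Set V) : ℕ :=
  (Finset.univ.filter fun T : Fin K → Fin ℓ → V => IsSpider v T ∧ SpiderWithEars u v T E ∧
    ∀ k (t : Fin ℓ), (t : ℕ) + 1 = ℓ → T k t ∈ S).card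

/-- Each injective choice of `K` among the `m` paths at `v` gives its own spider, since the feet `x`
determine the choice. The paths at `u` towards the chosen feet supply the ears. -/
lemma descFactorial_le_spiderCount (hK : 0 < K) (hℓ : 0 < ℓ) {m : ℕ} {G₀ G₁ G₂ : SimpleGraph V}
    (h1 : G₁ ≤ G₀) (h2 : G₂ ≤ G₀) {S : Set V} {u v : V} (huv : u ≠ v)
    (h : Linked G₁ G₂ S m ℓ v u) :
    m.descFactorial K ≤ spiderCount K ℓ u v G₀.edgeSet S := by
  classical
  obtain ⟨x, hx, hS, -, hP, -, hQ⟩ := h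
  obtain ⟨P, hP0, hPl, hPa, hPi, hPd⟩ := hP.exists_fun
  obtain ⟨Q, hQ0, hQl, hQa, hQi, hQd⟩ := hQ.exists_fun
  let T : (Fin K ↪ Fin m) → Fin K → Fin ℓ → V := fun j k t => P (j k) (t + 1)
  have hTend : ∀ j k (t : Fin ℓ), (t : ℕ) + 1 = ℓ → T j k t = x (j k) := by
    intro j k t ht
    simp only [T, ht, hPl]
  have hTinj : Function.Injective T := by
    intro j j' hjj
    ext k
    have e1 := hTend j k ⟨ℓ - 1, by omega⟩ (by simp; omega)
    have e2 := hTend j' k ⟨ℓ - 1, by omega⟩ (by simp; omega)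
    rw [hjj] at e1
    rw [hx (e1.symm.trans e2)]
  have hne : ∀ k t, 0 < t → t ≤ ℓ → P k t ≠ v := by
    intro k t h0 ht he
    have := hPi k t 0 ht (Nat.zero_le _) (he.trans (hP0 k).symm)
    omega
  have hTs : ∀ j, IsSpider v (T j) := by
    refine fun j => ⟨?_, fun k t => hne _ _ (by omega) (by omega)⟩
    rintro ⟨k, t⟩ ⟨k', t'⟩ he
    simp only [T] at he
    by_cases hk : k = k'
    · subst hk
      have := hPi _ _ _ (by omega) (by omega) he
      simp only [Prod.mk.injEq, true_and]
      exact Fin.ext (by omega)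
    · have := hPd (j k) (j k') (fun h => hk (j.injective h)) _ _ he
      exact absurd this (hne _ _ (by omega) (by omega))
  have hears : ∀ j, SpiderWithEars u v (T j) G₀.edgeSet := by
    intro j
    refine ⟨?_, ?_⟩
    · intro e he
      simp only [spiderEdges, Finset.mem_image, Finset.mem_univ, true_and, Prod.exists] at he
      obtain ⟨k, t, rfl⟩ := he
      have hc : (Fin.cons v (T j k) : Fin (ℓ + 1) → V) t.castSucc = P (j k) t := by
        obtain ⟨t, ht⟩ := t
        cases t with
        | zero => exact (hP0 _).symm
        | succ t => rfl
      rw [hc]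
      exact h2 (hPa (j k) t t.2)
    -- The leg through `u`, if there is one, is given up: the path from `u` to its foot may run
    -- along that leg. The legs are disjoint, so no other leg meets `u`.
    · obtain ⟨r, hr⟩ : ∃ r : Fin K, ∀ k, k ≠ r → ∀ t, T j k t ≠ u := by
        by_cases hu : ∃ i : Fin K × Fin ℓ, T j i.1 i.2 = u
        · obtain ⟨i, hi⟩ := hu
          refine ⟨i.1, fun k hk t hkt => hk ?_⟩
          have := (hTs j).1 (a₁ := (k, t)) (a₂ := i) (hkt.trans hi.symm)
          rw [← this]
        · exact ⟨⟨0, hK⟩, fun k _ t hkt => hu ⟨(k, t), hkt⟩⟩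
      have hex := fun k : {k // k ≠ r} => exists_ear huv (hTs j) k.1 (hr k.1 k.2) (q := Q (j k.1))
        hℓ (hQ0 _) (by rw [hQl]; exact (hTend j k.1 _ (by simp; omega)).symm) (hQi _)
      choose η hη1 hη2 hη3 hη4 using hex
      refine ⟨r, η, fun k => ⟨hη1 k, hη2 k, hη3 k⟩, fun k e he => ⟨(hη4 k e he).1, ?_⟩, ?_⟩
      · obtain ⟨t, ht, rfl⟩ := (hη4 k e he).2
        exact h1 (hQa _ t ht)
      · intro k k' hkk
        rw [Finset.disjoint_left]
        intro e he he'
        obtain ⟨t, ht, rfl⟩ := (hη4 k e he).2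
        obtain ⟨t', ht', hee⟩ := (hη4 k' _ he').2
        have hjk : j k.1 ≠ j k'.1 := fun h => hkk (Subtype.ext (j.injective h))
        -- Different paths from `u` share only the vertex `u`, so both ends of a common edge would
        -- be `u`.
        have key : Q (j k.1) t = u ∧ Q (j k.1) (t + 1) = u := by
          rcases Sym2.eq_iff.1 hee with ⟨ha, hb⟩ | ⟨ha, hb⟩
          · exact ⟨hQd _ _ hjk _ _ ha, hQd _ _ hjk _ _ hb⟩
          · exact ⟨hQd _ _ hjk _ _ ha, hQd _ _ hjk _ _ hb⟩
        exact (hQa (j k.1) t ht).ne (key.1.trans key.2.symm)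
  have hcard : m.descFactorial K = (Finset.univ.image T).card := by
    rw [Finset.card_image_of_injective _ hTinj, Finset.card_univ, Fintype.card_embedding_eq]
    simp
  rw [hcard, spiderCount]
  refine Finset.card_le_card fun t ht => ?_
  simp only [Finset.mem_image, Finset.mem_univ, true_and] at ht
  obtain ⟨j, rfl⟩ := ht
  simp only [Finset.mem_filter, Finset.mem_univ, true_and]
  refine ⟨hTs j, hears j, fun k t ht => ?_⟩
  rw [hTend j k t ht]
  exact hS _

lemma prob_ends_le (α : I) (hℓ : 0 < ℓ) {v : V} {T : Fin K → Fin ℓ → V} (hT : IsSpider v T) :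
    prob (bernoulliWeight V α) (fun τ => ∀ k (t : Fin ℓ), (t : ℕ) + 1 = ℓ → T k t ∈ {v | τ v = true}) ≤
      (α : ℝ) ^ K := by
  classical
  let F : Finset V := Finset.univ.image fun k : Fin K => T k ⟨ℓ - 1, by omega⟩
  have hF : F.card = K := by
    rw [Finset.card_image_of_injective]
    · simp
    · intro k k' h
      have := hT.1 (a₁ := (k, _)) (a₂ := (k', _)) h
      exact congrArg Prod.fst this
  have hle : (α : ℝ) ^ K = prob (bernoulliWeight V α) (fun τ => ∀ v ∈ F, τ v = true) := by
    rw [prob_seeds_forall, hF]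
  rw [hle]
  refine prob_mono (isWeight_bernoulliWeight V α) fun τ h w hw => ?_
  simp only [F, Finset.mem_image, Finset.mem_univ, true_and] at hw
  obtain ⟨k, rfl⟩ := hw
  exact h k _ (by simp; omega)

/-- A wrong pair is unlikely to be linked. -/
lemma expect_linked_le (p s α : I) (hK : 0 < K) (hℓ : 0 < ℓ) {m : ℕ} (hm : K ≤ m) {u v : V}
    (huv : u ≠ v) :
    expect (markWeight V p s) (fun ω => prob (bernoulliWeight V α) fun τ =>
      Linked (parent ω ⊓ markOne ω) (parent ω ⊓ markTwo ω) {v | τ v = true} m ℓ v u) ≤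
    ((Fintype.card V : ℝ) * p) ^ (K * ℓ) * (α : ℝ) ^ K *
      (K * earWeight K ℓ (Fintype.card V) p ^ (K - 1)) / m.descFactorial K := by
  classical
  have hw := isWeight_markWeight (V := V) p s
  have hα := isWeight_bernoulliWeight V α
  have hpos : (0 : ℝ) < m.descFactorial K := by
    exact_mod_cast Nat.descFactorial_pos.2 hm
  rw [le_div_iff₀ hpos, mul_comm]
  have hedge : ∀ ω : Sym2 V → Mark, ∀ e ∈ (parent ω).edgeSet, (ω e).1 = true := by
    intro ω e
    induction e with
    | _ a b => exact fun h => h.2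
  let Sp : Finset (Fin K → Fin ℓ → V) := Finset.univ.filter (IsSpider v)
  -- Markov's inequality for fixed marks: a linked pair accounts for at least `m.descFactorial K`
  -- spiders.
  have markov_bound : ∀ ω : Sym2 V → Mark, (m.descFactorial K : ℝ) * prob (bernoulliWeight V α) (fun τ =>
      Linked (parent ω ⊓ markOne ω) (parent ω ⊓ markTwo ω) {v | τ v = true} m ℓ v u) ≤
      ∑ T ∈ Sp, (if SpiderWithEars u v T {e | (ω e).1 = true} then 1 else 0) *
        prob (bernoulliWeight V α) (fun τ => ∀ k (t : Fin ℓ), (t : ℕ) + 1 = ℓ → T k t ∈ {v | τ v = true}) := by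
    intro ω
    simp only [prob, ← expect_const_mul]
    rw [← expect_sum]
    refine expect_mono hα fun τ => ?_
    split_ifs with h
    · have h1 := descFactorial_le_spiderCount hK hℓ (G₀ := parent ω) inf_le_left inf_le_left huv h
      rw [mul_one]
      have h2 : (spiderCount K ℓ u v (parent ω).edgeSet {v | τ v = true} : ℝ) =
          ∑ T ∈ Sp, if SpiderWithEars u v T (parent ω).edgeSet ∧
            ∀ k (t : Fin ℓ), (t : ℕ) + 1 = ℓ → T k t ∈ {v | τ v = true} then 1 else 0 := by
        rw [spiderCount, Finset.sum_boole, Finset.filter_filter]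
        congr!
      refine (Nat.cast_le.2 h1).trans (h2.le.trans (Finset.sum_le_sum fun T hT => ?_))
      split_ifs with ha hb hc hd he
      · simp
      · exact absurd ha.2 hc
      · refine absurd ⟨fun e he => hedge ω _ (ha.1.1 e he), ?_⟩ hb
        obtain ⟨r, η, x1, x2, x3⟩ := ha.1.2
        exact ⟨r, η, x1, fun k e he => ⟨(x2 k e he).1, hedge ω _ (x2 k e he).2⟩, x3⟩
      · exact absurd ha.2 hd
      all_goals simp
    · rw [mul_zero]
      refine Finset.sum_nonneg fun T _ => mul_nonneg ?_ ?_ <;> split_ifs <;> norm_num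
  rw [← expect_const_mul]
  refine (expect_mono hw markov_bound).trans ?_
  rw [expect_sum]
  have spider_bound : ∀ T ∈ Sp, expect (markWeight V p s) (fun ω =>
      (if SpiderWithEars u v T {e | (ω e).1 = true} then 1 else 0) *
        prob (bernoulliWeight V α) (fun τ => ∀ k (t : Fin ℓ), (t : ℕ) + 1 = ℓ → T k t ∈ {v | τ v = true})) ≤
      ((p : ℝ) ^ (K * ℓ) * (K * earWeight K ℓ (Fintype.card V) p ^ (K - 1))) * (α : ℝ) ^ K := by
    intro T hT
    simp only [Sp, Finset.mem_filter, Finset.mem_univ, true_and] at hT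
    simp only [mul_comm _ (prob _ _)]
    -- The probability over the seeds does not depend on the marks, so the edge factor and the seed
    -- factor separate.
    rw [expect_const_mul, mul_comm]
    refine mul_le_mul (prob_spiderWithEars_le p s hT) (prob_ends_le α hℓ hT) (prob_nonneg hα) ?_
    exact mul_nonneg (pow_nonneg p.2.1 _) (mul_nonneg (by positivity)
      (pow_nonneg (earWeight_nonneg _ _ _ _) _))
  refine (Finset.sum_le_sum spider_bound).trans ?_
  rw [Finset.sum_const, nsmul_eq_mul]
  have hc : (Sp.card : ℝ) ≤ (Fintype.card V : ℝ) ^ (K * ℓ) := by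
    have : Sp.card ≤ Fintype.card V ^ (K * ℓ) := by
      refine (Finset.card_le_univ _).trans ?_
      simp [Fintype.card_pi, ← pow_mul, mul_comm]
    exact_mod_cast this
  refine (mul_le_mul_of_nonneg_right hc ?_).trans (le_of_eq ?_)
  · exact mul_nonneg (mul_nonneg (pow_nonneg p.2.1 _) (mul_nonneg (by positivity)
      (pow_nonneg (earWeight_nonneg _ _ _ _) _))) (pow_nonneg α.2.1 _)
  · rw [mul_pow]; ring

end FirstMoment


/-! ### Chernoff bounds for independent indicators -/

section Tails

set_option linter.unusedSectionVars false

variable {J X : Type*} [Fintype J] [DecidableEq J] [Fintype X] {w : J → X → ℝ}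

lemma prob_not (hw : IsWeight w) (P : (J → X) → Prop) :
    prob w (fun ω => ¬ P ω) = 1 - prob w P := by
  classical
  have h : prob w (fun ω => ¬ P ω) + prob w P = 1 := by
    rw [← expect_one hw]
    simp only [prob, expect, ← Finset.sum_add_distrib, ← mul_add]
    refine Finset.sum_congr rfl fun ω _ => ?_
    by_cases hP : P ω <;> simp [hP]
  linarith

variable {ι : Type*} (R : Finset ι) (P : ι → (J → X) → Prop) (S : ι → Set J)
  [∀ ω, DecidablePred fun v => P v ω]

/-- The power is a product of one factor per indicator, and these factors depend on disjoint sets of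
coordinates. -/
lemma expect_pow_card_filter (hw : IsWeight w) (hP : ∀ v ∈ R, DependsOn (P v) (S v))
    (hS : (R : Set ι).PairwiseDisjoint S) (θ : ℝ) :
    expect w (fun ω => θ ^ (R.filter fun v => P v ω).card) =
      ∏ v ∈ R, (1 + (θ - 1) * prob w (P v)) := by
  have h1 : ∀ ω : J → X, θ ^ (R.filter fun v => P v ω).card =
      ∏ v ∈ R, if P v ω then θ else 1 := by
    intro ω
    rw [Finset.prod_ite]
    simp
  simp only [h1]
  rw [expect_prod_of_dependsOn hw R (S := S) _ hS]
  · refine Finset.prod_congr rfl fun v _ => ?_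
    have h3 : expect w (fun _ => (1 : ℝ)) = 1 := expect_one hw
    rw [prob, ← expect_const_mul]
    nth_rewrite 2 [← h3]
    rw [← expect_add]
    refine congrArg (expect w) (funext fun ω => ?_)
    by_cases h : P v ω <;> simp [h]
  · intro v hv x y h
    simp only [hP v hv h]

/-- Lower tail of a sum of independent indicators. -/
lemma prob_card_filter_le (hw : IsWeight w) (hP : ∀ v ∈ R, DependsOn (P v) (S v))
    (hS : (R : Set ι).PairwiseDisjoint S) {θ π : ℝ} (hθ : 0 < θ) (hθ1 : θ ≤ 1)
    (hπ : ∀ v ∈ R, π ≤ prob w (P v)) (M : ℕ) :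
    prob w (fun ω => (R.filter fun v => P v ω).card ≤ M) ≤
      θ⁻¹ ^ M * Real.exp (-((1 - θ) * π * R.card)) := by
  -- Markov's inequality for `θ` to the number of occurrences, which is at least `θ ^ M` on the
  -- event because `θ ≤ 1`.
  have h1 : prob w (fun ω => (R.filter fun v => P v ω).card ≤ M) ≤
      expect w (fun ω => θ⁻¹ ^ M * θ ^ (R.filter fun v => P v ω).card) := by
    refine prob_le_expect hw (fun ω => by positivity) fun ω hω => ?_
    rw [inv_pow, inv_mul_eq_div, le_div_iff₀ (by positivity), one_mul]
    exact pow_le_pow_of_le_one hθ.le hθ1 hω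
  refine h1.trans ?_
  rw [expect_const_mul, expect_pow_card_filter R P S hw hP hS]
  refine mul_le_mul_of_nonneg_left ?_ (by positivity)
  have h2 : ∏ v ∈ R, (1 + (θ - 1) * prob w (P v)) ≤ ∏ _v ∈ R, Real.exp (-((1 - θ) * π)) := by
    refine Finset.prod_le_prod (fun v _ => ?_) fun v hv => ?_
    · have := prob_le_one hw (P := P v)
      have := prob_nonneg hw (P := P v)
      nlinarith
    · refine le_trans ?_ (Real.add_one_le_exp _)
      have := hπ v hv
      nlinarith
  refine h2.trans (le_of_eq ?_)
  rw [Finset.prod_const, ← Real.exp_nat_mul]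
  congr 1; ring

/-- Upper tail of a sum of independent indicators. -/
lemma prob_le_card_filter (hw : IsWeight w) (hP : ∀ v ∈ R, DependsOn (P v) (S v))
    (hS : (R : Set ι).PairwiseDisjoint S) {π : ℝ}
    (hπ : ∀ v ∈ R, prob w (P v) ≤ π) (M : ℕ) :
    prob w (fun ω => M ≤ (R.filter fun v => P v ω).card) ≤
      (2 : ℝ)⁻¹ ^ M * Real.exp (π * R.card) := by
  have h1 : prob w (fun ω => M ≤ (R.filter fun v => P v ω).card) ≤
      expect w (fun ω => (2 : ℝ)⁻¹ ^ M * 2 ^ (R.filter fun v => P v ω).card) := by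
    refine prob_le_expect hw (fun ω => by positivity) fun ω hω => ?_
    rw [inv_pow, inv_mul_eq_div, le_div_iff₀ (by positivity), one_mul]
    exact pow_le_pow_right₀ (by norm_num) hω
  refine h1.trans ?_
  rw [expect_const_mul, expect_pow_card_filter R P S hw hP hS]
  refine mul_le_mul_of_nonneg_left ?_ (by positivity)
  have h2 : ∏ v ∈ R, (1 + (2 - 1) * prob w (P v)) ≤ ∏ _v ∈ R, Real.exp π := by
    refine Finset.prod_le_prod (fun v _ => ?_) fun v hv => ?_
    · have := prob_nonneg hw (P := P v)
      linarith
    · have := hπ v hv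
      have := Real.add_one_le_exp π
      linarith
  refine h2.trans (le_of_eq ?_)
  rw [Finset.prod_const, ← Real.exp_nat_mul]
  congr 1; ring

end Tails

/-! ### Independent paths from sequences of vertices -/

section Paths

/-- A walk through prescribed vertices. -/
lemma exists_walk_of_fun {W : Type} {G : SimpleGraph W} (f : ℕ → W) (ℓ : ℕ)
    (h : ∀ t < ℓ, G.Adj (f t) (f (t + 1))) :
    ∃ w : G.Walk (f 0) (f ℓ), w.length = ℓ ∧ w.support = (List.range (ℓ + 1)).map f := by
  induction ℓ with
  | zero => exact ⟨SimpleGraph.Walk.nil, rfl, by simp⟩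
  | succ ℓ ih =>
    obtain ⟨w, h1, h2⟩ := ih fun t ht => h t (by omega)
    refine ⟨w.concat (h ℓ (by omega)), by simp [h1], ?_⟩
    rw [SimpleGraph.Walk.support_concat, h2, List.range_succ (n := ℓ + 1)]
    simp

/-- Independent paths through prescribed vertices. -/
lemma independentPaths_of_fun {W : Type} {G : SimpleGraph W} {ℓ m : ℕ} {r : W} {x : Fin m → W}
    (q : Fin m → ℕ → W) (h0 : ∀ k, q k 0 = r) (hend : ∀ k, q k ℓ = x k)
    (hadj : ∀ k t, t < ℓ → G.Adj (q k t) (q k (t + 1)))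
    (hinj : ∀ k t t', t ≤ ℓ → t' ≤ ℓ → q k t = q k t' → t = t')
    (hdisj : ∀ j k, j ≠ k → ∀ t t', t ≤ ℓ → t' ≤ ℓ → q j t = q k t' → q j t = r) :
    IndependentPaths G ℓ r x := by
  have hex := fun k => exists_walk_of_fun (q k) ℓ (hadj k)
  choose w hw1 hw2 using hex
  refine ⟨fun k => (w k).copy (h0 k) (hend k), fun k => ⟨?_, by simp [hw1]⟩, ?_⟩
  · rw [SimpleGraph.Walk.isPath_def, SimpleGraph.Walk.support_copy, hw2]
    refine List.Nodup.map_on (fun a ha b hb hab => ?_) List.nodup_range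
    rw [List.mem_range] at ha hb
    exact hinj k a b (by omega) (by omega) hab
  · intro j k hjk v hv hv'
    simp only [SimpleGraph.Walk.support_copy, hw2, List.mem_map, List.mem_range] at hv hv'
    obtain ⟨t, ht, rfl⟩ := hv
    obtain ⟨t', ht', he⟩ := hv'
    exact hdisj j k hjk t t' (by omega) (by omega) he.symm

end Paths

/-! ### Breadth-first exploration with disjoint groups -/

section Exploration

set_option linter.unusedSectionVars false

variable {V : Type} [Fintype V] [DecidableEq V] {m : ℕ}

/-- The mark of the pairs which are edges of both subsampled graphs. -/
def full : Mark := (true, true, true)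

/-- The intersection of the two subsampled graphs. -/
abbrev cap (ω : Sym2 V → Mark) : SimpleGraph V :=
  parent ω ⊓ markOne ω ⊓ (parent ω ⊓ markTwo ω)

lemma cap_adj {ω : Sym2 V → Mark} {a b : V} : (cap ω).Adj a b ↔ a ≠ b ∧ ω s(a, b) = full := by
  simp only [cap, SimpleGraph.inf_adj, parent, markOne, markTwo, graphOf, full, Prod.ext_iff]
  tauto

/-- The neighbours in the parent graph. -/
def parentNbrs (ω : Sym2 V → Mark) (v : V) : Finset V :=
  Finset.univ.filter fun u => u ≠ v ∧ (ω s(v, u)).1 = true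

/-- The neighbours in the intersection graph. -/
def capNbrs (ω : Sym2 V → Mark) (v : V) : Finset V :=
  Finset.univ.filter fun u => u ≠ v ∧ ω s(v, u) = full

lemma capNbrs_subset (ω : Sym2 V → Mark) (v : V) : capNbrs ω v ⊆ parentNbrs ω v := by
  intro u hu
  simp only [capNbrs, parentNbrs, Finset.mem_filter, Finset.mem_univ, true_and] at hu ⊢
  exact ⟨hu.1, by rw [hu.2]; rfl⟩

/-- `m` disjoint subsets of `B` with `g` elements each, if there are any. -/
noncomputable def groups (m g : ℕ) (B : Finset V) : Fin m → Finset V :=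
  open Classical in
  if h : ∃ f : Fin m → Finset V, (∀ k, f k ⊆ B ∧ (f k).card = g) ∧
    ∀ j k, j ≠ k → Disjoint (f j) (f k) then h.choose else fun _ => ∅

lemma exists_groups {g : ℕ} (m : ℕ) {B : Finset V} (h : m * g ≤ B.card) :
    ∃ f : Fin m → Finset V, (∀ k, f k ⊆ B ∧ (f k).card = g) ∧
      ∀ j k, j ≠ k → Disjoint (f j) (f k) := by
  have e : Nonempty (Fin m × Fin g ↪ B) := by
    rw [Function.Embedding.nonempty_iff_card_le]
    simpa using h
  obtain ⟨e⟩ := e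
  let f : Fin m → Fin g ↪ V := fun k =>
    ⟨fun t => e (k, t), fun a b hab => by simpa using e.injective (Subtype.ext hab)⟩
  refine ⟨fun k => Finset.univ.map (f k), fun k => ⟨?_, by simp⟩, fun j k hjk => ?_⟩
  · intro v hv
    simp only [Finset.mem_map, Finset.mem_univ, true_and] at hv
    obtain ⟨t, rfl⟩ := hv
    exact (e (k, t)).2
  · rw [Finset.disjoint_left]
    intro v hv hv'
    simp only [Finset.mem_map, Finset.mem_univ, true_and] at hv hv'
    obtain ⟨t, rfl⟩ := hv
    obtain ⟨t', ht'⟩ := hv'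
    have := e.injective (Subtype.ext ht')
    simp only [Prod.mk.injEq] at this
    exact hjk this.1.symm

lemma groups_subset (m g : ℕ) (B : Finset V) (k : Fin m) : groups m g B k ⊆ B := by
  unfold groups
  split_ifs with h
  · exact (h.choose_spec.1 k).1
  · simp

lemma card_groups {g : ℕ} {B : Finset V} (h : m * g ≤ B.card) (k : Fin m) :
    (groups m g B k).card = g := by
  have h' := exists_groups m h
  unfold groups
  rw [dif_pos h']
  exact (h'.choose_spec.1 k).2

lemma groups_disjoint (g : ℕ) (B : Finset V) {j k : Fin m} (hjk : j ≠ k) :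
    Disjoint (groups m g B j) (groups m g B k) := by
  unfold groups
  split_ifs with h
  · exact h.choose_spec.2 j k hjk
  · simp

/-- A stage of the exploration: the vertices whose edges have been explored, the boundary, and `m`
disjoint groups of vertices on the boundary. -/
abbrev Stage (V : Type) (m : ℕ) : Type := Finset V × Finset V × (Fin m → Finset V)

/-- The next generation of the group `k`. -/
def nextGroup (ω : Sym2 V → Mark) (h : Stage V m) (k : Fin m) : Finset V :=
  (Finset.univ \ (h.1 ∪ h.2.1)).filter fun v =>
    (∃ u ∈ h.2.2 k, ω s(u, v) = full) ∧ ∀ k', k' ≠ k → ∀ u ∈ h.2.2 k', ω s(u, v) ≠ full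

/-- One step of the exploration. -/
def nextStage (ω : Sym2 V → Mark) (h : Stage V m) : Stage V m :=
  (h.1 ∪ h.2.1,
    (Finset.univ \ (h.1 ∪ h.2.1)).filter (fun v => ∃ u ∈ h.2.1, (ω s(u, v)).1 = true),
    nextGroup ω h)

/-- The exploration from the vertex `i`. The boundary of stage `j` has distance `j + 1` from `i`. -/
noncomputable def stage (m g : ℕ) (i : V) (ω : Sym2 V → Mark) : ℕ → Stage V m
  | 0 => ({i}, parentNbrs ω i, groups m g (capNbrs ω i))
  | j + 1 => nextStage ω (stage m g i ω j)

/-- The pairs which meet `A`. -/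
def touching (A : Finset V) : Set (Sym2 V) := {e | ∃ a ∈ A, a ∈ e}

end Exploration


/-! ### Deterministic properties of the exploration -/

section Stages

set_option linter.unusedSectionVars false

variable {V : Type} [Fintype V] [DecidableEq V] {m g : ℕ} {i : V}

lemma stage_group_subset (ω : Sym2 V → Mark) (j : ℕ) (k : Fin m) :
    (stage m g i ω j).2.2 k ⊆ (stage m g i ω j).2.1 := by
  induction j with
  | zero => exact (groups_subset _ _ _ _).trans (capNbrs_subset ω i)
  | succ j ih =>
    intro v hv
    simp only [stage, nextStage, nextGroup, Finset.mem_filter] at hv ⊢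
    obtain ⟨h1, ⟨u, hu, hf⟩, -⟩ := hv
    exact ⟨h1, u, ih hu, by rw [hf]; rfl⟩

lemma stage_disjoint (ω : Sym2 V → Mark) (j : ℕ) :
    Disjoint (stage m g i ω j).1 (stage m g i ω j).2.1 := by
  cases j with
  | zero => simp [stage, parentNbrs]
  | succ j =>
    rw [Finset.disjoint_right]
    intro v hv
    simp only [stage, nextStage, Finset.mem_filter, Finset.mem_sdiff] at hv ⊢
    exact hv.1.2

lemma stage_group_disjoint (ω : Sym2 V → Mark) (j : ℕ) {k k' : Fin m} (hk : k ≠ k') :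
    Disjoint ((stage m g i ω j).2.2 k) ((stage m g i ω j).2.2 k') := by
  cases j with
  | zero => exact groups_disjoint _ _ hk
  | succ j =>
    rw [Finset.disjoint_left]
    intro v hv hv'
    simp only [stage, nextStage, nextGroup, Finset.mem_filter] at hv hv'
    obtain ⟨-, ⟨u, hu, hf⟩, -⟩ := hv
    exact hv'.2.2 k hk u hu hf

/-- Reaching stage `j` reveals only pairs that meet the explored ball: a new generation is read off
from edges at the old boundary, which then joins the ball. -/
lemma stage_congr {ω ω' : Sym2 V → Mark} (j : ℕ)
    (h : ∀ e ∈ touching (stage m g i ω j).1, ω e = ω' e) :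
    stage m g i ω' j = stage m g i ω j := by
  induction j with
  | zero =>
    have h' : ∀ u, ω s(i, u) = ω' s(i, u) := fun u => h _ ⟨i, by simp [stage], by simp⟩
    simp [stage, parentNbrs, capNbrs, h']
  | succ j ih =>
    have h1 : stage m g i ω' j = stage m g i ω j := by
      refine ih fun e he => h e ?_
      obtain ⟨a, ha, hae⟩ := he
      exact ⟨a, Finset.mem_union_left _ ha, hae⟩
    rw [stage, stage, h1]
    set st := stage m g i ω j with hst
    have hD : ∀ u ∈ st.2.1, ∀ v, ω' s(u, v) = ω s(u, v) := fun u hu v =>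
      (h _ ⟨u, Finset.mem_union_right _ hu, by simp⟩).symm
    have hN : ∀ k, ∀ u ∈ st.2.2 k, ∀ v, ω' s(u, v) = ω s(u, v) := fun k u hu v =>
      hD u (stage_group_subset ω j k hu) v
    refine Prod.ext rfl (Prod.ext ?_ ?_)
    · refine Finset.filter_congr fun v _ => exists_congr fun u => and_congr_right fun hu => ?_
      rw [hD u hu]
    · funext k
      refine Finset.filter_congr fun v _ => and_congr
        (exists_congr fun u => and_congr_right fun hu => by rw [hN k u hu])
        (forall_congr' fun k' => forall_congr' fun _ => forall_congr' fun u =>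
          forall_congr' fun hu => by rw [hN k' u hu])

/-- The explored ball is random, but the event that the exploration has a given outcome is decided
by the pairs touching the given ball. This stopping-set property makes the edges from the boundary
to fresh vertices independent of the past. -/
lemma dependsOn_stage_eq (j : ℕ) (h : Stage V m) :
    DependsOn (fun ω => stage m g i ω j = h) (touching h.1) := by
  intro ω ω' hω
  refine propext ⟨fun he => ?_, fun he => ?_⟩
  · replace he : stage m g i ω j = h := he
    exact (stage_congr j (ω := ω) (by rw [he]; exact hω)).trans he
  · replace he : stage m g i ω' j = h := he
    exact (stage_congr j (ω := ω') (by rw [he]; exact fun e he => (hω e he).symm)).trans he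

lemma edist_le_succ_iff {W : Type} {G : SimpleGraph W} {a v : W} {j : ℕ} :
    G.edist a v ≤ (j + 1 : ℕ) ↔ G.edist a v ≤ j ∨ ∃ u, G.edist a u ≤ j ∧ G.Adj u v := by
  constructor
  · intro h
    obtain ⟨p, hp⟩ := SimpleGraph.exists_walk_of_edist_ne_top
      (ne_top_of_le_ne_top (by simp) h : G.edist a v ≠ ⊤)
    have hlen : p.length ≤ j + 1 := by rw [← hp] at h; exact_mod_cast h
    rcases hlen.lt_or_eq with h1 | h1
    · left
      rw [← hp]
      exact_mod_cast Nat.lt_succ_iff.1 h1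
    · right
      have hnn : ¬ p.Nil := by
        rw [← SimpleGraph.Walk.length_eq_zero_iff]; omega
      refine ⟨p.penultimate, ?_, p.adj_penultimate hnn⟩
      have h2 := SimpleGraph.Walk.edist_le p.dropLast
      refine h2.trans ?_
      have h3 : p.dropLast.length = j := by simp [h1]
      rw [h3]
  · rintro (h | ⟨u, hu, ha⟩)
    · exact h.trans (by exact_mod_cast Nat.le_succ j)
    · refine (SimpleGraph.edist_triangle (v := u)).trans ?_
      rw [SimpleGraph.edist_eq_one_iff_adj.2 ha]
      push_cast
      gcongr

lemma parent_adj {ω : Sym2 V → Mark} {a b : V} :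
    (parent ω).Adj a b ↔ a ≠ b ∧ (ω s(a, b)).1 = true := Iff.rfl

/-- The explored set is the ball of radius `j` in the parent graph and the boundary is the next
sphere. Both claims are carried together, since the second one at `j` is the first one at `j + 1`.
-/
lemma mem_stage_iff (ω : Sym2 V → Mark) (j : ℕ) :
    (∀ v, v ∈ (stage m g i ω j).1 ↔ (parent ω).edist i v ≤ j) ∧
    (∀ v, v ∈ (stage m g i ω j).1 ∪ (stage m g i ω j).2.1 ↔
      (parent ω).edist i v ≤ (j + 1 : ℕ)) := by
  have h00 : ∀ v, (parent ω).edist i v ≤ (0 : ℕ) ↔ v = i := by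
    intro v; rw [Nat.cast_zero, nonpos_iff_eq_zero, SimpleGraph.edist_eq_zero_iff, eq_comm]
  induction j with
  | zero =>
    have h0 : ∀ v, v ∈ (stage m g i ω 0).1 ↔ (parent ω).edist i v ≤ (0 : ℕ) := by
      intro v; rw [h00]; simp [stage]
    refine ⟨h0, fun v => ?_⟩
    rw [edist_le_succ_iff, ← h0, Finset.mem_union]
    simp only [h00, exists_eq_left]
    refine or_congr_right ?_
    simp only [stage, parentNbrs, Finset.mem_filter, Finset.mem_univ, true_and, parent_adj]
    rw [ne_comm]
  | succ j ih =>
    have h1 : ∀ v, v ∈ (stage m g i ω (j + 1)).1 ↔ (parent ω).edist i v ≤ (j + 1 : ℕ) := ih.2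
    refine ⟨h1, fun v => ?_⟩
    rw [edist_le_succ_iff, Finset.mem_union, h1]
    by_cases hv : (parent ω).edist i v ≤ (j + 1 : ℕ)
    · simp only [hv, true_or]
    simp only [hv, false_or]
    have hv' : v ∉ (stage m g i ω j).1 ∪ (stage m g i ω j).2.1 := by rwa [ih.2]
    simp only [stage, nextStage, Finset.mem_filter, Finset.mem_sdiff, Finset.mem_univ, true_and,
      hv', not_false_eq_true]
    constructor
    · rintro ⟨u, hu, hf⟩
      refine ⟨u, (ih.2 u).1 (Finset.mem_union_right _ hu), ?_, hf⟩
      rintro rfl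
      exact hv' (Finset.mem_union_right _ hu)
    · rintro ⟨u, hu, ha⟩
      refine ⟨u, ?_, ha.2⟩
      have := (ih.2 u).2 hu
      rcases Finset.mem_union.1 this with h | h
      · refine absurd ?_ hv
        rw [edist_le_succ_iff]
        exact Or.inr ⟨u, (ih.1 u).1 h, ha⟩
      · exact h

lemma edist_eq_of_mem_boundary {ω : Sym2 V → Mark} {j : ℕ} {v : V}
    (hv : v ∈ (stage m g i ω j).2.1) : (parent ω).edist i v = (j + 1 : ℕ) := by
  refine le_antisymm (((mem_stage_iff ω j).2 v).1 (Finset.mem_union_right _ hv)) ?_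
  have h : v ∉ (stage m g i ω j).1 := fun h =>
    (Finset.disjoint_left.1 (stage_disjoint ω j) h) hv
  rw [(mem_stage_iff ω j).1] at h
  push Not at h
  have := Order.add_one_le_of_lt h
  exact_mod_cast this

/-- Following parents back inside the group produces a path in `cap` with exactly one vertex per
generation, so that distances and disjointness can be read off from the stages. -/
lemma exists_path_of_mem_group (ω : Sym2 V → Mark) {k : Fin m} (j : ℕ) {v : V}
    (hv : v ∈ (stage m g i ω j).2.2 k) : ∃ q : ℕ → V, q 0 = i ∧ q (j + 1) = v ∧
      (∀ t ≤ j, q (t + 1) ∈ (stage m g i ω t).2.2 k) ∧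
      ∀ t < j + 1, (cap ω).Adj (q t) (q (t + 1)) := by
  induction j generalizing v with
  | zero =>
    have h1 := groups_subset m g (capNbrs ω i) k hv
    simp only [capNbrs, Finset.mem_filter, Finset.mem_univ, true_and] at h1
    refine ⟨fun t => if t = 0 then i else v, by simp, by simp, fun t ht => ?_, fun t ht => ?_⟩
    · obtain rfl : t = 0 := by omega
      simpa using hv
    · obtain rfl : t = 0 := by omega
      exact cap_adj.2 ⟨h1.1.symm, h1.2⟩
  | succ j ih =>
    have hv0 := hv
    simp only [stage, nextStage, nextGroup, Finset.mem_filter, Finset.mem_sdiff] at hv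
    obtain ⟨h1, ⟨u, hu, hf⟩, -⟩ := hv
    obtain ⟨q, hq0, hqj, hq, hqa⟩ := ih hu
    refine ⟨fun t => if t = j + 2 then v else q t, by simp [hq0], by simp, fun t ht => ?_,
      fun t ht => ?_⟩
    · rcases ht.lt_or_eq with h | rfl
      · simp only [show t + 1 ≠ j + 2 by omega, if_false]
        exact hq t (by omega)
      · simpa using hv0
    · rcases Nat.lt_or_eq_of_le (Nat.lt_succ_iff.1 ht) with h | rfl
      · simp only [show t + 1 ≠ j + 2 by omega, show t ≠ j + 2 by omega, if_false]
        exact hqa t (by omega)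
      · simp only [show j + 1 ≠ j + 2 by omega, if_false, if_true, hqj]
        rw [cap_adj]
        refine ⟨?_, hf⟩
        rintro rfl
        exact h1.2 (Finset.mem_union_right _ (stage_group_subset ω j k hu))

/-- If every group contains a seed after `ℓ` generations, the root is linked to itself. -/
lemma linked_self_of_groups {ω : Sym2 V → Mark} {S : Set V} {ℓ : ℕ}
    (h : ∀ k, ∃ v ∈ (stage m g i ω ℓ).2.2 k, v ∈ S) :
    Linked (parent ω ⊓ markOne ω) (parent ω ⊓ markTwo ω) S m (ℓ + 1) i i := by
  choose x hx hS using h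
  have hex := fun k => exists_path_of_mem_group ω ℓ (hx k)
  choose q hq0 hqe hqm hqa using hex
  have hdist : ∀ k t, t ≤ ℓ + 1 → (parent ω).edist i (q k t) = t := by
    intro k t ht
    cases t with
    | zero => simp [hq0]
    | succ t => exact edist_eq_of_mem_boundary (stage_group_subset ω t k (hqm k t (by omega)))
  -- The index along a chain is the distance from `i` in the parent graph, so two chains can meet
  -- only at equal indices, where the groups are disjoint.
  have heq : ∀ j k t t', t ≤ ℓ + 1 → t' ≤ ℓ + 1 → q j t = q k t' → t = t' := by
    intro j k t t' ht ht' he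
    have h1 := hdist j t ht
    rw [he, hdist k t' ht'] at h1
    exact_mod_cast h1.symm
  have hdj : ∀ j k, j ≠ k → ∀ t t', t ≤ ℓ + 1 → t' ≤ ℓ + 1 → q j t = q k t' → q j t = i := by
    intro j k hjk t t' ht ht' he
    obtain rfl := heq j k t t' ht ht' he
    cases t with
    | zero => exact hq0 j
    | succ t =>
      refine absurd (hqm k t (by omega)) ?_
      rw [← he]
      exact Finset.disjoint_left.1 (stage_group_disjoint ω t hjk) (hqm j t (by omega))
  have hxinj : Function.Injective x := by
    intro j k hjk
    by_contra hne
    have := hx k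
    rw [← hjk] at this
    exact Finset.disjoint_left.1 (stage_group_disjoint ω ℓ hne) (hx j) this
  -- The inclusion `cap ω ≤ G` provides the walk and `G ≤ parent ω` the lower bound for the
  -- distance. So the chains are geodesic in every graph in between, in particular in both
  -- subsampled graphs.
  have main : ∀ G : SimpleGraph V, cap ω ≤ G → G ≤ parent ω →
      (∀ k, x k ∈ sphere G (ℓ + 1) i) ∧ IndependentPaths G (ℓ + 1) i x := by
    intro G hG hG'
    refine ⟨fun k => ?_, independentPaths_of_fun q hq0 hqe
      (fun k t ht => hG (hqa k t ht)) (fun k t t' => heq k k t t') hdj⟩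
    refine le_antisymm ?_ ?_
    · obtain ⟨w, hw, -⟩ := exists_walk_of_fun (q k) (ℓ + 1) fun t ht => hG (hqa k t ht)
      have := SimpleGraph.Walk.edist_le w
      rwa [hw, hq0, hqe] at this
    · have := SimpleGraph.edist_anti (u := i) (v := x k) hG'
      rwa [← hqe k, hdist k (ℓ + 1) le_rfl, hqe k] at this
  have m1 := main _ inf_le_left inf_le_left
  have m2 := main _ inf_le_right inf_le_left
  exact ⟨x, hxinj, hS, m2.1, m2.2, m1.1, m1.2⟩

lemma card_stage_le {ω : Sym2 V → Mark} {Δ : ℕ} (hΔ : ∀ v, (parentNbrs ω v).card ≤ Δ) (j : ℕ) :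
    ((stage m g i ω j).1 ∪ (stage m g i ω j).2.1).card ≤ (Δ + 1) ^ (j + 1) := by
  induction j with
  | zero =>
    refine (Finset.card_union_le _ _).trans ?_
    have := hΔ i
    simp only [stage, Finset.card_singleton, zero_add, pow_one]
    omega
  | succ j ih =>
    set st := stage m g i ω j
    have hsub : (stage m g i ω (j + 1)).1 ∪ (stage m g i ω (j + 1)).2.1 ⊆
        (st.1 ∪ st.2.1) ∪ st.2.1.biUnion (parentNbrs ω) := by
      intro v hv
      rw [Finset.mem_union] at hv ⊢
      refine hv.imp id fun hv => ?_
      simp only [stage, nextStage, Finset.mem_filter, Finset.mem_sdiff] at hv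
      obtain ⟨h1, u, hu, hf⟩ := hv
      rw [Finset.mem_biUnion]
      refine ⟨u, hu, ?_⟩
      simp only [parentNbrs, Finset.mem_filter, Finset.mem_univ, true_and]
      refine ⟨?_, hf⟩
      rintro rfl
      exact h1.2 (Finset.mem_union_right _ hu)
    refine (Finset.card_le_card hsub).trans ((Finset.card_union_le _ _).trans ?_)
    have h1 : (st.2.1.biUnion (parentNbrs ω)).card ≤ st.2.1.card * Δ :=
      Finset.card_biUnion_le_card_mul _ _ _ fun v _ => hΔ v
    have h2 : st.2.1.card ≤ (st.1 ∪ st.2.1).card := Finset.card_le_card Finset.subset_union_right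
    calc _ ≤ (st.1 ∪ st.2.1).card + (st.1 ∪ st.2.1).card * Δ := by
            have := Nat.mul_le_mul_right Δ h2
            omega
      _ = (st.1 ∪ st.2.1).card * (Δ + 1) := by ring
      _ ≤ (Δ + 1) ^ (j + 1) * (Δ + 1) := Nat.mul_le_mul_right _ ih
      _ = _ := by ring

end Stages


/-! ### Growth of the groups and meeting the seeds -/

section Growth

set_option linter.unusedSectionVars false

variable {V : Type} [Fintype V] [DecidableEq V] {m g : ℕ} {i : V}

lemma prob_forall_ne_full (p s : I) (F : Finset (Sym2 V)) :
    prob (markWeight V p s) (fun ω => ∀ e ∈ F, ω e ≠ full) = (1 - (p : ℝ) * s ^ 2) ^ F.card := by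
  rw [prob_forall_mem (isWeight_markWeight p s) F fun _ x => x ≠ full]
  rw [Finset.prod_congr rfl (g := fun _ => 1 - (p : ℝ) * s ^ 2), Finset.prod_const]
  intro e _
  simp [Fintype.sum_prod_type, markWeight, bernoulliWeight, full]
  ring

lemma prob_eq_full (p s : I) (e : Sym2 V) :
    prob (markWeight V p s) (fun ω => ω e = full) = (p : ℝ) * s ^ 2 := by
  have h1 := prob_forall_ne_full p s {e}
  simp only [Finset.mem_singleton, forall_eq, Finset.card_singleton, pow_one, ne_eq] at h1
  rw [prob_not (isWeight_markWeight p s)] at h1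
  linarith

lemma prob_seeds_forall_not (α : I) (F : Finset V) :
    prob (bernoulliWeight V α) (fun τ => ∀ v ∈ F, τ v ≠ true) = (1 - (α : ℝ)) ^ F.card := by
  rw [prob_forall_mem (isWeight_bernoulliWeight V α) F fun _ x => x ≠ true]
  rw [Finset.prod_congr rfl (g := fun _ => 1 - (α : ℝ)), Finset.prod_const]
  intro e _
  simp [bernoulliWeight]

/-- The probability that a fresh vertex joins the group `k` in the next generation. -/
lemma le_prob_mem_nextGroup (p s : I) (h : Stage V m) (k : Fin m) (v : V)
    (hsub : ∀ k, h.2.2 k ⊆ h.2.1) (hdisj : ∀ j k, j ≠ k → Disjoint (h.2.2 j) (h.2.2 k))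
    (hq : (p : ℝ) * s ^ 2 * h.2.1.card ≤ 1 / 2) :
    (p : ℝ) * s ^ 2 * (h.2.2 k).card / 4 ≤ prob (markWeight V p s) (fun ω =>
      (∃ u ∈ h.2.2 k, ω s(u, v) = full) ∧ ∀ k', k' ≠ k → ∀ u ∈ h.2.2 k', ω s(u, v) ≠ full) := by
  have hw := isWeight_markWeight (V := V) p s
  set q : ℝ := (p : ℝ) * s ^ 2 with hqdef
  have hq0 : 0 ≤ q := mul_nonneg p.2.1 (sq_nonneg _)
  have hq1 : q ≤ 1 := by
    have h1 : (s : ℝ) ^ 2 ≤ 1 := pow_le_one₀ s.2.1 s.2.2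
    calc q ≤ 1 * 1 := mul_le_mul p.2.2 h1 (sq_nonneg _) zero_le_one
      _ = 1 := one_mul 1
  have hinj : Function.Injective (fun u : V => s(u, v)) := fun a b hab => by
    rcases Sym2.eq_iff.1 hab with ⟨h, -⟩ | ⟨h, h'⟩
    · exact h
    · exact h.trans h'
  let F₁ : Finset (Sym2 V) := (h.2.2 k).image fun u => s(u, v)
  let F₂ : Finset (Sym2 V) := (h.2.1 \ h.2.2 k).image fun u => s(u, v)
  have hF₁ : F₁.card = (h.2.2 k).card := Finset.card_image_of_injective _ hinj
  have hF₂ : F₂.card ≤ h.2.1.card :=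
    Finset.card_image_le.trans (Finset.card_le_card Finset.sdiff_subset)
  have hF : Disjoint (F₁ : Set (Sym2 V)) (F₂ : Set (Sym2 V)) := by
    rw [Finset.disjoint_coe, Finset.disjoint_left]
    intro e h1 h2
    simp only [F₁, F₂, Finset.mem_image, Finset.mem_sdiff] at h1 h2
    obtain ⟨a, ha, rfl⟩ := h1
    obtain ⟨b, hb, hab⟩ := h2
    exact hb.2 (hinj hab ▸ ha)
  -- Joining the group `k` is implied by a full edge to that group and none to the rest of the
  -- boundary; these two events concern disjoint sets of pairs.
  have hstep : prob (markWeight V p s) (fun ω => (¬ ∀ e ∈ F₁, ω e ≠ full) ∧ ∀ e ∈ F₂, ω e ≠ full) ≤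
      prob (markWeight V p s) (fun ω => (∃ u ∈ h.2.2 k, ω s(u, v) = full) ∧
        ∀ k', k' ≠ k → ∀ u ∈ h.2.2 k', ω s(u, v) ≠ full) := by
    refine prob_mono hw fun ω hω => ⟨?_, fun k' hk' u hu => ?_⟩
    · have h1 := hω.1
      push Not at h1
      obtain ⟨e, he, hef⟩ := h1
      simp only [F₁, Finset.mem_image] at he
      obtain ⟨u, hu, rfl⟩ := he
      exact ⟨u, hu, hef⟩
    · refine hω.2 _ (Finset.mem_image_of_mem _ (Finset.mem_sdiff.2 ⟨hsub k' hu, fun hk => ?_⟩))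
      exact Finset.disjoint_left.1 (hdisj k' k hk') hu hk
  refine le_trans ?_ hstep
  rw [prob_and_of_dependsOn hw hF, prob_not hw, prob_forall_ne_full, prob_forall_ne_full, hF₁]
  rotate_left
  · intro x y hxy
    refine congrArg Not (propext (forall_congr' fun e => forall_congr' fun he => ?_))
    rw [hxy e he]
  · intro x y hxy
    refine propext (forall_congr' fun e => forall_congr' fun he => ?_)
    rw [hxy e he]
  rw [← hqdef]
  set N := (h.2.2 k).card
  have hN : q * N ≤ 1 / 2 := by
    refine le_trans (mul_le_mul_of_nonneg_left ?_ hq0) hq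
    exact_mod_cast Finset.card_le_card (hsub k)
  -- Since `(1 - q)(1 + q) ≤ 1`, Bernoulli's inequality gives `(1 - q) ^ N * (1 + N * q) ≤ 1`, and
  -- `N * q ≤ 1 / 2` turns this into a linear lower bound.
  have b1 : q * N / 2 ≤ 1 - (1 - q) ^ N := by
    have e1 : 1 + (N : ℝ) * q ≤ (1 + q) ^ N := one_add_mul_le_pow (by linarith) N
    have e2 : (1 - q) ^ N * (1 + q) ^ N ≤ 1 := by
      rw [← mul_pow]
      exact pow_le_one₀ (by nlinarith) (by nlinarith)
    have e3 : 0 ≤ (1 - q) ^ N := pow_nonneg (by linarith) _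
    have e4 : (1 - q) ^ N * (1 + N * q) ≤ 1 := le_trans (mul_le_mul_of_nonneg_left e1 e3) e2
    have e5 : 0 ≤ (N : ℝ) * q := by positivity
    have e6 : (1 - q) ^ N ≤ 1 := pow_le_one₀ (by linarith) (by linarith)
    by_contra hcon
    push Not at hcon
    have e7 : 1 - q * N / 2 < (1 - q) ^ N := by linarith
    have e8 : (1 - q * N / 2) * (1 + N * q) < 1 :=
      lt_of_lt_of_le (mul_lt_mul_of_pos_right e7 (by linarith)) e4
    nlinarith
  have b2 : 1 / 2 ≤ (1 - q) ^ F₂.card := by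
    have e1 : 1 + (F₂.card : ℝ) * (-q) ≤ (1 + -q) ^ F₂.card := one_add_mul_le_pow (by linarith) _
    have e2 : q * F₂.card ≤ q * h.2.1.card :=
      mul_le_mul_of_nonneg_left (by exact_mod_cast hF₂) hq0
    rw [show 1 - q = 1 + -q by ring]
    linarith
  have b3 : 0 ≤ q * N / 2 := by positivity
  calc q * N / 4 = q * N / 2 * (1 / 2) := by ring
    _ ≤ _ := mul_le_mul b1 b2 (by norm_num) (b3.trans b1)

/-- Conditionally on stage `j`, the fresh vertices decide independently whether to join the group.
At least `n / 2` of them are available while the degrees are at most `Δ`, and each joins with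
probability at least `q * N / 4`, where `q = p * s ^ 2` and `N` is the size of the group. -/
lemma prob_growth_le (p s : I) (j Δ : ℕ) (k : Fin m)
    (h1 : 2 * (Δ + 1) ^ (j + 1) ≤ Fintype.card V)
    (h2 : (p : ℝ) * s ^ 2 * (Δ + 1) ^ (j + 1) ≤ 1 / 2) :
    prob (markWeight V p s) (fun ω => (∀ v, (parentNbrs ω v).card ≤ Δ) ∧
      g ≤ ((stage m g i ω j).2.2 k).card ∧ (((stage m g i ω (j + 1)).2.2 k).card : ℝ) ≤
        Fintype.card V * (p * s ^ 2) / 32 * ((stage m g i ω j).2.2 k).card) ≤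
    Real.exp (-(Fintype.card V * (p * s ^ 2) / 32 * g)) := by
  classical
  have hw := isWeight_markWeight (V := V) p s
  set q : ℝ := (p : ℝ) * s ^ 2 with hqdef
  have hq0 : 0 ≤ q := mul_nonneg p.2.1 (sq_nonneg _)
  set n := Fintype.card V with hn
  refine prob_le_of_fibres hw (fun ω => stage m g i ω j) _ (Real.exp_pos _).le ?_
  rintro h ⟨ω₀, rfl, hΔ, hg, -⟩
  have hcard := card_stage_le (m := m) (g := g) (i := i) hΔ j
  have hsub : ∀ k, (stage m g i ω₀ j).2.2 k ⊆ (stage m g i ω₀ j).2.1 :=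
    fun k => stage_group_subset ω₀ j k
  have hgd : ∀ a b, a ≠ b → Disjoint ((stage m g i ω₀ j).2.2 a) ((stage m g i ω₀ j).2.2 b) :=
    fun a b hab => stage_group_disjoint ω₀ j hab
  have hAD : Disjoint (stage m g i ω₀ j).1 (stage m g i ω₀ j).2.1 := stage_disjoint ω₀ j
  generalize stage m g i ω₀ j = h at hg hcard hsub hgd hAD ⊢
  set N := (h.2.2 k).card with hN
  set R := Finset.univ \ (h.1 ∪ h.2.1) with hR
  let P : V → (Sym2 V → Mark) → Prop := fun v ω =>
    (∃ u ∈ h.2.2 k, ω s(u, v) = full) ∧ ∀ k', k' ≠ k → ∀ u ∈ h.2.2 k', ω s(u, v) ≠ full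
  let S : V → Set (Sym2 V) := fun v => {e | ∃ u ∈ h.2.1, e = s(u, v)}
  have hRmem : ∀ v ∈ R, v ∉ h.1 ∧ v ∉ h.2.1 := by
    intro v hv
    simpa [hR] using hv
  have hPdep : ∀ v ∈ R, DependsOn (P v) (S v) := by
    intro v _ x y hxy
    refine propext (and_congr (exists_congr fun u => and_congr_right fun hu => ?_)
      (forall_congr' fun k' => forall_congr' fun _ => forall_congr' fun u =>
        forall_congr' fun hu => ?_))
    · rw [hxy _ ⟨u, hsub k hu, rfl⟩]
    · rw [hxy _ ⟨u, hsub k' hu, rfl⟩]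
  have hSdisj : (R : Set V).PairwiseDisjoint S := by
    intro v hv v' hv' hne
    rw [Function.onFun, Set.disjoint_left]
    rintro e ⟨u, hu, rfl⟩ ⟨u', hu', he⟩
    rcases Sym2.eq_iff.1 he with ⟨-, h⟩ | ⟨h, -⟩
    · exact hne h
    · exact (hRmem v' hv').2 (h ▸ hu)
  have hDcard : (h.2.1.card : ℝ) ≤ (Δ + 1) ^ (j + 1) := by
    have : h.2.1.card ≤ (Δ + 1) ^ (j + 1) :=
      (Finset.card_le_card Finset.subset_union_right).trans hcard
    exact_mod_cast this
  have hRcard : (n : ℝ) / 2 ≤ R.card := by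
    have h3 : R.card = n - (h.1 ∪ h.2.1).card := by
      rw [hR, Finset.card_sdiff_of_subset (Finset.subset_univ _), Finset.card_univ]
    have h4 : n ≤ 2 * R.card := by omega
    have : (n : ℝ) ≤ 2 * R.card := by exact_mod_cast h4
    linarith
  -- The revealed pairs meet the ball `h.1`; the pairs needed now join the boundary to fresh
  -- vertices and avoid it.
  refine ⟨touching h.1, {e | ∃ v ∈ R, e ∈ S v}, fun ω => (R.filter fun v => P v ω).card ≤
    ⌊n * q / 32 * N⌋₊, ?_, dependsOn_stage_eq j h, ?_, ?_, ?_⟩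
  · rw [Set.disjoint_left]
    rintro e ⟨a, ha, hae⟩ ⟨v, hv, u, hu, rfl⟩
    rcases Sym2.mem_iff.1 hae with rfl | rfl
    · exact Finset.disjoint_left.1 hAD ha hu
    · exact (hRmem _ hv).1 ha
  · intro x y hxy
    have : (R.filter fun v => P v x) = R.filter fun v => P v y :=
      Finset.filter_congr fun v hv => by
        rw [hPdep v hv fun e he => hxy e ⟨v, hv, he⟩]
    simp only [this]
  · rintro ω hω ⟨-, -, hle⟩
    have hs : (stage m g i ω (j + 1)).2.2 k = R.filter fun v => P v ω := by
      change nextGroup ω (stage m g i ω j) k = _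
      rw [hω]
      ext v
      simp only [nextGroup, Finset.mem_filter, hR, P]
    rw [hs, hω] at hle
    exact Nat.le_floor hle
  -- With `θ = 1 / 2` the Chernoff exponent is at least `n * q * N / 16`, and the factor `2 ^ M`
  -- costs at most `n * q * N / 32`. The difference is the exponent claimed, since `g ≤ N`.
  · refine (prob_card_filter_le R P S hw hPdep hSdisj (θ := 1 / 2) (π := q * N / 4) (by norm_num)
      (by norm_num) (fun v _ => ?_) _).trans ?_
    · exact le_prob_mem_nextGroup p s h k v hsub hgd
        ((mul_le_mul_of_nonneg_left hDcard hq0).trans h2)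
    · set M := ⌊n * q / 32 * N⌋₊
      have hM : (M : ℝ) ≤ n * q / 32 * N := Nat.floor_le (by positivity)
      have e1 : ((1 / 2 : ℝ)⁻¹) ^ M ≤ Real.exp M := by
        rw [← Real.exp_one_pow]
        refine pow_le_pow_left₀ (by norm_num) ?_ M
        have := Real.add_one_le_exp (1 : ℝ)
        norm_num at this ⊢
        linarith
      calc _ ≤ Real.exp M * Real.exp (-((1 - 1 / 2) * (q * N / 4) * R.card)) :=
            mul_le_mul_of_nonneg_right e1 (Real.exp_pos _).le
        _ = Real.exp (M - (q * N / 8) * R.card) := by rw [← Real.exp_add]; congr 1; ring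
        _ ≤ _ := by
            refine Real.exp_le_exp.2 ?_
            have e2 : q * N / 8 * (n / 2) ≤ q * N / 8 * R.card :=
              mul_le_mul_of_nonneg_left hRcard (by positivity)
            have e3 : (n : ℝ) * q / 32 * g ≤ n * q / 32 * N :=
              mul_le_mul_of_nonneg_left (by exact_mod_cast hg) (by positivity)
            nlinarith

/-- A vertex with many neighbours in the intersection graph is likely to be linked to itself. -/
lemma expect_not_linked_self_le (p s α : I) (i : V) (ℓ Δ : ℕ)
    (h1 : 2 * (Δ + 1) ^ ℓ ≤ Fintype.card V)
    (h2 : (p : ℝ) * s ^ 2 * (Δ + 1) ^ ℓ ≤ 1 / 2)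
    (h3 : 1 ≤ Fintype.card V * ((p : ℝ) * s ^ 2) / 32) :
    expect (markWeight V p s) (fun ω => prob (bernoulliWeight V α) fun τ =>
      (∀ v, (parentNbrs ω v).card ≤ Δ) ∧ m * g ≤ (capNbrs ω i).card ∧
      ¬ Linked (parent ω ⊓ markOne ω) (parent ω ⊓ markTwo ω) {v | τ v = true} m (ℓ + 1) i i) ≤
    m * ℓ * Real.exp (-(Fintype.card V * (p * s ^ 2) / 32 * g)) +
      m * Real.exp (-(α * ((Fintype.card V * (p * s ^ 2) / 32) ^ ℓ * g))) := by
  classical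
  have hw := isWeight_markWeight (V := V) p s
  have hα := isWeight_bernoulliWeight V α
  set β : ℝ := Fintype.card V * ((p : ℝ) * s ^ 2) / 32 with hβ
  let B : Fin m → Fin ℓ → (Sym2 V → Mark) → Prop := fun k j ω =>
    (∀ v, (parentNbrs ω v).card ≤ Δ) ∧ g ≤ ((stage m g i ω j).2.2 k).card ∧
      (((stage m g i ω (j + 1)).2.2 k).card : ℝ) ≤ β * ((stage m g i ω j).2.2 k).card
  have hB : prob (markWeight V p s) (fun ω => ∃ k, ∃ j, B k j ω) ≤
      m * ℓ * Real.exp (-(β * g)) := by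
    refine (prob_exists_le hw fun k ω => ∃ j, B k j ω).trans ?_
    refine (Finset.sum_le_sum fun k _ => (prob_exists_le hw fun j ω => B k j ω).trans
      (Finset.sum_le_sum fun j _ => prob_growth_le p s j Δ k ?_ ?_)).trans ?_
    · refine le_trans (Nat.mul_le_mul_left 2 (Nat.pow_le_pow_right (by omega) ?_)) h1
      omega
    · refine le_trans (mul_le_mul_of_nonneg_left ?_ (mul_nonneg p.2.1 (sq_nonneg _))) h2
      exact pow_le_pow_right₀ (by linarith [(Nat.cast_nonneg Δ : (0 : ℝ) ≤ Δ)]) (by omega)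
    · simp only [Finset.sum_const, Finset.card_univ, Fintype.card_fin, nsmul_eq_mul]
      rw [← hβ, mul_assoc]
  have hpt : ∀ ω, prob (bernoulliWeight V α) (fun τ =>
      (∀ v, (parentNbrs ω v).card ≤ Δ) ∧ m * g ≤ (capNbrs ω i).card ∧
      ¬ Linked (parent ω ⊓ markOne ω) (parent ω ⊓ markTwo ω) {v | τ v = true} m (ℓ + 1) i i) ≤
      (if ∃ k, ∃ j, B k j ω then 1 else 0) + m * Real.exp (-(α * (β ^ ℓ * g))) := by
    intro ω
    have hnn : (0 : ℝ) ≤ m * Real.exp (-(α * (β ^ ℓ * g))) := by positivity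
    split_ifs with hbad
    · have := prob_le_one hα (P := fun τ =>
        (∀ v, (parentNbrs ω v).card ≤ Δ) ∧ m * g ≤ (capNbrs ω i).card ∧
        ¬ Linked (parent ω ⊓ markOne ω) (parent ω ⊓ markTwo ω) {v | τ v = true} m (ℓ + 1) i i)
      linarith
    · rw [zero_add]
      by_cases hgood : (∀ v, (parentNbrs ω v).card ≤ Δ) ∧ m * g ≤ (capNbrs ω i).card
      -- Outside the event that some generation fails to grow, each group gains the factor `β` in
      -- every generation. As `β ≥ 1`, groups never fall below the size `g` required for the next
      -- step.
      · have hsize : ∀ k, ∀ j ≤ ℓ, β ^ j * g ≤ ((stage m g i ω j).2.2 k).card := by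
          intro k j
          induction j with
          | zero =>
            intro _
            rw [pow_zero, one_mul]
            exact_mod_cast (card_groups hgood.2 k).ge
          | succ j ih =>
            intro hj
            have ih' := ih (by omega)
            have hg' : (g : ℝ) ≤ ((stage m g i ω j).2.2 k).card := by
              refine le_trans ?_ ih'
              exact le_mul_of_one_le_left (by positivity) (one_le_pow₀ h3)
            have hnb : ¬ B k ⟨j, by omega⟩ ω := fun h => hbad ⟨k, _, h⟩
            have h4 : β * ((stage m g i ω j).2.2 k).card <
                ((stage m g i ω (j + 1)).2.2 k).card := by
              by_contra hcon
              push Not at hcon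
              exact hnb ⟨hgood.1, by exact_mod_cast hg', hcon⟩
            calc β ^ (j + 1) * g = β * (β ^ j * g) := by ring
              _ ≤ β * ((stage m g i ω j).2.2 k).card :=
                  mul_le_mul_of_nonneg_left ih' (by linarith)
              _ ≤ _ := h4.le
        -- The seeds are independent of the marks, so for fixed marks each final group misses all
        -- seeds with probability `(1 - α)` to its size.
        have hsub := prob_exists_le hα (fun (k : Fin m) τ =>
          ∀ v ∈ (stage m g i ω ℓ).2.2 k, τ v ≠ true)
        refine (prob_mono hα ?_).trans (hsub.trans ?_)
        · rintro τ ⟨-, -, hnl⟩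
          by_contra hcon
          push Not at hcon
          exact hnl (linked_self_of_groups (g := g) hcon)
        · have hterm : ∀ k : Fin m, prob (bernoulliWeight V α)
              (fun τ => ∀ v ∈ (stage m g i ω ℓ).2.2 k, τ v ≠ true) ≤
              Real.exp (-(α * (β ^ ℓ * g))) := by
            intro k
            rw [prob_seeds_forall_not]
            calc (1 - (α : ℝ)) ^ ((stage m g i ω ℓ).2.2 k).card
                ≤ Real.exp (-α) ^ ((stage m g i ω ℓ).2.2 k).card :=
                  pow_le_pow_left₀ (by linarith [α.2.2]) (by
                    have := Real.add_one_le_exp (-(α : ℝ)); linarith) _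
              _ = Real.exp (-(α * ((stage m g i ω ℓ).2.2 k).card)) := by
                  rw [← Real.exp_nat_mul]; congr 1; ring
              _ ≤ _ := Real.exp_le_exp.2 (neg_le_neg
                  (mul_le_mul_of_nonneg_left (hsize k ℓ le_rfl) α.2.1))
          refine (Finset.sum_le_sum fun k _ => hterm k).trans ?_
          simp
      · refine le_trans (prob_mono hα (Q := fun _ => False) fun τ h => hgood ⟨h.1, h.2.1⟩) ?_
        have : prob (bernoulliWeight V α) (fun _ => False) = 0 := by simp [prob, expect]
        rwa [this]
  refine (expect_mono hw hpt).trans ?_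
  have : expect (markWeight V p s) (fun ω => (if ∃ k, ∃ j, B k j ω then (1 : ℝ) else 0) +
      m * Real.exp (-(α * (β ^ ℓ * g)))) = prob (markWeight V p s) (fun ω => ∃ k, ∃ j, B k j ω) +
      m * Real.exp (-(α * (β ^ ℓ * g))) := by
    rw [expect_add, expect_const hw, prob]
    congr!
  rw [this]
  linarith

end Growth


/-! ### Degrees, isolated vertices and pairs of low vertices -/

section Degrees

set_option linter.unusedSectionVars false

variable {V : Type} [Fintype V] [DecidableEq V]

lemma pairwiseDisjoint_pairs (v : V) (R : Finset V) :
    (R : Set V).PairwiseDisjoint (fun u => ({s(v, u)} : Set (Sym2 V))) := by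
  intro a _ b _ hab
  rw [Function.onFun, Set.disjoint_singleton]
  intro h
  rcases Sym2.eq_iff.1 h with ⟨-, h⟩ | ⟨h, h'⟩
  · exact hab h
  · exact hab (h'.trans h)

lemma prob_parentNbrs_le (p s : I) (v : V) (M : ℕ) :
    prob (markWeight V p s) (fun ω => M ≤ (parentNbrs ω v).card) ≤
      (2 : ℝ)⁻¹ ^ M * Real.exp (Fintype.card V * p) := by
  have hw := isWeight_markWeight (V := V) p s
  have h := prob_le_card_filter (Finset.univ.erase v)
    (fun u (ω : Sym2 V → Mark) => (ω s(v, u)).1 = true) (fun u => {s(v, u)}) hw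
    (fun u _ x y hxy => by simp only [hxy s(v, u) rfl]) (pairwiseDisjoint_pairs v _) (π := (p : ℝ))
    (fun u _ => by
      have := prob_parent_forall p s {s(v, u)}
      simp only [Finset.mem_singleton, forall_eq, Finset.card_singleton, pow_one] at this
      exact this.le) M
  have he : ∀ ω : Sym2 V → Mark, ((Finset.univ.erase v).filter fun u => (ω s(v, u)).1 = true) =
      parentNbrs ω v := by
    intro ω; ext u; simp [parentNbrs]
  simp only [he] at h
  refine h.trans (mul_le_mul_of_nonneg_left (Real.exp_le_exp.2 ?_) (by positivity))
  rw [mul_comm]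
  refine mul_le_mul_of_nonneg_right ?_ p.2.1
  exact_mod_cast (Finset.card_le_univ _)

/-- The bound for the probability of having at most `M` neighbours in the intersection graph among
`r` given vertices. -/
noncomputable def lowBound (θ : ℝ) (M : ℕ) (q r : ℝ) : ℝ :=
  θ⁻¹ ^ M * Real.exp (-((1 - θ) * q * r))

lemma prob_cap_le (p s : I) (v : V) (R : Finset V) {θ : ℝ} (hθ : 0 < θ) (hθ1 : θ ≤ 1) (M : ℕ) :
    prob (markWeight V p s) (fun ω => (R.filter fun u => ω s(v, u) = full).card ≤ M) ≤
      lowBound θ M (p * s ^ 2) R.card :=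
  prob_card_filter_le R (fun u (ω : Sym2 V → Mark) => ω s(v, u) = full) (fun u => {s(v, u)})
    (isWeight_markWeight (V := V) p s)
    (fun u _ x y hxy => by simp only [hxy s(v, u) rfl]) (pairwiseDisjoint_pairs v _)
    hθ hθ1 (fun u _ => (prob_eq_full p s _).ge) M

lemma filter_subset_capNbrs {ω : Sym2 V → Mark} {v : V} {R : Finset V} (hv : v ∉ R) :
    (R.filter fun u => ω s(v, u) = full) ⊆ capNbrs ω v := by
  intro u hu
  simp only [Finset.mem_filter, capNbrs, Finset.mem_univ, true_and] at hu ⊢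
  exact ⟨fun h => hv (h ▸ hu.1), hu.2⟩

lemma prob_capNbrs_le (p s : I) (v : V) {θ : ℝ} (hθ : 0 < θ) (hθ1 : θ ≤ 1) (M : ℕ) :
    prob (markWeight V p s) (fun ω => (capNbrs ω v).card ≤ M) ≤
      lowBound θ M (p * s ^ 2) (Fintype.card V - 1) := by
  have hcard : (((Finset.univ : Finset V).erase v).card : ℝ) = Fintype.card V - 1 := by
    rw [Finset.card_erase_of_mem (Finset.mem_univ v), Finset.card_univ,
      Nat.cast_sub (Fintype.card_pos_iff.2 ⟨v⟩)]
    simp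
  rw [← hcard]
  refine le_trans (prob_mono (isWeight_markWeight p s) fun ω hω => ?_)
    (prob_cap_le p s v (Finset.univ.erase v) hθ hθ1 M)
  exact (Finset.card_le_card (filter_subset_capNbrs (by simp))).trans hω

/-- The sharp constant 1 in the exponent matters here: summed over all vertices, this bound tends to
zero exactly because d - log n tends to infinity. The Chernoff bound with `θ > 0` would lose too
much. -/
lemma prob_capNbrs_eq_empty_le (p s : I) (v : V) :
    prob (markWeight V p s) (fun ω => capNbrs ω v = ∅) ≤
      Real.exp (-(p * s ^ 2 * (Fintype.card V - 1))) := by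
  have hq1 : (p : ℝ) * s ^ 2 ≤ 1 := by
    have h1 : (s : ℝ) ^ 2 ≤ 1 := pow_le_one₀ s.2.1 s.2.2
    calc (p : ℝ) * s ^ 2 ≤ 1 * 1 := mul_le_mul p.2.2 h1 (sq_nonneg _) zero_le_one
      _ = 1 := one_mul 1
  let F : Finset (Sym2 V) := (Finset.univ.erase v).image fun u => s(v, u)
  have hF : (F.card : ℝ) = Fintype.card V - 1 := by
    rw [Finset.card_image_of_injOn, Finset.card_erase_of_mem (Finset.mem_univ v), Finset.card_univ,
      Nat.cast_sub (Fintype.card_pos_iff.2 ⟨v⟩)]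
    · simp
    · intro a _ b _ hab
      rcases Sym2.eq_iff.1 hab with ⟨-, h⟩ | ⟨h, h'⟩
      · exact h
      · exact h'.trans h
  have h1 : prob (markWeight V p s) (fun ω => capNbrs ω v = ∅) ≤
      (1 - (p : ℝ) * s ^ 2) ^ F.card := by
    rw [← prob_forall_ne_full]
    refine prob_mono (isWeight_markWeight p s) fun ω hω e he hf => ?_
    simp only [F, Finset.mem_image, Finset.mem_erase, Finset.mem_univ, and_true] at he
    obtain ⟨u, hu, rfl⟩ := he
    have : u ∈ capNbrs ω v := by simp [capNbrs, hu, hf]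
    rw [hω] at this
    simp at this
  refine h1.trans ?_
  calc (1 - (p : ℝ) * s ^ 2) ^ F.card ≤ Real.exp (-(p * s ^ 2)) ^ F.card :=
        pow_le_pow_left₀ (by linarith) (by
          have := Real.add_one_le_exp (-((p : ℝ) * s ^ 2)); linarith) _
    _ = _ := by rw [← Real.exp_nat_mul, hF]; congr 1; ring

/-- Two given vertices are unlikely to have few neighbours in the intersection graph while some
other pairs are edges of the parent graph. -/
lemma prob_low_low_le (p s : I) {u v : V} (huv : u ≠ v) (F : Finset (Sym2 V)) (R : Finset V)
    (hu : u ∉ R) (hv : v ∉ R) (hF : ∀ e ∈ F, ∀ x ∈ R, x ∉ e) {θ : ℝ} (hθ : 0 < θ) (hθ1 : θ ≤ 1)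
    (M : ℕ) :
    prob (markWeight V p s) (fun ω => (∀ e ∈ F, (ω e).1 = true) ∧
      (capNbrs ω u).card ≤ M ∧ (capNbrs ω v).card ≤ M) ≤
      (p : ℝ) ^ F.card * lowBound θ M (p * s ^ 2) R.card ^ 2 := by
  have hw := isWeight_markWeight (V := V) p s
  let A : V → (Sym2 V → Mark) → Prop := fun v ω =>
    (R.filter fun x => ω s(v, x) = full).card ≤ M
  let S : V → Set (Sym2 V) := fun v => {e | ∃ x ∈ R, e = s(v, x)}
  have hA : ∀ v, DependsOn (A v) (S v) := by
    intro v x y hxy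
    have : (R.filter fun z => x s(v, z) = full) = R.filter fun z => y s(v, z) = full :=
      Finset.filter_congr fun z hz => by rw [hxy _ ⟨z, hz, rfl⟩]
    simp only [A, this]
  have hFdep : DependsOn (fun ω : Sym2 V → Mark => ∀ e ∈ F, (ω e).1 = true) (F : Set (Sym2 V)) := by
    intro x y hxy
    refine propext (forall_congr' fun e => forall_congr' fun he => ?_)
    rw [hxy e he]
  have hS : Disjoint (S u) (S v) := by
    rw [Set.disjoint_left]
    rintro e ⟨x, hx, rfl⟩ ⟨y, hy, he⟩
    rcases Sym2.eq_iff.1 he with ⟨h, -⟩ | ⟨h, -⟩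
    · exact huv h
    · exact hu (h ▸ hy)
  have hAA : DependsOn (fun ω => A u ω ∧ A v ω) (S u ∪ S v) := by
    intro x y hxy
    exact congrArg₂ And (hA u fun e he => hxy e (Or.inl he)) (hA v fun e he => hxy e (Or.inr he))
  have hFS : Disjoint (F : Set (Sym2 V)) (S u ∪ S v) := by
    rw [Set.disjoint_left]
    rintro e he (⟨x, hx, rfl⟩ | ⟨x, hx, rfl⟩)
    · exact hF _ he x hx (by simp)
    · exact hF _ he x hx (by simp)
  -- Counting only neighbours in `R` makes the two degree events independent of each other and of
  -- the edges in `F`, as `R` contains neither `u`, `v` nor an end of an edge of `F`.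
  have h1 : prob (markWeight V p s) (fun ω => (∀ e ∈ F, (ω e).1 = true) ∧
      (capNbrs ω u).card ≤ M ∧ (capNbrs ω v).card ≤ M) ≤
      prob (markWeight V p s) (fun ω => (∀ e ∈ F, (ω e).1 = true) ∧ (A u ω ∧ A v ω)) :=
    prob_mono hw fun ω hω => ⟨hω.1,
      (Finset.card_le_card (filter_subset_capNbrs hu)).trans hω.2.1,
      (Finset.card_le_card (filter_subset_capNbrs hv)).trans hω.2.2⟩
  refine h1.trans ?_
  rw [prob_and_of_dependsOn hw hFS hFdep hAA, prob_parent_forall,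
    prob_and_of_dependsOn hw hS (hA u) (hA v), sq]
  refine mul_le_mul_of_nonneg_left ?_ (pow_nonneg p.2.1 _)
  have b1 := prob_cap_le p s u R hθ hθ1 M
  have b2 := prob_cap_le p s v R hθ hθ1 M
  exact mul_le_mul b1 b2 (prob_nonneg hw) ((prob_nonneg hw).trans b1)

lemma lowBound_anti {θ q r r' : ℝ} (hθ : 0 < θ) (hθ1 : θ ≤ 1) (M : ℕ) (hq : 0 ≤ q) (h : r ≤ r') :
    lowBound θ M q r' ≤ lowBound θ M q r := by
  refine mul_le_mul_of_nonneg_left (Real.exp_le_exp.2 (neg_le_neg ?_)) (by positivity)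
  exact mul_le_mul_of_nonneg_left h (mul_nonneg (by linarith) hq)

lemma lowBound_nonneg {θ q r : ℝ} (hθ : 0 < θ) (M : ℕ) : 0 ≤ lowBound θ M q r := by
  unfold lowBound; positivity

lemma card_compl_ge (A : Finset V) (k : ℕ) (hA : A.card ≤ k) :
    (Fintype.card V : ℝ) - k ≤ (Finset.univ \ A).card := by
  have h1 : (Finset.univ \ A).card + A.card = Fintype.card V := by
    rw [Finset.card_sdiff_add_card_eq_card (Finset.subset_univ A), Finset.card_univ]
  have h2 : Fintype.card V ≤ (Finset.univ \ A).card + k := by omega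
  have : (Fintype.card V : ℝ) ≤ (Finset.univ \ A).card + k := by exact_mod_cast h2
  linarith

/-- Only two vertices need to be left out of the count. The weaker `n - 3` gives the same bound as
in the case of a common neighbour. -/
lemma prob_low_adj_le (p s : I) {u v : V} {θ : ℝ} (hθ : 0 < θ) (hθ1 : θ ≤ 1) (M : ℕ) :
    prob (markWeight V p s) (fun ω => (parent ω).Adj u v ∧
      (capNbrs ω u).card ≤ M ∧ (capNbrs ω v).card ≤ M) ≤
      p * lowBound θ M (p * s ^ 2) (Fintype.card V - 3) ^ 2 := by
  have hw := isWeight_markWeight (V := V) p s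
  have hq0 : 0 ≤ (p : ℝ) * s ^ 2 := mul_nonneg p.2.1 (sq_nonneg _)
  by_cases huv : u = v
  · subst huv
    refine (prob_mono hw (Q := fun _ => False) fun ω hω => (parent ω).loopless.irrefl u hω.1).trans ?_
    have : prob (markWeight V p s) (fun _ => False) = 0 := by simp [prob, expect]
    rw [this]
    exact mul_nonneg p.2.1 (sq_nonneg _)
  have h := prob_low_low_le p s huv {s(u, v)} (Finset.univ \ {u, v}) (by simp) (by simp)
    (by
      intro e he x hx
      simp only [Finset.mem_singleton] at he
      subst he
      simp only [Finset.mem_sdiff, Finset.mem_univ, Finset.mem_insert, Finset.mem_singleton,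
        true_and] at hx
      rwa [Sym2.mem_iff]) hθ hθ1 M
  refine (prob_mono hw fun ω hω => ?_).trans (h.trans ?_)
  · exact ⟨fun e he => by rw [Finset.mem_singleton.1 he]; exact hω.1.2, hω.2⟩
  · rw [Finset.card_singleton, pow_one]
    refine mul_le_mul_of_nonneg_left (pow_le_pow_left₀ (lowBound_nonneg hθ M)
      (lowBound_anti hθ hθ1 M hq0 ?_) 2) p.2.1
    have := card_compl_ge ({u, v} : Finset V) 3 (Finset.card_le_two.trans (by norm_num))
    exact_mod_cast this

lemma prob_low_common_le (p s : I) {u v w : V} (huv : u ≠ v) {θ : ℝ} (hθ : 0 < θ) (hθ1 : θ ≤ 1)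
    (M : ℕ) :
    prob (markWeight V p s) (fun ω => ((parent ω).Adj u w ∧ (parent ω).Adj v w) ∧
      (capNbrs ω u).card ≤ M ∧ (capNbrs ω v).card ≤ M) ≤
      p ^ 2 * lowBound θ M (p * s ^ 2) (Fintype.card V - 3) ^ 2 := by
  have hw := isWeight_markWeight (V := V) p s
  have hq0 : 0 ≤ (p : ℝ) * s ^ 2 := mul_nonneg p.2.1 (sq_nonneg _)
  have h := prob_low_low_le p s huv {s(u, w), s(v, w)} (Finset.univ \ {u, v, w}) (by simp) (by simp)
    (by
      intro e he x hx
      simp only [Finset.mem_sdiff, Finset.mem_univ, Finset.mem_insert, Finset.mem_singleton,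
        true_and, not_or] at hx he
      rcases he with rfl | rfl
      · rw [Sym2.mem_iff]; tauto
      · rw [Sym2.mem_iff]; tauto) hθ hθ1 M
  refine (prob_mono hw fun ω hω => ?_).trans (h.trans ?_)
  · refine ⟨fun e he => ?_, hω.2⟩
    simp only [Finset.mem_insert, Finset.mem_singleton] at he
    rcases he with rfl | rfl
    · exact hω.1.1.2
    · exact hω.1.2.2
  · have hc : ({s(u, w), s(v, w)} : Finset (Sym2 V)).card = 2 := by
      rw [Finset.card_pair]
      intro he
      rcases Sym2.eq_iff.1 he with ⟨h, -⟩ | ⟨h, h'⟩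
      · exact huv h
      · exact huv (h.trans h')
    rw [hc]
    refine mul_le_mul_of_nonneg_left (pow_le_pow_left₀ (lowBound_nonneg hθ M)
      (lowBound_anti hθ hθ1 M hq0 ?_) 2) (sq_nonneg _)
    have := card_compl_ge ({u, v, w} : Finset V) 3 Finset.card_le_three
    exact_mod_cast this

end Degrees

/-! ### Union bounds for the failure probability -/

section Failure

variable {n : ℕ}

/-- The vertices with fewer than `M` neighbours. -/
def lowSet {V : Type} (H : SimpleGraph V) (M : ℕ) : Set V := {v | (H.neighborSet v).ncard < M}

lemma mem_lowSet_cap {V : Type} [Fintype V] [DecidableEq V] {ω : Sym2 V → Mark} {M : ℕ} {v : V} :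
    v ∈ lowSet (cap ω) M ↔ (capNbrs ω v).card < M := by
  have : (cap ω).neighborSet v = (capNbrs ω v : Set V) := by
    ext u
    rw [SimpleGraph.mem_neighborSet, cap_adj]
    simp [capNbrs, ne_comm]
  rw [lowSet, Set.mem_ofPred_eq, this, Set.ncard_coe_finset]

/-- The events of the edges and the seeds. -/
noncomputable def prob₂ (p s α : I) (E : (Sym2 (Fin n) → Mark) → (Fin n → Bool) → Prop) : ℝ :=
  expect (markWeight (Fin n) p s) fun ω => prob (bernoulliWeight (Fin n) α) (E ω)

lemma prob₂_mono (p s α : I) {E F : (Sym2 (Fin n) → Mark) → (Fin n → Bool) → Prop}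
    (h : ∀ ω τ, E ω τ → F ω τ) : prob₂ p s α E ≤ prob₂ p s α F :=
  expect_mono (isWeight_markWeight p s) fun ω => prob_mono (isWeight_bernoulliWeight _ α) (h ω)

lemma prob₂_or_le (p s α : I) (E F : (Sym2 (Fin n) → Mark) → (Fin n → Bool) → Prop) :
    prob₂ p s α (fun ω τ => E ω τ ∨ F ω τ) ≤ prob₂ p s α E + prob₂ p s α F := by
  rw [prob₂, prob₂, prob₂, ← expect_add]
  exact expect_mono (isWeight_markWeight p s) fun ω => prob_or_le (isWeight_bernoulliWeight _ α)

lemma prob₂_exists_mem_le (p s α : I) {ι : Type*} (A : Finset ι)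
    (E : ι → (Sym2 (Fin n) → Mark) → (Fin n → Bool) → Prop) (c : ℝ)
    (h : ∀ i ∈ A, prob₂ p s α (E i) ≤ c) :
    prob₂ p s α (fun ω τ => ∃ i ∈ A, E i ω τ) ≤ A.card * c := by
  calc prob₂ p s α (fun ω τ => ∃ i ∈ A, E i ω τ) ≤ ∑ i ∈ A, prob₂ p s α (E i) := by
        simp only [prob₂]
        rw [← expect_sum]
        exact expect_mono (isWeight_markWeight p s) fun ω =>
          prob_exists_mem_le (isWeight_bernoulliWeight _ α) A fun i => E i ω
    _ ≤ ∑ _i ∈ A, c := Finset.sum_le_sum h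
    _ = A.card * c := by simp

lemma prob₂_const (p s α : I) (E : (Sym2 (Fin n) → Mark) → Prop) :
    prob₂ p s α (fun ω _ => E ω) = prob (markWeight (Fin n) p s) E := by
  classical
  rw [prob₂, prob]
  refine congrArg (expect _) (funext fun ω => ?_)
  rw [prob, expect_const (isWeight_bernoulliWeight _ α)]

/-- The failure probability is at most the probability that the good event does not occur. -/
lemma one_sub_successProbability_le (p s α : I) (m ℓ M : ℕ) :
    1 - successProbability n p s α m ℓ ≤ prob₂ (n := n) p s α fun ω τ =>
      ¬ Good (parent ω) (cap ω) {v | τ v = true} (lowSet (cap ω) M)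
        (Linked (parent ω ⊓ markOne ω) (parent ω ⊓ markTwo ω) {v | τ v = true} m ℓ) := by
  have : IsProbabilityMeasure (law n p s α) := by unfold law; infer_instance
  have hms : ∀ A : Set (Sample n), MeasurableSet A := fun A => (Set.toFinite A).measurableSet
  have h1 : 1 - successProbability n p s α m ℓ = (law n p s α).real
      {ω | algorithmOutput ω.graphOne ω.graphTwo ω.seedMap m ℓ ω.fallback = ω.latent}ᶜ := by
    rw [probReal_compl_eq_one_sub (hms _), successProbability]
  rw [h1]
  have h2 := law_real_eq_expect n p s α fun A B C S =>
    ¬ Good A (A ⊓ B ⊓ (A ⊓ C)) S (lowSet (A ⊓ B ⊓ (A ⊓ C)) M) (Linked (A ⊓ B) (A ⊓ C) S m ℓ)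
  refine le_trans (measureReal_mono ?_) h2.le
  intro ω hω hgood
  exact hω (algorithmOutput_eq_latent ω m ℓ _ hgood)

/-- The contribution of the wrong pairs and of the exploration to the failure probability. -/
noncomputable def linkBound (n : ℕ) (p s α : ℝ) (m ℓ K g Δ : ℕ) : ℝ :=
  (n : ℝ) ^ 2 * ((n * p) ^ (K * (ℓ + 1)) * α ^ K * (K * earWeight K (ℓ + 1) n p ^ (K - 1)) /
      m.descFactorial K) +
    (n * ((2 : ℝ)⁻¹ ^ (Δ + 1) * Real.exp (n * p)) +
    n * (m * ℓ * Real.exp (-(n * (p * s ^ 2) / 32 * g)) +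
      m * Real.exp (-(α * ((n * (p * s ^ 2) / 32) ^ ℓ * g)))))

/-- The summands of `linkBound` correspond to the wrong pairs, to a vertex of parent degree above
`Δ`, and to the exploration from each vertex, which is controlled only while all degrees are at most
`Δ`. -/
lemma prob₂_link_le (p s α : I) {m ℓ K g Δ : ℕ} (hK : 0 < K) (hm : K ≤ m)
    (h1 : 2 * (Δ + 1) ^ ℓ ≤ n) (h2 : (p : ℝ) * s ^ 2 * (Δ + 1) ^ ℓ ≤ 1 / 2)
    (h3 : 1 ≤ n * ((p : ℝ) * s ^ 2) / 32) :
    prob₂ p s α (fun ω τ =>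
      (∃ v u, v ≠ u ∧ Linked (parent ω ⊓ markOne ω) (parent ω ⊓ markTwo ω) {v | τ v = true} m
        (ℓ + 1) v u) ∨
      ∃ v : Fin n, m * g ≤ (capNbrs ω v).card ∧ ¬ Linked (parent ω ⊓ markOne ω)
        (parent ω ⊓ markTwo ω) {v | τ v = true} m (ℓ + 1) v v) ≤ linkBound n p s α m ℓ K g Δ := by
  refine (prob₂_or_le p s α _ _).trans (add_le_add ?_ ?_)
  · have h := prob₂_exists_mem_le p s α
      (Finset.univ.filter fun x : Fin n × Fin n => x.1 ≠ x.2)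
      (fun x ω τ => Linked (parent ω ⊓ markOne ω) (parent ω ⊓ markTwo ω) {v | τ v = true} m
        (ℓ + 1) x.1 x.2) _ (fun x hx => by
          have := expect_linked_le (V := Fin n) p s α hK (Nat.succ_pos ℓ) hm (u := x.2) (v := x.1)
            (by simpa using (Finset.mem_filter.1 hx).2.symm)
          rw [Fintype.card_fin] at this
          exact this)
    refine (prob₂_mono p s α ?_).trans (h.trans (mul_le_mul_of_nonneg_right ?_ ?_))
    · rintro ω τ ⟨v, u, hvu, hl⟩
      exact ⟨(v, u), by simpa using hvu, hl⟩
    · have : (Finset.univ.filter fun x : Fin n × Fin n => x.1 ≠ x.2).card ≤ n ^ 2 := by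
        refine (Finset.card_le_univ _).trans ?_
        simp [sq]
      exact_mod_cast this
    · have e := earWeight_nonneg K (ℓ + 1) n p
      have := p.2.1
      have := α.2.1
      positivity
  · have ha := prob₂_exists_mem_le p s α (Finset.univ : Finset (Fin n))
      (fun v ω τ => Δ + 1 ≤ (parentNbrs ω v).card) _ (fun v _ => by
        rw [prob₂_const]
        have := prob_parentNbrs_le p s v (Δ + 1)
        rwa [Fintype.card_fin] at this)
    have hb := prob₂_exists_mem_le p s α (Finset.univ : Finset (Fin n))
      (fun v ω τ => (∀ v, (parentNbrs ω v).card ≤ Δ) ∧ m * g ≤ (capNbrs ω v).card ∧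
        ¬ Linked (parent ω ⊓ markOne ω) (parent ω ⊓ markTwo ω) {v | τ v = true} m (ℓ + 1) v v) _
      (fun v _ => by
        have := expect_not_linked_self_le (m := m) (g := g) p s α v ℓ Δ
          (by simpa using h1) h2 (by simpa using h3)
        rw [Fintype.card_fin] at this
        exact this)
    rw [Finset.card_univ, Fintype.card_fin] at ha hb
    refine le_trans (prob₂_mono p s α ?_) ((prob₂_or_le p s α _ _).trans (add_le_add ha hb))
    rintro ω τ ⟨v, hv, hl⟩
    by_cases hd : ∀ v, (parentNbrs ω v).card ≤ Δ
    · exact Or.inr ⟨v, Finset.mem_univ v, hd, hv, hl⟩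
    · push Not at hd
      obtain ⟨w, hw⟩ := hd
      exact Or.inl ⟨w, Finset.mem_univ w, hw⟩

/-- The failure probability when there are vertices of low degree. -/
lemma failure_le_of_low (p s α : I) {m ℓ K g Δ : ℕ} (hK : 0 < K) (hm : K ≤ m)
    (h1 : 2 * (Δ + 1) ^ ℓ ≤ n) (h2 : (p : ℝ) * s ^ 2 * (Δ + 1) ^ ℓ ≤ 1 / 2)
    (h3 : 1 ≤ n * ((p : ℝ) * s ^ 2) / 32) :
    1 - successProbability n p s α m (ℓ + 1) ≤ linkBound n p s α m ℓ K g Δ +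
      (n * Real.exp (-(p * s ^ 2 * (n - 1))) +
      ((n : ℝ) ^ 2 * (p * lowBound (1 / 4) (m * g) (p * s ^ 2) (n - 3) ^ 2) +
      (n : ℝ) ^ 3 * (p ^ 2 * lowBound (1 / 4) (m * g) (p * s ^ 2) (n - 3) ^ 2))) := by
  refine (one_sub_successProbability_le p s α m (ℓ + 1) (m * g)).trans ?_
  have hL := prob₂_link_le p s α (g := g) hK hm h1 h2 h3
  have hI := prob₂_exists_mem_le p s α (Finset.univ : Finset (Fin n))
      (fun v ω τ => capNbrs ω v = ∅) _ (fun v _ => by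
        rw [prob₂_const]
        have := prob_capNbrs_eq_empty_le p s v
        rwa [Fintype.card_fin] at this)
  have hA := prob₂_exists_mem_le p s α (Finset.univ : Finset (Fin n × Fin n))
      (fun x ω τ => (parent ω).Adj x.1 x.2 ∧
        (capNbrs ω x.1).card ≤ m * g ∧ (capNbrs ω x.2).card ≤ m * g) _ (fun x _ => by
        rw [prob₂_const]
        have := prob_low_adj_le p s (u := x.1) (v := x.2) (θ := 1 / 4) (by norm_num) (by norm_num)
          (m * g)
        rwa [Fintype.card_fin] at this)
  have hC := prob₂_exists_mem_le p s α
      (Finset.univ.filter fun x : Fin n × Fin n × Fin n => x.1 ≠ x.2.1)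
      (fun x ω τ => ((parent ω).Adj x.1 x.2.2 ∧ (parent ω).Adj x.2.1 x.2.2) ∧
        (capNbrs ω x.1).card ≤ m * g ∧ (capNbrs ω x.2.1).card ≤ m * g) _ (fun x hx => by
        rw [prob₂_const]
        have := prob_low_common_le p s (u := x.1) (v := x.2.1) (w := x.2.2)
          (Finset.mem_filter.1 hx).2 (θ := 1 / 4) (by norm_num) (by norm_num) (m * g)
        rwa [Fintype.card_fin] at this)
  have hC' : ((Finset.univ.filter fun x : Fin n × Fin n × Fin n => x.1 ≠ x.2.1).card : ℝ) ≤
      (n : ℝ) ^ 3 := by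
    have : (Finset.univ.filter fun x : Fin n × Fin n × Fin n => x.1 ≠ x.2.1).card ≤ n ^ 3 := by
      refine (Finset.card_le_univ _).trans (le_of_eq ?_)
      simp; ring
    exact_mod_cast this
  rw [Finset.card_univ, Fintype.card_fin] at hI
  rw [Finset.card_univ, Fintype.card_prod, Fintype.card_fin] at hA
  push_cast at hA
  rw [← sq] at hA
  replace hC := hC.trans (mul_le_mul_of_nonneg_right hC' (mul_nonneg (sq_nonneg _) (sq_nonneg _)))
  refine le_trans (prob₂_mono p s α ?_) ((prob₂_or_le p s α _ _).trans (add_le_add hL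
    ((prob₂_or_le p s α _ _).trans (add_le_add hI
      ((prob₂_or_le p s α _ _).trans (add_le_add hA hC))))))
  intro ω τ hng
  -- Outside the listed events every clause of `Good` holds. Low vertices have degree strictly below
  -- `m * g`, whereas the events allow equality, so the two cases for link-to-itself and low
  -- overlap.
  by_contra hcon
  simp only [not_or, not_exists, not_and, Finset.mem_univ, true_and,
    not_not, Prod.forall, Finset.mem_filter] at hcon
  obtain ⟨⟨hc1, hc2⟩, hc3, hc4, hc5⟩ := hcon
  refine hng ⟨fun v u h => ?_, fun v _ hv => ?_, fun v => ?_, fun u v hu hv ha => ?_,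
    fun u v w hu hv huv ha hb => ?_⟩
  · by_contra hvu
    exact hc1 v u hvu h
  · rw [mem_lowSet_cap, not_lt] at hv
    exact hc2 v hv
  · obtain ⟨w, hw⟩ := Finset.nonempty_iff_ne_empty.2 (hc3 v)
    simp only [capNbrs, Finset.mem_filter, Finset.mem_univ, true_and] at hw
    exact ⟨w, cap_adj.2 ⟨hw.1.symm, hw.2⟩⟩
  · rw [mem_lowSet_cap] at hu hv
    exact hc4 u v ha hu.le hv.le
  · rw [mem_lowSet_cap] at hu hv
    exact hc5 u v w huv ⟨ha, hb⟩ hu.le hv.le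

/-- The failure probability when there are no vertices of low degree. -/
lemma failure_le_of_high (p s α : I) {m ℓ K g Δ : ℕ} (hK : 0 < K) (hm : K ≤ m)
    (h1 : 2 * (Δ + 1) ^ ℓ ≤ n) (h2 : (p : ℝ) * s ^ 2 * (Δ + 1) ^ ℓ ≤ 1 / 2)
    (h3 : 1 ≤ n * ((p : ℝ) * s ^ 2) / 32) :
    1 - successProbability n p s α m (ℓ + 1) ≤ linkBound n p s α m ℓ K g Δ +
      n * lowBound (1 / 2) (m * g) (p * s ^ 2) (n - 1) := by
  refine (one_sub_successProbability_le p s α m (ℓ + 1) (m * g)).trans ?_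
  have hL := prob₂_link_le p s α (g := g) hK hm h1 h2 h3
  have hI := prob₂_exists_mem_le p s α (Finset.univ : Finset (Fin n))
      (fun v ω τ => (capNbrs ω v).card ≤ m * g) _ (fun v _ => by
        rw [prob₂_const]
        have := prob_capNbrs_le p s v (θ := 1 / 2) (by norm_num) (by norm_num) (m * g)
        rwa [Fintype.card_fin] at this)
  rw [Finset.card_univ, Fintype.card_fin] at hI
  refine le_trans (prob₂_mono p s α ?_) ((prob₂_or_le p s α _ _).trans (add_le_add hL hI))
  intro ω τ hng
  by_contra hcon
  simp only [not_or, not_exists, not_and, Finset.mem_univ, true_and,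
    not_not, not_le] at hcon
  obtain ⟨⟨hc1, hc2⟩, hc3⟩ := hcon
  -- No vertex is low, so the clauses about pairs of low vertices are vacuous, and positive degrees
  -- exclude isolated vertices.
  have hlow : ∀ v, v ∉ lowSet (cap ω) (m * g) := fun v hv => by
    rw [mem_lowSet_cap] at hv
    exact absurd hv (hc3 v).le.not_gt
  refine hng ⟨fun v u h => ?_, fun v _ hv => hc2 v (hc3 v).le, fun v => ?_,
    fun u v hu => absurd hu (hlow u), fun u v w hu => absurd hu (hlow u)⟩
  · by_contra hvu
    exact hc1 v u hvu h
  · have hpos : 0 < (capNbrs ω v).card := (Nat.zero_le _).trans_lt (hc3 v)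
    obtain ⟨w, hw⟩ := Finset.card_pos.1 hpos
    simp only [capNbrs, Finset.mem_filter, Finset.mem_univ, true_and] at hw
    exact ⟨w, cap_adj.2 ⟨hw.1.symm, hw.2⟩⟩

end Failure


/-! ### Numerical bounds when all degrees are large -/

section Numeric

/-- The contribution of the wrong pairs to the failure probability. -/
noncomputable def wrongTerm (n : ℕ) (p α : ℝ) (m L K : ℕ) : ℝ :=
  (n : ℝ) ^ 2 * ((n * p) ^ (K * L) * α ^ K * (K * earWeight K L n p ^ (K - 1)) /
      m.descFactorial K)

lemma exp_neg_log_mul {n : ℕ} (hn : 0 < n) (k : ℕ) :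
    Real.exp (-(k * Real.log n)) = ((n : ℝ) ^ k)⁻¹ := by
  rw [Real.exp_neg, Real.exp_nat_mul, Real.exp_log (by exact_mod_cast hn)]

lemma two_pow_le_exp (k : ℕ) : (2 : ℝ) ^ k ≤ Real.exp (7 / 10 * k) := by
  have h : (2 : ℝ) ≤ Real.exp (7 / 10) := by
    have h2 : Real.log 2 < 7 / 10 := by have := Real.log_two_lt_d9; linarith
    calc (2 : ℝ) = Real.exp (Real.log 2) := (Real.exp_log (by norm_num)).symm
      _ ≤ _ := Real.exp_le_exp.2 h2.le
  calc (2 : ℝ) ^ k ≤ Real.exp (7 / 10) ^ k := pow_le_pow_left₀ (by norm_num) h k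
    _ = _ := by rw [← Real.exp_nat_mul]; congr 1; ring

/-- The bound for the maximal degree of the parent graph. -/
lemma degree_term_le {n : ℕ} (hn : 0 < n) {x : ℝ} (hx : Real.log n ≤ x) :
    n * ((2 : ℝ)⁻¹ ^ ⌈4 * x⌉₊ * Real.exp x) ≤ (n : ℝ) ^ (-(1 / 2) : ℝ) := by
  have hn' : (0 : ℝ) < n := by exact_mod_cast hn
  have hlog : 0 ≤ Real.log n := Real.log_natCast_nonneg n
  -- Since log 2 > 5/8, the power of 1/2 is at most e^(-5x/2). This beats both e^x and n ≤ e^x and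
  -- leaves e^(-x/2).
  have h1 : (2 : ℝ)⁻¹ ^ ⌈4 * x⌉₊ ≤ Real.exp (-(5 / 2 * x)) := by
    have h2 : (2 : ℝ)⁻¹ ≤ Real.exp (-(5 / 8)) := by
      have h3 : 5 / 8 < Real.log 2 := by have := Real.log_two_gt_d9; linarith
      calc (2 : ℝ)⁻¹ = Real.exp (-Real.log 2) := by
            rw [Real.exp_neg, Real.exp_log (by norm_num)]
        _ ≤ _ := Real.exp_le_exp.2 (by linarith)
    calc (2 : ℝ)⁻¹ ^ ⌈4 * x⌉₊ ≤ Real.exp (-(5 / 8)) ^ ⌈4 * x⌉₊ :=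
          pow_le_pow_left₀ (by norm_num) h2 _
      _ = Real.exp (-(5 / 8 * ⌈4 * x⌉₊)) := by rw [← Real.exp_nat_mul]; congr 1; ring
      _ ≤ _ := Real.exp_le_exp.2 (by have := Nat.le_ceil (4 * x); linarith)
  calc n * ((2 : ℝ)⁻¹ ^ ⌈4 * x⌉₊ * Real.exp x)
      ≤ n * (Real.exp (-(5 / 2 * x)) * Real.exp x) := by gcongr
    _ = Real.exp (Real.log n + (-(5 / 2 * x) + x)) := by
        rw [Real.exp_add, Real.exp_log hn', Real.exp_add]
    _ ≤ Real.exp (Real.log n * (-(1 / 2))) := Real.exp_le_exp.2 (by linarith)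
    _ = _ := by rw [Real.rpow_def_of_pos hn']

/-- These are the size conditions of the exploration with `Δ = ⌈4np⌉₊ - 1`; the subtraction is
genuine and `Δ + 1 ≤ 5np`. The spare factor `5np` in the hypothesis pays for the second condition,
where `p` equals `np / n`. -/
lemma pow_conditions {n ℓ : ℕ} {p s : I} (hx1 : 1 ≤ (n : ℝ) * p)
    (h : (5 * (n * (p : ℝ))) ^ (ℓ + 1) ≤ n / 2) :
    2 * ((⌈4 * ((n : ℝ) * p)⌉₊ - 1) + 1) ^ ℓ ≤ n ∧
      (p : ℝ) * s ^ 2 * ((⌈4 * ((n : ℝ) * p)⌉₊ - 1 : ℕ) + 1) ^ ℓ ≤ 1 / 2 ∧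
      ⌈4 * ((n : ℝ) * p)⌉₊ - 1 + 1 = ⌈4 * ((n : ℝ) * p)⌉₊ := by
  set x := (n : ℝ) * p with hx
  have hpos : 0 < ⌈4 * x⌉₊ := Nat.ceil_pos.2 (by linarith)
  have hD : ⌈4 * x⌉₊ - 1 + 1 = ⌈4 * x⌉₊ := by omega
  have hle : (⌈4 * x⌉₊ : ℝ) ≤ 5 * x := by
    have := Nat.ceil_lt_add_one (show 0 ≤ 4 * x by linarith)
    linarith
  have hpow : (⌈4 * x⌉₊ : ℝ) ^ ℓ ≤ (5 * x) ^ ℓ := pow_le_pow_left₀ (by positivity) hle ℓ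
  have h5 : (5 * x) ^ ℓ * (5 * x) ≤ n / 2 := by rw [← pow_succ]; exact h
  have hn : (0 : ℝ) < n := by
    rcases Nat.eq_zero_or_pos n with h0 | h0
    · rw [h0] at hx; simp at hx; linarith
    · exact_mod_cast h0
  have hp5 : 0 ≤ (5 * x) ^ ℓ := by positivity
  refine ⟨?_, ?_, hD⟩
  · rw [hD]
    have h2 : (2 : ℝ) * (⌈4 * x⌉₊ : ℝ) ^ ℓ ≤ n := by nlinarith
    exact_mod_cast h2
  · have hc : ((⌈4 * x⌉₊ - 1 : ℕ) : ℝ) + 1 = ⌈4 * x⌉₊ := by exact_mod_cast hD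
    rw [hc]
    have hs1 : (s : ℝ) ^ 2 ≤ 1 := pow_le_one₀ s.2.1 s.2.2
    have hq : (p : ℝ) * s ^ 2 ≤ x / n := by
      rw [hx, mul_div_assoc, mul_comm (n : ℝ), div_mul_cancel₀ _ hn.ne']
      nlinarith [p.2.1]
    calc (p : ℝ) * s ^ 2 * (⌈4 * x⌉₊ : ℝ) ^ ℓ ≤ x / n * (5 * x) ^ ℓ :=
          mul_le_mul hq hpow (by positivity) (by positivity)
      _ = ((5 * x) ^ ℓ * x) / n := by ring
      _ ≤ 1 / 2 := by rw [div_le_iff₀ hn]; nlinarith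

/-- The base `5x` exceeds e, so a power below n has exponent at most log n. -/
lemma natCast_le_of_pow_le {n ℓ : ℕ} {x : ℝ} (hx1 : 1 ≤ x)
    (h : (5 * x) ^ (ℓ + 1) ≤ n / 2) (hn : 0 < n) : (ℓ : ℝ) ≤ Real.log n := by
  have hn' : (0 : ℝ) < n := by exact_mod_cast hn
  rw [Real.le_log_iff_exp_le hn']
  calc Real.exp ℓ = Real.exp 1 ^ ℓ := by rw [Real.exp_one_pow]
    _ ≤ (5 * x) ^ ℓ := pow_le_pow_left₀ (Real.exp_pos _).le (by
        have := Real.exp_one_lt_d9; linarith) ℓ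
    _ ≤ (5 * x) ^ (ℓ + 1) := pow_le_pow_right₀ (by linarith) (Nat.le_succ ℓ)
    _ ≤ n := by linarith

/-- The failure probability when all degrees are large. -/
lemma failure_le_high {n m ℓ K : ℕ} (p s α : I) (hn : 2 ≤ n) (hK : 0 < K) (hm : K ≤ m)
    (hd : 128 * Real.log n ≤ n * p * s ^ 2) (hd1 : 32 ≤ (n : ℝ) * p * s ^ 2)
    (hL : (5 * (n * (p : ℝ))) ^ (ℓ + 1) ≤ n / 2) (hmd : 4 * (m : ℝ) ≤ n * p * s ^ 2)
    (hα : 3 * Real.log n ≤ α * (n * p * s ^ 2 / 32) ^ ℓ * (n * p * s ^ 2 / (8 * m))) :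
    1 - successProbability n p s α m (ℓ + 1) ≤
      wrongTerm n p α m (ℓ + 1) K + 5 * (n : ℝ) ^ (-(1 / 2) : ℝ) := by
  have hn0 : 0 < n := by omega
  have hn' : (0 : ℝ) < n := by exact_mod_cast hn0
  have hn1 : (1 : ℝ) ≤ n := by exact_mod_cast hn0
  have hlog : 0 ≤ Real.log n := Real.log_natCast_nonneg n
  have hs1 : (s : ℝ) ^ 2 ≤ 1 := pow_le_one₀ s.2.1 s.2.2
  have hm0 : (0 : ℝ) < m := by exact_mod_cast (by omega : 0 < m)
  set d := (n : ℝ) * p * s ^ 2 with hd_def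
  have hdx : d ≤ n * p := by
    have : 0 ≤ (n : ℝ) * p := mul_nonneg hn'.le p.2.1
    nlinarith
  have hx1 : 1 ≤ (n : ℝ) * p := by linarith
  obtain ⟨c1, c2, c3⟩ := pow_conditions (s := s) hx1 hL
  have hdn : d ≤ n := by
    have hpn : (n : ℝ) * p ≤ n := mul_le_of_le_one_right hn'.le p.2.2
    linarith
  have hdq : (n : ℝ) * (p * s ^ 2) = d := by rw [hd_def]; ring
  -- The largest group size for which `m` groups use at most a quarter of the expected degree; all
  -- degrees exceed `d / 4` with high probability.
  set g := ⌊d / (4 * m)⌋₊ with hg_def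
  have hdm : 1 ≤ d / (4 * m) := by rw [le_div_iff₀ (by positivity)]; linarith
  have hg1 : 1 ≤ g := Nat.le_floor (by simpa using hdm)
  have hg1' : (1 : ℝ) ≤ g := by exact_mod_cast hg1
  have hgle : (g : ℝ) ≤ d / (4 * m) := Nat.floor_le (by linarith)
  have hgge : d / (8 * m) ≤ g := by
    have h1 := Nat.lt_floor_add_one (d / (4 * m))
    have h2 : d / (8 * m) = d / (4 * m) / 2 := by field_simp; ring
    rw [h2]
    linarith
  have hfail := failure_le_of_high (g := g) p s α hK hm c1 c2
    (by rw [hdq]; linarith)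
  refine hfail.trans ?_
  rw [linkBound, c3, hdq]
  have hinv : (n : ℝ)⁻¹ ≤ (n : ℝ) ^ (-(1 / 2) : ℝ) := by
    rw [← Real.rpow_neg_one]
    exact Real.rpow_le_rpow_of_exponent_le hn1 (by norm_num)
  have t2 := degree_term_le hn0 (hd.trans' (by linarith) |>.trans hdx)
  have hℓn : (ℓ : ℝ) ≤ n := (natCast_le_of_pow_le hx1 hL hn0).trans (Real.log_le_self hn'.le)
  have hmn : (m : ℝ) ≤ n := by linarith
  have t3 : n * (m * ℓ * Real.exp (-(d / 32 * g))) ≤ (n : ℝ) ^ (-(1 / 2) : ℝ) := by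
    refine le_trans ?_ hinv
    have e1 : Real.exp (-(d / 32 * g)) ≤ ((n : ℝ) ^ 4)⁻¹ := by
      rw [← exp_neg_log_mul hn0 4]
      refine Real.exp_le_exp.2 (neg_le_neg ?_)
      push_cast
      nlinarith
    calc n * (m * ℓ * Real.exp (-(d / 32 * g))) ≤ n * (n * n * ((n : ℝ) ^ 4)⁻¹) := by gcongr
      _ = (n : ℝ)⁻¹ := by field_simp
  have t4 : n * (m * Real.exp (-(α * ((d / 32) ^ ℓ * g)))) ≤ (n : ℝ) ^ (-(1 / 2) : ℝ) := by
    refine le_trans ?_ hinv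
    have e1 : Real.exp (-(α * ((d / 32) ^ ℓ * g))) ≤ ((n : ℝ) ^ 3)⁻¹ := by
      rw [← exp_neg_log_mul hn0 3]
      refine Real.exp_le_exp.2 (neg_le_neg ?_)
      push_cast
      refine hα.trans ?_
      rw [← mul_assoc]
      exact mul_le_mul_of_nonneg_left hgge (mul_nonneg α.2.1 (pow_nonneg (by linarith) _))
    calc n * (m * Real.exp (-(α * ((d / 32) ^ ℓ * g)))) ≤ n * (n * ((n : ℝ) ^ 3)⁻¹) := by gcongr
      _ = (n : ℝ)⁻¹ := by field_simp
  have t8 : n * lowBound (1 / 2) (m * g) (p * s ^ 2) (n - 1) ≤ 2 * (n : ℝ) ^ (-(1 / 2) : ℝ) := by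
    have hmg : ((m * g : ℕ) : ℝ) ≤ d / 4 := by
      push_cast
      calc (m : ℝ) * g ≤ m * (d / (4 * m)) := by gcongr
        _ = d / 4 := by field_simp
    have hq1 : (p : ℝ) * s ^ 2 ≤ 1 := by nlinarith [p.2.2, p.2.1, sq_nonneg (s : ℝ)]
    -- The factor `2 ^ (m * g)` is at most e^(0.7·d/4), against e^(-d/2) from the Chernoff bound.
    -- The excess `p * s ^ 2 / 2 ≤ 1 / 2` is absorbed by the factor 2.
    have e0 : lowBound (1 / 2) (m * g) (p * s ^ 2) (n - 1) ≤ 2 * Real.exp (-(d / 4)) := by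
      unfold lowBound
      rw [show ((1 / 2 : ℝ)⁻¹) = 2 by norm_num]
      have e1 := two_pow_le_exp (m * g)
      calc _ ≤ Real.exp (7 / 10 * (m * g : ℕ)) *
            Real.exp (-((1 - 1 / 2) * (p * s ^ 2) * (n - 1))) := by gcongr
        _ = Real.exp (7 / 10 * (m * g : ℕ) - d / 2 + p * s ^ 2 / 2) := by
            rw [← Real.exp_add]; congr 1; rw [← hdq]; ring
        _ ≤ Real.exp (Real.log 2 + -(d / 4)) := Real.exp_le_exp.2 (by
            have := Real.log_two_gt_d9
            linarith)
        _ = 2 * Real.exp (-(d / 4)) := by rw [Real.exp_add, Real.exp_log (by norm_num)]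
    have e2 : Real.exp (-(d / 4)) ≤ ((n : ℝ) ^ 2)⁻¹ := by
      rw [← exp_neg_log_mul hn0 2]
      refine Real.exp_le_exp.2 (neg_le_neg ?_)
      push_cast
      linarith
    calc n * lowBound (1 / 2) (m * g) (p * s ^ 2) (n - 1) ≤ n * (2 * ((n : ℝ) ^ 2)⁻¹) := by
          gcongr
          exact e0.trans (by gcongr)
      _ = 2 * (n : ℝ)⁻¹ := by field_simp
      _ ≤ _ := by gcongr
  have hw : (n : ℝ) ^ 2 * ((n * p) ^ (K * (ℓ + 1)) * α ^ K *
      (K * earWeight K (ℓ + 1) n p ^ (K - 1)) / m.descFactorial K) =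
      wrongTerm n p α m (ℓ + 1) K := rfl
  rw [hw, mul_add (n : ℝ) (m * ℓ * _)]
  linarith

end Numeric


/-! ### Numerical bounds in the presence of low vertices -/

section Numeric

/-- The bound for the pairs of close vertices of small degree. -/
lemma low_pairs_le {n : ℕ} (p s : I) (m : ℕ) {C₀ : ℝ} (hn : 0 < n)
    (hd : Real.log n ≤ n * p * s ^ 2) (hd0 : 0 ≤ (n : ℝ) * p * s ^ 2) (hx1 : 1 ≤ (n : ℝ) * p)
    (hC₀ : (n : ℝ) * p ≤ C₀ * (n * p * s ^ 2)) :
    (n : ℝ) ^ 2 * (p * lowBound (1 / 4) (m * 64) (p * s ^ 2) (n - 3) ^ 2) +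
      (n : ℝ) ^ 3 * (p ^ 2 * lowBound (1 / 4) (m * 64) (p * s ^ 2) (n - 3) ^ 2) ≤
      128 * C₀ ^ 2 * 16 ^ (m * 64) * Real.exp (9 / 2) * (n : ℝ) ^ (-(1 / 4) : ℝ) := by
  have hn' : (0 : ℝ) < n := by exact_mod_cast hn
  have hq1 : (p : ℝ) * s ^ 2 ≤ 1 :=
    mul_le_one₀ p.2.2 (by positivity) (pow_le_one₀ s.2.1 s.2.2)
  have hdq : (n : ℝ) * (p * s ^ 2) = n * p * s ^ 2 := by ring
  generalize (n : ℝ) * p * s ^ 2 = d at *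
  -- Two low vertices at `θ = 1 / 4` give the exponent 2·(3/4)·q·(n-3) with q = ps² ≤ 1, hence at
  -- least 3d/2 - 9/2.
  have e0 : lowBound (1 / 4) (m * 64) (p * s ^ 2) (n - 3) ^ 2 ≤
      16 ^ (m * 64) * Real.exp (9 / 2) * Real.exp (-(3 / 2 * d)) := by
    unfold lowBound
    rw [mul_pow, ← pow_mul, mul_comm (m * 64) 2, pow_mul, ← Real.exp_nat_mul, mul_assoc (16 ^ _)]
    rw [show ((1 / 4 : ℝ)⁻¹) ^ 2 = 16 by norm_num, ← Real.exp_add]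
    refine mul_le_mul_of_nonneg_left (Real.exp_le_exp.2 ?_) (by positivity)
    push_cast
    rw [← hdq]
    linarith
  have e1 : (n : ℝ) * p + (n * p) ^ 2 ≤ 128 * C₀ ^ 2 * Real.exp (d / 4) := by
    have e2 : d ^ 2 ≤ 64 * Real.exp (d / 4) := by
      have e3 : d / 8 ≤ Real.exp (d / 8) := by
        have := Real.add_one_le_exp (d / 8); linarith
      have e4 : Real.exp (d / 4) = Real.exp (d / 8) ^ 2 := by
        rw [← Real.exp_nat_mul]; congr 1; push_cast; ring
      rw [e4]
      nlinarith
    have e5 : ((n : ℝ) * p) ^ 2 ≤ C₀ ^ 2 * d ^ 2 := by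
      rw [← mul_pow]; exact pow_le_pow_left₀ (by linarith) hC₀ 2
    have e6 : (n : ℝ) * p ≤ (n * p) ^ 2 := by nlinarith
    have e7 := mul_le_mul_of_nonneg_left e2 (sq_nonneg C₀)
    linarith
  -- What is left is n·e^(-5d/4), which is at most n^(-1/4) because d ≥ log n. Choosing `θ` below
  -- 1/2 is what pushes the exponent beyond one.
  have e8 : n * (Real.exp (d / 4) * Real.exp (-(3 / 2 * d))) ≤ (n : ℝ) ^ (-(1 / 4) : ℝ) := by
    calc n * (Real.exp (d / 4) * Real.exp (-(3 / 2 * d)))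
        = Real.exp (Real.log n + (d / 4 + -(3 / 2 * d))) := by
          rw [Real.exp_add, Real.exp_log hn', Real.exp_add]
      _ ≤ Real.exp (Real.log n * (-(1 / 4))) := Real.exp_le_exp.2 (by linarith)
      _ = _ := by rw [Real.rpow_def_of_pos hn']
  calc _ = n * ((n : ℝ) * p + (n * p) ^ 2) *
        lowBound (1 / 4) (m * 64) (p * s ^ 2) (n - 3) ^ 2 := by ring
    _ ≤ n * (128 * C₀ ^ 2 * Real.exp (d / 4)) *
        (16 ^ (m * 64) * Real.exp (9 / 2) * Real.exp (-(3 / 2 * d))) := by gcongr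
    _ = 128 * C₀ ^ 2 * 16 ^ (m * 64) * Real.exp (9 / 2) *
        (n * (Real.exp (d / 4) * Real.exp (-(3 / 2 * d)))) := by ring
    _ ≤ _ := mul_le_mul_of_nonneg_left e8 (by positivity)

/-- The failure probability when vertices of small degree may be present. -/
lemma failure_le_low {n m ℓ : ℕ} (p s α : I) {C₀ : ℝ} (hn : 2 ≤ n) (hm : 0 < m)
    (hd : Real.log n ≤ n * p * s ^ 2) (hd1 : 32 ≤ (n : ℝ) * p * s ^ 2)
    (hC₀ : (n : ℝ) * p ≤ C₀ * (n * p * s ^ 2)) (hL : (5 * (n * (p : ℝ))) ^ (ℓ + 1) ≤ n / 2)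
    (hα : 2 * Real.log n ≤ α * (n * p * s ^ 2 / 32) ^ ℓ) :
    1 - successProbability n p s α m (ℓ + 1) ≤
      wrongTerm n p α m (ℓ + 1) m +
        (1 + 3 * m + 128 * C₀ ^ 2 * 16 ^ (m * 64) * Real.exp (9 / 2)) * (n : ℝ) ^ (-(1 / 4) : ℝ) +
        3 * Real.exp (-(n * p * s ^ 2 - Real.log n)) := by
  have hn0 : 0 < n := by omega
  have hn' : (0 : ℝ) < n := by exact_mod_cast hn0
  have hn1 : (1 : ℝ) ≤ n := by exact_mod_cast hn0
  have hlog : 0 ≤ Real.log n := Real.log_natCast_nonneg n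
  have hs1 : (s : ℝ) ^ 2 ≤ 1 := pow_le_one₀ s.2.1 s.2.2
  have hm0 : (0 : ℝ) < m := by exact_mod_cast hm
  set d := (n : ℝ) * p * s ^ 2 with hd_def
  have hdx : d ≤ n * p := by
    have : 0 ≤ (n : ℝ) * p := mul_nonneg hn'.le p.2.1
    nlinarith
  have hx1 : 1 ≤ (n : ℝ) * p := by linarith
  have hC1 : 1 ≤ C₀ := by
    by_contra hcon
    push Not at hcon
    nlinarith
  obtain ⟨c1, c2, c3⟩ := pow_conditions (s := s) hx1 hL
  have hdq : (n : ℝ) * (p * s ^ 2) = d := by rw [hd_def]; ring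
  have hq1 : (p : ℝ) * s ^ 2 ≤ 1 := by nlinarith [p.2.2, p.2.1, sq_nonneg (s : ℝ)]
  -- The constant group size 64 gives e^(-2d) ≤ n^(-2) for the failure of one growth step, which
  -- survives the union over all vertices, groups and generations.
  refine (failure_le_of_low (g := 64) p s α hm le_rfl c1 c2 (by rw [hdq]; linarith)).trans ?_
  rw [linkBound, c3, hdq]
  have hhalf : (n : ℝ) ^ (-(1 / 2) : ℝ) ≤ (n : ℝ) ^ (-(1 / 4) : ℝ) :=
    Real.rpow_le_rpow_of_exponent_le hn1 (by norm_num)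
  have hinv : (n : ℝ)⁻¹ ≤ (n : ℝ) ^ (-(1 / 4) : ℝ) := by
    rw [← Real.rpow_neg_one]
    exact Real.rpow_le_rpow_of_exponent_le hn1 (by norm_num)
  have t2 := (degree_term_le hn0 (hd.trans hdx)).trans hhalf
  have t3 : n * (m * ℓ * Real.exp (-(d / 32 * (64 : ℕ)))) ≤
      2 * m * (n : ℝ) ^ (-(1 / 4) : ℝ) := by
    have e1 : Real.exp (-(d / 32 * (64 : ℕ))) ≤ ((n : ℝ) ^ 2)⁻¹ := by
      rw [← exp_neg_log_mul hn0 2]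
      refine Real.exp_le_exp.2 (neg_le_neg ?_)
      push_cast
      linarith
    have e2 : (ℓ : ℝ) ≤ 2 * (n : ℝ) ^ (1 / 2 : ℝ) := by
      refine (natCast_le_of_pow_le hx1 hL hn0).trans ?_
      have := Real.log_le_rpow_div hn'.le (show (0 : ℝ) < 1 / 2 by norm_num)
      linarith
    calc n * (m * ℓ * Real.exp (-(d / 32 * (64 : ℕ))))
        ≤ n * (m * (2 * (n : ℝ) ^ (1 / 2 : ℝ)) * ((n : ℝ) ^ 2)⁻¹) := by gcongr
      _ = 2 * m * ((n : ℝ) ^ (1 / 2 : ℝ) * (n : ℝ) ^ (-1 : ℝ)) := by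
          rw [Real.rpow_neg_one]; field_simp
      _ = 2 * m * (n : ℝ) ^ (-(1 / 2) : ℝ) := by rw [← Real.rpow_add hn']; norm_num
      _ ≤ _ := by gcongr
  have t4 : n * (m * Real.exp (-(α * ((d / 32) ^ ℓ * (64 : ℕ))))) ≤
      m * (n : ℝ) ^ (-(1 / 4) : ℝ) := by
    have e1 : Real.exp (-(α * ((d / 32) ^ ℓ * (64 : ℕ)))) ≤ ((n : ℝ) ^ 2)⁻¹ := by
      rw [← exp_neg_log_mul hn0 2]
      refine Real.exp_le_exp.2 (neg_le_neg ?_)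
      push_cast
      nlinarith
    calc n * (m * Real.exp (-(α * ((d / 32) ^ ℓ * (64 : ℕ)))))
        ≤ n * (m * ((n : ℝ) ^ 2)⁻¹) := by gcongr
      _ = m * (n : ℝ)⁻¹ := by field_simp
      _ ≤ _ := by gcongr
  -- The isolated vertices: the only term that need not decay like a power of n. Replacing n - 1 by
  -- n costs a factor e^(ps²) ≤ 3.
  have t5 : n * Real.exp (-(p * s ^ 2 * (n - 1))) ≤ 3 * Real.exp (-(d - Real.log n)) := by
    calc n * Real.exp (-(p * s ^ 2 * (n - 1)))
        = Real.exp (p * s ^ 2 + -(d - Real.log n)) := by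
          nth_rewrite 1 [← Real.exp_log hn']
          rw [← Real.exp_add]; congr 1; rw [← hdq]; ring
      _ ≤ Real.exp (1 + -(d - Real.log n)) := Real.exp_le_exp.2 (by linarith)
      _ = Real.exp 1 * Real.exp (-(d - Real.log n)) := Real.exp_add _ _
      _ ≤ _ := by
          have := Real.exp_one_lt_d9
          gcongr
          linarith
  have t6 := low_pairs_le p s m hn0 hd (by linarith) hx1 hC₀
  have hw : (n : ℝ) ^ 2 * ((n * p) ^ (m * (ℓ + 1)) * α ^ m *
      (m * earWeight m (ℓ + 1) n p ^ (m - 1)) / m.descFactorial m) =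
      wrongTerm n p α m (ℓ + 1) m := rfl
  rw [hw, mul_add (n : ℝ) (m * ℓ * _)]
  linarith

/-- An ear with `a + 1 ≤ L` edges has weight `(np) ^ (a + 1) / n` up to the choice of its ends, and
the longest ears dominate because `np ≥ 1`. -/
lemma earWeight_le {K L n : ℕ} {p : ℝ} (hn : 0 < n) (hx : 1 ≤ n * p) :
    earWeight K L n p ≤ ((K * L + 2 : ℕ) : ℝ) ^ 2 * L * ((n * p) ^ L / n) := by
  have hn' : (0 : ℝ) < n := by exact_mod_cast hn
  unfold earWeight
  calc _ ≤ ∑ _a : Fin L, ((K * L + 2 : ℕ) : ℝ) ^ 2 * ((n * p) ^ L / n) := by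
        refine Finset.sum_le_sum fun a _ => ?_
        rw [mul_assoc]
        refine mul_le_mul_of_nonneg_left ?_ (by positivity)
        rw [le_div_iff₀ hn']
        calc (n : ℝ) ^ (a : ℕ) * p ^ ((a : ℕ) + 1) * n = (n * p) ^ ((a : ℕ) + 1) := by ring
          _ ≤ (n * p) ^ L := pow_le_pow_right₀ hx a.2
    _ = _ := by simp; ring

/-- Regroups the first moment by legs: each leg contributes `(np) ^ L * α` and each of `K - 1` ears
contributes `Q * ((np) ^ L / n)`, where `Q` is a bound for the polynomial factor. -/
lemma wrongTerm_le {n m L K : ℕ} {p α Q : ℝ} (hn : 0 < n) (hx : 1 ≤ n * p) (hα : 0 ≤ α)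
    (hQ : ((K * L + 2 : ℕ) : ℝ) ^ 2 * L ≤ Q) :
    wrongTerm n p α m L K ≤
      (n : ℝ) ^ 2 * (((n * p) ^ L * α) ^ K * (K * (Q * ((n * p) ^ L / n)) ^ (K - 1)) /
        m.descFactorial K) := by
  have hn' : (0 : ℝ) < n := by exact_mod_cast hn
  have hp : 0 ≤ p := by
    by_contra h
    push Not at h
    nlinarith
  have h0 : 0 ≤ earWeight K L n p := by unfold earWeight; positivity
  have h1 : earWeight K L n p ≤ Q * ((n * p) ^ L / n) :=
    (earWeight_le hn hx).trans (by gcongr)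
  unfold wrongTerm
  have h2 : ((n : ℝ) * p) ^ (K * L) * α ^ K = ((n * p) ^ L * α) ^ K := by
    rw [mul_pow _ α, ← pow_mul, mul_comm L K]
  rw [h2]
  gcongr

end Numeric


/-! ### Moderate average degree -/

section Numeric

lemma eventually_log_pow_le (k : ℕ) (A : ℝ) {δ : ℝ} (hδ : 0 < δ) :
    ∀ᶠ n : ℕ in atTop, A * Real.log n ^ k ≤ (n : ℝ) ^ δ := by
  have h := (isLittleO_log_rpow_rpow_atTop (k : ℝ) hδ).comp_tendsto
    (tendsto_natCast_atTop_atTop (R := ℝ))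
  have hb := h.bound (show (0 : ℝ) < (|A| + 1)⁻¹ by positivity)
  filter_upwards [hb] with n hn
  simp only [Function.comp_apply, Real.rpow_natCast, Real.norm_eq_abs] at hn
  rw [abs_of_nonneg (pow_nonneg (Real.log_natCast_nonneg n) k),
    abs_of_nonneg (Real.rpow_nonneg (Nat.cast_nonneg n) δ), ← div_eq_inv_mul,
    le_div_iff₀ (by positivity)] at hn
  refine le_trans ?_ hn
  have : 0 ≤ Real.log n ^ k := pow_nonneg (Real.log_natCast_nonneg n) k
  nlinarith [le_abs_self A]

lemma eventually_le_log_rpow (B : ℝ) {δ : ℝ} (hδ : 0 < δ) :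
    ∀ᶠ n : ℕ in atTop, B ≤ Real.log n ^ δ :=
  ((tendsto_rpow_atTop hδ).comp (Real.tendsto_log_atTop.comp
    (tendsto_natCast_atTop_atTop (R := ℝ)))).eventually_ge_atTop B

lemma eventually_le_log (B : ℝ) : ∀ᶠ n : ℕ in atTop, B ≤ Real.log n :=
  (Real.tendsto_log_atTop.comp (tendsto_natCast_atTop_atTop (R := ℝ))).eventually_ge_atTop B

/-- The radius prescribed for moderate average degrees. -/
lemma radius_bounds {n : ℕ} {d ε : ℝ} (hn : 2 ≤ n) (hd : 1 < d) (hε : 0 < ε) (hε6 : ε ≤ 1 / 6)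
    (hdn : d ≤ (n : ℝ) ^ ε) :
    let L := ⌊(1 / 2 - ε) * (Real.log n / Real.log d)⌋₊
    d ^ L ≤ (n : ℝ) ^ (1 / 2 - ε) ∧ (n : ℝ) ^ (1 / 2 - ε) ≤ d ^ (L + 1) ∧ 1 ≤ L ∧
      (L : ℝ) * Real.log d ≤ Real.log n := by
  intro L
  have hn' : (0 : ℝ) < n := by positivity
  have hy : 0 < Real.log d := Real.log_pos hd
  have hX : 0 ≤ Real.log n := Real.log_natCast_nonneg n
  have hd0 : 0 < d := by linarith
  have h1 : (L : ℝ) ≤ (1 / 2 - ε) * (Real.log n / Real.log d) :=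
    Nat.floor_le (mul_nonneg (by linarith) (by positivity))
  have h2 := Nat.lt_floor_add_one ((1 / 2 - ε) * (Real.log n / Real.log d))
  have h3 : (1 / 2 - ε) * (Real.log n / Real.log d) * Real.log d = Real.log n * (1 / 2 - ε) := by
    field_simp
  have h4 : Real.log d ≤ ε * Real.log n := by
    rw [← Real.log_rpow hn']
    exact Real.log_le_log hd0 hdn
  have key : ∀ k : ℕ, d ^ k = Real.exp (k * Real.log d) := fun k => by
    rw [Real.exp_nat_mul, Real.exp_log hd0]
  refine ⟨?_, ?_, ?_, ?_⟩
  · rw [key, Real.rpow_def_of_pos hn']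
    refine Real.exp_le_exp.2 ?_
    rw [← h3]
    gcongr
  · rw [key, Real.rpow_def_of_pos hn']
    refine Real.exp_le_exp.2 ?_
    rw [← h3]
    push_cast
    exact mul_le_mul_of_nonneg_right h2.le hy.le
  -- As ε ≤ 1/6, the factor 1/2 - ε is at least ε, and log d ≤ ε log n.
  · refine Nat.le_floor ?_
    rw [Nat.cast_one, ← mul_div_assoc, le_div_iff₀ hy]
    nlinarith
  · calc (L : ℝ) * Real.log d ≤ Real.log n * (1 / 2 - ε) := by
          rw [← h3]; gcongr
      _ ≤ _ := by nlinarith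

/-- Here `K = m` and α is bounded by 1. The errors in x^L and in the polynomial factor cost n^(ε/8)
each and are dominated by the gain of order n^(-2ε) per leg and ear. -/
lemma wrongTerm_le_of_moderate {n m L : ℕ} {p α : I} {ε : ℝ} (hε : 0 < ε) (hε6 : ε ≤ 1 / 6)
    (hm : 0 < m) (hmε : 2 / ε ≤ m) (hn : 0 < n) (hlog : 1 ≤ Real.log n) (hx1 : 1 ≤ (n : ℝ) * p)
    (hLX : (L : ℝ) ≤ Real.log n) (hQ : (m + 2) ^ 2 * Real.log n ^ 3 ≤ (n : ℝ) ^ (ε / 8))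
    (hxL : ((n : ℝ) * p) ^ L ≤ (n : ℝ) ^ (1 / 2 - ε + ε / 8)) :
    wrongTerm n p α m L m ≤ m * (n : ℝ) ^ (-(1 / 4) : ℝ) := by
  have hn' : (0 : ℝ) < n := by positivity
  have hn1 : (1 : ℝ) ≤ n := by exact_mod_cast hn
  have hQ' : ((m * L + 2 : ℕ) : ℝ) ^ 2 * (L : ℝ) ≤ (n : ℝ) ^ (ε / 8) := by
    refine le_trans ?_ hQ
    have h1 : ((m * L + 2 : ℕ) : ℝ) ≤ (m + 2) * Real.log n := by
      push_cast
      have : (m : ℝ) * L ≤ m * Real.log n := by gcongr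
      linarith
    calc ((m * L + 2 : ℕ) : ℝ) ^ 2 * (L : ℝ) ≤ ((m + 2) * Real.log n) ^ 2 * Real.log n := by gcongr
      _ = _ := by ring
  refine (wrongTerm_le hn hx1 α.2.1 hQ').trans ?_
  obtain ⟨k, hk⟩ : ∃ k, m = k + 1 := ⟨m - 1, by omega⟩
  have hfac : (1 : ℝ) ≤ m.descFactorial m := by
    exact_mod_cast (Nat.descFactorial_pos.2 le_rfl)
  have hx0 : (0 : ℝ) ≤ ((n : ℝ) * p) ^ L := by positivity
  have e0 : 0 ≤ ((n : ℝ) * p) ^ L * α := mul_nonneg hx0 α.2.1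
  have e1 : ((n : ℝ) * p) ^ L * α ≤ (n : ℝ) ^ (1 / 2 - ε + ε / 8) :=
    (mul_le_of_le_one_right hx0 α.2.2).trans hxL
  have e2 : (n : ℝ) ^ (ε / 8) * (((n : ℝ) * p) ^ L / n) ≤
      (n : ℝ) ^ (-(1 / 2) - ε + 2 * (ε / 8)) := by
    calc (n : ℝ) ^ (ε / 8) * (((n : ℝ) * p) ^ L / n)
        ≤ (n : ℝ) ^ (ε / 8) * ((n : ℝ) ^ (1 / 2 - ε + ε / 8) * (n : ℝ) ^ (-1 : ℝ)) := by
          rw [Real.rpow_neg_one, ← div_eq_mul_inv]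
          gcongr
      _ = _ := by
          rw [← Real.rpow_add hn', ← Real.rpow_add hn']
          congr 1
          ring
  -- With m = k + 1 the exponent is 5/2 - (13/8)·εm + (3/4)·ε, where εm ≥ 2 and ε ≤ 1/6.
  have hexp : 2 + (1 / 2 - ε + ε / 8) * (k + 1) + (-(1 / 2) - ε + 2 * (ε / 8)) * k ≤
      -(1 / 4) := by
    have hkm : (2 : ℝ) ≤ ε * (k + 1) := by
      rw [div_le_iff₀ hε, hk] at hmε
      push_cast at hmε
      linarith
    linarith
  have e3 : 0 ≤ (n : ℝ) ^ (ε / 8) * (((n : ℝ) * p) ^ L / n) := by positivity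
  generalize ((n : ℝ) * p) ^ L * α = y at *
  generalize (n : ℝ) ^ (ε / 8) * (((n : ℝ) * p) ^ L / n) = z at *
  calc _ ≤ (n : ℝ) ^ 2 * (((n : ℝ) ^ (1 / 2 - ε + ε / 8)) ^ m *
        (m * ((n : ℝ) ^ (-(1 / 2) - ε + 2 * (ε / 8))) ^ (m - 1)) / 1) := by
          gcongr
    _ = m * (n : ℝ) ^ (2 + (1 / 2 - ε + ε / 8) * (k + 1) +
          (-(1 / 2) - ε + 2 * (ε / 8)) * k) := by
          rw [div_one, ← Real.rpow_natCast _ (m - 1), ← Real.rpow_natCast _ m,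
            ← Real.rpow_mul hn'.le, ← Real.rpow_mul hn'.le, Real.rpow_add hn',
            Real.rpow_add hn', ← Real.rpow_natCast _ 2]
          simp only [hk, Nat.add_sub_cancel]
          push_cast
          ring
    _ ≤ _ := mul_le_mul_of_nonneg_left (Real.rpow_le_rpow_of_exponent_le hn1 hexp) (by positivity)

/-- Moderate average degrees: the failure probability with the prescribed parameters. -/
lemma failure_le_of_moderate {ε C₀ : ℝ} (hε : 0 < ε) (hε6 : ε ≤ 1 / 6) (hC₀ : 1 ≤ C₀) :
    ∃ C : ℝ, ∀ᶠ n : ℕ in atTop, ∀ p s α : I,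
      (n : ℝ) * p ≤ C₀ * (n * p * s ^ 2) → Real.log n ≤ n * p * s ^ 2 →
      (n : ℝ) * p * s ^ 2 ≤ (n : ℝ) ^ ε → (n : ℝ) ^ (-(1 / 2) + 3 * ε) ≤ α →
      1 - successProbability n p s α ⌈2 / ε⌉₊
          ⌊(1 / 2 - ε) * (Real.log n / Real.log (n * p * s ^ 2))⌋₊ ≤
        C * (n : ℝ) ^ (-(1 / 4) : ℝ) + 3 * Real.exp (-(n * p * s ^ 2 - Real.log n)) := by
  set m := ⌈2 / ε⌉₊ with hm_def
  have hmε : 2 / ε ≤ m := Nat.le_ceil _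
  have hm : 0 < m := Nat.ceil_pos.2 (by positivity)
  -- Bounds every constant that is raised to the power `L`: the 5C₀ of the degree bound and the 32
  -- of the growth rate.
  set B := max (5 * C₀) 32 with hB_def
  refine ⟨m + 5 + (1 + 3 * m + 128 * C₀ ^ 2 * 16 ^ (m * 64) * Real.exp (9 / 2)), ?_⟩
  filter_upwards [eventually_le_log_rpow B (show 0 < 2 * (ε / 8) by positivity),
    eventually_log_pow_le 3 ((m + 2) ^ 2) (show 0 < ε / 8 by positivity),
    eventually_ge_atTop 4, eventually_log_pow_le 1 2 (show 0 < 7 * ε / 8 by positivity),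
    eventually_log_pow_le 1 (24 * m) (show 0 < 7 * ε / 8 by positivity), eventually_le_log 32,
    eventually_log_pow_le 1 128 (show 0 < ε / 2 by positivity),
    eventually_log_pow_le 0 (4 * m) (show 0 < ε / 2 by positivity)]
    with n f1 f2 f3 f4 f5 f6 f7 f8 p s α hpd hld hdn hα
  simp only [pow_one, pow_zero, mul_one] at f4 f5 f7 f8
  have hn' : (0 : ℝ) < n := by positivity
  have hn1 : (1 : ℝ) ≤ n := by exact_mod_cast (by omega : 1 ≤ n)
  have hs1 : (s : ℝ) ^ 2 ≤ 1 := pow_le_one₀ s.2.1 s.2.2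
  have hdx : (n : ℝ) * p * s ^ 2 ≤ n * p :=
    mul_le_of_le_one_right (mul_nonneg hn'.le p.2.1) hs1
  have hd32 : 32 ≤ (n : ℝ) * p * s ^ 2 := f6.trans hld
  obtain ⟨r1, r2, r3, r4⟩ := radius_bounds (by omega) (by linarith) hε hε6 hdn
  have hx1 : 1 ≤ (n : ℝ) * p := by linarith
  generalize hL : ⌊(1 / 2 - ε) * (Real.log n / Real.log (n * p * s ^ 2))⌋₊ = L at *
  obtain ⟨ℓ, rfl⟩ : ∃ ℓ, L = ℓ + 1 := ⟨L - 1, by omega⟩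
  set d := (n : ℝ) * p * s ^ 2 with hd_def
  have hd0 : 0 < d := by linarith
  have hB32 : 32 ≤ B := le_max_right _ _
  -- L may be of order log n / log log n, so constants to the power L are unbounded. But B is at
  -- most d^(ε/4) eventually, because d ≥ log n, and d^L ≤ n^(1/2) then gives n^(ε/8).
  have hBL : B ^ (ℓ + 1) ≤ (n : ℝ) ^ (ε / 8) := by
    have hBd : B ≤ d ^ (2 * (ε / 8)) :=
      f1.trans (Real.rpow_le_rpow (by linarith) hld (by positivity))
    calc B ^ (ℓ + 1) ≤ (d ^ (2 * (ε / 8))) ^ (ℓ + 1) := pow_le_pow_left₀ (by linarith) hBd _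
      _ = (d ^ (ℓ + 1)) ^ (2 * (ε / 8)) := by
          rw [← Real.rpow_natCast, ← Real.rpow_natCast d, ← Real.rpow_mul hd0.le,
            ← Real.rpow_mul hd0.le, mul_comm]
      _ ≤ ((n : ℝ) ^ (1 / 2 - ε)) ^ (2 * (ε / 8)) :=
          Real.rpow_le_rpow (by positivity) r1 (by positivity)
      _ = (n : ℝ) ^ ((1 / 2 - ε) * (2 * (ε / 8))) := by rw [← Real.rpow_mul hn'.le]
      _ ≤ _ := Real.rpow_le_rpow_of_exponent_le hn1 (by nlinarith)
  have h5x : (5 * (n * (p : ℝ))) ^ (ℓ + 1) ≤ (n : ℝ) ^ (1 / 2 - ε + ε / 8) := by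
    calc (5 * (n * (p : ℝ))) ^ (ℓ + 1) ≤ (B * d) ^ (ℓ + 1) := by
          refine pow_le_pow_left₀ (by linarith) ?_ _
          calc 5 * (n * (p : ℝ)) ≤ 5 * C₀ * d := by linarith
            _ ≤ _ := mul_le_mul_of_nonneg_right (le_max_left _ _) hd0.le
      _ = B ^ (ℓ + 1) * d ^ (ℓ + 1) := mul_pow _ _ _
      _ ≤ (n : ℝ) ^ (ε / 8) * (n : ℝ) ^ (1 / 2 - ε) := by gcongr
      _ = _ := by rw [← Real.rpow_add hn']; ring_nf
  have hhalf : (n : ℝ) ^ (1 / 2 : ℝ) ≤ n / 2 := by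
    have h2 : (2 : ℝ) ≤ (n : ℝ) ^ (1 / 2 : ℝ) := by
      rw [← Real.sqrt_eq_rpow]
      refine Real.le_sqrt_of_sq_le ?_
      have : (4 : ℝ) ≤ n := by exact_mod_cast f3
      linarith
    have h3 : (n : ℝ) ^ (1 / 2 : ℝ) * (n : ℝ) ^ (1 / 2 : ℝ) = n := by
      rw [← Real.rpow_add hn']; norm_num
    nlinarith
  have hpow : (5 * (n * (p : ℝ))) ^ (ℓ + 1) ≤ n / 2 :=
    h5x.trans ((Real.rpow_le_rpow_of_exponent_le hn1 (by linarith)).trans hhalf)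
  have hw : wrongTerm n p α m (ℓ + 1) m ≤ m * (n : ℝ) ^ (-(1 / 4) : ℝ) := by
    refine wrongTerm_le_of_moderate hε hε6 hm hmε (by omega) (by linarith) hx1 ?_ f2
      ((pow_le_pow_left₀ (by linarith) (by linarith) _).trans h5x)
    have h1 : 1 ≤ Real.log d := by
      rw [Real.le_log_iff_exp_le hd0]
      have := Real.exp_one_lt_d9
      linarith
    exact (le_mul_of_one_le_right (by positivity) h1).trans r4
  -- The maximality of L gives d^(L+1) ≥ n^(1/2-ε), and L + 1 = ℓ + 2; hence the two additional
  -- factors d on the right.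
  have hgrow : (n : ℝ) ^ (2 * ε - ε / 8) ≤ α * (d / 32) ^ ℓ * d ^ 2 := by
    have h32 : (32 : ℝ) ^ ℓ ≤ (n : ℝ) ^ (ε / 8) :=
      (pow_le_pow_left₀ (by norm_num) hB32 ℓ).trans
        ((pow_le_pow_right₀ (by linarith) (Nat.le_succ ℓ)).trans hBL)
    rw [div_pow]
    calc (n : ℝ) ^ (2 * ε - ε / 8)
        = (n : ℝ) ^ (-(1 / 2) + 3 * ε) * (n : ℝ) ^ (1 / 2 - ε) / (n : ℝ) ^ (ε / 8) := by
          rw [← Real.rpow_add hn', ← Real.rpow_sub hn']; congr 1; ring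
      _ ≤ α * d ^ (ℓ + 1 + 1) / 32 ^ ℓ := by
          gcongr
          · exact mul_nonneg α.2.1 (by positivity)
          · exact α.2.1
      _ = _ := by ring
  have hsmall : (n : ℝ) ^ (-(1 / 2) : ℝ) ≤ (n : ℝ) ^ (-(1 / 4) : ℝ) :=
    Real.rpow_le_rpow_of_exponent_le hn1 (by norm_num)
  have hC0 : 0 ≤ (128 * C₀ ^ 2 * 16 ^ (m * 64) * Real.exp (9 / 2)) * (n : ℝ) ^ (-(1 / 4) : ℝ) := by
    positivity
  have hN0 : 0 ≤ (n : ℝ) ^ (-(1 / 4) : ℝ) := by positivity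
  have hmN0 : 0 ≤ m * (n : ℝ) ^ (-(1 / 4) : ℝ) := by positivity
  have hE0 : 0 ≤ Real.exp (-(d - Real.log n)) := by positivity
  have hαd0 : 0 ≤ (α : ℝ) * (d / 32) ^ ℓ := mul_nonneg α.2.1 (by positivity)
  -- The two surplus factors d of `hgrow` have to be removed. If d ≤ n^(ε/2), both together are at
  -- most n^ε and constant group sizes suffice. Otherwise one of them is supplied by groups of size
  -- about d, and the other is at most n^ε.
  rcases le_or_gt d ((n : ℝ) ^ (ε / 2)) with hcase | hcase
  · have := failure_le_low (ℓ := ℓ) p s α (by omega) hm hld hd32 hpd hpow (by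
      refine f4.trans ?_
      have hd2 : d ^ 2 ≤ (n : ℝ) ^ ε := by
        calc d ^ 2 ≤ ((n : ℝ) ^ (ε / 2)) ^ 2 := pow_le_pow_left₀ hd0.le hcase 2
          _ = _ := by rw [← Real.rpow_natCast, ← Real.rpow_mul hn'.le]; congr 1; push_cast; ring
      have h3 : (n : ℝ) ^ (7 * ε / 8) * (n : ℝ) ^ ε ≤ α * (d / 32) ^ ℓ * (n : ℝ) ^ ε := by
        calc (n : ℝ) ^ (7 * ε / 8) * (n : ℝ) ^ ε = (n : ℝ) ^ (2 * ε - ε / 8) := by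
              rw [← Real.rpow_add hn']; congr 1; ring
          _ ≤ _ := hgrow
          _ ≤ _ := by gcongr
      exact le_of_mul_le_mul_right h3 (by positivity))
    linarith
  · have := failure_le_high (ℓ := ℓ) (K := m) p s α (by omega) hm le_rfl (f7.trans hcase.le) hd32
      hpow (f8.trans hcase.le) (by
      have hm0 : (0 : ℝ) < m := by exact_mod_cast hm
      have h3 : (n : ℝ) ^ (7 * ε / 8) * d ≤ (α * (d / 32) ^ ℓ * d) * d := by
        calc (n : ℝ) ^ (7 * ε / 8) * d ≤ (n : ℝ) ^ (7 * ε / 8) * (n : ℝ) ^ ε := by gcongr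
          _ = (n : ℝ) ^ (2 * ε - ε / 8) := by
              rw [← Real.rpow_add hn']; congr 1; ring
          _ ≤ _ := hgrow
          _ = _ := by ring
      have h4 := le_of_mul_le_mul_right h3 hd0
      rw [← mul_div_assoc, le_div_iff₀ (by positivity)]
      linarith)
    linarith

end Numeric


/-! ### Large average degree, and the limit -/

section Numeric

/-- The radius used for large average degree `d`: the smallest one at which about `n ^ ε` seeds are
expected. -/
noncomputable def freeRadius (n : ℕ) (d α ε : ℝ) : ℕ :=
  sInf {L : ℕ | 1 ≤ L ∧ (n : ℝ) ^ ε ≤ d ^ L * α}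

/-- By minimality, d^(L-1)α ≤ n^ε. With the lower bound for α this gives d^(L-1) ≤ n^(1/2-2ε), and
one more factor d ≤ n^(1/2-ε) keeps the ball well below n. The radius is bounded because d ≥ n^ε. -/
lemma freeRadius_bounds {n : ℕ} {d α ε : ℝ} (hn : 0 < n) (hε : 0 < ε) (hε6 : ε ≤ 1 / 6)
    (hd : (n : ℝ) ^ ε ≤ d) (hdu : d ≤ (n : ℝ) ^ (1 / 2 - ε))
    (hα : (n : ℝ) ^ (-(1 / 2) + 3 * ε) ≤ α) (hα1 : α ≤ 1) :
    let L := freeRadius n d α ε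
    1 ≤ L ∧ L ≤ ⌈1 / ε⌉₊ ∧ (n : ℝ) ^ ε ≤ d ^ L * α ∧ d ^ L ≤ (n : ℝ) ^ (1 - 3 * ε) ∧
      d ^ (2 * L) * α ≤ d * (n : ℝ) ^ (1 - 2 * ε) := by
  intro L
  have hn' : (0 : ℝ) < n := by exact_mod_cast hn
  have hn1 : (1 : ℝ) ≤ n := by exact_mod_cast hn
  have hd0 : 0 < d := lt_of_lt_of_le (by positivity) hd
  have hα0 : 0 < α := lt_of_lt_of_le (by positivity) hα
  have hmem : ⌈1 / ε⌉₊ ∈ {L : ℕ | 1 ≤ L ∧ (n : ℝ) ^ ε ≤ d ^ L * α} := by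
    refine ⟨Nat.ceil_pos.2 (by positivity), ?_⟩
    have h1 : (1 : ℝ) ≤ ε * ⌈1 / ε⌉₊ := by
      have := Nat.le_ceil (1 / ε)
      rw [div_le_iff₀ hε] at this
      linarith
    calc (n : ℝ) ^ ε ≤ (n : ℝ) ^ (ε * ⌈1 / ε⌉₊ + (-(1 / 2) + 3 * ε)) :=
          Real.rpow_le_rpow_of_exponent_le hn1 (by linarith)
      _ = ((n : ℝ) ^ ε) ^ ⌈1 / ε⌉₊ * (n : ℝ) ^ (-(1 / 2) + 3 * ε) := by
          rw [Real.rpow_add hn', Real.rpow_mul hn'.le, Real.rpow_natCast]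
      _ ≤ _ := by gcongr
  obtain ⟨h1, h2⟩ : L ∈ {L : ℕ | 1 ≤ L ∧ (n : ℝ) ^ ε ≤ d ^ L * α} := Nat.sInf_mem ⟨_, hmem⟩
  -- Minimality of L applies only when L - 1 ≥ 1; for L = 1 the bound follows from α ≤ 1.
  have h3 : d ^ (L - 1) * α ≤ (n : ℝ) ^ ε := by
    rcases Nat.lt_or_ge 1 L with h | h
    · by_contra hcon
      exact Nat.notMem_of_lt_sInf (show L - 1 < L by omega) ⟨by omega, (not_le.1 hcon).le⟩
    · rw [show L - 1 = 0 by omega, pow_zero, one_mul]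
      exact hα1.trans (Real.one_le_rpow hn1 hε.le)
  have h4 : d ^ (L - 1) ≤ (n : ℝ) ^ (1 / 2 - 2 * ε) := by
    have h5 : d ^ (L - 1) * (n : ℝ) ^ (-(1 / 2) + 3 * ε) ≤
        (n : ℝ) ^ (1 / 2 - 2 * ε) * (n : ℝ) ^ (-(1 / 2) + 3 * ε) := by
      rw [← Real.rpow_add hn', show 1 / 2 - 2 * ε + (-(1 / 2) + 3 * ε) = ε by ring]
      exact le_trans (by gcongr) h3
    exact le_of_mul_le_mul_right h5 (by positivity)
  have h6 : d ^ L = d ^ (L - 1) * d := by rw [← pow_succ]; congr 1; omega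
  have h7 : d ^ L ≤ (n : ℝ) ^ (1 - 3 * ε) := by
    rw [h6]
    calc d ^ (L - 1) * d ≤ (n : ℝ) ^ (1 / 2 - 2 * ε) * (n : ℝ) ^ (1 / 2 - ε) := by gcongr
      _ = _ := by rw [← Real.rpow_add hn']; congr 1; ring
  refine ⟨h1, Nat.sInf_le hmem, h2, h7, ?_⟩
  calc d ^ (2 * L) * α = d * ((d ^ (L - 1) * α) * d ^ L) := by
        rw [two_mul, pow_add]; nth_rewrite 1 [h6]; ring
    _ ≤ d * ((n : ℝ) ^ ε * (n : ℝ) ^ (1 - 3 * ε)) := by gcongr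
    _ = _ := by rw [← Real.rpow_add hn']; congr 2; ring

/-- The number of paths used for large average degree `d`. -/
noncomputable def freeCount (n : ℕ) (d α ε : ℝ) : ℕ :=
  ⌈(n : ℝ) ^ (ε / 4) * max 1 (d ^ (2 * freeRadius n d α ε) * α / n)⌉₊

/-- The threshold m must exceed the order d^(2L)α/n of the number of seeds common to two unrelated
spheres, yet leave room for m groups among d neighbours and for many seeds per group. All this is
possible with a margin that is a power of n. -/
lemma freeCount_bounds {n : ℕ} {d α ε : ℝ} (hn : 0 < n) (hε : 0 < ε) (hε6 : ε ≤ 1 / 6)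
    (hd : (n : ℝ) ^ ε ≤ d) (hdu : d ≤ (n : ℝ) ^ (1 / 2 - ε))
    (hα : (n : ℝ) ^ (-(1 / 2) + 3 * ε) ≤ α) (hα1 : α ≤ 1) :
    let L := freeRadius n d α ε
    let m := freeCount n d α ε
    (n : ℝ) ^ (ε / 4) ≤ m ∧ (n : ℝ) ^ (ε / 4) * (d ^ (2 * L) * α / n) ≤ m ∧
      m * (n : ℝ) ^ (3 * ε / 4) ≤ 2 * d ∧ m * (n : ℝ) ^ (3 * ε / 4) ≤ 2 * (α * d ^ L) := by
  intro L m
  obtain ⟨-, -, h2, h7, h8⟩ := freeRadius_bounds hn hε hε6 hd hdu hα hα1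
  have hn' : (0 : ℝ) < n := by exact_mod_cast hn
  have hn1 : (1 : ℝ) ≤ n := by exact_mod_cast hn
  have hd0 : 0 < d := lt_of_lt_of_le (by positivity) hd
  have hα0 : 0 < α := lt_of_lt_of_le (by positivity) hα
  change (n : ℝ) ^ ε ≤ d ^ L * α at h2
  change d ^ L ≤ (n : ℝ) ^ (1 - 3 * ε) at h7
  change d ^ (2 * L) * α ≤ d * (n : ℝ) ^ (1 - 2 * ε) at h8
  set y := d ^ (2 * L) * α / n with hy
  set R := (n : ℝ) ^ (ε / 4) * max 1 y with hR
  have hN : 1 ≤ (n : ℝ) ^ (ε / 4) := Real.one_le_rpow hn1 (by positivity)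
  have hR1 : 1 ≤ R := by
    have : 1 ≤ max 1 y := le_max_left _ _
    nlinarith
  have hmR : R ≤ m := Nat.le_ceil _
  have hm2 : (m : ℝ) ≤ 2 * R := by
    have : (m : ℝ) < R + 1 := Nat.ceil_lt_add_one (by linarith)
    linarith
  have hmul : R * (n : ℝ) ^ (3 * ε / 4) = max ((n : ℝ) ^ ε) ((n : ℝ) ^ ε * y) := by
    rw [hR, mul_right_comm, ← Real.rpow_add hn', mul_max_of_nonneg _ _ (by positivity), mul_one]
    ring_nf
  have hy1 : (n : ℝ) ^ ε * y = d ^ (2 * L) * α * (n : ℝ) ^ (ε - 1) := by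
    rw [Real.rpow_sub hn', Real.rpow_one, hy]; ring
  have key : ∀ z, (n : ℝ) ^ ε ≤ z → d ^ (2 * L) * α * (n : ℝ) ^ (ε - 1) ≤ z →
      m * (n : ℝ) ^ (3 * ε / 4) ≤ 2 * z := by
    intro z hz1 hz2
    calc m * (n : ℝ) ^ (3 * ε / 4) ≤ 2 * R * (n : ℝ) ^ (3 * ε / 4) := by gcongr
      _ = 2 * max ((n : ℝ) ^ ε) ((n : ℝ) ^ ε * y) := by rw [mul_assoc, hmul]
      _ ≤ 2 * z := by
          rw [hy1]
          have := max_le hz1 hz2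
          linarith
  refine ⟨?_, ?_, key d hd ?_, key _ (by linarith) ?_⟩
  · refine le_trans ?_ hmR
    exact le_mul_of_one_le_right (by positivity) (le_max_left _ _)
  · refine le_trans ?_ hmR
    exact mul_le_mul_of_nonneg_left (le_max_right _ _) (by positivity)
  · calc d ^ (2 * L) * α * (n : ℝ) ^ (ε - 1) ≤ d * (n : ℝ) ^ (1 - 2 * ε) * (n : ℝ) ^ (ε - 1) := by
          gcongr
      _ = d * (n : ℝ) ^ (-ε) := by rw [mul_assoc, ← Real.rpow_add hn']; congr 2; ring
      _ ≤ d := mul_le_of_le_one_right hd0.le (Real.rpow_le_one_of_one_le_of_nonpos hn1 (by linarith))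
  · calc d ^ (2 * L) * α * (n : ℝ) ^ (ε - 1) = α * d ^ L * (d ^ L * (n : ℝ) ^ (ε - 1)) := by
          rw [two_mul, pow_add]; ring
      _ ≤ α * d ^ L * ((n : ℝ) ^ (1 - 3 * ε) * (n : ℝ) ^ (ε - 1)) := by gcongr
      _ = α * d ^ L * (n : ℝ) ^ (-2 * ε) := by rw [← Real.rpow_add hn']; congr 2; ring
      _ ≤ _ := mul_le_of_le_one_right (by positivity)
          (Real.rpow_le_one_of_one_le_of_nonpos hn1 (by linarith))

/-- As m ≥ 2K, the falling factorial is at least (m/2)^K, so each of the K legs with its ear is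
divided by m/2 and contributes at most 2A·n^(-ε/4). The constant K only has to beat a fixed power of
n. -/
lemma wrongTerm_le_of_count {n m L K : ℕ} {p α : I} {A ε : ℝ} (hn : 0 < n) (hx1 : 1 ≤ (n : ℝ) * p)
    (hL : 1 ≤ L) (hK : 0 < K) (hKε : 16 / ε ≤ K) (hε : 0 < ε) (hm : 2 * K ≤ m)
    (hA : ((K * L + 2 : ℕ) : ℝ) ^ 2 * L * (n : ℝ) ^ (ε / 4) * ((n * p) ^ (2 * L) * α / n) ≤ A * m) :
    wrongTerm n p α m L K ≤ K * (2 * A) ^ K * (n : ℝ) ^ (-(1 / 4) : ℝ) := by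
  have hn' : (0 : ℝ) < n := by exact_mod_cast hn
  have hn1 : (1 : ℝ) ≤ n := by exact_mod_cast hn
  have hm0 : (0 : ℝ) < m := by exact_mod_cast (by omega : 0 < m)
  refine (wrongTerm_le hn hx1 α.2.1 le_rfl).trans ?_
  set Q := ((K * L + 2 : ℕ) : ℝ) ^ 2 * L with hQ
  have hQ1 : 1 ≤ Q := by
    rw [hQ]
    have h1 : (1 : ℝ) ≤ ((K * L + 2 : ℕ) : ℝ) := by exact_mod_cast (by omega)
    have h2 : (1 : ℝ) ≤ L := by exact_mod_cast hL
    nlinarith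
  have hα0 : (0 : ℝ) ≤ α := α.2.1
  have hdesc : ((m : ℝ) / 2) ^ K ≤ m.descFactorial K := by
    calc ((m : ℝ) / 2) ^ K ≤ ((m + 1 - K : ℕ) : ℝ) ^ K := by
          refine pow_le_pow_left₀ (by positivity) ?_ K
          rw [div_le_iff₀ (by norm_num)]
          exact_mod_cast (by omega)
      _ ≤ _ := by exact_mod_cast Nat.pow_sub_le_descFactorial m K
  set w := ((n : ℝ) * p) ^ L with hw
  have hw1 : 1 ≤ w := one_le_pow₀ hx1
  -- Supplying the missing K-th ear costs at most a factor n.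
  have hQw : (Q * (w / n)) ^ (K - 1) ≤ n * (Q * (w / n)) ^ K := by
    obtain ⟨k, rfl⟩ : ∃ k, K = k + 1 := ⟨K - 1, by omega⟩
    rw [Nat.add_sub_cancel, pow_succ]
    have h1 : 1 ≤ n * (Q * (w / n)) := by
      have : n * (Q * (w / n)) = Q * w := by field_simp
      rw [this]; nlinarith
    have h2 : 0 ≤ (Q * (w / n)) ^ k := by positivity
    nlinarith
  have hA' : w * α * (Q * (w / n)) / (m / 2) ≤ 2 * A * (n : ℝ) ^ (-(ε / 4)) := by
    rw [div_le_iff₀ (by positivity), Real.rpow_neg hn'.le, ← div_eq_mul_inv, div_mul_eq_mul_div,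
      le_div_iff₀ (by positivity)]
    calc _ = Q * (n : ℝ) ^ (ε / 4) * ((n * p) ^ (2 * L) * α / n) := by
          rw [hw, two_mul, pow_add]; ring
      _ ≤ A * m := hA
      _ = _ := by ring
  have hw0 : 0 ≤ w * α * (Q * (w / n)) / (m / 2) := by positivity
  have hA0 : 0 ≤ A := by
    have h0 : 0 ≤ A * m := le_trans (by positivity) hA
    exact nonneg_of_mul_nonneg_left h0 hm0
  -- From K ≥ 16/ε: the gain n^(-4) outweighs the n² of the pairs and the n of the missing ear.
  have hexp : ((n : ℝ) ^ (-(ε / 4))) ^ K ≤ ((n : ℝ) ^ 4)⁻¹ := by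
    rw [← Real.rpow_natCast, ← Real.rpow_mul hn'.le, ← Real.rpow_natCast, ← Real.rpow_neg hn'.le]
    refine Real.rpow_le_rpow_of_exponent_le hn1 ?_
    rw [div_le_iff₀ hε] at hKε
    push_cast
    linarith
  calc _ ≤ (n : ℝ) ^ 2 * ((w * α) ^ K * (K * (n * (Q * (w / n)) ^ K)) / (m / 2) ^ K) := by
        gcongr
    _ = (n : ℝ) ^ 3 * K * (w * α * (Q * (w / n)) / (m / 2)) ^ K := by
        rw [div_pow (w * α * (Q * (w / n))), mul_pow (w * α)]; ring
    _ ≤ (n : ℝ) ^ 3 * K * (2 * A * (n : ℝ) ^ (-(ε / 4))) ^ K := by gcongr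
    _ = (n : ℝ) ^ 3 * K * ((2 * A) ^ K * ((n : ℝ) ^ (-(ε / 4))) ^ K) := by rw [mul_pow (2 * A)]
    _ ≤ (n : ℝ) ^ 3 * K * ((2 * A) ^ K * ((n : ℝ) ^ 4)⁻¹) := by gcongr
    _ = K * (2 * A) ^ K * (n : ℝ)⁻¹ := by field_simp
    _ ≤ _ := by
        gcongr
        rw [← Real.rpow_neg_one]
        exact Real.rpow_le_rpow_of_exponent_le hn1 (by norm_num)

/-- Large average degrees: the failure probability with freely chosen parameters. -/
lemma failure_le_of_large {ε C₀ : ℝ} (hε : 0 < ε) (hε6 : ε ≤ 1 / 6) (hC₀ : 1 ≤ C₀) :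
    ∃ C : ℝ, ∀ᶠ n : ℕ in atTop, ∀ p s α : I,
      (n : ℝ) * p ≤ (n : ℝ) ^ (1 / 2 - ε) →
      (n : ℝ) * p ≤ C₀ * (n * p * s ^ 2) → (n : ℝ) ^ ε ≤ n * p * s ^ 2 →
      (n : ℝ) ^ (-(1 / 2) + 3 * ε) ≤ α →
      1 - successProbability n p s α (freeCount n (n * p * s ^ 2) α ε)
          (freeRadius n (n * p * s ^ 2) α ε) ≤ C * (n : ℝ) ^ (-(1 / 4) : ℝ) := by
  -- An upper bound for the radius, so that constants to the power L are harmless here.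
  set M := ⌈1 / ε⌉₊ with hM
  set K := ⌈16 / ε⌉₊ with hK_def
  have hKε : 16 / ε ≤ K := Nat.le_ceil _
  have hK : 0 < K := Nat.ceil_pos.2 (by positivity)
  set A := ((K * M + 2 : ℕ) : ℝ) ^ 2 * M * C₀ ^ (2 * M) with hA
  refine ⟨K * (2 * A) ^ K + 5, ?_⟩
  filter_upwards [eventually_log_pow_le 0 (2 * (5 * C₀) ^ M) (show 0 < 3 * ε by positivity),
    eventually_log_pow_le 1 128 hε, eventually_log_pow_le 0 32 hε,
    eventually_log_pow_le 0 8 (show 0 < 3 * ε / 4 by positivity),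
    eventually_log_pow_le 0 (2 * K) (show 0 < ε / 4 by positivity),
    eventually_log_pow_le 1 (48 * 32 ^ M) (show 0 < 3 * ε / 4 by positivity),
    eventually_ge_atTop 2] with n f1 f2 f3 f4 f5 f6 f7 p s α hpu hpd hdl hα
  simp only [pow_one, pow_zero, mul_one] at f1 f2 f3 f4 f5 f6
  have hn' : (0 : ℝ) < n := by positivity
  have hn1 : (1 : ℝ) ≤ n := by exact_mod_cast (by omega : 1 ≤ n)
  have hs1 : (s : ℝ) ^ 2 ≤ 1 := pow_le_one₀ s.2.1 s.2.2
  have hdx : (n : ℝ) * p * s ^ 2 ≤ n * p :=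
    mul_le_of_le_one_right (mul_nonneg hn'.le p.2.1) hs1
  have hd32 : 32 ≤ (n : ℝ) * p * s ^ 2 := f3.trans hdl
  have hx1 : 1 ≤ (n : ℝ) * p := by linarith
  obtain ⟨r1, r2, r3, r4, r5⟩ := freeRadius_bounds (by omega) hε hε6 hdl (hdx.trans hpu) hα α.2.2
  obtain ⟨c1, c2, c3, c4⟩ := freeCount_bounds (by omega) hε hε6 hdl (hdx.trans hpu) hα α.2.2
  generalize freeRadius n (n * p * s ^ 2) α ε = L at *
  generalize freeCount n (n * p * s ^ 2) α ε = m at *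
  obtain ⟨ℓ, rfl⟩ : ∃ ℓ, L = ℓ + 1 := ⟨L - 1, by omega⟩
  set d := (n : ℝ) * p * s ^ 2 with hd_def
  have hd0 : 0 < d := by linarith
  have hmK : 2 * K ≤ m := by exact_mod_cast f5.trans c1
  have hm0 : (0 : ℝ) < m := by exact_mod_cast (by omega : 0 < m)
  have hα0 : (0 : ℝ) ≤ α := α.2.1
  have hw : wrongTerm n p α m (ℓ + 1) K ≤ K * (2 * A) ^ K * (n : ℝ) ^ (-(1 / 4) : ℝ) := by
    refine wrongTerm_le_of_count (by omega) hx1 (by omega) hK hKε hε hmK ?_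
    have h1 : ((n : ℝ) * p) ^ (2 * (ℓ + 1)) ≤ C₀ ^ (2 * M) * d ^ (2 * (ℓ + 1)) := by
      calc ((n : ℝ) * p) ^ (2 * (ℓ + 1)) ≤ (C₀ * d) ^ (2 * (ℓ + 1)) :=
            pow_le_pow_left₀ (by linarith) hpd _
        _ = C₀ ^ (2 * (ℓ + 1)) * d ^ (2 * (ℓ + 1)) := mul_pow _ _ _
        _ ≤ _ := by gcongr
    have h2 : ((K * (ℓ + 1) + 2 : ℕ) : ℝ) ^ 2 * ((ℓ + 1 : ℕ) : ℝ) ≤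
        ((K * M + 2 : ℕ) : ℝ) ^ 2 * M := by
      gcongr
    calc _ ≤ ((K * M + 2 : ℕ) : ℝ) ^ 2 * M * (n : ℝ) ^ (ε / 4) *
          (C₀ ^ (2 * M) * d ^ (2 * (ℓ + 1)) * α / n) := by gcongr
      _ = A * ((n : ℝ) ^ (ε / 4) * (d ^ (2 * (ℓ + 1)) * α / n)) := by rw [hA]; ring
      _ ≤ A * m := by gcongr
  have hpow : (5 * (n * (p : ℝ))) ^ (ℓ + 1) ≤ n / 2 := by
    have h1 : (5 * (n * (p : ℝ))) ^ (ℓ + 1) ≤ (5 * C₀) ^ M * (n : ℝ) ^ (1 - 3 * ε) := by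
      calc (5 * (n * (p : ℝ))) ^ (ℓ + 1) ≤ (5 * C₀ * d) ^ (ℓ + 1) :=
            pow_le_pow_left₀ (by linarith) (by linarith) _
        _ = (5 * C₀) ^ (ℓ + 1) * d ^ (ℓ + 1) := mul_pow _ _ _
        _ ≤ _ := by
            gcongr
            · linarith
    have h2 : (n : ℝ) ^ (3 * ε) * (n : ℝ) ^ (1 - 3 * ε) = n := by
      rw [← Real.rpow_add hn']; simp
    have h3 : 0 < (n : ℝ) ^ (1 - 3 * ε) := by positivity
    nlinarith
  have h4m : 4 * (m : ℝ) ≤ d := by nlinarith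
  have hlog := f2.trans hdl
  have := failure_le_high (ℓ := ℓ) (K := K) p s α f7 hK (by omega) hlog hd32 hpow h4m (by
    rw [div_pow, ← mul_div_assoc, ← mul_div_assoc, div_mul_eq_mul_div, div_div,
      le_div_iff₀ (by positivity)]
    have h32 : (32 : ℝ) ^ ℓ ≤ 32 ^ M := pow_le_pow_right₀ (by norm_num) (by omega)
    have hX : 0 ≤ Real.log n := Real.log_natCast_nonneg n
    calc 3 * Real.log n * (32 ^ ℓ * (8 * m)) ≤ 3 * Real.log n * (32 ^ M * (8 * m)) := by gcongr
      _ = m * (48 * 32 ^ M * Real.log n) / 2 := by ring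
      _ ≤ m * (n : ℝ) ^ (3 * ε / 4) / 2 := by gcongr
      _ ≤ α * d ^ (ℓ + 1) := by linarith
      _ = _ := by ring)
  have hsmall : (n : ℝ) ^ (-(1 / 2) : ℝ) ≤ (n : ℝ) ^ (-(1 / 4) : ℝ) :=
    Real.rpow_le_rpow_of_exponent_le hn1 (by norm_num)
  linarith

/-- The number of paths required for a match. -/
noncomputable def pathCount (ε : ℝ) (n : ℕ) (p s α : I) : ℕ :=
  if (n : ℝ) * p * s ^ 2 ≤ (n : ℝ) ^ ε then ⌈2 / ε⌉₊ else freeCount n (n * p * s ^ 2) α ε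

/-- The length of the paths. -/
noncomputable def pathLength (ε : ℝ) (n : ℕ) (p s α : I) : ℕ :=
  if (n : ℝ) * p * s ^ 2 ≤ (n : ℝ) ^ ε then
    ⌊(1 / 2 - ε) * (Real.log n / Real.log (n * p * s ^ 2))⌋₊
  else freeRadius n (n * p * s ^ 2) α ε

/-- Both regimes give a failure bound of the form C·n^(-1/4) + 3e^(-(d - log n)) that is uniform in
p, s and α, so the sequence may alternate between them. -/
theorem tendsto_successProbability {ε : ℝ} (hε : 0 < ε) (p s α : ℕ → I)
    (hp : ∀ᶠ n : ℕ in atTop, (n : ℝ) * p n ≤ (n : ℝ) ^ (1 / 2 - ε))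
    (hs : ∃ c : ℝ, 0 < c ∧ ∀ᶠ n : ℕ in atTop, c ≤ (s n : ℝ))
    (hd : Tendsto (fun n : ℕ => (n : ℝ) * p n * (s n : ℝ) ^ 2 - Real.log n) atTop atTop)
    (hα : ∀ᶠ n : ℕ in atTop, (n : ℝ) ^ (-(1 / 2) + 3 * ε) ≤ α n) :
    Tendsto (fun n : ℕ => successProbability n (p n) (s n) (α n) (pathCount ε n (p n) (s n) (α n))
      (pathLength ε n (p n) (s n) (α n))) atTop (𝓝 1) := by
  obtain ⟨c, hc, hs⟩ := hs
  -- The hypotheses force this: α ≤ 1 is incompatible with a positive exponent in its lower bound.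
  have hε6 : ε ≤ 1 / 6 := by
    obtain ⟨n, hn, hn2⟩ := (hα.and (eventually_ge_atTop 2)).exists
    by_contra hcon
    push Not at hcon
    have h1 : 1 < (n : ℝ) ^ (-(1 / 2) + 3 * ε) :=
      Real.one_lt_rpow (by exact_mod_cast hn2) (by linarith)
    linarith [(α n).2.2]
  -- Since s ≥ c eventually, np is at most `C₀` times nps².
  set C₀ := max 1 (c ^ 2)⁻¹ with hC₀
  obtain ⟨C₁, h₁⟩ := failure_le_of_moderate hε hε6 (le_max_left 1 (c ^ 2)⁻¹)
  obtain ⟨C₂, h₂⟩ := failure_le_of_large hε hε6 (le_max_left 1 (c ^ 2)⁻¹)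
  have hbound : ∀ᶠ n : ℕ in atTop, 1 - successProbability n (p n) (s n) (α n)
      (pathCount ε n (p n) (s n) (α n)) (pathLength ε n (p n) (s n) (α n)) ≤
      (|C₁| + |C₂|) * (n : ℝ) ^ (-(1 / 4) : ℝ) +
        3 * Real.exp (-((n : ℝ) * p n * (s n : ℝ) ^ 2 - Real.log n)) := by
    filter_upwards [h₁, h₂, hp, hs, hα, hd.eventually_ge_atTop 0] with n h₁ h₂ hp hs hα hd
    have hpd : (n : ℝ) * p n ≤ C₀ * (n * p n * (s n : ℝ) ^ 2) := by
      have h0 : 0 ≤ (n : ℝ) * p n := mul_nonneg (Nat.cast_nonneg n) (p n).2.1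
      have h1 : 1 ≤ C₀ * (s n : ℝ) ^ 2 := by
        calc (1 : ℝ) = (c ^ 2)⁻¹ * c ^ 2 := by field_simp
          _ ≤ C₀ * (s n : ℝ) ^ 2 := by
              gcongr
              exact le_max_right _ _
      calc (n : ℝ) * p n ≤ n * p n * (C₀ * (s n : ℝ) ^ 2) := le_mul_of_one_le_right h0 h1
        _ = _ := by ring
    have hN : 0 ≤ (n : ℝ) ^ (-(1 / 4) : ℝ) := by positivity
    have e1 := mul_le_mul_of_nonneg_right (le_abs_self C₁) hN
    have e2 := mul_le_mul_of_nonneg_right (le_abs_self C₂) hN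
    have e3 := mul_nonneg (abs_nonneg C₁) hN
    have e4 := mul_nonneg (abs_nonneg C₂) hN
    have e5 := Real.exp_pos (-((n : ℝ) * p n * (s n : ℝ) ^ 2 - Real.log n))
    unfold pathCount pathLength
    split_ifs with h
    · have := h₁ (p n) (s n) (α n) hpd (by linarith) h hα
      linarith
    · have := h₂ (p n) (s n) (α n) hp hpd (not_le.1 h).le hα
      linarith
  have hzero : Tendsto (fun n : ℕ => (|C₁| + |C₂|) * (n : ℝ) ^ (-(1 / 4) : ℝ) +
      3 * Real.exp (-((n : ℝ) * p n * (s n : ℝ) ^ 2 - Real.log n))) atTop (𝓝 0) := by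
    have t1 : Tendsto (fun n : ℕ => (n : ℝ) ^ (-(1 / 4) : ℝ)) atTop (𝓝 0) :=
      (tendsto_rpow_neg_atTop (by norm_num)).comp tendsto_natCast_atTop_atTop
    have t2 := Real.tendsto_exp_neg_atTop_nhds_zero.comp hd
    simpa using (t1.const_mul (|C₁| + |C₂|)).add (t2.const_mul 3)
  have hlow : Tendsto (fun n : ℕ => 1 - ((|C₁| + |C₂|) * (n : ℝ) ^ (-(1 / 4) : ℝ) +
      3 * Real.exp (-((n : ℝ) * p n * (s n : ℝ) ^ 2 - Real.log n)))) atTop (𝓝 1) := by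
    simpa using tendsto_const_nhds.sub hzero
  refine tendsto_of_tendsto_of_tendsto_of_le_of_le' hlow tendsto_const_nhds ?_ ?_
  · filter_upwards [hbound] with n hn
    linarith
  · refine Eventually.of_forall fun n => ?_
    have : IsProbabilityMeasure (law n (p n) (s n) (α n)) := by unfold law; infer_instance
    exact measureReal_le_one

end Numeric


/-! ### A language of bounded loops

Terms with bounded summation and commands with bounded loops, both compiled into programs. The
variable `3` holds the common bound of all loops and is never modified. -/

namespace Store

/-- Overwrite a variable. -/
def set (S : Store) (x v : ℕ) : Store := ⟨Function.update S.var x v, S.arr⟩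

/-- Overwrite an array. -/
def setArr (S : Store) (a : ℕ) (f : ℕ → ℕ) : Store := ⟨S.var, Function.update S.arr a f⟩

@[simp] lemma set_arr (S : Store) (x v : ℕ) : (S.set x v).arr = S.arr := rfl

@[simp] lemma setArr_var (S : Store) (a : ℕ) (f : ℕ → ℕ) : (S.setArr a f).var = S.var := rfl

lemma set_var (S : Store) (x v y : ℕ) : (S.set x v).var y = if y = x then v else S.var y := by
  simp [set, Function.update_apply]

lemma setArr_arr (S : Store) (a : ℕ) (f : ℕ → ℕ) (b : ℕ) :
    (S.setArr a f).arr b = if b = a then f else S.arr b := by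
  simp [setArr, Function.update_apply]

end Store

/-- The functions bounded by a polynomial. -/
def PolyBounded (T : ℕ → ℕ) : Prop := ∃ C d : ℕ, ∀ N, T N ≤ C * (N + 1) ^ d

lemma PolyBounded.const (c : ℕ) : PolyBounded fun _ => c := ⟨c, 0, by simp⟩

lemma PolyBounded.id : PolyBounded fun N => N := ⟨1, 1, by intro N; simp⟩

lemma PolyBounded.add {T U : ℕ → ℕ} (hT : PolyBounded T) (hU : PolyBounded U) :
    PolyBounded fun N => T N + U N := by
  obtain ⟨C, d, h⟩ := hT
  obtain ⟨C', d', h'⟩ := hU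
  refine ⟨C + C', d + d', fun N => ?_⟩
  have e1 : (N + 1) ^ d ≤ (N + 1) ^ (d + d') := Nat.pow_le_pow_right (by omega) (by omega)
  have e2 : (N + 1) ^ d' ≤ (N + 1) ^ (d + d') := Nat.pow_le_pow_right (by omega) (by omega)
  calc T N + U N ≤ C * (N + 1) ^ d + C' * (N + 1) ^ d' := Nat.add_le_add (h N) (h' N)
    _ ≤ C * (N + 1) ^ (d + d') + C' * (N + 1) ^ (d + d') := by gcongr
    _ = _ := by ring

lemma PolyBounded.mul {T U : ℕ → ℕ} (hT : PolyBounded T) (hU : PolyBounded U) :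
    PolyBounded fun N => T N * U N := by
  obtain ⟨C, d, h⟩ := hT
  obtain ⟨C', d', h'⟩ := hU
  refine ⟨C * C', d + d', fun N => ?_⟩
  calc T N * U N ≤ C * (N + 1) ^ d * (C' * (N + 1) ^ d') := Nat.mul_le_mul (h N) (h' N)
    _ = _ := by ring

/-- Terms: expressions extended by a conditional and a bounded sum. -/
inductive Term where
  | num (c : ℕ)
  | var (x : ℕ)
  | get (a : ℕ) (e : Term)
  | add (e f : Term)
  | sub (e f : Term)
  | ite (c e f : Term)
  | sum (x : ℕ) (e : Term)

namespace Term

/-- The value of a term. -/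
def eval : Term → Store → ℕ
  | num c, _ => c
  | var x, S => S.var x
  | get a e, S => S.arr a (e.eval S)
  | add e f, S => e.eval S + f.eval S
  | sub e f, S => e.eval S - f.eval S
  | ite c e f, S => if c.eval S = 0 then f.eval S else e.eval S
  | sum x e, S => ∑ i ∈ Finset.range (S.var 3), e.eval (S.set x i)

/-- All variables of a term are below `100`, all arrays below `30`, and the variable `3` is not
bound. -/
def ok : Term → Bool
  | num _ => true
  | var x => x < 100
  | get a e => a < 30 && e.ok
  | add e f => e.ok && f.ok
  | sub e f => e.ok && f.ok
  | ite c e f => c.ok && e.ok && f.ok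
  | sum x e => x < 100 && x != 3 && e.ok

/-- A program that evaluates a term into the variable `o` and changes no smaller variable. -/
def compile : ℕ → Term → Program
  | o, num c => .assign o (.num c)
  | o, var x => .assign o (.var x)
  | o, get a e => .seq (e.compile o) (.assign o (.get a (.var o)))
  | o, add e f =>
    .seq (e.compile o) (.seq (f.compile (o + 1)) (.assign o (.add (.var o) (.var (o + 1)))))
  | o, sub e f =>
    .seq (e.compile o) (.seq (f.compile (o + 1)) (.assign o (.sub (.var o) (.var (o + 1)))))
  | o, ite c e f => .seq (c.compile o) (.cond (.var o) (e.compile o) (f.compile o))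
  | o, sum x e =>
    .seq (.assign (o + 1) (.var x)) <| .seq (.assign o (.num 0)) <| .seq (.assign x (.num 0)) <|
      .seq (.loop (.sub (.var 3) (.var x)) <|
        .seq (e.compile (o + 2)) <| .seq (.assign o (.add (.var o) (.var (o + 2))))
          (.assign x (.add (.var x) (.num 1))))
        (.assign x (.var (o + 1)))

end Term

/-- Two stores agree on all names that are not reserved for scratch space. -/
def Agree (S S' : Store) : Prop :=
  (∀ x < 100, S.var x = S'.var x) ∧ ∀ a < 30, S.arr a = S'.arr a

lemma Agree.set {S S' : Store} (h : Agree S S') (x v : ℕ) : Agree (S.set x v) (S'.set x v) := by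
  refine ⟨fun y hy => ?_, h.2⟩
  rw [Store.set_var, Store.set_var, h.1 y hy]

/-- A term cannot see the scratch space, so a value already computed survives the evaluation of
further terms. -/
lemma Term.eval_congr {e : Term} (he : e.ok) {S S' : Store} (h : Agree S S') :
    e.eval S = e.eval S' := by
  induction e generalizing S S' with
  | num c => rfl
  | var x => exact h.1 x (by simpa [Term.ok] using he)
  | get a e ih =>
    simp only [Term.ok, Bool.and_eq_true, decide_eq_true_eq] at he
    simp only [Term.eval, ih he.2 h, h.2 a he.1]
  | add e f ihe ihf =>
    simp only [Term.ok, Bool.and_eq_true] at he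
    simp only [Term.eval, ihe he.1 h, ihf he.2 h]
  | sub e f ihe ihf =>
    simp only [Term.ok, Bool.and_eq_true] at he
    simp only [Term.eval, ihe he.1 h, ihf he.2 h]
  | ite c e f ihc ihe ihf =>
    simp only [Term.ok, Bool.and_eq_true] at he
    simp only [Term.eval, ihe he.1.2 h, ihf he.2 h, ihc he.1.1 h]
  | sum x e ih =>
    simp only [Term.ok, Bool.and_eq_true] at he
    simp only [Term.eval, h.1 3 (by norm_num)]
    exact Finset.sum_congr rfl fun i _ => ih he.2 (h.set x i)

/-- Running a loop that counts `x` up to the variable `3`. -/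
lemma runs_loop {x : ℕ} {c : Program} {P : ℕ → Store → Prop} {N T : ℕ}
    (hP : ∀ i S, P i S → S.var x = i ∧ S.var 3 = N)
    (hstep : ∀ i < N, ∀ S, P i S → ∃ t S', Runs c S t S' ∧ P (i + 1) S' ∧ t ≤ T) :
    ∀ k i S, i + k = N → P i S → ∃ t S', Runs (.loop (.sub (.var 3) (.var x)) c) S t S' ∧ P N S' ∧
      t ≤ k * (T + 4) + 4 := by
  intro k
  induction k with
  | zero =>
    intro i S hi h
    obtain ⟨h1, h2⟩ := hP i S h
    obtain rfl : i = N := by omega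
    exact ⟨_, S, Runs.loop_stop (by simp [Expr.eval, h1, h2]), h, by simp [Expr.cost]⟩
  | succ k ih =>
    intro i S hi h
    obtain ⟨h1, h2⟩ := hP i S h
    obtain ⟨t, S', r, h', ht⟩ := hstep i (by omega) S h
    obtain ⟨t', S'', r', h'', ht'⟩ := ih (i + 1) S' (by omega) h'
    refine ⟨_, S'', Runs.loop_step ?_ r r', h'', ?_⟩
    · simp only [Expr.eval, h1, h2]
      omega
    · simp only [Expr.cost]
      rw [Nat.succ_mul]
      omega

/-- The effect of the program compiled from a term. -/
def Evaluates (c : Program) (o : ℕ) (e : Term) (T : ℕ → ℕ) : Prop :=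
  ∀ S, ∃ t S', Runs c S t S' ∧ S'.var o = e.eval S ∧ (∀ y < o, S'.var y = S.var y) ∧
    S'.arr = S.arr ∧ t ≤ T (S.var 3)

lemma agree_of_below {o : ℕ} (ho : 100 ≤ o) {S S' : Store} (h : ∀ y < o, S'.var y = S.var y)
    (ha : S'.arr = S.arr) : Agree S S' :=
  ⟨fun y hy => (h y (by omega)).symm, fun a _ => by rw [ha]⟩

/-- Intermediate results are kept on a stack of scratch variables starting at `o`. The running time
is a polynomial in the loop bound because a bounded sum multiplies the time of its body by that
bound plus a constant. -/
lemma evaluates_compile (e : Term) (he : e.ok) (o : ℕ) (ho : 100 ≤ o) :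
    ∃ T, PolyBounded T ∧ Evaluates (e.compile o) o e T := by
  induction e generalizing o with
  | num c =>
    refine ⟨fun _ => 2, .const 2, fun S => ⟨_, _, Runs.assign S o _, ?_, ?_, rfl, le_rfl⟩⟩
    · simp [Expr.eval, Term.eval]
    · intro y hy
      simp [Function.update_of_ne (by omega : y ≠ o)]
  | var x =>
    refine ⟨fun _ => 2, .const 2, fun S => ⟨_, _, Runs.assign S o _, ?_, ?_, rfl, le_rfl⟩⟩
    · simp [Expr.eval, Term.eval]
    · intro y hy
      simp [Function.update_of_ne (by omega : y ≠ o)]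
  | get a e ih =>
    simp only [Term.ok, Bool.and_eq_true, decide_eq_true_eq] at he
    obtain ⟨T, hT, h⟩ := ih he.2 o ho
    refine ⟨fun N => T N + 3, hT.add (.const 3), fun S => ?_⟩
    obtain ⟨t, S', r, h1, h2, h3, h4⟩ := h S
    refine ⟨_, _, r.seq (Runs.assign S' o _), ?_, ?_, h3, ?_⟩
    · simp [Expr.eval, Term.eval, h1, h3]
    · intro y hy
      simp [Function.update_of_ne (by omega : y ≠ o), h2 y hy]
    · simp only [Expr.cost]; omega
  | add e f ihe ihf =>
    simp only [Term.ok, Bool.and_eq_true] at he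
    obtain ⟨T, hT, h⟩ := ihe he.1 o ho
    obtain ⟨U, hU, h'⟩ := ihf he.2 (o + 1) (by omega)
    refine ⟨fun N => T N + U N + 4, (hT.add hU).add (.const 4), fun S => ?_⟩
    obtain ⟨t, S', r, h1, h2, h3, h4⟩ := h S
    obtain ⟨t', S'', r', h1', h2', h3', h4'⟩ := h' S'
    refine ⟨_, _, r.seq (r'.seq (Runs.assign S'' o _)), ?_, ?_, h3'.trans h3, ?_⟩
    · simp [Expr.eval, Term.eval, h1', h2' o (by omega), h1,
        Term.eval_congr he.2 (agree_of_below ho h2 h3)]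
    · intro y hy
      simp [Function.update_of_ne (by omega : y ≠ o), h2 y hy, h2' y (by omega)]
    · simp only [Expr.cost]
      rw [h2 3 (by omega)] at h4'
      omega
  | sub e f ihe ihf =>
    simp only [Term.ok, Bool.and_eq_true] at he
    obtain ⟨T, hT, h⟩ := ihe he.1 o ho
    obtain ⟨U, hU, h'⟩ := ihf he.2 (o + 1) (by omega)
    refine ⟨fun N => T N + U N + 4, (hT.add hU).add (.const 4), fun S => ?_⟩
    obtain ⟨t, S', r, h1, h2, h3, h4⟩ := h S
    obtain ⟨t', S'', r', h1', h2', h3', h4'⟩ := h' S'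
    refine ⟨_, _, r.seq (r'.seq (Runs.assign S'' o _)), ?_, ?_, h3'.trans h3, ?_⟩
    · simp [Expr.eval, Term.eval, h1', h2' o (by omega), h1,
        Term.eval_congr he.2 (agree_of_below ho h2 h3)]
    · intro y hy
      simp [Function.update_of_ne (by omega : y ≠ o), h2 y hy, h2' y (by omega)]
    · simp only [Expr.cost]
      rw [h2 3 (by omega)] at h4'
      omega
  | ite c e f ihc ihe ihf =>
    simp only [Term.ok, Bool.and_eq_true] at he
    obtain ⟨T, hT, h⟩ := ihc he.1.1 o ho
    obtain ⟨U, hU, hu⟩ := ihe he.1.2 o ho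
    obtain ⟨V, hV, hv⟩ := ihf he.2 o ho
    refine ⟨fun N => T N + (U N + V N) + 2, (hT.add (hU.add hV)).add (.const 2), fun S => ?_⟩
    obtain ⟨t, S', r, h1, h2, h3, h4⟩ := h S
    have hag := agree_of_below ho h2 h3
    by_cases hc : c.eval S = 0
    · obtain ⟨t', S'', r', h1', h2', h3', h4'⟩ := hv S'
      refine ⟨_, _, r.seq (Runs.cond_false (by simp [Expr.eval, h1, hc]) r'), ?_, ?_,
        h3'.trans h3, ?_⟩
      · simp [Term.eval, hc, h1', Term.eval_congr he.2 hag]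
      · intro y hy
        rw [h2' y hy, h2 y hy]
      · simp only [Expr.cost]
        rw [h2 3 (by omega)] at h4'
        omega
    · obtain ⟨t', S'', r', h1', h2', h3', h4'⟩ := hu S'
      refine ⟨_, _, r.seq (Runs.cond_true (by simp [Expr.eval, h1, hc]) r'), ?_, ?_,
        h3'.trans h3, ?_⟩
      · simp [Term.eval, hc, h1', Term.eval_congr he.1.2 hag]
      · intro y hy
        rw [h2' y hy, h2 y hy]
      · simp only [Expr.cost]
        rw [h2 3 (by omega)] at h4'
        omega
  | sum x e ih =>
    simp only [Term.ok, Bool.and_eq_true, decide_eq_true_eq, bne_iff_ne] at he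
    obtain ⟨⟨hx, hx3⟩, he⟩ := he
    obtain ⟨T, hT, h⟩ := ih he (o + 2) (by omega)
    refine ⟨fun N => N * (T N + 8 + 4) + 4 + 8,
      ((PolyBounded.id.mul ((hT.add (.const 8)).add (.const 4))).add (.const 4)).add (.const 8),
      fun S => ?_⟩
    set S₁ : Store := ⟨Function.update S.var (o + 1) (S.var x), S.arr⟩ with hS₁
    set S₂ : Store := ⟨Function.update S₁.var o 0, S.arr⟩ with hS₂
    set S₃ : Store := ⟨Function.update S₂.var x 0, S.arr⟩ with hS₃
    have r₁ : Runs (.assign (o + 1) (.var x)) S 2 S₁ := Runs.assign S (o + 1) (.var x)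
    have r₂ : Runs (.assign o (.num 0)) S₁ 2 S₂ := Runs.assign S₁ o (.num 0)
    have r₃ : Runs (.assign x (.num 0)) S₂ 2 S₃ := Runs.assign S₂ x (.num 0)
    -- Loop invariant: `o` holds the partial sum and `o + 1` the old value of `x`, to be restored at
    -- the end. The body is evaluated in `o + 2` and touches neither.
    let P : ℕ → Store → Prop := fun i R => R.var x = i ∧ R.var (o + 1) = S.var x ∧
      R.arr = S.arr ∧ (∀ y < o, y ≠ x → R.var y = S.var y) ∧
      R.var o = ∑ j ∈ Finset.range i, e.eval (S.set x j)
    have hP3 : ∀ i R, P i R → R.var x = i ∧ R.var 3 = S.var 3 := fun i R hR =>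
      ⟨hR.1, hR.2.2.2.1 3 (by omega) (by omega)⟩
    have hP0 : P 0 S₃ := by
      refine ⟨by simp [S₃], ?_, rfl, ?_, ?_⟩
      · simp [S₃, S₂, S₁, Function.update_of_ne (by omega : o + 1 ≠ x)]
      · intro y hy hyx
        simp [S₃, S₂, S₁, Function.update_of_ne hyx, Function.update_of_ne (by omega : y ≠ o),
          Function.update_of_ne (by omega : y ≠ o + 1)]
      · simp [S₃, S₂, Function.update_of_ne (by omega : o ≠ x)]
    have hstep : ∀ i < S.var 3, ∀ R, P i R → ∃ t R', Runs (.seq (e.compile (o + 2)) <|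
        .seq (.assign o (.add (.var o) (.var (o + 2)))) (.assign x (.add (.var x) (.num 1)))) R t R'
        ∧ P (i + 1) R' ∧ t ≤ T (S.var 3) + 8 := by
      intro i _ R hR
      obtain ⟨t, R', r, h1, h2, h3, h4⟩ := h R
      obtain ⟨p1, p2, p3, p4, p5⟩ := hR
      refine ⟨_, _, r.seq ((Runs.assign R' o _).seq (Runs.assign _ x _)), ⟨?_, ?_, ?_, ?_, ?_⟩, ?_⟩
      · simp [Expr.eval, Function.update_of_ne (by omega : x ≠ o), h2 x (by omega), p1]
      · simp [Function.update_of_ne (by omega : o + 1 ≠ x), h2 (o + 1) (by omega), p2]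
      · simp [h3, p3]
      · intro y hy hyx
        simp [Function.update_of_ne hyx, Function.update_of_ne (by omega : y ≠ o),
          h2 y (by omega), p4 y hy hyx]
      · have hag : Agree R (S.set x i) := by
          refine ⟨fun y hy => ?_, fun a _ => by rw [p3]; rfl⟩
          rw [Store.set_var]
          split_ifs with hyx
          · rw [hyx, p1]
          · exact p4 y (by omega) hyx
        simp [Expr.eval, Function.update_of_ne (by omega : o ≠ x), h1, h2 o (by omega), p5,
          Term.eval_congr he hag, Finset.sum_range_succ]
      · simp only [Expr.cost]
        rw [(hP3 i R ⟨p1, p2, p3, p4, p5⟩).2] at h4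
        omega
    obtain ⟨t, R, r, hR, ht⟩ := runs_loop hP3 hstep (S.var 3) 0 S₃ (by omega) hP0
    refine ⟨_, _, r₁.seq (r₂.seq (r₃.seq (r.seq (Runs.assign R x _)))), ?_, ?_, hR.2.2.1, ?_⟩
    · simp [Function.update_of_ne (by omega : o ≠ x), hR.2.2.2.2, Term.eval]
    · intro y hy
      by_cases hyx : y = x
      · simp [hyx, Expr.eval, hR.2.1]
      · simp [Function.update_of_ne hyx, hR.2.2.2.1 y hy hyx]
    · simp only [Expr.cost]
      omega


/-- Commands. `map a x e` replaces simultaneously the entries `i < N` of the array `a` by the values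
of `e` at `x = i`; `rep x c` executes `c` for `x = 0, …, N - 1`. -/
inductive Cmd where
  | assign (x : ℕ) (e : Term)
  | write (a : ℕ) (e f : Term)
  | map (a x : ℕ) (e : Term)
  | seq (c d : Cmd)
  | rep (x : ℕ) (c : Cmd)

namespace Cmd

/-- The effect of a command. -/
def denote : Cmd → Store → Store
  | assign x e, S => S.set x (e.eval S)
  | write a e f, S => S.setArr a (Function.update (S.arr a) (e.eval S) (f.eval S))
  | map a x e, S =>
    S.setArr a fun i => if i < S.var 3 then e.eval (S.set x i) else S.arr a i
  | seq c d, S => d.denote (c.denote S)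
  | rep x c, S =>
    Store.set (Nat.rec S (fun i R => c.denote (R.set x i)) (S.var 3)) x (S.var 3)

/-- The variables that a command does not assign to. -/
def keeps (y : ℕ) : Cmd → Bool
  | assign x _ => y != x
  | write _ _ _ => true
  | map _ _ _ => true
  | seq c d => c.keeps y && d.keeps y
  | rep x c => y != x && c.keeps y

/-- Names are in range, and loop variables are not assigned to. -/
def ok : Cmd → Bool
  | assign x e => x < 100 && x != 3 && e.ok
  | write a e f => a < 30 && e.ok && f.ok
  | map a x e => a < 30 && x < 100 && x != 3 && e.ok
  | seq c d => c.ok && d.ok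
  | rep x c => x < 100 && x != 3 && c.keeps x && c.ok

/-- The program of a command. -/
def compile : Cmd → Program
  | assign x e => .seq (e.compile 100) (.assign x (.var 100))
  | write a e f => .seq (e.compile 100) (.seq (f.compile 101) (.write a (.var 100) (.var 101)))
  | map a x e =>
    .seq (.assign 100 (.var x)) <| .seq (.assign x (.num 0)) <|
      .seq (.loop (.sub (.var 3) (.var x)) <| .seq (e.compile 101) <|
        .seq (.write 30 (.var x) (.var 101)) (.assign x (.add (.var x) (.num 1)))) <|
      .seq (.assign x (.num 0)) <|
      .seq (.loop (.sub (.var 3) (.var x)) <|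
        .seq (.write a (.var x) (.get 30 (.var x))) (.assign x (.add (.var x) (.num 1))))
      (.assign x (.var 100))
  | seq c d => .seq c.compile d.compile
  | rep x c =>
    .seq (.assign x (.num 0)) <|
      .loop (.sub (.var 3) (.var x)) (.seq c.compile (.assign x (.add (.var x) (.num 1))))

lemma denote_var_of_keeps {y : ℕ} {c : Cmd} (h : c.keeps y) (S : Store) :
    (c.denote S).var y = S.var y := by
  induction c generalizing S with
  | assign x e =>
    simp only [keeps, bne_iff_ne] at h
    simp [denote, Store.set_var, h]
  | write a e f => rfl
  | map a x e => rfl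
  | seq c d ihc ihd =>
    simp only [keeps, Bool.and_eq_true] at h
    simp [denote, ihd h.2, ihc h.1]
  | rep x c ih =>
    simp only [keeps, Bool.and_eq_true, bne_iff_ne] at h
    simp only [denote, Store.set_var, if_neg h.1]
    induction S.var 3 with
    | zero => rfl
    | succ k ihk => simp only [ih h.2, Store.set_var, if_neg h.1, ihk]

/-- The common loop bound is never overwritten, so the time bounds of consecutive commands refer to
the same number. -/
lemma keeps_three {c : Cmd} (h : c.ok) : c.keeps 3 := by
  induction c with
  | assign x e =>
    simp only [ok, Bool.and_eq_true, bne_iff_ne] at h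
    simpa [keeps] using h.1.2.symm
  | write a e f => rfl
  | map a x e => rfl
  | seq c d ihc ihd =>
    simp only [ok, Bool.and_eq_true] at h
    simp [keeps, ihc h.1, ihd h.2]
  | rep x c ih =>
    simp only [ok, Bool.and_eq_true, bne_iff_ne] at h
    simpa [keeps, ih h.2] using h.1.1.2.symm

end Cmd

lemma Agree.trans {S S' S'' : Store} (h : Agree S S') (h' : Agree S' S'') : Agree S S'' :=
  ⟨fun x hx => (h.1 x hx).trans (h'.1 x hx), fun a ha => (h.2 a ha).trans (h'.2 a ha)⟩

lemma runs_assign (S : Store) (x : ℕ) (e : Expr) :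
    Runs (.assign x e) S (e.cost + 1) (S.set x (e.eval S)) := Runs.assign S x e

lemma runs_write (S : Store) (a : ℕ) (e f : Expr) :
    Runs (.write a e f) S (e.cost + f.cost + 1)
      (S.setArr a (Function.update (S.arr a) (e.eval S) (f.eval S))) := Runs.write S a e f

/-- The compiled program has, up to the scratch space, the effect of the command. -/
def Executes (c : Program) (f : Store → Store) (T : ℕ → ℕ) : Prop :=
  ∀ S S', Agree S S' → ∃ t S'', Runs c S' t S'' ∧ Agree (f S) S'' ∧ t ≤ T (S.var 3)

/-- The term may read the array `a` that is being replaced. The new entries are therefore first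
collected in the scratch array `30` and copied afterwards. -/
lemma executes_map {a x : ℕ} {e : Term} (h : (Cmd.map a x e).ok) :
    ∃ T, PolyBounded T ∧ Executes (Cmd.map a x e).compile (Cmd.map a x e).denote T := by
  simp only [Cmd.ok, Bool.and_eq_true, decide_eq_true_eq, bne_iff_ne] at h
  obtain ⟨⟨⟨ha, hx⟩, hx3⟩, he⟩ := h
  obtain ⟨T, hT, ev⟩ := evaluates_compile e he 101 (by norm_num)
  refine ⟨fun N => N * (T N + 7 + 4) + 4 + (N * (8 + 4) + 4) + 8,
    (((PolyBounded.id.mul ((hT.add (.const 7)).add (.const 4))).add (.const 4)).add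
      ((PolyBounded.id.mul (.const 12)).add (.const 4))).add (.const 8), fun S S' hS => ?_⟩
  have h3 : S'.var 3 = S.var 3 := (hS.1 3 (by norm_num)).symm
  have hx100 : 100 ≠ x := by omega
  have ha30 : 30 ≠ a := by omega
  let P : ℕ → Store → Prop := fun i R => R.var x = i ∧ R.var 100 = S'.var x ∧
    (∀ b < 30, R.arr b = S'.arr b) ∧ (∀ y < 100, y ≠ x → R.var y = S'.var y) ∧
    ∀ j < i, R.arr 30 j = e.eval (S.set x j)
  have hP3 : ∀ i R, P i R → R.var x = i ∧ R.var 3 = S.var 3 := fun i R hR =>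
    ⟨hR.1, (hR.2.2.2.1 3 (by omega) (by omega)).trans h3⟩
  have hP0 : P 0 ((S'.set 100 (S'.var x)).set x 0) := by
    refine ⟨by simp [Store.set_var], ?_, fun b _ => rfl, ?_, by simp⟩
    · simp [Store.set_var, hx100]
    · intro y hy hyx
      have hy100 : y ≠ 100 := by omega
      simp [Store.set_var, hyx, hy100]
  have hstep : ∀ i < S.var 3, ∀ R, P i R → ∃ t R', Runs (.seq (e.compile 101) <|
      .seq (.write 30 (.var x) (.var 101)) (.assign x (.add (.var x) (.num 1)))) R t R'
      ∧ P (i + 1) R' ∧ t ≤ T (S.var 3) + 7 := by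
    intro i _ R hR
    obtain ⟨t, R', r, h1, h2, h3', h4⟩ := ev R
    have hR3 := (hP3 i R hR).2
    obtain ⟨p1, p2, p3, p4, p5⟩ := hR
    refine ⟨_, _, r.seq ((runs_write R' 30 _ _).seq (runs_assign _ x _)),
      ⟨?_, ?_, ?_, ?_, ?_⟩, ?_⟩
    · simp [Expr.eval, Store.set_var, h2 x (by omega), p1]
    · simp [Store.set_var, hx100, h2 100 (by omega), p2]
    · intro b hb
      have hb30 : b ≠ 30 := by omega
      simp [Store.setArr_arr, hb30, h3', p3 b hb]
    · intro y hy hyx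
      simp [Store.set_var, hyx, h2 y (by omega), p4 y hy hyx]
    · intro j hj
      have hag : Agree R (S.set x i) := by
        refine ⟨fun y hy => ?_, fun b hb => ?_⟩
        · rw [Store.set_var]
          split_ifs with hyx
          · rw [hyx, p1]
          · exact (p4 y hy hyx).trans (hS.1 y hy).symm
        · rw [p3 b hb]
          exact (hS.2 b hb).symm
      simp only [Store.set_arr, Store.setArr_arr, if_pos, Expr.eval, h1, h2 x (by omega), p1, h3',
        Term.eval_congr he hag]
      rcases Nat.lt_succ_iff_lt_or_eq.1 hj with hji | rfl
      · rw [Function.update_of_ne (by omega), p5 j hji]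
      · rw [Function.update_self]
    · simp only [Expr.cost]
      rw [hR3] at h4
      omega
  obtain ⟨t, R, r, hR, ht⟩ := runs_loop hP3 hstep (S.var 3) 0 _ (by omega) hP0
  obtain ⟨-, q2, q3, q4, q5⟩ := hR
  -- Invariant of the copying loop: the buffer is unchanged, and the entries of `a` below the
  -- counter are the new ones.
  let P' : ℕ → Store → Prop := fun i R' => R'.var x = i ∧ R'.var 100 = S'.var x ∧
    (∀ b < 30, b ≠ a → R'.arr b = S'.arr b) ∧ (∀ y < 100, y ≠ x → R'.var y = S'.var y) ∧
    R'.arr 30 = R.arr 30 ∧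
    ∀ j, R'.arr a j = if j < i then e.eval (S.set x j) else S.arr a j
  have hP3' : ∀ i R, P' i R → R.var x = i ∧ R.var 3 = S.var 3 := fun i R hR =>
    ⟨hR.1, (hR.2.2.2.1 3 (by omega) (by omega)).trans h3⟩
  have hP0' : P' 0 (R.set x 0) := by
    refine ⟨by simp [Store.set_var], ?_, fun b hb _ => q3 b hb, ?_, rfl, ?_⟩
    · simp [Store.set_var, hx100, q2]
    · intro y hy hyx
      simp [Store.set_var, hyx, q4 y hy hyx]
    · intro j
      simp [q3 a ha, (hS.2 a ha)]
  have hstep' : ∀ i < S.var 3, ∀ R, P' i R → ∃ t R', Runs (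
      .seq (.write a (.var x) (.get 30 (.var x))) (.assign x (.add (.var x) (.num 1)))) R t R'
      ∧ P' (i + 1) R' ∧ t ≤ 8 := by
    intro i hi R' hR'
    obtain ⟨p1, p2, p3, p4, p5, p6⟩ := hR'
    refine ⟨_, _, (runs_write R' a _ _).seq (runs_assign _ x _), ⟨?_, ?_, ?_, ?_, ?_, ?_⟩, ?_⟩
    · simp [Expr.eval, Store.set_var, p1]
    · simp [Store.set_var, hx100, p2]
    · intro b hb hba
      simp [Store.setArr_arr, hba, p3 b hb hba]
    · intro y hy hyx
      simp [Store.set_var, hyx, p4 y hy hyx]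
    · simp [Store.setArr_arr, ha30, p5]
    · intro j
      simp only [Store.set_arr, Store.setArr_arr, if_pos, Expr.eval, p1, p5, q5 i hi]
      by_cases hji : j = i
      · subst hji
        simp
      · rw [Function.update_of_ne hji, p6]
        simp [(by omega : j < i + 1 ↔ j < i)]
    · simp [Expr.cost]
  obtain ⟨t', R', r', hR', ht'⟩ := runs_loop hP3' hstep' (S.var 3) 0 _ (by omega) hP0'
  obtain ⟨-, w2, w3, w4, -, w6⟩ := hR'
  refine ⟨_, _, (runs_assign S' 100 (.var x)).seq <| (runs_assign _ x (.num 0)).seq <| r.seq <|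
    (runs_assign R x (.num 0)).seq <| r'.seq (runs_assign R' x (.var 100)), ⟨?_, ?_⟩, ?_⟩
  · intro y hy
    simp only [Cmd.denote, Store.setArr_var, Store.set_var, Expr.eval]
    split_ifs with hyx
    · rw [w2, hyx, hS.1 x hx]
    · rw [w4 y hy hyx, hS.1 y hy]
  · intro b hb
    simp only [Cmd.denote, Store.set_arr, Store.setArr_arr]
    split_ifs with hba
    · subst hba
      funext j
      rw [w6]
    · rw [w3 b hb hba, hS.2 b hb]
  · simp only [Expr.cost]
    omega

lemma executes_compile (c : Cmd) (h : c.ok) :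
    ∃ T, PolyBounded T ∧ Executes c.compile c.denote T := by
  induction c with
  | assign x e =>
    simp only [Cmd.ok, Bool.and_eq_true, decide_eq_true_eq, bne_iff_ne] at h
    obtain ⟨T, hT, ev⟩ := evaluates_compile e h.2 100 le_rfl
    refine ⟨fun N => T N + 2, hT.add (.const 2), fun S S' hS => ?_⟩
    obtain ⟨t, R, r, h1, h2, h3, h4⟩ := ev S'
    refine ⟨_, _, r.seq (runs_assign R x _), ?_, ?_⟩
    · have := (hS.trans (agree_of_below le_rfl h2 h3)).set x (e.eval S)
      simpa [Cmd.denote, Expr.eval, h1, ← Term.eval_congr h.2 hS] using this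
    · simp only [Expr.cost]
      rw [← hS.1 3 (by norm_num)] at h4
      omega
  | write a e f =>
    simp only [Cmd.ok, Bool.and_eq_true, decide_eq_true_eq] at h
    obtain ⟨T, hT, ev⟩ := evaluates_compile e h.1.2 100 le_rfl
    obtain ⟨U, hU, ev'⟩ := evaluates_compile f h.2 101 (by norm_num)
    refine ⟨fun N => T N + U N + 3, (hT.add hU).add (.const 3), fun S S' hS => ?_⟩
    obtain ⟨t, R, r, h1, h2, h3, h4⟩ := ev S'
    obtain ⟨t', R', r', h1', h2', h3', h4'⟩ := ev' R
    have hR := hS.trans (agree_of_below le_rfl h2 h3)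
    have hR' := hR.trans (agree_of_below (by norm_num) h2' h3')
    refine ⟨_, _, r.seq (r'.seq (runs_write R' a _ _)), ?_, ?_⟩
    · refine ⟨fun y hy => hR'.1 y hy, fun b hb => ?_⟩
      simp only [Cmd.denote, Store.setArr_arr, Expr.eval, h1', h2' 100 (by norm_num), h1]
      rw [← Term.eval_congr h.1.2 hS, ← Term.eval_congr h.2 hR, hR'.2 b hb, hR'.2 a h.1.1]
    · simp only [Expr.cost]
      rw [← hS.1 3 (by norm_num)] at h4
      rw [← hR.1 3 (by norm_num)] at h4'
      omega
  | map a x e => exact executes_map h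
  | seq c d ihc ihd =>
    simp only [Cmd.ok, Bool.and_eq_true] at h
    obtain ⟨T, hT, ec⟩ := ihc h.1
    obtain ⟨U, hU, ed⟩ := ihd h.2
    refine ⟨fun N => T N + U N, hT.add hU, fun S S' hS => ?_⟩
    obtain ⟨t, R, r, h1, h2⟩ := ec S S' hS
    obtain ⟨t', R', r', h1', h2'⟩ := ed _ R h1
    refine ⟨_, R', r.seq r', h1', ?_⟩
    rw [Cmd.denote_var_of_keeps (Cmd.keeps_three h.1)] at h2'
    exact Nat.add_le_add h2 h2'
  | rep x c ih =>
    simp only [Cmd.ok, Bool.and_eq_true, decide_eq_true_eq, bne_iff_ne] at h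
    obtain ⟨⟨⟨hx, hx3⟩, hk⟩, hc⟩ := h
    obtain ⟨T, hT, ec⟩ := ih hc
    refine ⟨fun N => N * (T N + 4 + 4) + 4 + 2,
      ((PolyBounded.id.mul ((hT.add (.const 4)).add (.const 4))).add (.const 4)).add (.const 2),
      fun S S' hS => ?_⟩
    let F : ℕ → Store := fun k => Nat.rec S (fun i R => c.denote (R.set x i)) k
    have hF : ∀ k, (F k).var 3 = S.var 3 := by
      intro k
      induction k with
      | zero => rfl
      | succ k ihk =>
        change (c.denote ((F k).set x k)).var 3 = _
        rw [Cmd.denote_var_of_keeps (Cmd.keeps_three hc), Store.set_var, if_neg (by omega), ihk]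
    let P : ℕ → Store → Prop := fun i R => Agree ((F i).set x i) R
    have hP3 : ∀ i R, P i R → R.var x = i ∧ R.var 3 = S.var 3 := fun i R hR =>
      ⟨by rw [← hR.1 x hx]; simp [Store.set_var],
        by rw [← hR.1 3 (by norm_num), Store.set_var, if_neg (by omega), hF]⟩
    have hP0 : P 0 (S'.set x 0) := hS.set x 0
    have hstep : ∀ i < S.var 3, ∀ R, P i R → ∃ t R',
        Runs (.seq c.compile (.assign x (.add (.var x) (.num 1)))) R t R' ∧ P (i + 1) R' ∧
          t ≤ T (S.var 3) + 4 := by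
      intro i _ R hR
      obtain ⟨t, R', r, h1, h2⟩ := ec _ R hR
      rw [Store.set_var, if_neg (by omega), hF] at h2
      refine ⟨_, _, r.seq (runs_assign R' x _), ?_, ?_⟩
      -- The body does not assign to the loop variable, so the increment yields the next counter
      -- value.
      · have hv : R'.var x = i := by
          rw [← h1.1 x hx, Cmd.denote_var_of_keeps hk]
          simp [Store.set_var]
        simp only [Expr.eval, hv]
        exact h1.set x (i + 1)
      · simp only [Expr.cost]
        omega
    obtain ⟨t, R, r, hR, ht⟩ := runs_loop hP3 hstep (S.var 3) 0 _ (by omega) hP0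
    exact ⟨_, R, (runs_assign S' x (.num 0)).seq r, hR, by simp only [Expr.cost]; omega⟩


/-! ### Perfect matchings by auction

The persons and the objects are the numbers below `N`. An object `b` with `o b = a + 1` is owned by
the person `a`, and `p b` is its price. A person without an object bids for an allowed object of
least price; the bid raises the price by one. -/

section Auction

variable {N : ℕ} {A : ℕ → ℕ → Prop}

/-- One successful bid. -/
def Bid (N : ℕ) (A : ℕ → ℕ → Prop) (o p o' p' : ℕ → ℕ) : Prop :=
  ∃ a < N, ∃ b < N, (∀ c < N, o c ≠ a + 1) ∧ A a b ∧ p b < N ∧ (∀ c < N, A a c → p b ≤ p c) ∧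
    (∀ c < N, o' c = if c = b then a + 1 else o c) ∧
    ∀ c < N, p' c = if c = b then p b + 1 else p c

/-- Every person owns an object. -/
def AllAssigned (N : ℕ) (o : ℕ → ℕ) : Prop := ∀ a < N, ∃ b < N, o b = a + 1

/-- Some person without an object finds all allowed objects too expensive. -/
def PricedOut (N : ℕ) (A : ℕ → ℕ → Prop) (o p : ℕ → ℕ) : Prop :=
  ∃ a < N, (∀ c < N, o c ≠ a + 1) ∧ ∀ c < N, A a c → N ≤ p c

/-- The invariant of the auction. -/
structure AuctionInv (N : ℕ) (A : ℕ → ℕ → Prop) (o p : ℕ → ℕ) : Prop where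
  owned : ∀ b < N, 1 ≤ p b → o b ≠ 0
  owner : ∀ b < N, o b ≠ 0 → ∃ a < N, o b = a + 1 ∧ A a b ∧ ∀ c < N, A a c → p b ≤ p c + 1
  inj : ∀ b < N, ∀ c < N, o b ≠ 0 → o b = o c → b = c
  le : ∀ b < N, p b ≤ N

/-- Prices only rise, so the inequalities of the old owners persist. The bidder took a cheapest
allowed object, so after the increase it is at most one more expensive than the others. -/
lemma AuctionInv.bid {o p o' p' : ℕ → ℕ} (h : AuctionInv N A o p) (hb : Bid N A o p o' p') :
    AuctionInv N A o' p' := by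
  obtain ⟨a, ha, b, hbN, hfree, hA, hpN, hmin, ho, hp⟩ := hb
  have hmono : ∀ c < N, p c ≤ p' c := fun c hc => by
    rw [hp c hc]
    split_ifs with hcb
    · rw [hcb]; omega
    · exact le_rfl
  refine ⟨fun c hc h1 => ?_, fun c hc h1 => ?_, fun c hc c' hc' h1 h2 => ?_, fun c hc => ?_⟩
  · rw [ho c hc]
    split_ifs with hcb
    · omega
    · rw [hp c hc, if_neg hcb] at h1
      exact h.owned c hc h1
  · rw [ho c hc] at h1 ⊢
    rw [hp c hc]
    split_ifs with hcb
    · subst hcb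
      refine ⟨a, ha, rfl, hA, fun c' hc' hac' => ?_⟩
      have := hmin c' hc' hac'
      have := hmono c' hc'
      omega
    · rw [if_neg hcb] at h1
      obtain ⟨a', ha', e1, e2, e3⟩ := h.owner c hc h1
      exact ⟨a', ha', e1, e2, fun c' hc' hac' => (e3 c' hc' hac').trans
        (Nat.succ_le_succ (hmono c' hc'))⟩
  · rw [ho c hc] at h1 h2
    rw [ho c' hc'] at h2
    split_ifs at h1 h2 with e1 e2
    · rw [e1, e2]
    · exact absurd h2.symm (hfree c' hc')
    · exact absurd h2 (hfree c hc)
    · exact h.inj c hc c' hc' h1 h2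
  · rw [hp c hc]
    split_ifs with hcb
    · omega
    · exact h.le c hc

lemma AuctionInv.congr {o p o' p' : ℕ → ℕ} (h : AuctionInv N A o p) (ho : ∀ c < N, o' c = o c)
    (hp : ∀ c < N, p' c = p c) : AuctionInv N A o' p' := by
  refine ⟨fun c hc => ?_, fun c hc => ?_, fun c hc c' hc' => ?_, fun c hc => ?_⟩
  · rw [ho c hc, hp c hc]; exact h.owned c hc
  · rw [ho c hc, hp c hc]
    intro h1
    obtain ⟨a', ha', e1, e2, e3⟩ := h.owner c hc h1
    exact ⟨a', ha', e1, e2, fun c' hc' hac' => by rw [hp c' hc']; exact e3 c' hc' hac'⟩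
  · rw [ho c hc, ho c' hc']; exact h.inj c hc c' hc'
  · rw [hp c hc]; exact h.le c hc

/-- There is a permutation all of whose moves are allowed. -/
def HasPerm (N : ℕ) (A : ℕ → ℕ → Prop) : Prop := ∃ π : Equiv.Perm (Fin N), ∀ a : Fin N, A a (π a)

lemma AuctionInv.hasPerm {o p : ℕ → ℕ} (h : AuctionInv N A o p) (ho : AllAssigned N o) :
    HasPerm N A := by
  choose f hf1 hf2 using fun a : Fin N => ho a a.2
  have hinj : Function.Injective fun a => (⟨f a, hf1 a⟩ : Fin N) := by
    intro a a' haa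
    have h1 := hf2 a
    rw [show f a = f a' from congrArg Fin.val haa, hf2 a'] at h1
    exact Fin.ext (by omega)
  refine ⟨Equiv.ofBijective _ (Finite.injective_iff_bijective.1 hinj), fun a => ?_⟩
  obtain ⟨a', -, e1, e2, -⟩ := h.owner (f a) (hf1 a) (by rw [hf2 a]; omega)
  rw [hf2 a] at e1
  obtain rfl : (a : ℕ) = a' := by omega
  exact e2

/-- If a person is priced out, an unused price level yields a violation of Hall's condition. -/
lemma AuctionInv.not_hasPerm {o p : ℕ → ℕ} (h : AuctionInv N A o p) (hout : PricedOut N A o p) :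
    ¬ HasPerm N A := by
  rintro ⟨π, hπ⟩
  obtain ⟨a, ha, hfree, hexp⟩ := hout
  have hinj : ∀ b < N, ∀ c < N, 1 ≤ p b → 1 ≤ p c → o b - 1 = o c - 1 → b = c := by
    intro b hb c hc h1 h2 hbc
    have h3 := h.owned b hb h1
    have h4 := h.owned c hc h2
    exact h.inj b hb c hc h3 (by omega)
  have hown : ∀ b < N, 1 ≤ p b → o b - 1 < N ∧ o b - 1 ≠ a ∧
      ∀ c < N, A (o b - 1) c → p b ≤ p c + 1 := by
    intro b hb h1
    obtain ⟨a', ha', e1, -, e3⟩ := h.owner b hb (h.owned b hb h1)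
    have e4 : o b - 1 = a' := by omega
    rw [e4]
    refine ⟨ha', ?_, e3⟩
    rintro rfl
    exact hfree b hb e1
  -- Objects with positive price have distinct owners, none of which is `a`, so there are fewer than
  -- `N` of them.
  set B := (Finset.range N).filter fun b => 1 ≤ p b with hB
  have hBcard : B.card < N := by
    have h1 : B.card ≤ ((Finset.range N).erase a).card := by
      refine Finset.card_le_card_of_injOn (fun b => o b - 1) (fun b hb => ?_) ?_
      · obtain ⟨hb1, hb2⟩ := Finset.mem_filter.1 hb
        obtain ⟨e1, e2, -⟩ := hown b (Finset.mem_range.1 hb1) hb2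
        exact Finset.mem_coe.2 (Finset.mem_erase.2 ⟨e2, Finset.mem_range.2 e1⟩)
      · intro b hb c hc hbc
        obtain ⟨hb1, hb2⟩ := Finset.mem_filter.1 hb
        obtain ⟨hc1, hc2⟩ := Finset.mem_filter.1 hc
        exact hinj b (Finset.mem_range.1 hb1) c (Finset.mem_range.1 hc1) hb2 hc2 hbc
    rw [Finset.card_erase_of_mem (Finset.mem_range.2 ha), Finset.card_range] at h1
    omega
  -- Pigeonhole: fewer than `N` objects have a positive price, so one of the `N` levels from 1 to
  -- `N` is not taken.
  obtain ⟨j, hj, hjp⟩ : ∃ j ∈ Finset.Icc 1 N, j ∉ B.image p :=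
    Finset.exists_mem_notMem_of_card_lt_card
      (lt_of_le_of_lt Finset.card_image_le (by simpa using hBcard))
  obtain ⟨hj1, hjN⟩ := Finset.mem_Icc.1 hj
  have hgap : ∀ b < N, j ≤ p b → j < p b := by
    intro b hb hle
    refine lt_of_le_of_ne hle fun hjb => hjp ?_
    exact Finset.mem_image.2 ⟨b, Finset.mem_filter.2 ⟨Finset.mem_range.2 hb, by omega⟩, hjb.symm⟩
  set T := (Finset.range N).filter fun b => j < p b with hT
  have hTm : ∀ b, b ∈ T ↔ b < N ∧ j < p b := fun b => by simp [hT]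
  -- The owners of the objects above the gap, together with `a`: one person more than there are such
  -- objects.
  set U := insert a (T.image fun b => o b - 1) with hU
  have hUcard : U.card = T.card + 1 := by
    rw [hU, Finset.card_insert_of_notMem, Finset.card_image_of_injOn]
    · intro b hb c hc hbc
      obtain ⟨hb1, hb2⟩ := (hTm b).1 hb
      obtain ⟨hc1, hc2⟩ := (hTm c).1 hc
      exact hinj b hb1 c hc1 (by omega) (by omega) hbc
    · rw [Finset.mem_image]
      rintro ⟨b, hb, hba⟩
      obtain ⟨hb1, hb2⟩ := (hTm b).1 hb
      exact (hown b hb1 (by omega)).2.1 hba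
  -- Objects allowed to an owner are at most one level below a price above `j`, hence at level at
  -- least `j`; those allowed to `a` have level at least `N`. As the level `j` is empty, all of them
  -- lie in `T`.
  have hUT : ∀ u ∈ U, ∃ hu : u < N, (π ⟨u, hu⟩ : ℕ) ∈ T := by
    intro u hu
    rcases Finset.mem_insert.1 hu with rfl | hu
    · refine ⟨ha, (hTm _).2 ⟨(π ⟨u, ha⟩).2, hgap _ (π ⟨u, ha⟩).2 ?_⟩⟩
      exact hjN.trans (hexp _ (π ⟨u, ha⟩).2 (hπ ⟨u, ha⟩))
    · obtain ⟨b, hb, rfl⟩ := Finset.mem_image.1 hu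
      obtain ⟨hb1, hb2⟩ := (hTm b).1 hb
      obtain ⟨e1, -, e3⟩ := hown b hb1 (by omega)
      refine ⟨e1, (hTm _).2 ⟨(π ⟨_, e1⟩).2, hgap _ (π ⟨_, e1⟩).2 ?_⟩⟩
      have := e3 _ (π ⟨_, e1⟩).2 (hπ ⟨_, e1⟩)
      omega
  have hle : U.card ≤ T.card := by
    refine Finset.card_le_card_of_injOn
      (fun u => if hu : u < N then (π ⟨u, hu⟩ : ℕ) else 0) (fun u hu => ?_) ?_
    · obtain ⟨h1, h2⟩ := hUT u hu
      simpa [h1] using h2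
    · intro u hu v hv huv
      obtain ⟨h1, -⟩ := hUT u hu
      obtain ⟨h2, -⟩ := hUT v hv
      simp only [h1, h2, dif_pos] at huv
      simpa using π.injective (Fin.ext huv)
  omega

/-- The state of an auction after `t` rounds. -/
structure AuctionState (N : ℕ) (A : ℕ → ℕ → Prop) (t : ℕ) (o p : ℕ → ℕ) : Prop where
  inv : AuctionInv N A o p
  progress : HasPerm N A → AllAssigned N o ∨ ∑ c ∈ Finset.range N, p c = t

lemma auctionState_zero {o p : ℕ → ℕ} (ho : ∀ c < N, o c = 0) (hp : ∀ c < N, p c = 0) :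
    AuctionState N A 0 o p :=
  ⟨⟨fun b hb h => by rw [hp b hb] at h; omega, fun b hb h => absurd (ho b hb) h,
    fun b hb _ _ h => absurd (ho b hb) h, fun b hb => by rw [hp b hb]; omega⟩,
    fun _ => Or.inr (Finset.sum_eq_zero fun c hc => hp c (Finset.mem_range.1 hc))⟩

lemma AuctionState.bid {t : ℕ} {o p o' p' : ℕ → ℕ} (h : AuctionState N A t o p)
    (hb : Bid N A o p o' p') : AuctionState N A (t + 1) o' p' := by
  refine ⟨h.inv.bid hb, fun hperm => Or.inr ?_⟩
  obtain ⟨a, ha, b, hbN, hfree, -, -, -, -, h1⟩ := hb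
  rcases h.progress hperm with h2 | h2
  · obtain ⟨c, hc, hac⟩ := h2 a ha
    exact absurd hac (hfree c hc)
  · have h3 : ∀ c ∈ Finset.range N, p' c = p c + if c = b then 1 else 0 := by
      intro c hc
      rw [h1 c (Finset.mem_range.1 hc)]
      split_ifs with hcb
      · rw [hcb]
      · rfl
    rw [Finset.sum_congr rfl h3, Finset.sum_add_distrib, h2, Finset.sum_ite_eq',
      if_pos (Finset.mem_range.2 hbN)]

/-- Once no bid is possible, either everyone is served or there is no permutation. In both cases the
counter may run on. -/
lemma AuctionState.stay {t : ℕ} {o p o' p' : ℕ → ℕ} (h : AuctionState N A t o p)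
    (hs : AllAssigned N o ∨ PricedOut N A o p) (ho : ∀ c < N, o' c = o c)
    (hp : ∀ c < N, p' c = p c) : AuctionState N A (t + 1) o' p' := by
  refine ⟨h.inv.congr ho hp, fun hperm => Or.inl ?_⟩
  rcases hs with hs | hs
  · intro a ha
    obtain ⟨b, hb, hab⟩ := hs a ha
    exact ⟨b, hb, (ho b hb).trans hab⟩
  · exact absurd hperm (h.inv.not_hasPerm hs)

/-- The outcome of an auction with more than `N ^ 2` rounds. -/
lemma AuctionState.outcome {t : ℕ} {o p : ℕ → ℕ} (h : AuctionState N A t o p) (ht : N * N < t) :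
    AllAssigned N o ↔ HasPerm N A := by
  refine ⟨h.inv.hasPerm, fun hperm => (h.progress hperm).resolve_right fun hsum => ?_⟩
  -- Prices never exceed `N`, so the total price cannot keep pace with more than `N * N` rounds.
  have hle : ∑ c ∈ Finset.range N, p c ≤ ∑ _c ∈ Finset.range N, N :=
    Finset.sum_le_sum fun c hc => h.inv.le c (Finset.mem_range.1 hc)
  rw [hsum] at hle
  simp at hle
  omega

end Auction


/-! ### Independent paths and permutations -/

section Layered

variable {V : Type} {G : SimpleGraph V} {r : V} {m ℓ : ℕ}

/-- Disjoint chains that visit the spheres around `r` one after the other. -/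
structure Layered (G : SimpleGraph V) (r : V) (ℓ : ℕ) (q : Fin m → ℕ → V) : Prop where
  edist : ∀ k t, 1 ≤ t → t ≤ ℓ → G.edist r (q k t) = (t : ℕ)
  adj : ∀ k t, 1 ≤ t → t < ℓ → G.Adj (q k t) (q k (t + 1))
  inj : ∀ j k t, 1 ≤ t → t ≤ ℓ → q j t = q k t → j = k

/-- A path of length `ℓ` to a vertex at distance `ℓ` is geodesic, so its vertex number `t` lies at
distance `t`. Disjointness then has to be checked only level by level, and simple paths need not be
distinguished from chains. -/
lemma exists_layered_iff (hℓ : 1 ≤ ℓ) {x : Fin m → V} :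
    (Function.Injective x ∧ (∀ k, x k ∈ sphere G ℓ r) ∧ IndependentPaths G ℓ r x) ↔
      ∃ q : Fin m → ℕ → V, Layered G r ℓ q ∧ ∀ k, q k ℓ = x k := by
  constructor
  · rintro ⟨hx, hs, hP⟩
    obtain ⟨q, h0, hend, hadj, hinj, hdisj⟩ := hP.exists_fun
    have hwalk : ∀ k a b, a ≤ b → b ≤ ℓ → G.edist (q k a) (q k b) ≤ (b - a : ℕ) := by
      intro k a b hab hb
      obtain ⟨w, hw, -⟩ := exists_walk_of_fun (fun t => q k (a + t)) (b - a)
        fun t ht => hadj k (a + t) (by omega)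
      have h1 := SimpleGraph.Walk.edist_le w
      rw [hw] at h1
      simpa [show a + (b - a) = b by omega] using h1
    -- The initial piece bounds the distance above; the final piece and the distance of the end
    -- bound it below by the triangle inequality.
    have hdist : ∀ k t, t ≤ ℓ → G.edist r (q k t) = (t : ℕ) := by
      intro k t ht
      have h1 := hwalk k 0 t (by omega) ht
      rw [h0, Nat.sub_zero] at h1
      refine le_antisymm h1 ?_
      have h2 := hwalk k t ℓ ht le_rfl
      have h3 := hs k
      rw [sphere, Set.mem_ofPred_eq, ← hend k] at h3
      have h4 := G.edist_triangle (u := r) (v := q k t) (w := q k ℓ)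
      rw [h3] at h4
      have h5 : ((ℓ : ℕ) : ℕ∞) ≤ G.edist r (q k t) + (ℓ - t : ℕ) := h4.trans (by gcongr)
      obtain ⟨d, hd⟩ := ENat.ne_top_iff_exists.1 (ne_top_of_le_ne_top (ENat.natCast_ne_top t) h1)
      rw [← hd] at h5 ⊢
      norm_cast at h5 ⊢
      omega
    refine ⟨q, ⟨fun k t _ ht => hdist k t ht, fun k t _ ht => hadj k t ht,
      fun j k t h1 ht hjk => ?_⟩, hend⟩
    by_contra hne
    have h2 := hdist j t ht
    rw [hdisj j k hne t t hjk, SimpleGraph.edist_self] at h2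
    norm_cast at h2
    omega
  · rintro ⟨q, hq, hend⟩
    refine ⟨fun j k hjk => ?_, fun k => ?_, ?_⟩
    · rw [← hend, ← hend] at hjk
      exact hq.inj j k ℓ hℓ le_rfl hjk
    · rw [sphere, Set.mem_ofPred_eq, ← hend k]
      exact hq.edist k ℓ hℓ le_rfl
    · set q' : Fin m → ℕ → V := fun k t => if t = 0 then r else q k t with hq'
      have hdist : ∀ k t, t ≤ ℓ → G.edist r (q' k t) = (t : ℕ) := by
        intro k t ht
        by_cases h0 : t = 0
        · simp [hq', h0]
        · simpa [hq', h0] using hq.edist k t (by omega) ht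
      have hsame : ∀ j k t t', t ≤ ℓ → t' ≤ ℓ → q' j t = q' k t' → t = t' := by
        intro j k t t' ht ht' h
        have h1 := hdist j t ht
        rw [h, hdist k t' ht'] at h1
        exact_mod_cast h1.symm
      refine independentPaths_of_fun q' (fun k => by simp [hq'])
        (fun k => by rw [← hend k]; exact if_neg (by omega)) (fun k t ht => ?_)
        (fun k t t' => hsame k k t t') (fun j k hjk t t' ht ht' h => ?_)
      · by_cases h0 : t = 0
        · subst h0
          have := hq.edist k 1 le_rfl hℓ
          rw [Nat.cast_one, SimpleGraph.edist_eq_one_iff_adj] at this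
          simpa [hq'] using this
        · simpa [hq', h0] using hq.adj k t (by omega) ht
      · obtain rfl := hsame j k t t' ht ht' h
        by_contra hr
        have h0 : t ≠ 0 := by
          rintro rfl
          exact hr (by simp [hq'])
        simp only [hq', if_neg h0] at h
        exact hjk (hq.inj j k t (by omega) ht h)

end Layered

/-! ### Matching pairs as permutations by allowed moves -/

section Moves

variable {n : ℕ} (G₁ G₂ : SimpleGraph (Fin n)) (π₀ : Fin n → Option (Fin n)) (m ℓ : ℕ)
  (i₂ i₁ : Fin n)

/-- The moves of a token that travels along a path of `G₂` from `i₂` to a seed and back along a path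
of `G₁` to `i₁`. A vertex `v` of `G₂` has the number `v`, a vertex `v` of `G₁` the number `n + v`, and
the tokens start and end at the numbers `2n, …, 2n + m - 1`. -/
def Move (a b : ℕ) : Prop :=
  (∃ k : Fin m, ∃ v : Fin n, a = 2 * n + k ∧ b = v ∧ G₂.edist i₂ v = (1 : ℕ)) ∨
  (∃ u v : Fin n, a = u ∧ b = v ∧ G₂.Adj u v ∧
    ∃ t : ℕ, 1 ≤ t ∧ t < ℓ ∧ G₂.edist i₂ u = (t : ℕ) ∧ G₂.edist i₂ v = (t + 1 : ℕ)) ∨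
  (∃ u v : Fin n, a = u ∧ b = n + v ∧ π₀ u = some v ∧ G₂.edist i₂ u = (ℓ : ℕ) ∧
    G₁.edist i₁ v = (ℓ : ℕ)) ∨
  (∃ u v : Fin n, a = n + u ∧ b = n + v ∧ G₁.Adj u v ∧
    ∃ t : ℕ, 1 ≤ t ∧ t < ℓ ∧ G₁.edist i₁ u = (t + 1 : ℕ) ∧ G₁.edist i₁ v = (t : ℕ)) ∨
  (∃ u : Fin n, ∃ k : Fin m, a = n + u ∧ b = 2 * n + k ∧ G₁.edist i₁ u = (1 : ℕ)) ∨
  (a = b ∧ (a < 2 * n ∨ 2 * n + m ≤ a))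

/-- The number of the token `k` is at stage `t` of its tour. -/
def AtStage (t a : ℕ) : Prop :=
  (1 ≤ t ∧ t ≤ ℓ ∧ ∃ v : Fin n, a = v ∧ G₂.edist i₂ v = (t : ℕ)) ∨
  (ℓ + 1 ≤ t ∧ t ≤ 2 * ℓ ∧ ∃ v : Fin n, a = n + v ∧ G₁.edist i₁ v = (2 * ℓ + 1 - t : ℕ))

variable {G₁ G₂ π₀ m ℓ i₂ i₁}

/-- The size of the number tells the graph, and the distance in that graph tells the stage. -/
lemma AtStage.unique {t t' a : ℕ} (h : AtStage G₁ G₂ ℓ i₂ i₁ t a)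
    (h' : AtStage G₁ G₂ ℓ i₂ i₁ t' a) : t = t' := by
  rcases h with ⟨h1, h2, v, rfl, hv⟩ | ⟨h1, h2, v, rfl, hv⟩ <;>
    rcases h' with ⟨h1', h2', v', e, hv'⟩ | ⟨h1', h2', v', e, hv'⟩
  · obtain rfl := Fin.ext e
    rw [hv] at hv'
    exact_mod_cast hv'
  · omega
  · omega
  · obtain rfl : v = v' := Fin.ext (by omega)
    rw [hv] at hv'
    have : 2 * ℓ + 1 - t = 2 * ℓ + 1 - t' := by exact_mod_cast hv'
    omega

lemma AtStage.lt {t a : ℕ} (h : AtStage G₁ G₂ ℓ i₂ i₁ t a) : a < 2 * n := by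
  rcases h with ⟨-, -, v, rfl, -⟩ | ⟨-, -, v, rfl, -⟩ <;> omega

lemma Move.atStage_one (hℓ : 1 ≤ ℓ) {k b : ℕ} (hk : k < m)
    (h : Move G₁ G₂ π₀ m ℓ i₂ i₁ (2 * n + k) b) : AtStage G₁ G₂ ℓ i₂ i₁ 1 b := by
  rcases h with ⟨k', v, -, hb, hv⟩ | ⟨u, v, e, -⟩ | ⟨u, v, e, -⟩ | ⟨u, v, e, -⟩ | ⟨u, k', e, -⟩ |
    ⟨-, h | h⟩
  · exact Or.inl ⟨le_rfl, hℓ, v, hb, hv⟩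
  all_goals omega

lemma Move.atStage_succ {t a b : ℕ} (hab : a ≠ b) (ht : t < 2 * ℓ)
    (h : Move G₁ G₂ π₀ m ℓ i₂ i₁ a b) (ha : AtStage G₁ G₂ ℓ i₂ i₁ t a) :
    AtStage G₁ G₂ ℓ i₂ i₁ (t + 1) b := by
  have hlt := ha.lt
  rcases ha with ⟨h1, h2, w, rfl, hw⟩ | ⟨h1, h2, w, rfl, hw⟩
  · rcases h with ⟨k', v, e, -⟩ | ⟨u, v, e, rfl, -, t', ht1, htl, hu, hv⟩ |
      ⟨u, v, e, rfl, -, hu, hv⟩ | ⟨u, v, e, -⟩ | ⟨u, k', e, -⟩ | ⟨e, -⟩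
    · omega
    · obtain rfl := Fin.ext e
      rw [hw] at hu
      obtain rfl : t = t' := by exact_mod_cast hu
      exact Or.inl ⟨by omega, by omega, v, rfl, hv⟩
    · obtain rfl := Fin.ext e
      rw [hw] at hu
      obtain rfl : t = ℓ := by exact_mod_cast hu
      refine Or.inr ⟨by omega, by omega, v, rfl, ?_⟩
      rw [hv, show 2 * t + 1 - (t + 1) = t by omega]
    · omega
    · omega
    · exact absurd e hab
  · rcases h with ⟨k', v, e, -⟩ | ⟨u, v, e, -⟩ | ⟨u, v, e, -⟩ |
      ⟨u, v, e, rfl, -, t', ht1, htl, hu, hv⟩ | ⟨u, k', e, rfl, hu⟩ | ⟨e, -⟩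
    · omega
    · omega
    · omega
    · obtain rfl : w = u := Fin.ext (by omega)
      rw [hw] at hu
      have e1 : 2 * ℓ + 1 - t = t' + 1 := by exact_mod_cast hu
      refine Or.inr ⟨by omega, by omega, v, rfl, ?_⟩
      rw [hv, show 2 * ℓ + 1 - (t + 1) = t' by omega]
    · obtain rfl : w = u := Fin.ext (by omega)
      rw [hw] at hu
      have e1 : 2 * ℓ + 1 - t = 1 := by exact_mod_cast hu
      omega
    · exact absurd e hab

/-- The stages of the tours under a permutation. -/
lemma atStage_iterate (hℓ : 1 ≤ ℓ) {N : ℕ} {π : Equiv.Perm (Fin N)}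
    (hπ : ∀ a : Fin N, Move G₁ G₂ π₀ m ℓ i₂ i₁ a (π a)) {k : ℕ} (hk : k < m)
    (hN : 2 * n + k < N) (t : ℕ) (ht : t < 2 * ℓ) :
    AtStage G₁ G₂ ℓ i₂ i₁ (t + 1) ((π^[t + 1] ⟨2 * n + k, hN⟩ : Fin N) : ℕ) := by
  -- Strengthened by the claim that the token has just moved. It is needed because vertices are
  -- allowed to stay put.
  suffices h : AtStage G₁ G₂ ℓ i₂ i₁ (t + 1) ((π^[t + 1] ⟨2 * n + k, hN⟩ : Fin N) : ℕ) ∧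
      π^[t] ⟨2 * n + k, hN⟩ ≠ π^[t + 1] ⟨2 * n + k, hN⟩ from h.1
  induction t with
  | zero =>
    have hstart : AtStage G₁ G₂ ℓ i₂ i₁ 1 ((π^[1] ⟨2 * n + k, hN⟩ : Fin N) : ℕ) :=
      Move.atStage_one hℓ hk (hπ ⟨2 * n + k, hN⟩)
    refine ⟨hstart, fun h => ?_⟩
    have h1 := hstart.lt
    rw [zero_add, Function.iterate_zero, id] at h
    rw [← h] at h1
    exact absurd h1 (by simp)
  | succ t ih =>
    obtain ⟨h1, h2⟩ := ih (by omega)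
    -- A token that stops would, by injectivity of `π`, have been at rest already one step before.
    have h3 : π^[t + 1] ⟨2 * n + k, hN⟩ ≠ π^[t + 1 + 1] ⟨2 * n + k, hN⟩ := by
      rw [Function.iterate_succ_apply', Function.iterate_succ_apply' π (t + 1)]
      exact fun h => h2 (π.injective h)
    refine ⟨?_, h3⟩
    rw [Function.iterate_succ_apply' π (t + 1)] at h3 ⊢
    exact Move.atStage_succ (fun h => h3 (Fin.ext h)) (by omega) (hπ _) h1

lemma Move.adj_two {u v : Fin n} (huv : u ≠ v) (h : Move G₁ G₂ π₀ m ℓ i₂ i₁ u v) : G₂.Adj u v := by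
  rcases h with ⟨k', v', e, -⟩ | ⟨u', v', e, e', h, -⟩ | ⟨u', v', e, e', -⟩ | ⟨u', v', e, -⟩ |
    ⟨u', k', e, -⟩ | ⟨e, -⟩
  · omega
  · rwa [Fin.ext e, Fin.ext e']
  · omega
  · omega
  · omega
  · exact absurd (Fin.ext e) huv

lemma Move.adj_one {u v : Fin n} (huv : u ≠ v) (h : Move G₁ G₂ π₀ m ℓ i₂ i₁ (n + u) (n + v)) :
    G₁.Adj u v := by
  rcases h with ⟨k', v', e, e', -⟩ | ⟨u', v', e, e', h, -⟩ | ⟨u', v', e, e', -⟩ |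
    ⟨u', v', e, e', h, -⟩ | ⟨u', k', e, e', -⟩ | ⟨e, -⟩
  · omega
  · omega
  · omega
  · rwa [show u = u' from Fin.ext (by omega), show v = v' from Fin.ext (by omega)]
  · omega
  · exact absurd (Fin.ext (by omega)) huv

lemma Move.seed {u v : Fin n} (h : Move G₁ G₂ π₀ m ℓ i₂ i₁ u (n + v)) : π₀ u = some v := by
  rcases h with ⟨k', v', e, e', -⟩ | ⟨u', v', e, e', h, -⟩ | ⟨u', v', e, e', h, -⟩ |
    ⟨u', v', e, e', h, -⟩ | ⟨u', k', e, e', -⟩ | ⟨e, -⟩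
  · omega
  · omega
  · rwa [show u = u' from Fin.ext (by omega), show v = v' from Fin.ext (by omega)]
  · omega
  · omega
  · omega

/-- A permutation by moves yields disjoint chains. -/
lemma exists_layered_of_hasPerm (hℓ : 1 ≤ ℓ) {N : ℕ} (hN : 2 * n + m ≤ N)
    (h : HasPerm N (Move G₁ G₂ π₀ m ℓ i₂ i₁)) :
    ∃ q₂ q₁ : Fin m → ℕ → Fin n, Layered G₂ i₂ ℓ q₂ ∧ Layered G₁ i₁ ℓ q₁ ∧
      ∀ k, π₀ (q₂ k ℓ) = some (q₁ k ℓ) := by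
  obtain ⟨π, hπ⟩ := h
  have hkN : ∀ k : Fin m, 2 * n + (k : ℕ) < N := fun k => by omega
  set s : Fin m → ℕ → Fin N := fun k t => π^[t] ⟨2 * n + k, hkN k⟩ with hs
  have hinj : ∀ j k t, s j t = s k t → j = k := by
    intro j k t hjk
    have := Function.Injective.iterate π.injective t hjk
    rw [Fin.mk.injEq] at this
    exact Fin.ext (by omega)
  have hmove : ∀ k t, Move G₁ G₂ π₀ m ℓ i₂ i₁ (s k t) (s k (t + 1)) := by
    intro k t
    simp only [hs]
    rw [Function.iterate_succ_apply' π t]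
    exact hπ _
  have hst : ∀ k t, 1 ≤ t → t ≤ 2 * ℓ → AtStage G₁ G₂ ℓ i₂ i₁ t (s k t) := by
    intro k t h1 h2
    obtain ⟨t, rfl⟩ : ∃ t', t = t' + 1 := ⟨t - 1, by omega⟩
    exact atStage_iterate hℓ hπ k.2 (hkN k) t (by omega)
  have h₂ : ∀ k t, ∃ v : Fin n, 1 ≤ t → t ≤ ℓ → (s k t : ℕ) = v ∧ G₂.edist i₂ v = (t : ℕ) := by
    intro k t
    by_cases ht : 1 ≤ t ∧ t ≤ ℓ
    · rcases hst k t ht.1 (by omega) with ⟨-, -, v, e, hv⟩ | ⟨h1, -⟩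
      · exact ⟨v, fun _ _ => ⟨e, hv⟩⟩
      · omega
    · exact ⟨i₂, fun h1 h2 => absurd ⟨h1, h2⟩ ht⟩
  -- The second half of the tour is read backwards: at stage `2 * ℓ + 1 - t` the token is at
  -- distance `t` from `i₁`.
  have h₁ : ∀ k t, ∃ v : Fin n, 1 ≤ t → t ≤ ℓ →
      (s k (2 * ℓ + 1 - t) : ℕ) = n + v ∧ G₁.edist i₁ v = (t : ℕ) := by
    intro k t
    by_cases ht : 1 ≤ t ∧ t ≤ ℓ
    · rcases hst k (2 * ℓ + 1 - t) (by omega) (by omega) with ⟨-, h1, -⟩ | ⟨-, -, v, e, hv⟩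
      · omega
      · refine ⟨v, fun _ _ => ⟨e, ?_⟩⟩
        rwa [show 2 * ℓ + 1 - (2 * ℓ + 1 - t) = t by omega] at hv
    · exact ⟨i₁, fun h1 h2 => absurd ⟨h1, h2⟩ ht⟩
  choose q₂ hq₂ using h₂
  choose q₁ hq₁ using h₁
  refine ⟨q₂, q₁, ⟨fun k t h1 h2 => (hq₂ k t h1 h2).2, fun k t h1 h2 => ?_,
    fun j k t h1 h2 h => hinj j k t (Fin.ext ?_)⟩, ⟨fun k t h1 h2 => (hq₁ k t h1 h2).2,
    fun k t h1 h2 => ?_, fun j k t h1 h2 h => hinj j k (2 * ℓ + 1 - t) (Fin.ext ?_)⟩, fun k => ?_⟩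
  · have a1 := hq₂ k t h1 (by omega)
    have a2 := hq₂ k (t + 1) (by omega) (by omega)
    have hm := hmove k t
    rw [a1.1, a2.1] at hm
    refine hm.adj_two fun heq => ?_
    have := a1.2
    rw [heq, a2.2] at this
    norm_cast at this
    omega
  · rw [(hq₂ j t h1 h2).1, (hq₂ k t h1 h2).1, h]
  · have a1 := hq₁ k t h1 (by omega)
    have a2 := hq₁ k (t + 1) (by omega) (by omega)
    have hm := hmove k (2 * ℓ + 1 - (t + 1))
    rw [show 2 * ℓ + 1 - (t + 1) + 1 = 2 * ℓ + 1 - t by omega, a1.1, a2.1] at hm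
    refine (hm.adj_one fun heq => ?_).symm
    have := a1.2
    rw [← heq, a2.2] at this
    norm_cast at this
    omega
  · rw [(hq₁ j t h1 h2).1, (hq₁ k t h1 h2).1, h]
  · have a1 := hq₁ k ℓ hℓ le_rfl
    have a2 := hq₂ k ℓ hℓ le_rfl
    have hm := hmove k ℓ
    rw [show ℓ + 1 = 2 * ℓ + 1 - ℓ by omega, a1.1, a2.1] at hm
    exact hm.seed

/-- The tours along disjoint chains form a permutation by moves. -/
lemma hasPerm_of_layered (hℓ : 1 ≤ ℓ) {N : ℕ} (hN : 2 * n + m ≤ N) {q₂ q₁ : Fin m → ℕ → Fin n}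
    (h₂ : Layered G₂ i₂ ℓ q₂) (h₁ : Layered G₁ i₁ ℓ q₁)
    (hseed : ∀ k, π₀ (q₂ k ℓ) = some (q₁ k ℓ)) : HasPerm N (Move G₁ G₂ π₀ m ℓ i₂ i₁) := by
  classical
  -- Each tour has `2 * ℓ + 1` positions: the token, `ℓ` vertices of the second graph and `ℓ` of the
  -- first.
  set pos : Fin m × Fin (2 * ℓ + 1) → ℕ := fun z =>
    if (z.2 : ℕ) = 0 then 2 * n + z.1 else if (z.2 : ℕ) ≤ ℓ then q₂ z.1 z.2
    else n + q₁ z.1 (2 * ℓ + 1 - z.2) with hpos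
  have hposN : ∀ z, pos z < N := by
    intro z
    simp only [hpos]
    split_ifs <;> omega
  have hstage : ∀ z : Fin m × Fin (2 * ℓ + 1), (z.2 : ℕ) ≠ 0 →
      AtStage G₁ G₂ ℓ i₂ i₁ z.2 (pos z) := by
    intro z hz
    simp only [hpos, if_neg hz]
    split_ifs with h
    · exact Or.inl ⟨by omega, h, _, rfl, h₂.edist _ _ (by omega) h⟩
    · exact Or.inr ⟨by omega, by omega, _, rfl, h₁.edist _ _ (by omega) (by omega)⟩
  have hinj : Function.Injective pos := by
    intro z z' h
    have hlt : ∀ z : Fin m × Fin (2 * ℓ + 1), (z.2 : ℕ) = 0 ↔ 2 * n ≤ pos z := by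
      intro z
      constructor
      · intro h0
        simp only [hpos, if_pos h0]
        omega
      · intro h0
        by_contra hne
        have := (hstage z hne).lt
        omega
    have hz2 : z.2 = z'.2 := by
      by_cases h0 : (z.2 : ℕ) = 0
      · have h0' := (hlt z).1 h0
        rw [h, ← hlt] at h0'
        exact Fin.ext (by omega)
      · have h0' : (z'.2 : ℕ) ≠ 0 := by rwa [Ne, hlt, ← h, ← hlt]
        have h1 := hstage z h0
        rw [h] at h1
        exact Fin.ext (h1.unique (hstage z' h0'))
    obtain ⟨k, t⟩ := z
    obtain ⟨k', t'⟩ := z'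
    obtain rfl : t = t' := hz2
    simp only [Prod.mk.injEq, and_true]
    simp only [hpos] at h
    split_ifs at h with e1 e2
    · exact Fin.ext (by omega)
    · exact h₂.inj k k' t (by omega) e2 (Fin.ext h)
    · exact h₁.inj k k' (2 * ℓ + 1 - t) (by omega) (by omega) (Fin.ext (by omega))
  let f : Fin m × Fin (2 * ℓ + 1) ↪ Fin N :=
    ⟨fun z => ⟨pos z, hposN z⟩, fun z z' h => hinj (congrArg Fin.val h)⟩
  -- Every tour is closed up to a cycle and rotated by one; numbers on no tour stay fixed.
  let τ : Equiv.Perm (Fin m × Fin (2 * ℓ + 1)) :=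
    (Equiv.refl (Fin m)).prodCongr (finRotate (2 * ℓ + 1))
  refine ⟨τ.viaFintypeEmbedding f, fun a => ?_⟩
  by_cases ha : a ∈ Set.range f
  · obtain ⟨⟨k, t⟩, rfl⟩ := ha
    rw [Equiv.Perm.viaFintypeEmbedding_apply_image]
    change Move G₁ G₂ π₀ m ℓ i₂ i₁ (pos (k, t)) (pos (k, finRotate (2 * ℓ + 1) t))
    rcases lt_or_ge (t : ℕ) (2 * ℓ) with ht | ht
    · have hrot : (finRotate (2 * ℓ + 1) t : ℕ) = t + 1 := by
        rw [coe_finRotate_of_ne_last]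
        intro hlast
        rw [hlast] at ht
        simp at ht
      by_cases h0 : (t : ℕ) = 0
      · refine Or.inl ⟨k, q₂ k 1, ?_, ?_, h₂.edist k 1 le_rfl hℓ⟩
        · simp only [hpos, if_pos h0]
        · simp only [hpos, hrot, h0]
          rw [if_neg (by omega), if_pos (by omega)]
      · rcases lt_trichotomy (t : ℕ) ℓ with htl | htl | htl
        · refine Or.inr (Or.inl ⟨q₂ k t, q₂ k (t + 1), ?_, ?_, h₂.adj k t (by omega) htl, t,
            by omega, htl, h₂.edist k t (by omega) htl.le,
            h₂.edist k (t + 1) (by omega) (by omega)⟩)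
          · simp only [hpos]
            rw [if_neg h0, if_pos htl.le]
          · simp only [hpos, hrot]
            rw [if_neg (by omega), if_pos (by omega)]
        · refine Or.inr (Or.inr (Or.inl ⟨q₂ k ℓ, q₁ k ℓ, ?_, ?_, hseed k,
            h₂.edist k ℓ hℓ le_rfl, h₁.edist k ℓ hℓ le_rfl⟩))
          · simp only [hpos]
            rw [if_neg h0, if_pos htl.le, htl]
          · simp only [hpos, hrot]
            rw [if_neg (by omega), if_neg (by omega),
              show 2 * ℓ + 1 - ((t : ℕ) + 1) = ℓ by omega]
        · set j := 2 * ℓ - (t : ℕ) with hj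
          refine Or.inr (Or.inr (Or.inr (Or.inl ⟨q₁ k (j + 1), q₁ k j, ?_, ?_,
            (h₁.adj k j (by omega) (by omega)).symm, j, by omega, by omega,
            h₁.edist k (j + 1) (by omega) (by omega), h₁.edist k j (by omega) (by omega)⟩)))
          · simp only [hpos]
            rw [if_neg h0, if_neg (by omega), show 2 * ℓ + 1 - (t : ℕ) = j + 1 by omega]
          · simp only [hpos, hrot]
            rw [if_neg (by omega), if_neg (by omega),
              show 2 * ℓ + 1 - ((t : ℕ) + 1) = j by omega]
    · have hlast : t = Fin.last (2 * ℓ) := Fin.ext (by simp; omega)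
      refine Or.inr (Or.inr (Or.inr (Or.inr (Or.inl ⟨q₁ k 1, k, ?_, ?_,
        h₁.edist k 1 le_rfl hℓ⟩))))
      · simp only [hpos]
        rw [if_neg (by omega), if_neg (by omega), show 2 * ℓ + 1 - (t : ℕ) = 1 by omega]
      · rw [hlast, finRotate_last]
        simp [hpos]
  · rw [Equiv.Perm.viaFintypeEmbedding_apply_notMem_range _ _ ha]
    refine Or.inr (Or.inr (Or.inr (Or.inr (Or.inr ⟨rfl, ?_⟩))))
    by_contra hcon
    push Not at hcon
    have hk : (a : ℕ) - 2 * n < m := by omega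
    have hval : pos (⟨a - 2 * n, hk⟩, 0) = a := by
      simp only [hpos]
      rw [if_pos (by simp)]
      omega
    exact ha ⟨(⟨a - 2 * n, hk⟩, 0), Fin.ext hval⟩

/-- Tokens are forbidden to rest, so a permutation by moves sends all `m` of them on disjoint tours.
A tour may return to a token other than its own, which is irrelevant because only the paths matter.
-/
theorem highDegreeMatch_iff_hasPerm {N : ℕ} (hN : 2 * n + m ≤ N) (hℓ : 1 ≤ ℓ) :
    HighDegreeMatch G₁ G₂ π₀ m ℓ i₂ i₁ ↔ π₀ i₂ = none ∧ (∀ j, π₀ j ≠ some i₁) ∧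
      HasPerm N (Move G₁ G₂ π₀ m ℓ i₂ i₁) := by
  unfold HighDegreeMatch
  refine and_congr_right fun _ => and_congr_right fun _ => ⟨?_, fun h => ?_⟩
  · rintro ⟨x, y, hx, hy, hxy, hsx, hPx, hsy, hPy⟩
    obtain ⟨q₂, h₂, e₂⟩ := (exists_layered_iff hℓ).1 ⟨hx, hsx, hPx⟩
    obtain ⟨q₁, h₁, e₁⟩ := (exists_layered_iff hℓ).1 ⟨hy, hsy, hPy⟩
    exact hasPerm_of_layered hℓ hN h₂ h₁ fun k => by rw [e₂, e₁]; exact hxy k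
  · obtain ⟨q₂, q₁, h₂, h₁, hs⟩ := exists_layered_of_hasPerm hℓ hN h
    obtain ⟨hx, hsx, hPx⟩ := (exists_layered_iff hℓ).2 ⟨q₂, h₂, fun _ => rfl⟩
    obtain ⟨hy, hsy, hPy⟩ := (exists_layered_iff hℓ).2 ⟨q₁, h₁, fun _ => rfl⟩
    exact ⟨_, _, hx, hy, hs, hsx, hPx, hsy, hPy⟩

/-- No vertex has paths that are too long, or too many independent paths. -/
lemma HighDegreeMatch.bounds (h : HighDegreeMatch G₁ G₂ π₀ m ℓ i₂ i₁) (hm : 0 < m) :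
    1 ≤ ℓ ∧ ℓ < n ∧ m ≤ n := by
  obtain ⟨h0, -, x, y, hx, -, hxy, hs, ⟨P, hP, -⟩, -⟩ := h
  refine ⟨?_, ?_, ?_⟩
  -- Length zero would make `i₂` itself a seed.
  · by_contra hℓ
    obtain rfl : ℓ = 0 := by omega
    have h1 := hs ⟨0, hm⟩
    rw [sphere, Set.mem_ofPred_eq, Nat.cast_zero, SimpleGraph.edist_eq_zero_iff] at h1
    have h2 := hxy ⟨0, hm⟩
    rw [← h1, h0] at h2
    simp at h2
  · have h1 := (hP ⟨0, hm⟩).1.length_lt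
    rwa [(hP ⟨0, hm⟩).2, Fintype.card_fin] at h1
  · simpa using Fintype.card_le_of_injective x hx

lemma highDegreeMatch_zero : HighDegreeMatch G₁ G₂ π₀ 0 ℓ i₂ i₁ ↔
    π₀ i₂ = none ∧ ∀ j, π₀ j ≠ some i₁ := by
  unfold HighDegreeMatch
  refine and_congr_right fun _ => and_iff_left ?_
  refine ⟨Fin.elim0, Fin.elim0, fun a => a.elim0, fun a => a.elim0, fun a => a.elim0,
    fun a => a.elim0, ⟨fun a => a.elim0, fun a => a.elim0, fun a => a.elim0⟩, fun a => a.elim0,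
    ⟨fun a => a.elim0, fun a => a.elim0, fun a => a.elim0⟩⟩

end Moves


/-! ### Logical terms -/

namespace Term

/-- A term holds if its value is nonzero. -/
def Holds (e : Term) (S : Store) : Prop := e.eval S ≠ 0

instance (e : Term) (S : Store) : Decidable (e.Holds S) := inferInstanceAs (Decidable (_ ≠ _))

def neg (e : Term) : Term := ite e (num 0) (num 1)
def conj (e f : Term) : Term := ite e f (num 0)
def disj (e f : Term) : Term := ite e (num 1) f
def lt (e f : Term) : Term := sub f e
def le (e f : Term) : Term := neg (lt f e)
def eq (e f : Term) : Term := conj (le e f) (le f e)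
def ex (x : ℕ) (e : Term) : Term := sum x e
def all (x : ℕ) (e : Term) : Term := neg (ex x (neg e))

/-- The least value of `x` below the bound for which `e` holds, or the bound. -/
def mu (x y : ℕ) (e : Term) : Term := sum y (neg (ex x (conj (le (var x) (var y)) e)))

/-- The product of `e` and `f`, where `e` is at most the bound. -/
def mul (e f : Term) : Term := sum 50 (ite (lt (var 50) e) f (num 0))

variable {S : Store} {e f c : Term} {x y : ℕ}

@[simp] lemma eval_num (k : ℕ) : (num k).eval S = k := rfl
@[simp] lemma eval_var : (var x).eval S = S.var x := rfl
@[simp] lemma eval_get (a : ℕ) : (get a e).eval S = S.arr a (e.eval S) := rfl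
@[simp] lemma eval_add : (add e f).eval S = e.eval S + f.eval S := rfl
@[simp] lemma eval_sub : (sub e f).eval S = e.eval S - f.eval S := rfl

@[simp] lemma eval_ite : (ite c e f).eval S = if c.Holds S then e.eval S else f.eval S := by
  by_cases h : c.eval S = 0 <;> simp [eval, Holds, h]

@[simp] lemma holds_neg : (neg e).Holds S ↔ ¬ e.Holds S := by
  unfold neg
  by_cases h : e.Holds S
  · simp only [h, not_true, iff_false]; unfold Holds; rw [eval_ite, if_pos h]; simp
  · simp only [h, not_false_eq_true, iff_true]; unfold Holds; rw [eval_ite, if_neg h]; simp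

@[simp] lemma holds_conj : (conj e f).Holds S ↔ e.Holds S ∧ f.Holds S := by
  unfold conj
  by_cases h : e.Holds S
  · simp only [h, true_and]; unfold Holds; rw [eval_ite, if_pos h]
  · simp only [h, false_and, iff_false]; unfold Holds; rw [eval_ite, if_neg h]; simp

@[simp] lemma holds_disj : (disj e f).Holds S ↔ e.Holds S ∨ f.Holds S := by
  unfold disj
  by_cases h : e.Holds S
  · simp only [h, true_or, iff_true]; unfold Holds; rw [eval_ite, if_pos h]; simp
  · simp only [h, false_or]; unfold Holds; rw [eval_ite, if_neg h]

@[simp] lemma holds_lt : (lt e f).Holds S ↔ e.eval S < f.eval S := by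
  unfold lt Holds
  rw [eval_sub]
  omega

@[simp] lemma holds_le : (le e f).Holds S ↔ e.eval S ≤ f.eval S := by
  simp [le]

@[simp] lemma holds_eq : (eq e f).Holds S ↔ e.eval S = f.eval S := by
  simp only [eq, holds_conj, holds_le]
  omega

@[simp] lemma holds_ex : (ex x e).Holds S ↔ ∃ i < S.var 3, e.Holds (S.set x i) := by
  unfold ex Holds
  simp only [eval, ne_eq, Finset.sum_eq_zero_iff, Finset.mem_range, not_forall, exists_prop]

@[simp] lemma holds_all : (all x e).Holds S ↔ ∀ i < S.var 3, e.Holds (S.set x i) := by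
  simp [all]

lemma eval_neg : (neg e).eval S = if e.Holds S then 0 else 1 := by simp [neg]

/-- The defining property of `mu`; the auxiliary variable `y` must not occur in `e`. -/
lemma eval_mu {P : ℕ → Prop} (hxy : x ≠ y) (hy3 : y ≠ 3)
    (hP : ∀ v w, e.Holds ((S.set y v).set x w) ↔ P w) :
    (mu x y e).eval S ≤ S.var 3 ∧ ((mu x y e).eval S < S.var 3 → P ((mu x y e).eval S)) ∧
      ∀ i < (mu x y e).eval S, ¬ P i := by
  classical
  -- The least solution is counted: it is the number of values below which, inclusively, there is no
  -- solution.
  have hval : (mu x y e).eval S =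
      ((Finset.range (S.var 3)).filter fun v => ∀ w ≤ v, ¬ P w).card := by
    rw [Finset.card_filter]
    change ∑ i ∈ Finset.range (S.var 3), _ = _
    refine Finset.sum_congr rfl fun v hv => ?_
    rw [Finset.mem_range] at hv
    rw [eval_neg]
    have h1 : (ex x (conj (le (var x) (var y)) e)).Holds (S.set y v) ↔ ¬ ∀ w ≤ v, ¬ P w := by
      simp only [holds_ex, holds_conj, holds_le, eval_var, Store.set_var, if_true, hxy.symm, hP,
        if_neg hy3.symm, if_false]
      push Not
      exact ⟨fun ⟨i, _, h1, h2⟩ => ⟨i, h1, h2⟩, fun ⟨i, h1, h2⟩ => ⟨i, by omega, h1, h2⟩⟩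
    by_cases h2 : ∀ w ≤ v, ¬ P w
    · rw [if_neg (by rw [h1]; exact not_not_intro h2), if_pos h2]
    · rw [if_pos (h1.2 h2), if_neg h2]
  have key : ∀ r, r ≤ S.var 3 → (r < S.var 3 → P r) → (∀ i < r, ¬ P i) →
      (mu x y e).eval S = r := by
    intro r h1 h2 h3
    rw [hval]
    have : ((Finset.range (S.var 3)).filter fun v => ∀ w ≤ v, ¬ P w) = Finset.range r := by
      ext v
      simp only [Finset.mem_filter, Finset.mem_range]
      constructor
      · rintro ⟨hv, hw⟩
        by_contra hcon
        exact hw r (by omega) (h2 (by omega))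
      · exact fun hv => ⟨by omega, fun w hw => h3 w (by omega)⟩
    rw [this, Finset.card_range]
  by_cases hex : ∃ i, i < S.var 3 ∧ P i
  · have h1 := Nat.find_spec hex
    have h2 : ∀ i < Nat.find hex, ¬ P i := fun i hi hPi =>
      Nat.find_min hex hi ⟨by omega, hPi⟩
    rw [key (Nat.find hex) h1.1.le (fun _ => h1.2) h2]
    exact ⟨h1.1.le, fun _ => h1.2, h2⟩
  · push Not at hex
    rw [key (S.var 3) le_rfl (fun h => absurd h (lt_irrefl _)) hex]
    exact ⟨le_rfl, fun h => absurd h (lt_irrefl _), hex⟩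

/-- The machine has no multiplication, so the product is a bounded sum of copies of `f`. Hence the
first factor must not exceed the loop bound, and the variable `50` must not occur in the factors. -/
lemma eval_mul (he : ∀ i, e.eval (S.set 50 i) = e.eval S) (hf : ∀ i, f.eval (S.set 50 i) = f.eval S)
    (hle : e.eval S ≤ S.var 3) : (mul e f).eval S = e.eval S * f.eval S := by
  change ∑ i ∈ Finset.range (S.var 3), _ = _
  simp only [eval_ite, holds_lt, eval_var, Store.set_var, he, hf, eval_num, if_true]
  rw [Finset.sum_ite, Finset.sum_const_zero, add_zero, Finset.sum_const, smul_eq_mul]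
  congr 1
  rw [show ((Finset.range (S.var 3)).filter fun i => i < e.eval S) = Finset.range (e.eval S) from ?_,
    Finset.card_range]
  ext i
  simp only [Finset.mem_filter, Finset.mem_range]
  omega

end Term

/-! ### Loop invariants for commands -/

namespace Cmd

/-- The arrays that a command does not modify. -/
def keepsArr (b : ℕ) : Cmd → Bool
  | assign _ _ => true
  | write a _ _ => b != a
  | map a _ _ => b != a
  | seq c d => c.keepsArr b && d.keepsArr b
  | rep _ c => c.keepsArr b

lemma denote_arr_of_keepsArr {b : ℕ} {c : Cmd} (h : c.keepsArr b) (S : Store) :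
    (c.denote S).arr b = S.arr b := by
  induction c generalizing S with
  | assign x e => rfl
  | write a e f =>
    simp only [keepsArr, bne_iff_ne] at h
    simp [denote, Store.setArr_arr, h]
  | map a x e =>
    simp only [keepsArr, bne_iff_ne] at h
    simp [denote, Store.setArr_arr, h]
  | seq c d ihc ihd =>
    simp only [keepsArr, Bool.and_eq_true] at h
    simp [denote, ihd h.2, ihc h.1]
  | rep x c ih =>
    simp only [keepsArr] at h
    simp only [denote, Store.set_arr]
    induction S.var 3 with
    | zero => rfl
    | succ k ihk => simp only [ih h, Store.set_arr, ihk]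

lemma denote_rep {x : ℕ} {c : Cmd} {P : ℕ → Store → Prop} {S : Store} (h0 : P 0 S)
    (hs : ∀ i < S.var 3, ∀ R, P i R → P (i + 1) (c.denote (R.set x i))) :
    ∃ R, P (S.var 3) R ∧ (rep x c).denote S = R.set x (S.var 3) := by
  refine ⟨_, ?_, rfl⟩
  have key : ∀ k ≤ S.var 3, P k (Nat.rec S (fun i R => c.denote (R.set x i)) k) := by
    intro k
    induction k with
    | zero => exact fun _ => h0
    | succ k ih => exact fun hk => hs k hk _ (ih (by omega))
  exact key _ le_rfl

end Cmd

/-- The store holds the input, and the bound of all loops. -/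
structure Input {n : ℕ} (G₁ G₂ : SimpleGraph (Fin n)) (π₀ : Fin n → Option (Fin n)) (m ℓ : ℕ)
    (ρ : Equiv.Perm (Fin n)) (S : Store) : Prop where
  n_eq : S.var 0 = n
  m_eq : S.var 1 = m
  ℓ_eq : S.var 2 = ℓ
  size : S.var 3 = 3 * n + 2
  one : S.arr 0 = encodeGraph G₁
  two : S.arr 1 = encodeGraph G₂
  seeds : S.arr 2 = encodeSeeds π₀
  perm : S.arr 3 = encodePerm ρ

/-! ### Reading the encoded input -/

section Program

variable {n : ℕ} {G₁ G₂ G : SimpleGraph (Fin n)} {π₀ : Fin n → Option (Fin n)} {m ℓ : ℕ}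
  {ρ : Equiv.Perm (Fin n)} {S S' : Store}

lemma Input.congr (h : Input G₁ G₂ π₀ m ℓ ρ S) (hv : ∀ x < 4, S'.var x = S.var x)
    (ha : ∀ a < 4, S'.arr a = S.arr a) : Input G₁ G₂ π₀ m ℓ ρ S' :=
  ⟨by rw [hv 0 (by norm_num), h.n_eq], by rw [hv 1 (by norm_num), h.m_eq],
    by rw [hv 2 (by norm_num), h.ℓ_eq], by rw [hv 3 (by norm_num), h.size],
    by rw [ha 0 (by norm_num), h.one], by rw [ha 1 (by norm_num), h.two],
    by rw [ha 2 (by norm_num), h.seeds], by rw [ha 3 (by norm_num), h.perm]⟩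

lemma Input.set (h : Input G₁ G₂ π₀ m ℓ ρ S) {x : ℕ} (hx : 4 ≤ x) (v : ℕ) :
    Input G₁ G₂ π₀ m ℓ ρ (S.set x v) :=
  h.congr (fun y hy => by rw [Store.set_var, if_neg (by omega)]) fun _ _ => rfl

lemma Input.setArr (h : Input G₁ G₂ π₀ m ℓ ρ S) {a : ℕ} (ha : 4 ≤ a) (f : ℕ → ℕ) :
    Input G₁ G₂ π₀ m ℓ ρ (S.setArr a f) :=
  h.congr (fun _ _ => rfl) fun b hb => by rw [Store.setArr_arr, if_neg (by omega)]

lemma encodeGraph_ne_zero_iff (u v : Fin n) : encodeGraph G ((u : ℕ) * n + v) ≠ 0 ↔ G.Adj u v := by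
  unfold encodeGraph
  have h : (∃ i j : Fin n, (u : ℕ) * n + v = (i : ℕ) * n + (j : ℕ) ∧ G.Adj i j) ↔ G.Adj u v := by
    refine ⟨?_, fun h => ⟨u, v, rfl, h⟩⟩
    rintro ⟨i, j, hij, h⟩
    have hn : 0 < n := u.pos
    have h1 : (v : ℕ) = j := by
      have := congrArg (· % n) hij
      simpa [Nat.mod_eq_of_lt] using this
    have h2 : (u : ℕ) = i := by
      rw [h1] at hij
      exact Nat.eq_of_mul_eq_mul_right hn (by omega)
    rwa [Fin.ext h1, Fin.ext h2]
  by_cases h' : G.Adj u v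
  · rw [if_pos (h.2 h')]
    simpa
  · rw [if_neg (fun h'' => h' (h.1 h''))]
    simpa

lemma encodeSeeds_eq_succ_iff {u : Fin n} {k : ℕ} :
    encodeSeeds π₀ u = k + 1 ↔ ∃ v : Fin n, k = v ∧ π₀ u = some v := by
  unfold encodeSeeds
  rw [dif_pos u.2]
  cases h : π₀ u with
  | none => simp
  | some v => simp [eq_comm]

lemma encodeSeeds_eq_zero_iff {u : Fin n} : encodeSeeds π₀ u = 0 ↔ π₀ u = none := by
  unfold encodeSeeds
  rw [dif_pos u.2]
  cases h : π₀ u <;> simp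

open Term in
/-- Adjacency in the graph stored in the array `g`. -/
def adjTerm (g : ℕ) (e f : Term) : Term :=
  conj (lt e (var 0)) (conj (lt f (var 0)) (get g (add (mul e (var 0)) f)))

/-- Both arguments are tested to be vertices before the matrix is read, since an index out of range
could alias another entry. Only `e` is evaluated under the bound variable `50` of the product. -/
lemma holds_adjTerm {g : ℕ} {e f : Term} (hn : S.var 0 = n) (hN : n ≤ S.var 3)
    (hg : S.arr g = encodeGraph G) (he : ∀ i, e.eval (S.set 50 i) = e.eval S) :
    (adjTerm g e f).Holds S ↔ ∃ u v : Fin n, e.eval S = u ∧ f.eval S = v ∧ G.Adj u v := by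
  unfold adjTerm
  simp only [Term.holds_conj, Term.holds_lt, Term.eval_var, hn]
  have key : ∀ u v : Fin n, e.eval S = u → f.eval S = v →
      ((Term.get g (.add (.mul e (.var 0)) f)).Holds S ↔ G.Adj u v) := by
    intro u v hu hv
    unfold Term.Holds
    rw [Term.eval_get, Term.eval_add, Term.eval_mul he (fun i => by simp [Store.set_var])
      (by omega), hg, Term.eval_var, hn, hu, hv, encodeGraph_ne_zero_iff]
  constructor
  · rintro ⟨h1, h2, h3⟩
    exact ⟨⟨_, h1⟩, ⟨_, h2⟩, rfl, rfl, (key ⟨_, h1⟩ ⟨_, h2⟩ rfl rfl).1 h3⟩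
  · rintro ⟨u, v, hu, hv, h⟩
    exact ⟨by omega, by omega, (key u v hu hv).2 h⟩

end Program


section Program

variable {n : ℕ} {G₁ G₂ G : SimpleGraph (Fin n)} {π₀ : Fin n → Option (Fin n)} {m ℓ : ℕ}
  {ρ : Equiv.Perm (Fin n)} {S S' : Store}

/-! ### Distances -/

open Term Cmd in
/-- One round of breadth-first search, in which the vertices at distance `S.var 6 + 1` are found. -/
def bfsRound (g d : ℕ) : Cmd :=
  map d 20 <| ite (conj (eq (get d (var 20)) (add (var 3) (num 1)))
      (ex 21 (conj (eq (get d (var 21)) (var 6)) (adjTerm g (var 21) (var 20)))))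
    (add (var 6) (num 1)) (get d (var 20))

open Term Cmd in
/-- Breadth-first search in the graph `g` from the vertex in the variable `r`; the distances are
written into the array `d`. -/
def bfs (g d r : ℕ) : Cmd :=
  seq (map d 20 (ite (eq (var 20) (var r)) (num 0) (add (var 3) (num 1))))
    (rep 6 (bfsRound g d))

/-- The array `d` holds the distances from `i`, as far as they are at most `N`. -/
def Distances (G : SimpleGraph (Fin n)) (i : Fin n) (N : ℕ) (d : ℕ → ℕ) : Prop :=
  ∀ v : Fin n, ∀ k ≤ N, d v = k ↔ G.edist i v = (k : ℕ)

/-- The recursion of breadth-first search: a vertex lies in the next sphere if it has not been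
reached before and has a neighbour in the current one. -/
lemma edist_eq_succ_iff {V : Type} {G : SimpleGraph V} {a v : V} {j : ℕ} :
    G.edist a v = (j + 1 : ℕ) ↔
      (∀ k ≤ j, G.edist a v ≠ (k : ℕ)) ∧ ∃ u, G.edist a u = (j : ℕ) ∧ G.Adj u v := by
  have hle : ∀ (w : V) (j : ℕ), G.edist a w ≤ (j : ℕ) ↔ ∃ k ≤ j, G.edist a w = (k : ℕ) := by
    intro w j
    constructor
    · intro h
      obtain ⟨d, hd⟩ := ENat.ne_top_iff_exists.1 (ne_top_of_le_ne_top (ENat.natCast_ne_top j) h)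
      rw [← hd] at h ⊢
      exact ⟨d, by exact_mod_cast h, rfl⟩
    · rintro ⟨k, hk, h⟩
      rw [h]
      exact_mod_cast hk
  constructor
  · intro h
    have hno : ∀ k ≤ j, G.edist a v ≠ (k : ℕ) := by
      intro k hk h'
      rw [h] at h'
      have : j + 1 = k := by exact_mod_cast h'
      omega
    refine ⟨hno, ?_⟩
    rcases edist_le_succ_iff.1 h.le with h1 | ⟨u, h1, h2⟩
    · obtain ⟨k, hk, h'⟩ := (hle v j).1 h1
      exact absurd h' (hno k hk)
    · refine ⟨u, ?_, h2⟩
      obtain ⟨k, hk, h'⟩ := (hle u j).1 h1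
      rcases hk.lt_or_eq with hk' | rfl
      · obtain ⟨j, rfl⟩ : ∃ j', j = j' + 1 := ⟨j - 1, by omega⟩
        have h3 : G.edist a v ≤ (j + 1 : ℕ) :=
          edist_le_succ_iff.2 (Or.inr ⟨u, by rw [h']; exact_mod_cast (by omega), h2⟩)
        rw [h] at h3
        have : j + 1 + 1 ≤ j + 1 := by exact_mod_cast h3
        omega
      · exact h'
  · rintro ⟨hno, u, h1, h2⟩
    have h3 : G.edist a v ≤ (j + 1 : ℕ) := edist_le_succ_iff.2 (Or.inr ⟨u, h1.le, h2⟩)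
    obtain ⟨k, hk, h'⟩ := (hle v (j + 1)).1 h3
    rcases hk.lt_or_eq with hk' | rfl
    · exact absurd h' (hno k (by omega))
    · exact h'

lemma distances_bfs {g d r : ℕ} {i : Fin n} (hg : g < 4) (hd : 4 ≤ d) (hr : r ≠ 20 ∧ r ≠ 6)
    (h : Input G₁ G₂ π₀ m ℓ ρ S) (hG : S.arr g = encodeGraph G) (hi : S.var r = i) :
    Distances G i (3 * n + 2) (((bfs g d r).denote S).arr d) := by
  classical
  set N := 3 * n + 2 with hN
  have hgd : g ≠ d := by omega
  -- After `j` rounds all distances up to `j` are recorded, and every other entry is the sentinel `N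
  -- + 1`, which is larger than any distance that is ever compared.
  let P : ℕ → Store → Prop := fun j R => Input G₁ G₂ π₀ m ℓ ρ R ∧ R.arr g = encodeGraph G ∧
    ∀ v : Fin n, (∀ k ≤ j, R.arr d v = k ↔ G.edist i v = (k : ℕ)) ∧
      (R.arr d v ≤ j ∨ R.arr d v = N + 1)
  have h0 : P 0 ((Cmd.map d 20 (.ite (.eq (.var 20) (.var r)) (.num 0)
      (.add (.var 3) (.num 1)))).denote S) := by
    refine ⟨h.setArr hd _, ?_, fun v => ?_⟩
    · simp only [Cmd.denote, Store.setArr_arr, if_neg hgd, hG]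
    · have hv : ((Cmd.map d 20 (.ite (.eq (.var 20) (.var r)) (.num 0)
          (.add (.var 3) (.num 1)))).denote S).arr d v = if v = i then 0 else N + 1 := by
        have hvN : (v : ℕ) < N := by omega
        simp [Cmd.denote, Store.setArr_arr, Store.set_var, h.size, hr.1, hi, hvN, Fin.ext_iff,
          ← hN]
      rw [hv]
      by_cases hvi : v = i
      · simp [hvi, eq_comm]
      · simp only [if_neg hvi]
        refine ⟨fun k hk => ?_, by simp⟩
        obtain rfl : k = 0 := by omega
        simp [SimpleGraph.edist_eq_zero_iff, Ne.symm hvi]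
  have hS : ((Cmd.map d 20 (.ite (.eq (.var 20) (.var r)) (.num 0)
      (.add (.var 3) (.num 1)))).denote S).var 3 = N := h.size
  obtain ⟨R, hR, hden⟩ := Cmd.denote_rep (x := 6) (c := bfsRound g d) h0 (by
    intro j hj R hR
    obtain ⟨hin, hgR, hR⟩ := hR
    have hin6 : Input G₁ G₂ π₀ m ℓ ρ (R.set 6 j) := hin.set (by norm_num) j
    refine ⟨hin6.setArr hd _, ?_, fun v => ?_⟩
    · simp only [bfsRound, Cmd.denote, Store.setArr_arr, if_neg hgd, Store.set_arr, hgR]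
    · have hvN : (v : ℕ) < N := by omega
      have hadj : ∀ w : ℕ, (adjTerm g (.var 21) (.var 20)).Holds
          (((R.set 6 j).set 20 v).set 21 w) ↔ ∃ u : Fin n, w = u ∧ G.Adj u v := by
        intro w
        rw [holds_adjTerm (G := G) (by simp [Store.set_var, hin.n_eq])
          (by simp [Store.set_var, hin.size]; omega) (by simpa using hgR)
          (fun i => by simp [Store.set_var])]
        simp only [Term.eval_var, Store.set_var]
        constructor
        · rintro ⟨u, v', h1, h2, h3⟩
          obtain rfl : v = v' := Fin.ext (by simpa using h2)
          exact ⟨u, by simpa using h1, h3⟩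
        · rintro ⟨u, h1, h3⟩
          exact ⟨u, v, by simpa using h1, by simp, h3⟩
      have hv : ((bfsRound g d).denote (R.set 6 j)).arr d v =
          if R.arr d v = N + 1 ∧ ∃ u : Fin n, R.arr d u = j ∧ G.Adj u v then j + 1
          else R.arr d v := by
        have hiff : (∃ w < N, R.arr d w = j ∧ ∃ u : Fin n, w = u ∧ G.Adj u v) ↔
            ∃ u : Fin n, R.arr d u = j ∧ G.Adj u v :=
          ⟨fun ⟨w, _, h1, u, h2, h3⟩ => ⟨u, h2 ▸ h1, h3⟩,
            fun ⟨u, h1, h3⟩ => ⟨u, by omega, h1, u, rfl, h3⟩⟩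
        have hcond : (Term.conj (.eq (.get d (.var 20)) (.add (.var 3) (.num 1)))
            (.ex 21 (.conj (.eq (.get d (.var 21)) (.var 6)) (adjTerm g (.var 21) (.var 20))))).Holds
            ((R.set 6 j).set 20 v) ↔
            R.arr d v = N + 1 ∧ ∃ u : Fin n, R.arr d u = j ∧ G.Adj u v := by
          rw [Term.holds_conj, Term.holds_ex, ← hiff]
          refine and_congr (by simp [Store.set_var, hin.size, hN]) ?_
          rw [show ((R.set 6 j).set 20 v).var 3 = N by simp [Store.set_var, hin.size, hN]]
          refine exists_congr fun w => and_congr_right fun _ => ?_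
          rw [Term.holds_conj, hadj]
          simp [Store.set_var]
        have hval : ((bfsRound g d).denote (R.set 6 j)).arr d v =
            Term.eval (.ite (.conj (.eq (.get d (.var 20)) (.add (.var 3) (.num 1)))
            (.ex 21 (.conj (.eq (.get d (.var 21)) (.var 6)) (adjTerm g (.var 21) (.var 20)))))
            (.add (.var 6) (.num 1)) (.get d (.var 20))) ((R.set 6 j).set 20 v) := by
          simp only [bfsRound, Cmd.denote, Store.setArr_arr, if_true]
          rw [if_pos (by rw [hin6.size]; exact hvN)]
        rw [hval, Term.eval_ite]
        refine if_congr hcond ?_ ?_ <;> simp [Store.set_var]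
      rw [hS] at hj
      have hex : (∃ u : Fin n, R.arr d u = j ∧ G.Adj u v) ↔
          ∃ u : Fin n, G.edist i u = (j : ℕ) ∧ G.Adj u v :=
        exists_congr fun u => and_congr_left fun _ => (hR u).1 j le_rfl
      obtain ⟨h1, h2⟩ := hR v
      have hfar : R.arr d v = N + 1 ↔ ∀ k ≤ j, G.edist i v ≠ (k : ℕ) := by
        constructor
        · intro h3 k hk hk'
          rw [← h1 k hk] at hk'
          omega
        · intro h3
          refine h2.resolve_left fun h4 => ?_
          exact h3 _ h4 ((h1 _ h4).1 rfl)
      rw [hv]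
      split_ifs with hc <;> rw [hfar, hex, ← edist_eq_succ_iff] at hc
      · refine ⟨fun k hk => ?_, Or.inl le_rfl⟩
        rw [hc]
        exact ⟨fun h => by rw [h], fun h => by exact_mod_cast h⟩
      · refine ⟨fun k hk => ?_, by omega⟩
        rcases hk.lt_or_eq with hk' | rfl
        · exact h1 k (by omega)
        · simp only [hc, iff_false]
          omega)
  change Distances G i N (((Cmd.rep 6 (bfsRound g d)).denote _).arr d)
  rw [hden, Store.set_arr]
  rw [hS] at hR
  exact fun v k hk => (hR.2.2 v).1 k hk

end Program


section Program

variable {n : ℕ} {G₁ G₂ G : SimpleGraph (Fin n)} {π₀ : Fin n → Option (Fin n)} {m ℓ : ℕ}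
  {ρ : Equiv.Perm (Fin n)} {S S' : Store} {i₂ i₁ : Fin n}

/-! ### The auction -/

open Term in
/-- The number in the variable `x` stands for a token. -/
def tokenTerm (x : ℕ) : Term :=
  conj (le (add (var 0) (var 0)) (var x)) (lt (var x) (add (add (var 0) (var 0)) (var 1)))

open Term in
/-- The number in the variable `x` stands for a vertex of the first graph. -/
def oneTerm (x : ℕ) : Term := conj (le (var 0) (var x)) (lt (var x) (add (var 0) (var 0)))

open Term in
/-- The moves, in terms of the distances stored in the arrays `5` and `6`. -/
def moveTerm (x y : ℕ) : Term :=
  disj (conj (tokenTerm x) (conj (lt (var y) (var 0)) (eq (get 5 (var y)) (num 1)))) <|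
  disj (conj (adjTerm 1 (var x) (var y)) (conj (le (num 1) (get 5 (var x)))
    (conj (lt (get 5 (var x)) (var 2)) (eq (get 5 (var y)) (add (get 5 (var x)) (num 1)))))) <|
  disj (conj (lt (var x) (var 0)) (conj (oneTerm y)
    (conj (eq (add (get 2 (var x)) (var 0)) (add (var y) (num 1)))
    (conj (eq (get 5 (var x)) (var 2)) (eq (get 6 (sub (var y) (var 0))) (var 2)))))) <|
  disj (conj (conj (oneTerm x) (oneTerm y))
    (conj (adjTerm 0 (sub (var x) (var 0)) (sub (var y) (var 0)))
    (conj (le (num 1) (get 6 (sub (var y) (var 0))))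
    (conj (lt (get 6 (sub (var y) (var 0))) (var 2))
    (eq (get 6 (sub (var x) (var 0))) (add (get 6 (sub (var y) (var 0))) (num 1))))))) <|
  disj (conj (oneTerm x) (conj (eq (get 6 (sub (var x) (var 0))) (num 1)) (tokenTerm y))) <|
  conj (eq (var x) (var y))
    (disj (lt (var x) (add (var 0) (var 0))) (le (add (add (var 0) (var 0)) (var 1)) (var x)))

/-- Input and distances are in place. -/
structure Ready (G₁ G₂ : SimpleGraph (Fin n)) (π₀ : Fin n → Option (Fin n)) (m ℓ : ℕ)
    (ρ : Equiv.Perm (Fin n)) (i₂ i₁ : Fin n) (S : Store) : Prop where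
  input : Input G₁ G₂ π₀ m ℓ ρ S
  two : Distances G₂ i₂ (3 * n + 2) (S.arr 5)
  one : Distances G₁ i₁ (3 * n + 2) (S.arr 6)

lemma Ready.set (h : Ready G₁ G₂ π₀ m ℓ ρ i₂ i₁ S) {x : ℕ} (hx : 4 ≤ x) (v : ℕ) :
    Ready G₁ G₂ π₀ m ℓ ρ i₂ i₁ (S.set x v) := ⟨h.input.set hx v, h.two, h.one⟩

lemma Ready.setArr (h : Ready G₁ G₂ π₀ m ℓ ρ i₂ i₁ S) {a : ℕ} (ha : 7 ≤ a) (f : ℕ → ℕ) :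
    Ready G₁ G₂ π₀ m ℓ ρ i₂ i₁ (S.setArr a f) := by
  refine ⟨h.input.setArr (by omega) f, ?_, ?_⟩
  · rw [Store.setArr_arr, if_neg (by omega)]; exact h.two
  · rw [Store.setArr_arr, if_neg (by omega)]; exact h.one

lemma exists_distance_iff {i : Fin n} {d : ℕ → ℕ} (h : Distances G i (3 * n + 2) d) (hℓ : ℓ < n)
    {u v : Fin n} : (1 ≤ d u ∧ d u < ℓ ∧ d v = d u + 1) ↔
      ∃ t : ℕ, 1 ≤ t ∧ t < ℓ ∧ G.edist i u = (t : ℕ) ∧ G.edist i v = (t + 1 : ℕ) := by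
  constructor
  · rintro ⟨h1, h2, h3⟩
    exact ⟨d u, h1, h2, (h u _ (by omega)).1 rfl, (h v _ (by omega)).1 h3⟩
  · rintro ⟨t, h1, h2, h3, h4⟩
    rw [← h u t (by omega)] at h3
    rw [← h v (t + 1) (by omega)] at h4
    omega

/-- The stored distances are exact up to `3 * n + 2`, and `ℓ < n` keeps every distance that occurs
in a move within this range. The variable `x` must differ from `50`, which is bound by the product
inside `adjTerm`. -/
lemma holds_moveTerm (h : Ready G₁ G₂ π₀ m ℓ ρ i₂ i₁ S) (hℓ : ℓ < n) {x y : ℕ} (hx : x ≠ 50) :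
    (moveTerm x y).Holds S ↔ Move G₁ G₂ π₀ m ℓ i₂ i₁ (S.var x) (S.var y) := by
  have hin := h.input
  unfold moveTerm Move
  simp only [Term.holds_disj]
  refine or_congr ?_ (or_congr ?_ (or_congr ?_ (or_congr ?_ (or_congr ?_ ?_))))
  · simp only [tokenTerm, Term.holds_conj, Term.holds_lt, Term.holds_le, Term.holds_eq,
      Term.eval_get, Term.eval_add, Term.eval_var, Term.eval_num, hin.n_eq, hin.m_eq]
    constructor
    · rintro ⟨⟨h1, h2⟩, h3, h4⟩
      exact ⟨⟨S.var x - 2 * n, by omega⟩, ⟨S.var y, h3⟩, by simp; omega, rfl,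
        (h.two ⟨S.var y, h3⟩ 1 (by omega)).1 h4⟩
    · rintro ⟨k, v, h1, h2, h3⟩
      rw [← h.two v 1 (by omega)] at h3
      rw [h1, h2]
      exact ⟨by omega, by omega, h3⟩
  · simp only [Term.holds_conj]
    rw [holds_adjTerm (G := G₂) hin.n_eq (by rw [hin.size]; omega) hin.two
      (fun i => by simp [Store.set_var, hx])]
    simp only [Term.holds_lt, Term.holds_le, Term.holds_eq,
      Term.eval_get, Term.eval_add, Term.eval_var, Term.eval_num, hin.ℓ_eq]
    constructor
    · rintro ⟨⟨u, v, hu, hv, hadj⟩, h1⟩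
      rw [hu, hv, exists_distance_iff h.two hℓ] at h1
      exact ⟨u, v, hu, hv, hadj, h1⟩
    · rintro ⟨u, v, hu, hv, hadj, h1⟩
      rw [← exists_distance_iff h.two hℓ] at h1
      rw [hu, hv]
      exact ⟨⟨u, v, rfl, rfl, hadj⟩, h1⟩
  · simp only [oneTerm, Term.holds_conj, Term.holds_lt, Term.holds_le, Term.holds_eq,
      Term.eval_get, Term.eval_add, Term.eval_sub, Term.eval_var, Term.eval_num, hin.n_eq,
      hin.ℓ_eq, hin.seeds]
    constructor
    · rintro ⟨h1, ⟨h2, h3⟩, h4, h5, h6⟩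
      -- The seed array stores the image plus one, and vertices of the first graph are shifted by
      -- `n`; the tested equation accounts for both shifts.
      obtain ⟨v, hv, hs⟩ := (encodeSeeds_eq_succ_iff (π₀ := π₀) (u := ⟨S.var x, h1⟩)
        (k := S.var y - n)).1 (by simp only; omega)
      refine ⟨⟨S.var x, h1⟩, v, rfl, by omega, hs, (h.two ⟨S.var x, h1⟩ ℓ (by omega)).1 h5, ?_⟩
      rw [hv] at h6
      exact (h.one v ℓ (by omega)).1 h6
    · rintro ⟨u, v, h1, h2, h3, h4, h5⟩
      rw [← h.two u ℓ (by omega)] at h4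
      rw [← h.one v ℓ (by omega)] at h5
      have hs := (encodeSeeds_eq_succ_iff (π₀ := π₀) (u := u) (k := v)).2 ⟨v, rfl, h3⟩
      rw [h1, h2, show n + (v : ℕ) - n = v by omega]
      exact ⟨by omega, by omega, by omega, h4, h5⟩
  · simp only [Term.holds_conj]
    rw [holds_adjTerm (G := G₁) hin.n_eq (by rw [hin.size]; omega) hin.one
      (fun i => by simp [Store.set_var, hx])]
    simp only [oneTerm, Term.holds_conj, Term.holds_lt, Term.holds_le, Term.holds_eq,
      Term.eval_get, Term.eval_add, Term.eval_sub, Term.eval_var, Term.eval_num, hin.n_eq,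
      hin.ℓ_eq]
    constructor
    · rintro ⟨⟨⟨h1, h2⟩, h3, h4⟩, ⟨u, v, hu, hv, hadj⟩, h5⟩
      rw [hu, hv, exists_distance_iff h.one hℓ] at h5
      obtain ⟨t, t1, t2, t3, t4⟩ := h5
      exact ⟨u, v, by omega, by omega, hadj, t, t1, t2, t4, t3⟩
    · rintro ⟨u, v, hu, hv, hadj, t, t1, t2, t3, t4⟩
      have h5 := (exists_distance_iff h.one hℓ).2 ⟨t, t1, t2, t4, t3⟩
      rw [hu, hv, show n + (v : ℕ) - n = v by omega, show n + (u : ℕ) - n = u by omega]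
      exact ⟨by omega, ⟨u, v, rfl, rfl, hadj⟩, h5⟩
  · simp only [tokenTerm, oneTerm, Term.holds_conj, Term.holds_lt, Term.holds_le, Term.holds_eq,
      Term.eval_get, Term.eval_add, Term.eval_sub, Term.eval_var, Term.eval_num, hin.n_eq, hin.m_eq]
    constructor
    · rintro ⟨⟨h1, h2⟩, h3, h4, h5⟩
      refine ⟨⟨S.var x - n, by omega⟩, ⟨S.var y - 2 * n, by omega⟩, by simp; omega, by simp; omega,
        (h.one ⟨S.var x - n, by omega⟩ 1 (by omega)).1 h3⟩
    · rintro ⟨u, k, h1, h2, h3⟩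
      rw [← h.one u 1 (by omega)] at h3
      rw [h1, h2, show n + (u : ℕ) - n = u by omega]
      exact ⟨by omega, h3, by omega⟩
  · simp only [Term.holds_conj, Term.holds_disj, Term.holds_lt, Term.holds_le, Term.holds_eq,
      Term.eval_add, Term.eval_var, hin.n_eq, hin.m_eq]
    omega

open Term Cmd in
/-- The choice of the bidder, of the least price and of the object. -/
def bidChoice : Cmd :=
  seq (assign 10 (mu 20 21 (neg (ex 22 (eq (get 7 (var 22)) (add (var 20) (num 1))))))) <|
  seq (assign 11 (mu 20 21 (ex 22 (conj (moveTerm 10 22) (eq (get 8 (var 22)) (var 20)))))) <|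
  assign 12 (mu 20 21 (conj (lt (var 10) (var 3)) (conj (lt (var 11) (var 3))
    (conj (moveTerm 10 20) (eq (get 8 (var 20)) (var 11))))))

open Term Cmd in
/-- One round of the auction. -/
def auctionRound : Cmd :=
  seq bidChoice <|
  seq (map 7 20 (ite (eq (var 20) (var 12)) (add (var 10) (num 1)) (get 7 (var 20)))) <|
  map 8 20 (ite (eq (var 20) (var 12)) (add (get 8 (var 20)) (num 1)) (get 8 (var 20)))

/-- A failed search returns the loop bound `3 * n + 2`. The three searches for bidder, price and
object are chained so that this value of `b` signals that no bid is possible. -/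
lemma bidChoice_spec (h : Ready G₁ G₂ π₀ m ℓ ρ i₂ i₁ S) (hℓ : ℓ < n) :
    ∃ a v b, bidChoice.denote S = ((S.set 10 a).set 11 v).set 12 b ∧
      ((a < 3 * n + 2 → ∀ c < 3 * n + 2, S.arr 7 c ≠ a + 1) ∧
        ∀ w < a, ∃ c < 3 * n + 2, S.arr 7 c = w + 1) ∧ a ≤ 3 * n + 2 ∧
      (∀ w < v, ¬ ∃ c < 3 * n + 2, Move G₁ G₂ π₀ m ℓ i₂ i₁ a c ∧ S.arr 8 c = w) ∧
      (v < 3 * n + 2 → ∃ c < 3 * n + 2, Move G₁ G₂ π₀ m ℓ i₂ i₁ a c ∧ S.arr 8 c = v) ∧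
      v ≤ 3 * n + 2 ∧
      (b < 3 * n + 2 → a < 3 * n + 2 ∧ v < 3 * n + 2 ∧ Move G₁ G₂ π₀ m ℓ i₂ i₁ a b ∧
        S.arr 8 b = v) ∧
      (∀ c < b, ¬ (a < 3 * n + 2 ∧ v < 3 * n + 2 ∧ Move G₁ G₂ π₀ m ℓ i₂ i₁ a c ∧
        S.arr 8 c = v)) ∧ b ≤ 3 * n + 2 := by
  have hN := h.input.size
  set e₁ := Term.mu 20 21
    (.neg (.ex 22 (.eq (.get 7 (.var 22)) (.add (.var 20) (.num 1))))) with he₁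
  set e₂ := Term.mu 20 21
    (.ex 22 (.conj (moveTerm 10 22) (.eq (.get 8 (.var 22)) (.var 20)))) with he₂
  set e₃ := Term.mu 20 21 (.conj (.lt (.var 10) (.var 3)) (.conj (.lt (.var 11) (.var 3))
    (.conj (moveTerm 10 20) (.eq (.get 8 (.var 20)) (.var 11))))) with he₃
  set a := e₁.eval S with ha
  set S₁ := S.set 10 a with hS₁
  set v := e₂.eval S₁ with hv
  set S₂ := S₁.set 11 v with hS₂
  set b := e₃.eval S₂ with hb
  have r₁ : Ready G₁ G₂ π₀ m ℓ ρ i₂ i₁ S₁ := h.set (by norm_num) a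
  have r₂ : Ready G₁ G₂ π₀ m ℓ ρ i₂ i₁ S₂ := r₁.set (by norm_num) v
  obtain ⟨p1, p2, p3⟩ := Term.eval_mu (S := S) (x := 20) (y := 21)
    (e := .neg (.ex 22 (.eq (.get 7 (.var 22)) (.add (.var 20) (.num 1)))))
    (P := fun w => ¬ ∃ c < 3 * n + 2, S.arr 7 c = w + 1) (by norm_num) (by norm_num)
    (fun _ w => by simp [Store.set_var, hN])
  obtain ⟨q1, q2, q3⟩ := Term.eval_mu (S := S₁) (x := 20) (y := 21)
    (e := .ex 22 (.conj (moveTerm 10 22) (.eq (.get 8 (.var 22)) (.var 20))))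
    (P := fun w => ∃ c < 3 * n + 2, Move G₁ G₂ π₀ m ℓ i₂ i₁ a c ∧ S.arr 8 c = w)
    (by norm_num) (by norm_num) (fun t w => by
      rw [Term.holds_ex]
      have h3 : ((S₁.set 21 t).set 20 w).var 3 = 3 * n + 2 := by simp [Store.set_var, r₁.input.size]
      rw [h3]
      refine exists_congr fun c => and_congr_right fun _ => ?_
      rw [Term.holds_conj, holds_moveTerm (((r₁.set (by norm_num) t).set (by norm_num) w).set
        (by norm_num) c) hℓ (by norm_num)]
      simp [Store.set_var, hS₁])
  obtain ⟨s1, s2, s3⟩ := Term.eval_mu (S := S₂) (x := 20) (y := 21)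
    (e := .conj (.lt (.var 10) (.var 3)) (.conj (.lt (.var 11) (.var 3))
      (.conj (moveTerm 10 20) (.eq (.get 8 (.var 20)) (.var 11)))))
    (P := fun c => a < 3 * n + 2 ∧ v < 3 * n + 2 ∧ Move G₁ G₂ π₀ m ℓ i₂ i₁ a c ∧ S.arr 8 c = v)
    (by norm_num) (by norm_num) (fun t w => by
      simp only [Term.holds_conj]
      rw [holds_moveTerm ((r₂.set (by norm_num) t).set (by norm_num) w) hℓ (by norm_num)]
      simp [Store.set_var, hS₁, hS₂, hN])
  rw [hN] at p1 p2
  rw [r₁.input.size] at q1 q2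
  rw [r₂.input.size] at s1 s2
  refine ⟨a, v, b, rfl, ⟨fun ha' c hc hc' => p2 ha' ⟨c, hc, hc'⟩,
    fun w hw => not_not.1 (p3 w hw)⟩, p1, q3, q2, q1, s2, s3, s1⟩

/-- If `b` is in range, the round is a legal bid. Otherwise the updates touch no entry below the
bound, and either nobody is free or the chosen bidder is priced out. -/
lemma auctionRound_spec (h : Ready G₁ G₂ π₀ m ℓ ρ i₂ i₁ S) (hℓ : ℓ < n) {t : ℕ}
    (ha : AuctionState (3 * n + 2) (Move G₁ G₂ π₀ m ℓ i₂ i₁) t (S.arr 7) (S.arr 8)) :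
    Ready G₁ G₂ π₀ m ℓ ρ i₂ i₁ (auctionRound.denote S) ∧
      AuctionState (3 * n + 2) (Move G₁ G₂ π₀ m ℓ i₂ i₁) (t + 1)
        ((auctionRound.denote S).arr 7) ((auctionRound.denote S).arr 8) := by
  obtain ⟨a, v, b, hden, ⟨a1, a2⟩, a3, v1, v2, v3, b1, b2, b3⟩ := bidChoice_spec h hℓ
  have hN := h.input.size
  set R := bidChoice.denote S with hR
  have hRr : Ready G₁ G₂ π₀ m ℓ ρ i₂ i₁ R := by
    rw [hden]
    exact ((h.set (by norm_num) a).set (by norm_num) v).set (by norm_num) b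
  have hR7 : R.arr 7 = S.arr 7 := by rw [hden]; rfl
  have hR8 : R.arr 8 = S.arr 8 := by rw [hden]; rfl
  have hR10 : R.var 10 = a := by simp [hden, Store.set_var]
  have hR12 : R.var 12 = b := by simp [hden, Store.set_var]
  have ho : ∀ c < 3 * n + 2, (auctionRound.denote S).arr 7 c =
      if c = b then a + 1 else S.arr 7 c := by
    intro c hc
    simp only [auctionRound, Cmd.denote, ← hR, Store.setArr_arr]
    simp [Store.set_var, hRr.input.size, hc, hR12, hR10, hR7]
  have hp : ∀ c < 3 * n + 2, (auctionRound.denote S).arr 8 c =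
      if c = b then S.arr 8 c + 1 else S.arr 8 c := by
    intro c hc
    simp only [auctionRound, Cmd.denote, ← hR, Store.setArr_arr]
    simp [Store.set_var, Store.setArr_arr, hRr.input.size, hc, hR12, hR8]
  refine ⟨(hRr.setArr (by norm_num) _).setArr (by norm_num) _, ?_⟩
  rcases b3.lt_or_eq with hb | hb
  · obtain ⟨c1, c2, c3, c4⟩ := b1 hb
    refine ha.bid ⟨a, c1, b, hb, a1 c1, c3, by omega, fun c hc hac => ?_, ho, fun c hc => ?_⟩
    · by_contra hlt
      exact v1 (S.arr 8 c) (by omega) ⟨c, hc, hac, rfl⟩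
    · rw [hp c hc]
      split_ifs with hcb
      · rw [hcb]
      · rfl
  · refine ha.stay ?_ (fun c hc => ?_) (fun c hc => ?_)
    -- A bidder below the bound without an object to bid for has only allowed objects of price at
    -- least `3 * n + 2`; a bidder equal to the bound means that everyone is served.
    · rcases a3.lt_or_eq with ha' | ha'
      · refine Or.inr ⟨a, ha', a1 ha', fun c hc hac => ?_⟩
        by_contra hlt
        have hv : v < 3 * n + 2 := by
          by_contra hv
          exact v1 (S.arr 8 c) (by omega) ⟨c, hc, hac, rfl⟩
        obtain ⟨c', hc', e1, e2⟩ := v2 hv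
        exact b2 c' (by omega) ⟨ha', hv, e1, e2⟩
      · exact Or.inl fun w hw => a2 w (by omega)
    · rw [ho c hc, if_neg (by omega)]
    · rw [hp c hc, if_neg (by omega)]

/-- Repeating a command that advances a counter. -/
lemma rep_advance {Q : ℕ → Store → Prop} {x k N : ℕ} {c : Cmd} (hQ3 : ∀ t R, Q t R → R.var 3 = N)
    (hset : ∀ t R v, Q t R → Q t (R.set x v)) (hc : ∀ t R, Q t R → Q (t + k) (c.denote R))
    {t : ℕ} (hS : Q t S) : Q (t + N * k) ((Cmd.rep x c).denote S) := by
  obtain ⟨R, hR, hden⟩ := Cmd.denote_rep (x := x) (c := c) (S := S)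
    (P := fun i R => Q (t + i * k) R) (by simpa using hS) (fun i _ R hR => by
      have := hc _ _ (hset _ _ i hR)
      rwa [show t + i * k + k = t + (i + 1) * k by ring] at this)
  rw [hden]
  rw [hQ3 t S hS] at hR
  exact hset _ _ _ hR

open Term Cmd in
/-- The auction for the moves between the arrays `5` and `6`; the owners are in the array `7`. -/
def auction : Cmd :=
  seq (map 7 20 (num 0)) <| seq (map 8 20 (num 0)) <| rep 7 (rep 8 (rep 9 auctionRound))

/-- Three nested loops of length N = 3n+2 perform N³ rounds, more than the N² that settle the
auction. -/
lemma auction_spec (h : Ready G₁ G₂ π₀ m ℓ ρ i₂ i₁ S) (hℓ : ℓ < n) :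
    AllAssigned (3 * n + 2) ((auction.denote S).arr 7) ↔
      HasPerm (3 * n + 2) (Move G₁ G₂ π₀ m ℓ i₂ i₁) := by
  let Q : ℕ → Store → Prop := fun t R => Ready G₁ G₂ π₀ m ℓ ρ i₂ i₁ R ∧
    AuctionState (3 * n + 2) (Move G₁ G₂ π₀ m ℓ i₂ i₁) t (R.arr 7) (R.arr 8)
  have hQ3 : ∀ t R, Q t R → R.var 3 = 3 * n + 2 := fun t R hR => hR.1.input.size
  have hset : ∀ x, 4 ≤ x → ∀ t R v, Q t R → Q t (R.set x v) := fun x hx t R v hR =>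
    ⟨hR.1.set hx v, hR.2⟩
  have h1 : ∀ t R, Q t R → Q (t + 1) (auctionRound.denote R) := fun t R hR =>
    auctionRound_spec hR.1 hℓ hR.2
  have h2 := fun t R (hR : Q t R) => rep_advance hQ3 (hset 9 (by norm_num)) h1 hR
  have h3 := fun t R (hR : Q t R) => rep_advance hQ3 (hset 8 (by norm_num)) h2 hR
  have h4 := fun t R (hR : Q t R) => rep_advance hQ3 (hset 7 (by norm_num)) h3 hR
  have h0 : Q 0 ((Cmd.map 8 20 (.num 0)).denote ((Cmd.map 7 20 (.num 0)).denote S)) := by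
    refine ⟨(h.setArr (by norm_num) _).setArr (by norm_num) _,
      auctionState_zero (fun c hc => ?_) (fun c hc => ?_)⟩
    · simp [Cmd.denote, Store.setArr_arr, h.input.size, hc]
    · simp [Cmd.denote, Store.setArr_arr, h.input.size, hc]
  refine (h4 0 _ h0).2.outcome ?_
  have : 1 * ((3 * n + 2) * (3 * n + 2)) < (3 * n + 2) * ((3 * n + 2) * (3 * n + 2)) :=
    Nat.mul_lt_mul_of_pos_right (by omega) (by positivity)
  simpa using this

end Program


section Program

variable {n : ℕ} {G₁ G₂ G : SimpleGraph (Fin n)} {π₀ : Fin n → Option (Fin n)} {m ℓ : ℕ}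
  {ρ : Equiv.Perm (Fin n)} {S S' : Store} {i₂ i₁ : Fin n}

/-! ### The matched pairs -/

open Term in
/-- Quantifiers over the vertices. -/
def exFin (x : ℕ) (e : Term) : Term := ex x (conj (lt (var x) (var 0)) e)

open Term in
def allFin (x : ℕ) (e : Term) : Term := neg (exFin x (neg e))

lemma holds_exFin (h : Input G₁ G₂ π₀ m ℓ ρ S) {x : ℕ} (hx : 4 ≤ x) {e : Term} :
    (exFin x e).Holds S ↔ ∃ u : Fin n, e.Holds (S.set x u) := by
  have hx0 : 0 ≠ x := by omega
  simp only [exFin, Term.holds_ex, Term.holds_conj, Term.holds_lt, Term.eval_var, Store.set_var,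
    if_neg hx0, if_true, h.n_eq, h.size]
  exact ⟨fun ⟨i, _, h1, h2⟩ => ⟨⟨i, h1⟩, h2⟩, fun ⟨u, h2⟩ => ⟨u, by omega, u.2, h2⟩⟩

lemma holds_allFin (h : Input G₁ G₂ π₀ m ℓ ρ S) {x : ℕ} (hx : 4 ≤ x) {e : Term} :
    (allFin x e).Holds S ↔ ∀ u : Fin n, e.Holds (S.set x u) := by
  simp [allFin, holds_exFin h hx]

open Term in
/-- The condition for matching the pair in the variables `4` and `5` in the first step. -/
def pairTerm : Term :=
  conj (eq (get 2 (var 4)) (num 0)) <|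
  conj (allFin 20 (neg (eq (get 2 (var 20)) (add (var 5) (num 1))))) <|
  disj (eq (var 1) (num 0)) <|
  conj (le (num 1) (var 2)) <| conj (lt (var 2) (var 0)) <| conj (le (var 1) (var 0)) <|
  all 20 (ex 21 (eq (get 7 (var 21)) (add (var 20) (num 1))))

/-- For m > 0 a match forces 1 ≤ ℓ < n and m ≤ n. These tests come with the auction, whose result is
meaningless otherwise, and they make the running time independent of m and ℓ; m = 0 needs no paths
at all. -/
lemma holds_pairTerm (h : Input G₁ G₂ π₀ m ℓ ρ S) (h4 : S.var 4 = i₂) (h5 : S.var 5 = i₁)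
    (hperm : ℓ < n → (AllAssigned (3 * n + 2) (S.arr 7) ↔
      HasPerm (3 * n + 2) (Move G₁ G₂ π₀ m ℓ i₂ i₁))) :
    pairTerm.Holds S ↔ HighDegreeMatch G₁ G₂ π₀ m ℓ i₂ i₁ := by
  have e1 : (Term.eq (.get 2 (.var 4)) (.num 0)).Holds S ↔ π₀ i₂ = none := by
    simp [h.seeds, h4, encodeSeeds_eq_zero_iff]
  have e2 : (allFin 20 (.neg (.eq (.get 2 (.var 20)) (.add (.var 5) (.num 1))))).Holds S ↔
      ∀ j, π₀ j ≠ some i₁ := by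
    rw [holds_allFin h (by norm_num)]
    refine forall_congr' fun j => ?_
    rw [Term.holds_neg]
    refine not_congr ?_
    simp only [Term.holds_eq, Term.eval_get, Term.eval_add, Term.eval_var, Term.eval_num,
      Store.set_var, Store.set_arr, h.seeds]
    rw [if_pos trivial, if_neg (by norm_num), h5, encodeSeeds_eq_succ_iff]
    exact ⟨fun ⟨v, hv, hj⟩ => by rw [hj, Fin.ext hv], fun hj => ⟨i₁, rfl, hj⟩⟩
  have e3 : (Term.all 20 (.ex 21 (.eq (.get 7 (.var 21)) (.add (.var 20) (.num 1))))).Holds S ↔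
      AllAssigned (3 * n + 2) (S.arr 7) := by
    simp [AllAssigned, Store.set_var, h.size]
  unfold pairTerm
  simp only [Term.holds_conj, Term.holds_disj, e1, e2, e3]
  simp only [Term.holds_eq, Term.holds_le, Term.holds_lt, Term.eval_var, Term.eval_num, h.n_eq,
    h.m_eq, h.ℓ_eq]
  rcases Nat.eq_zero_or_pos m with rfl | hm
  · rw [highDegreeMatch_zero]
    simp
  · constructor
    · rintro ⟨h1, h2, h3 | ⟨h3, h4, h5, h6⟩⟩
      · omega
      · rw [highDegreeMatch_iff_hasPerm (N := 3 * n + 2) (by omega) h3]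
        exact ⟨h1, h2, (hperm h4).1 h6⟩
    · intro hH
      obtain ⟨h3, h4, h5⟩ := hH.bounds hm
      rw [highDegreeMatch_iff_hasPerm (N := 3 * n + 2) (by omega) h3] at hH
      exact ⟨hH.1, hH.2.1, Or.inr ⟨h3, h4, h5, (hperm h4).2 hH.2.2⟩⟩

open Term Cmd in
/-- Distances and auction for the pair in the variables `4` and `5`. -/
def pairPrepare : Cmd := seq (seq (bfs 1 5 4) (bfs 0 6 5)) auction

open Term Cmd in
/-- The first step for the pair in the variables `4` and `5`. -/
def pairBody : Cmd :=
  seq pairPrepare (write 9 (add (mul (var 4) (var 3)) (var 5)) pairTerm)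

lemma Input.denote (h : Input G₁ G₂ π₀ m ℓ ρ S) {c : Cmd}
    (hv : (c.keeps 0 && c.keeps 1 && c.keeps 2 && c.keeps 3) = true)
    (ha : (c.keepsArr 0 && c.keepsArr 1 && c.keepsArr 2 && c.keepsArr 3) = true) :
    Input G₁ G₂ π₀ m ℓ ρ (c.denote S) := by
  simp only [Bool.and_eq_true] at hv ha
  refine h.congr (fun x hx => ?_) (fun a hx => ?_)
  · interval_cases x
    exacts [Cmd.denote_var_of_keeps hv.1.1.1 S, Cmd.denote_var_of_keeps hv.1.1.2 S,
      Cmd.denote_var_of_keeps hv.1.2 S, Cmd.denote_var_of_keeps hv.2 S]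
  · interval_cases a
    exacts [Cmd.denote_arr_of_keepsArr ha.1.1.1 S, Cmd.denote_arr_of_keepsArr ha.1.1.2 S,
      Cmd.denote_arr_of_keepsArr ha.1.2 S, Cmd.denote_arr_of_keepsArr ha.2 S]

lemma pairPrepare_spec (h : Input G₁ G₂ π₀ m ℓ ρ S) (h4 : S.var 4 = i₂) (h5 : S.var 5 = i₁)
    (hℓ : ℓ < n) : AllAssigned (3 * n + 2) ((pairPrepare.denote S).arr 7) ↔
      HasPerm (3 * n + 2) (Move G₁ G₂ π₀ m ℓ i₂ i₁) := by
  set S₁ := (bfs 1 5 4).denote S with hS₁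
  have hin₁ : Input G₁ G₂ π₀ m ℓ ρ S₁ := h.denote rfl rfl
  have d₂ : Distances G₂ i₂ (3 * n + 2) (S₁.arr 5) :=
    distances_bfs (by norm_num) (by norm_num) (by norm_num) h h.two h4
  have h5' : S₁.var 5 = i₁ := (Cmd.denote_var_of_keeps rfl S).trans h5
  have d₁ : Distances G₁ i₁ (3 * n + 2) (((bfs 0 6 5).denote S₁).arr 6) :=
    distances_bfs (by norm_num) (by norm_num) (by norm_num) hin₁ hin₁.one h5'
  refine auction_spec (S := (bfs 0 6 5).denote S₁) ⟨hin₁.denote rfl rfl, ?_, d₁⟩ hℓ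
  rw [Cmd.denote_arr_of_keepsArr rfl]
  exact d₂

lemma pairBody_spec (h : Input G₁ G₂ π₀ m ℓ ρ S) (h4 : S.var 4 ≤ 3 * n + 2) :
    ∃ val, (pairBody.denote S).arr 9 =
        Function.update (S.arr 9) (S.var 4 * (3 * n + 2) + S.var 5) val ∧
      ∀ i₂ i₁ : Fin n, S.var 4 = i₂ → S.var 5 = i₁ →
        (val ≠ 0 ↔ HighDegreeMatch G₁ G₂ π₀ m ℓ i₂ i₁) := by
  set R := pairPrepare.denote S with hR
  have hin : Input G₁ G₂ π₀ m ℓ ρ R := h.denote rfl rfl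
  have hR4 : R.var 4 = S.var 4 := Cmd.denote_var_of_keeps rfl S
  have hR5 : R.var 5 = S.var 5 := Cmd.denote_var_of_keeps rfl S
  have hR9 : R.arr 9 = S.arr 9 := Cmd.denote_arr_of_keepsArr rfl S
  refine ⟨pairTerm.eval R, ?_, fun i₂ i₁ e4 e5 => ?_⟩
  · simp only [pairBody, Cmd.denote, ← hR, Store.setArr_arr, if_true, hR9, Term.eval_add]
    rw [Term.eval_mul (fun i => by simp [Store.set_var]) (fun i => by simp [Store.set_var])
      (by rw [Term.eval_var, hR4, hin.size]; exact h4)]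
    simp only [Term.eval_var, hR4, hR5, hin.size]
  · exact holds_pairTerm hin (hR4.trans e4) (hR5.trans e5) (pairPrepare_spec h e4 e5)

/-- The first step has been carried out; its result is in the array `9`. -/
structure Paired (G₁ G₂ : SimpleGraph (Fin n)) (π₀ : Fin n → Option (Fin n)) (m ℓ : ℕ)
    (ρ : Equiv.Perm (Fin n)) (S : Store) : Prop where
  input : Input G₁ G₂ π₀ m ℓ ρ S
  iff : ∀ i₂ i₁ : Fin n, S.arr 9 ((i₂ : ℕ) * (3 * n + 2) + i₁) ≠ 0 ↔
    HighDegreeMatch G₁ G₂ π₀ m ℓ i₂ i₁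

lemma mul_add_eq_iff {N a b c d : ℕ} (hb : b < N) (hd : d < N) :
    a * N + b = c * N + d ↔ a = c ∧ b = d := by
  refine ⟨fun h => ?_, fun ⟨h1, h2⟩ => by rw [h1, h2]⟩
  have h1 : b = d := by
    have := congrArg (· % N) h
    simpa [Nat.mod_eq_of_lt hb, Nat.mod_eq_of_lt hd] using this
  subst h1
  exact ⟨Nat.eq_of_mul_eq_mul_right (by omega : 0 < N) (by omega), rfl⟩

/-- The loops run up to 3n+2 instead of n. Superfluous pairs write to addresses of their own,
because rows have length 3n+2 and both coordinates stay below it. -/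
lemma paired_rep (h : Input G₁ G₂ π₀ m ℓ ρ S) :
    Paired G₁ G₂ π₀ m ℓ ρ ((Cmd.rep 4 (Cmd.rep 5 pairBody)).denote S) := by
  set N := 3 * n + 2 with hN
  have inner : ∀ i < N, ∀ R, Input G₁ G₂ π₀ m ℓ ρ R →
      (∀ i₂ i₁ : Fin n, (i₂ : ℕ) < i → (R.arr 9 ((i₂ : ℕ) * N + i₁) ≠ 0 ↔
        HighDegreeMatch G₁ G₂ π₀ m ℓ i₂ i₁)) →
      ∀ i₂ i₁ : Fin n, (i₂ : ℕ) < i + 1 →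
        (((Cmd.rep 5 pairBody).denote (R.set 4 i)).arr 9 ((i₂ : ℕ) * N + i₁) ≠ 0 ↔
          HighDegreeMatch G₁ G₂ π₀ m ℓ i₂ i₁) := by
    intro i hi R hR hprev
    obtain ⟨R', hR', hden⟩ := Cmd.denote_rep (x := 5) (c := pairBody) (S := R.set 4 i)
      (P := fun j R' => Input G₁ G₂ π₀ m ℓ ρ R' ∧ R'.var 4 = i ∧
        ∀ i₂ i₁ : Fin n, (i₂ : ℕ) < i ∨ ((i₂ : ℕ) = i ∧ (i₁ : ℕ) < j) →
          (R'.arr 9 ((i₂ : ℕ) * N + i₁) ≠ 0 ↔ HighDegreeMatch G₁ G₂ π₀ m ℓ i₂ i₁))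
      ⟨hR.set (by norm_num) i, by simp [Store.set_var], fun i₂ i₁ hlt => hprev i₂ i₁ (by omega)⟩
      (by
        intro j hj T hT
        obtain ⟨t1, t2, t3⟩ := hT
        rw [(hR.set (by norm_num) i).size, ← hN] at hj
        have t1' : Input G₁ G₂ π₀ m ℓ ρ (T.set 5 j) := t1.set (by norm_num) j
        have e4 : (T.set 5 j).var 4 = i := by simp [Store.set_var, t2]
        have e5 : (T.set 5 j).var 5 = j := by simp [Store.set_var]
        refine ⟨t1'.denote rfl rfl, (Cmd.denote_var_of_keeps rfl _).trans e4,
          fun i₂ i₁ hlt => ?_⟩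
        obtain ⟨val, v1, v2⟩ := pairBody_spec t1' (by omega)
        rw [v1, e4, e5, ← hN]
        -- Either the entry has just been written, or it belongs to another pair and is unchanged.
        by_cases heq : (i₂ : ℕ) * N + i₁ = i * N + j
        · rw [heq, Function.update_self]
          rw [mul_add_eq_iff (by omega) hj] at heq
          exact v2 i₂ i₁ (by omega) (by omega)
        · rw [Function.update_of_ne heq]
          rw [mul_add_eq_iff (by omega) hj] at heq
          exact t3 i₂ i₁ (by omega))
    rw [hden]
    intro i₂ i₁ hlt
    refine hR'.2.2 i₂ i₁ ?_
    rw [(hR.set (by norm_num) i).size]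
    omega
  obtain ⟨R, hR, hden⟩ := Cmd.denote_rep (x := 4) (c := Cmd.rep 5 pairBody) (S := S)
    (P := fun i R => Input G₁ G₂ π₀ m ℓ ρ R ∧ ∀ i₂ i₁ : Fin n, (i₂ : ℕ) < i →
      (R.arr 9 ((i₂ : ℕ) * N + i₁) ≠ 0 ↔ HighDegreeMatch G₁ G₂ π₀ m ℓ i₂ i₁))
    ⟨h, fun _ _ hlt => absurd hlt (by omega)⟩
    (fun i hi R hR => by
      rw [h.size] at hi
      exact ⟨(hR.1.set (by norm_num) i).denote rfl rfl, inner i hi R hR.1 hR.2⟩)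
  rw [hden]
  rw [h.size] at hR
  exact ⟨hR.1.set (by norm_num) _, fun i₂ i₁ => hR.2 i₂ i₁ (by omega)⟩

lemma Paired.set (h : Paired G₁ G₂ π₀ m ℓ ρ S) {x : ℕ} (hx : 4 ≤ x) (v : ℕ) :
    Paired G₁ G₂ π₀ m ℓ ρ (S.set x v) := ⟨h.input.set hx v, h.iff⟩

open Term in
def matchedTerm (x y : ℕ) : Term :=
  disj (get 9 (add (mul (var x) (var 3)) (var y))) (eq (get 2 (var x)) (add (var y) (num 1)))

open Term in
def lowTerm (x y : ℕ) : Term :=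
  conj (neg (exFin 30 (matchedTerm x 30))) <| conj (neg (exFin 30 (matchedTerm 30 y))) <|
    exFin 30 <| exFin 31 <| conj (matchedTerm 30 31) <|
      conj (adjTerm 0 (var y) (var 31)) (adjTerm 1 (var x) (var 30))

def finalTerm (x y : ℕ) : Term := .disj (matchedTerm x y) (lowTerm x y)

lemma holds_matchedTerm (h : Paired G₁ G₂ π₀ m ℓ ρ S) {x y : ℕ} (hx : x ≠ 50) {u v : Fin n}
    (hu : S.var x = u) (hv : S.var y = v) :
    (matchedTerm x y).Holds S ↔ Matched G₁ G₂ π₀ m ℓ u v := by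
  unfold matchedTerm Matched
  rw [Term.holds_disj]
  refine or_congr ?_ ?_
  · rw [← h.iff u v]
    unfold Term.Holds
    rw [Term.eval_get, Term.eval_add, Term.eval_mul (fun i => by simp [Store.set_var, hx])
      (fun i => by simp [Store.set_var]) (by rw [Term.eval_var, hu, h.input.size]; omega)]
    simp only [Term.eval_var, hu, hv, h.input.size]
  · simp only [Term.holds_eq, Term.eval_get, Term.eval_add, Term.eval_var, Term.eval_num, hu, hv,
      h.input.seeds, encodeSeeds_eq_succ_iff]
    exact ⟨fun ⟨w, hw, hj⟩ => by rw [hj, Fin.ext hw], fun hj => ⟨v, rfl, hj⟩⟩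

lemma holds_adjTerm_var {g : ℕ} (h : Input G₁ G₂ π₀ m ℓ ρ S) (hg : S.arr g = encodeGraph G)
    {x y : ℕ} (hx : x ≠ 50) {u v : Fin n} (hu : S.var x = u) (hv : S.var y = v) :
    (adjTerm g (.var x) (.var y)).Holds S ↔ G.Adj u v := by
  rw [holds_adjTerm (G := G) h.n_eq (by rw [h.size]; omega) hg
    (fun i => by simp [Store.set_var, hx])]
  simp only [Term.eval_var, hu, hv]
  exact ⟨fun ⟨u', v', e1, e2, e3⟩ => by rwa [Fin.ext e1, Fin.ext e2],
    fun e => ⟨u, v, rfl, rfl, e⟩⟩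

lemma holds_finalTerm (h : Paired G₁ G₂ π₀ m ℓ ρ S) {x y : ℕ} (hx : x < 30) (hy : y < 30)
    {u v : Fin n} (hu : S.var x = u) (hv : S.var y = v) :
    (finalTerm x y).Holds S ↔ FinalMatch G₁ G₂ π₀ m ℓ u v := by
  have hx30 : x ≠ 30 := by omega
  have hx31 : x ≠ 31 := by omega
  have hy30 : y ≠ 30 := by omega
  have hy31 : y ≠ 31 := by omega
  unfold finalTerm FinalMatch
  rw [Term.holds_disj, holds_matchedTerm h (by omega) hu hv]
  refine or_congr Iff.rfl ?_
  unfold lowTerm LowDegreeMatch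
  rw [Term.holds_conj, Term.holds_conj, Term.holds_neg, Term.holds_neg,
    holds_exFin h.input (by norm_num), holds_exFin h.input (by norm_num),
    holds_exFin h.input (by norm_num), not_exists, not_exists]
  refine and_congr (forall_congr' fun j => ?_) (and_congr (forall_congr' fun j => ?_)
    (exists_congr fun j => ?_))
  · rw [holds_matchedTerm (u := u) (v := j) (h.set (by norm_num) j) (by omega)
      (by simp [Store.set_var, hx30, hu]) (by simp [Store.set_var])]
  · rw [holds_matchedTerm (u := j) (v := v) (h.set (by norm_num) j) (by omega)
      (by simp [Store.set_var]) (by simp [Store.set_var, hy30, hv])]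
  · have hj := h.set (x := 30) (by norm_num) j
    rw [holds_exFin hj.input (by norm_num)]
    refine exists_congr fun k => ?_
    have hk := hj.set (x := 31) (by norm_num) k
    have vx : ((S.set 30 j).set 31 k).var x = u := by simp [Store.set_var, hx30, hx31, hu]
    have vy : ((S.set 30 j).set 31 k).var y = v := by simp [Store.set_var, hy30, hy31, hv]
    have v30 : ((S.set 30 j).set 31 k).var 30 = j := by simp [Store.set_var]
    have v31 : ((S.set 30 j).set 31 k).var 31 = k := by simp [Store.set_var]
    rw [Term.holds_conj, Term.holds_conj, holds_matchedTerm hk (by norm_num) v30 v31,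
      holds_adjTerm_var hk.input hk.input.one (by omega) vy v31,
      holds_adjTerm_var hk.input hk.input.two (by omega) vx v30]

/-! ### The output -/

open Term in
/-- Every vertex is matched, and there is no conflict. -/
def successTerm : Term :=
  conj (allFin 20 (exFin 21 (finalTerm 20 21))) <|
  conj
    (neg (exFin 20 (exFin 21 (exFin 22 (conj (finalTerm 20 21) (conj (finalTerm 20 22)
      (neg (eq (var 21) (var 22))))))))) <|
  neg (exFin 20 (exFin 21 (exFin 22 (conj (finalTerm 20 22) (conj (finalTerm 21 22)
    (neg (eq (var 20) (var 21))))))))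

lemma holds_successTerm (h : Paired G₁ G₂ π₀ m ℓ ρ S) :
    successTerm.Holds S ↔ (∀ i, ∃ j, FinalMatch G₁ G₂ π₀ m ℓ i j) ∧
      ¬ Conflict (FinalMatch G₁ G₂ π₀ m ℓ) := by
  have key : ∀ a b c : Fin n, Paired G₁ G₂ π₀ m ℓ ρ (((S.set 20 a).set 21 b).set 22 c) :=
    fun a b c => ((h.set (by norm_num) a).set (by norm_num) b).set (by norm_num) c
  have v20 : ∀ a b c : Fin n, (((S.set 20 a).set 21 b).set 22 c).var 20 = a :=
    fun a b c => by simp [Store.set_var]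
  have v21 : ∀ a b c : Fin n, (((S.set 20 a).set 21 b).set 22 c).var 21 = b :=
    fun a b c => by simp [Store.set_var]
  have v22 : ∀ a b c : Fin n, (((S.set 20 a).set 21 b).set 22 c).var 22 = c :=
    fun a b c => by simp [Store.set_var]
  have hex : ∀ e : Term, (exFin 20 (exFin 21 (exFin 22 e))).Holds S ↔
      ∃ a b c : Fin n, e.Holds (((S.set 20 a).set 21 b).set 22 c) := by
    intro e
    rw [holds_exFin h.input (by norm_num)]
    refine exists_congr fun a => ?_
    rw [holds_exFin (h.set (by norm_num) a).input (by norm_num)]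
    refine exists_congr fun b => ?_
    rw [holds_exFin ((h.set (by norm_num) a).set (by norm_num) b).input (by norm_num)]
  unfold successTerm Conflict
  rw [Term.holds_conj, Term.holds_conj, Term.holds_neg, Term.holds_neg, hex, hex, not_or]
  refine and_congr ?_ (and_congr (not_congr ?_) (not_congr ?_))
  · rw [holds_allFin h.input (by norm_num)]
    refine forall_congr' fun i => ?_
    rw [holds_exFin (h.set (by norm_num) i).input (by norm_num)]
    refine exists_congr fun j => ?_
    exact holds_finalTerm ((h.set (by norm_num) i).set (by norm_num) j) (by norm_num)
      (by norm_num) (by simp [Store.set_var]) (by simp [Store.set_var])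
  · refine exists_congr fun a => exists_congr fun b => exists_congr fun c => ?_
    rw [Term.holds_conj, Term.holds_conj, Term.holds_neg, Term.holds_eq, Term.eval_var,
      Term.eval_var, holds_finalTerm (key a b c) (by norm_num) (by norm_num) (v20 a b c) (v21 a b c),
      holds_finalTerm (key a b c) (by norm_num) (by norm_num) (v20 a b c) (v22 a b c), v21, v22,
      Fin.val_inj]
  · refine exists_congr fun a => exists_congr fun b => exists_congr fun c => ?_
    rw [Term.holds_conj, Term.holds_conj, Term.holds_neg, Term.holds_eq, Term.eval_var,
      Term.eval_var, holds_finalTerm (key a b c) (by norm_num) (by norm_num) (v20 a b c) (v22 a b c),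
      holds_finalTerm (key a b c) (by norm_num) (by norm_num) (v21 a b c) (v22 a b c), v20, v21,
      Fin.val_inj]

/-- The output in terms of totality and absence of conflicts. -/
lemma algorithmOutput_spec :
    ((∀ i, ∃ j, FinalMatch G₁ G₂ π₀ m ℓ i j) ∧ ¬ Conflict (FinalMatch G₁ G₂ π₀ m ℓ) →
      ∀ i, FinalMatch G₁ G₂ π₀ m ℓ i (algorithmOutput G₁ G₂ π₀ m ℓ ρ i)) ∧
    (¬ ((∀ i, ∃ j, FinalMatch G₁ G₂ π₀ m ℓ i j) ∧ ¬ Conflict (FinalMatch G₁ G₂ π₀ m ℓ)) →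
      algorithmOutput G₁ G₂ π₀ m ℓ ρ = ρ) := by
  constructor
  · rintro ⟨htot, hconf⟩
    -- A conflict in the first step is also one among the final pairs, so the separate test for it
    -- is redundant. A total relation without conflicts on a finite set is a permutation.
    have hhigh : ¬ Conflict (HighDegreeMatch G₁ G₂ π₀ m ℓ) := by
      rintro (⟨a, b, c, h1, h2, h3⟩ | ⟨a, b, c, h1, h2, h3⟩)
      · exact hconf (Or.inl ⟨a, b, c, Or.inl (Or.inl h1), Or.inl (Or.inl h2), h3⟩)
      · exact hconf (Or.inr ⟨a, b, c, Or.inl (Or.inl h1), Or.inl (Or.inl h2), h3⟩)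
    have hperm : ∃ π : Equiv.Perm (Fin n), ∀ i, FinalMatch G₁ G₂ π₀ m ℓ i (π i) := by
      choose f hf using htot
      have hinj : Function.Injective f := by
        intro a b hab
        by_contra hne
        have h2 := hf b
        rw [← hab] at h2
        exact hconf (Or.inr ⟨a, b, f a, hf a, h2, hne⟩)
      exact ⟨Equiv.ofBijective f (Finite.injective_iff_bijective.1 hinj), hf⟩
    have hall := And.intro hhigh (And.intro hconf hperm)
    unfold algorithmOutput
    rw [dif_pos hall]
    exact hperm.choose_spec
  · intro hno
    unfold algorithmOutput
    refine dif_neg fun hyes => hno ⟨fun i => ?_, hyes.2.1⟩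
    obtain ⟨π, hπ⟩ := hyes.2.2
    exact ⟨π i, hπ i⟩

open Term Cmd in
/-- The last step, which writes the output into the array `4`. -/
def outputCmd : Cmd :=
  seq (assign 13 successTerm) <|
  map 4 20 <| ite (var 13) (mu 21 22 (conj (lt (var 21) (var 0)) (finalTerm 20 21)))
    (get 3 (var 20))

/-- On success each vertex has exactly one partner, so the least one found by `mu` is the output;
otherwise the supplied permutation is copied. -/
lemma outputCmd_spec (h : Paired G₁ G₂ π₀ m ℓ ρ S) (i : Fin n) :
    (outputCmd.denote S).arr 4 i = (algorithmOutput G₁ G₂ π₀ m ℓ ρ i : ℕ) := by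
  set R := S.set 13 (successTerm.eval S) with hR
  have hRp : Paired G₁ G₂ π₀ m ℓ ρ R := h.set (by norm_num) _
  have hval : (outputCmd.denote S).arr 4 i =
      Term.eval (.ite (.var 13) (.mu 21 22 (.conj (.lt (.var 21) (.var 0)) (finalTerm 20 21)))
        (.get 3 (.var 20))) (R.set 20 i) := by
    simp only [outputCmd, Cmd.denote, Store.setArr_arr, if_true, ← hR]
    rw [if_pos (by rw [hRp.input.size]; omega)]
  have h13 : (Term.var 13).Holds (R.set 20 i) ↔ successTerm.Holds S := by
    unfold Term.Holds
    simp [Store.set_var, hR]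
  rw [hval, Term.eval_ite]
  by_cases hs : successTerm.Holds S
  · rw [if_pos (h13.2 hs)]
    rw [holds_successTerm h] at hs
    have hout := (algorithmOutput_spec (ρ := ρ)).1 hs i
    obtain ⟨p1, p2, p3⟩ := Term.eval_mu (S := R.set 20 i) (x := 21) (y := 22)
      (e := .conj (.lt (.var 21) (.var 0)) (finalTerm 20 21))
      (P := fun w => ∃ v : Fin n, w = v ∧ FinalMatch G₁ G₂ π₀ m ℓ i v) (by norm_num) (by norm_num)
      (fun t w => by
        have hp := ((hRp.set (x := 20) (by norm_num) i).set (x := 22) (by norm_num) t).set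
          (x := 21) (by norm_num) w
        have w20 : (((R.set 20 i).set 22 t).set 21 w).var 20 = i := by simp [Store.set_var]
        have w21 : (((R.set 20 i).set 22 t).set 21 w).var 21 = w := by simp [Store.set_var]
        rw [Term.holds_conj, Term.holds_lt, Term.eval_var, Term.eval_var, hp.input.n_eq, w21]
        constructor
        · rintro ⟨h1, h2⟩
          exact ⟨⟨w, h1⟩, rfl, (holds_finalTerm hp (by norm_num) (by norm_num) w20 w21).1 h2⟩
        · rintro ⟨v, hw, h2⟩
          exact ⟨by omega, (holds_finalTerm hp (by norm_num) (by norm_num) w20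
            (w21.trans hw)).2 h2⟩)
    rw [(hRp.set (x := 20) (by norm_num) i).input.size] at p1 p2
    set r := (Term.mu 21 22 (.conj (.lt (.var 21) (.var 0)) (finalTerm 20 21))).eval (R.set 20 i)
      with hr
    have hle : r ≤ (algorithmOutput G₁ G₂ π₀ m ℓ ρ i : ℕ) := by
      by_contra hlt
      exact p3 _ (by omega) ⟨_, rfl, hout⟩
    obtain ⟨v, hv, hvm⟩ := p2 (by omega)
    rw [hv]
    by_contra hne
    exact hs.2 (Or.inl ⟨i, v, _, hvm, hout, fun he => hne (congrArg Fin.val he)⟩)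
  · rw [if_neg (fun h' => hs (h13.1 h'))]
    rw [holds_successTerm h] at hs
    rw [(algorithmOutput_spec (ρ := ρ)).2 hs]
    simp [Store.set_var, hRp.input.perm, encodePerm]

/-- The algorithm. -/
def algorithmCmd : Cmd := .seq (.rep 4 (.rep 5 pairBody)) outputCmd

lemma algorithmCmd_ok : algorithmCmd.ok = true := by decide

lemma input_inputStore (G₁ G₂ : SimpleGraph (Fin n)) (π₀ : Fin n → Option (Fin n)) (m ℓ : ℕ)
    (ρ : Equiv.Perm (Fin n)) :
    Input G₁ G₂ π₀ m ℓ ρ ((inputStore G₁ G₂ π₀ m ℓ ρ).set 3 (3 * n + 2)) := by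
  constructor <;> simp [inputStore, Store.set_var]

/-- The loop bound is first set to 3n+2. A polynomial in the bound is a polynomial in n, with the
constant enlarged by 3^d because 3n+3 = 3(n+1), and by 10 for the initial assignment. -/
theorem algorithmPolynomialTime : AlgorithmPolynomialTime := by
  obtain ⟨T, ⟨C, d, hT⟩, hexec⟩ := executes_compile algorithmCmd algorithmCmd_ok
  refine ⟨.seq (.assign 3 (.add (.add (.add (.var 0) (.var 0)) (.var 0)) (.num 2)))
    algorithmCmd.compile, C * 3 ^ d + 10, d, fun n G₁ G₂ π₀ m ℓ ρ => ?_⟩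
  have hin := input_inputStore G₁ G₂ π₀ m ℓ ρ
  set S := (inputStore G₁ G₂ π₀ m ℓ ρ).set 3 (3 * n + 2) with hS
  obtain ⟨t, S', hrun, hag, ht⟩ := hexec S S ⟨fun _ _ => rfl, fun _ _ => rfl⟩
  have hfirst := runs_assign (inputStore G₁ G₂ π₀ m ℓ ρ) 3
    (.add (.add (.add (.var 0) (.var 0)) (.var 0)) (.num 2))
  have hval : Expr.eval (inputStore G₁ G₂ π₀ m ℓ ρ)
      (.add (.add (.add (.var 0) (.var 0)) (.var 0)) (.num 2)) = 3 * n + 2 := by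
    simp only [Expr.eval, inputStore, if_true]
    ring
  rw [hval, ← hS] at hfirst
  refine ⟨_, S', hfirst.seq hrun, ?_, fun i => ?_⟩
  · have h1 : t ≤ C * (3 * n + 3) ^ d := by
      refine ht.trans ?_
      rw [hin.size]
      exact hT _
    have h2 : (3 * n + 3) ^ d = 3 ^ d * (n + 1) ^ d := by rw [← mul_pow]; ring_nf
    have h3 : 1 ≤ (n + 1) ^ d := Nat.one_le_pow _ _ (by omega)
    simp only [Expr.cost]
    rw [h2, ← mul_assoc] at h1
    rw [add_mul]
    omega
  · rw [← hag.2 4 (by norm_num)]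
    exact outputCmd_spec (paired_rep hin) i

end Program

end SeededGM

theorem theorem1 :
    SeededGM.AlgorithmPolynomialTime ∧
    ∀ ε : ℝ, 0 < ε →
      ∃ m ℓ : ℕ → unitInterval → unitInterval → unitInterval → ℕ,
        (∀ (n : ℕ) (p s α : unitInterval),
          (n : ℝ) * (p : ℝ) * (s : ℝ) ^ 2 ≤ (n : ℝ) ^ ε →
            m n p s α = ⌈2 / ε⌉₊ ∧
            ℓ n p s α =
              ⌊(1 / 2 - ε) * (Real.log (n : ℝ) / Real.log ((n : ℝ) * (p : ℝ) * (s : ℝ) ^ 2))⌋₊) ∧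
        ∀ p s α : ℕ → unitInterval,
          (∀ᶠ n : ℕ in Filter.atTop, (n : ℝ) * (p n : ℝ) ≤ (n : ℝ) ^ (1 / 2 - ε)) →
          (∃ c : ℝ, 0 < c ∧ ∀ᶠ n : ℕ in Filter.atTop, c ≤ (s n : ℝ)) →
          Filter.Tendsto
            (fun n : ℕ => (n : ℝ) * (p n : ℝ) * (s n : ℝ) ^ 2 - Real.log (n : ℝ))
            Filter.atTop Filter.atTop →
          (∀ᶠ n : ℕ in Filter.atTop, (n : ℝ) ^ (-(1 / 2) + 3 * ε) ≤ (α n : ℝ)) →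
          Filter.Tendsto
            (fun n : ℕ => SeededGM.successProbability n (p n) (s n) (α n)
              (m n (p n) (s n) (α n)) (ℓ n (p n) (s n) (α n)))
            Filter.atTop (nhds 1) := by
  refine ⟨SeededGM.algorithmPolynomialTime, fun ε hε =>
    ⟨SeededGM.pathCount ε, SeededGM.pathLength ε, fun n p s α h => ?_, fun p s α hp hs hd hα =>
      SeededGM.tendsto_successProbability hε p s α hp hs hd hα⟩⟩
  simp only [SeededGM.pathCount, SeededGM.pathLength, if_pos h, and_self]
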